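/- Let $\mathbb{T}^2=\mathbb{R}^2/\mathbb{Z}^2$, $e_k(x)=e^{2\pi i k\cdot x}$, and for $\alpha\in\mathbb{R}$ let $H^\alpha$ be the real Sobolev space of distributions $u$ on $\mathbb{T}^2$ with $\|u\|_{H^\alpha}^2=\sum_{k\in\mathbb{Z}^2}(1+|k|^2)^\alpha|\hat u_k|^2<\infty$. Let $G$ be the zero-average Green function of $\Delta$ on $\mathbb{T}^2$ and $K(x,y)=\nabla^\perp G(x-y)$, $\nabla^\perp=(\partial_2,-\partial_1)$, the Biot–Savart kernel. Fix $\theta,\lambda,T>0$. For real $M\ge 0$ and integer $N\ge 1$ consider, on a probability space, two independent Poisson point processes of rate $N\lambda$ on $[0,\infty)$, with points $(s_n)$ and $(t_n)$; every point carries a sign, uniform on $\{\pm1\}$, and a position, uniform on $\mathbb{T}^2$, all of these being independent of each other and of the points. The points $s_n\le M$, with sign $\sigma$ and position $x$, give the initial vortices: they are present from time $0$ on, start at $x$ and have intensity $\frac{\sigma}{\sqrt N}e^{-\theta s_n}e^{-\theta t}$ at time $t\ge 0$. The points $t_n$, with sign $\sigma$ and position $x$, give the vortices created by the noise: they are present from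 time $t_n$ on, start at $x$ at time $t_n$ and have intensity $\frac{\sigma}{\sqrt N}e^{-\theta (t-t_n)}$ at time $t\ge t_n$. While present, the vortices move by $$\dot x_{i,t}=\sum_{j\ne i,\ j\text{ present at }t}\xi_{j,t}\,K(x_{i,t},x_{j,t}),$$ where $x_{j,t}$ and $\xi_{j,t}$ are position and intensity of the $j$-th vortex (almost surely this system has a unique global solution without collisions). Let $$\omega_{M,N,t}=\sum_{i\text{ present at }t}\xi_{i,t}\,\delta_{x_{i,t}},\qquad t\in[0,T].$$ Then, for every $\delta>0$ and every $1\le q<\infty$, the processes $\omega_{M,N}$ are (up to null sets) random variables in $$L^q([0,T],H^{-1-\delta})\cap\mathbb{D}([0,T],H^{-3-\delta}),$$ where $\mathbb{D}([0,T],S)$ is the space of càdlàg functions with the Skorokhod $J_1$ topology and the intersection carries the coarsest topology that makes both inclusions continuous, and the family of their laws, over all $M\ge0$ and $N\ge1$, is tight in this space: for every $\varepsilon>0$ there is a compact subset $\mathcal{K}$ of it such that $\mathbb{P}(\omega_{M,N}\notin\mathcal{K})\le\varepsilon$ for all $M\ge 0$ and $N\ge 1$. -/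

import Mathlib

open MeasureTheory ProbabilityTheory Filter Topology Set
open scoped ENNReal NNReal

noncomputable section

namespace PointVortex

/-! ### Torus and Sobolev spaces -/

/-- The two-dimensional torus `ℝ² / ℤ²`. Its `volume` is the uniform probability measure and
`UnitAddTorus.mFourier k` is the character `x ↦ exp (2 π i k · x)`. -/
abbrev Torus : Type := UnitAddTorus (Fin 2)

/-- `|k|²` for a frequency `k ∈ ℤ²`. -/
def freqSq (k : Fin 2 → ℤ) : ℝ := (k 0 : ℝ) ^ 2 + (k 1 : ℝ) ^ 2

/-- The weight `(1 + |k|²)^(α/2)`. -/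
def weight (α : ℝ) (k : Fin 2 → ℤ) : ℝ := (1 + freqSq k) ^ (α / 2)

/-- Families of Fourier coefficients of real distributions on the torus with
`∑ (1 + |k|²)^α |û_k|² < ∞`. -/
def sobolevSubmodule (α : ℝ) : Submodule ℝ ((Fin 2 → ℤ) → ℂ) where
  carrier := {u | (∀ k, u (-k) = star (u k)) ∧ Memℓp (fun k => weight α k • u k) 2}
  add_mem' := by
    rintro u v ⟨hu, hu'⟩ ⟨hv, hv'⟩
    refine ⟨fun k => by simp [hu k, hv k], ?_⟩
    have h := hu'.add hv'
    have e : (fun k => weight α k • (u + v) k)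
        = (fun k => weight α k • u k) + fun k => weight α k • v k := by
      funext k; simp
    rw [e]; exact h
  zero_mem' := by
    refine ⟨fun k => by simp, ?_⟩
    have e : (fun k => weight α k • (0 : (Fin 2 → ℤ) → ℂ) k) = 0 := by funext k; simp
    rw [e]; exact zero_memℓp
  smul_mem' := by
    rintro c u ⟨hu, hu'⟩
    refine ⟨fun k => by simp [hu k], ?_⟩
    have h := hu'.const_smul c
    have e : (fun k => weight α k • (c • u) k) = c • fun k => weight α k • u k := by
      funext k; simp only [Pi.smul_apply]; rw [smul_comm]
    rw [e]; exact h

/-- The real Sobolev space `H^α` of the torus, for any real `α`. An element is identified with its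
Fourier coefficients. -/
def Sobolev (α : ℝ) : Type := sobolevSubmodule α

instance (α : ℝ) : AddCommGroup (Sobolev α) := inferInstanceAs (AddCommGroup (sobolevSubmodule α))

instance (α : ℝ) : Module ℝ (Sobolev α) := inferInstanceAs (Module ℝ (sobolevSubmodule α))

/-- The Fourier coefficients of an element of `H^α`. -/
def Sobolev.coeff {α : ℝ} (u : Sobolev α) : (Fin 2 → ℤ) → ℂ := u.1

/-- The isometric embedding of `H^α` in `ℓ²`, by `û ↦ ((1 + |k|²)^(α/2) û_k)_k`. -/
def Sobolev.toL2 (α : ℝ) : Sobolev α →ₗ[ℝ] lp (fun _ : Fin 2 → ℤ => ℂ) 2 where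
  toFun u := ⟨fun k => weight α k • u.coeff k, u.2.2⟩
  map_add' u v := by
    ext k; exact smul_add (weight α k) (u.coeff k) (v.coeff k)
  map_smul' c u := by
    ext k; exact smul_comm (weight α k) c (u.coeff k)

theorem Sobolev.toL2_injective (α : ℝ) : Function.Injective (Sobolev.toL2 α) := by
  intro u v h
  apply Subtype.ext
  funext k
  have hk : weight α k • u.coeff k = weight α k • v.coeff k :=
    congrFun (congrArg Subtype.val h) k
  have hw : weight α k ≠ 0 := by
    have : 0 < 1 + freqSq k := by unfold freqSq; positivity
    exact (Real.rpow_pos_of_pos this _).ne'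
  exact smul_right_injective ℂ hw hk

/-- The norm `‖u‖² = ∑ (1 + |k|²)^α |û_k|²`. -/
instance (α : ℝ) : NormedAddCommGroup (Sobolev α) :=
  NormedAddCommGroup.induced (Sobolev α) (lp (fun _ : Fin 2 → ℤ => ℂ) 2) (Sobolev.toL2 α)
    (Sobolev.toL2_injective α)

instance (α : ℝ) : NormedSpace ℝ (Sobolev α) :=
  NormedSpace.induced ℝ (Sobolev α) (lp (fun _ : Fin 2 → ℤ => ℂ) 2) (Sobolev.toL2 α)

/-! ### The path space -/

/-- Right-continuous functions with left limits from `[0,T]` to `S`. -/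
structure Cadlag (T : ℝ) (S : Type*) [TopologicalSpace S] where
  toFun : Icc (0 : ℝ) T → S
  rightCont : ∀ t, ContinuousWithinAt toFun (Ici t) t
  leftLim : ∀ t, ∃ l, Tendsto toFun (𝓝[<] t) (𝓝 l)

instance (T : ℝ) (S : Type*) [TopologicalSpace S] :
    CoeFun (Cadlag T S) (fun _ => Icc (0 : ℝ) T → S) := ⟨Cadlag.toFun⟩

/-- The distortion between `f` and `g` under the time change `φ` (an increasing bijection of
`[0,T]`): the larger one of `sup |φ t - t|` and `sup d (f t, g (φ t))`. -/
def distortion {T : ℝ} {S : Type*} [PseudoEMetricSpace S] (f g : Icc (0 : ℝ) T → S)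
    (φ : Icc (0 : ℝ) T ≃o Icc (0 : ℝ) T) : ℝ≥0∞ :=
  ⨆ t, max (edist (φ t) t) (edist (f t) (g (φ t)))

/-- The space of cadlag functions with the Skorokhod (`J₁`) distance, the infimum of the distortions
over all time changes. -/
instance {T : ℝ} {S : Type*} [PseudoEMetricSpace S] : PseudoEMetricSpace (Cadlag T S) where
  edist f g := ⨅ φ : Icc (0 : ℝ) T ≃o Icc (0 : ℝ) T, distortion f g φ
  edist_self f := by
    refine le_antisymm (iInf_le_of_le (OrderIso.refl _) ?_) zero_le
    simp [distortion]
  edist_comm f g := by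
    have key : ∀ f g : Cadlag T S,
        (⨅ φ : Icc (0 : ℝ) T ≃o Icc (0 : ℝ) T, distortion f g φ)
          ≤ ⨅ φ : Icc (0 : ℝ) T ≃o Icc (0 : ℝ) T, distortion g f φ := by
      intro f g
      refine le_iInf fun φ => iInf_le_of_le φ.symm (iSup_le fun t => ?_)
      refine le_trans ?_ (le_iSup _ (φ.symm t))
      simp [edist_comm]
    exact le_antisymm (key f g) (key g f)
  edist_triangle f g h := by
    refine ENNReal.le_iInf_add_iInf ?_
    intro φ ψ
    refine iInf_le_of_le (φ.trans ψ) (iSup_le fun t => ?_)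
    have h1 : max (edist (φ t) t) (edist (f t) (g (φ t))) ≤ distortion f g φ :=
      le_iSup (fun t => max (edist (φ t) t) (edist (f t) (g (φ t)))) t
    have h2 : max (edist (ψ (φ t)) (φ t)) (edist (g (φ t)) (h (ψ (φ t)))) ≤ distortion g h ψ :=
      le_iSup (fun t => max (edist (ψ t) t) (edist (g t) (h (ψ t)))) (φ t)
    refine max_le ?_ ?_
    · rw [add_comm]
      exact (edist_triangle _ (φ t) _).trans
        (add_le_add ((le_max_left _ _).trans h2) ((le_max_left _ _).trans h1))
    · exact (edist_triangle _ (g (φ t)) _).trans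
        (add_le_add ((le_max_right _ _).trans h1) ((le_max_right _ _).trans h2))

/-- Lebesgue measure on `[0,T]`. -/
def timeMeasure (T : ℝ) : Measure (Icc (0 : ℝ) T) := Measure.comap Subtype.val volume

/-- The intersection `L^q([0,T], H^(-1-δ)) ∩ 𝔻([0,T], H^(-3-δ))`: pairs of an element of either space
which agree, as distributions, at almost every time. -/
def PathSpace (T δ : ℝ) (q : ℝ≥0∞) : Type :=
  {p : Cadlag T (Sobolev (-3 - δ)) ×
      Lp (Sobolev (-1 - δ)) q (timeMeasure T) //
    ∀ᵐ t ∂timeMeasure T, (p.1 t).coeff = (p.2 t).coeff}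

/-- The intersection topology: the coarsest one for which both inclusions are continuous. -/
instance (T δ : ℝ) (q : ℝ≥0∞) [Fact (1 ≤ q)] : TopologicalSpace (PathSpace T δ q) :=
  inferInstanceAs (TopologicalSpace {p : Cadlag T (Sobolev (-3 - δ)) ×
      Lp (Sobolev (-1 - δ)) q (timeMeasure T) //
    ∀ᵐ t ∂timeMeasure T, (p.1 t).coeff = (p.2 t).coeff})

instance (T δ : ℝ) (q : ℝ≥0∞) [Fact (1 ≤ q)] : MeasurableSpace (PathSpace T δ q) := borel _

instance (T δ : ℝ) (q : ℝ≥0∞) [Fact (1 ≤ q)] : BorelSpace (PathSpace T δ q) := ⟨rfl⟩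

/-- The Fourier coefficients at time `t` of an element of the path space. -/
def PathSpace.coeff {T δ : ℝ} {q : ℝ≥0∞} (f : PathSpace T δ q) (t : Icc (0 : ℝ) T) :
    (Fin 2 → ℤ) → ℂ := (f.1.1 t).coeff

/-! ### The Biot-Savart kernel -/

/-- The zero average Green function of `Δ` on the torus, that is the kernel of
`Δ⁻¹ = - ∫₀^∞ exp (t Δ) dt` on zero average functions:
`G(x) = - ∫₀^∞ ∑_{k ≠ 0} exp (- 4 π² |k|² t) cos (2 π k · x) dt`
(the value at `x = 0`, where `G` is singular, is irrelevant). -/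
def green (x : Torus) : ℝ :=
  -∫ t in Ioi (0 : ℝ), ∑' k : {k : Fin 2 → ℤ // k ≠ 0},
    Real.exp (-(4 * Real.pi ^ 2 * freqSq k * t)) * (UnitAddTorus.mFourier k.1 x).re

/-- The partial derivative of a function on the torus. -/
def partialDeriv (j : Fin 2) (f : Torus → ℝ) (x : Torus) : ℝ :=
  deriv (fun h : ℝ => f (x + Pi.single j (h : UnitAddCircle))) 0

/-- The Biot-Savart kernel `K = ∇^⊥ G` with `∇^⊥ = (∂₂, -∂₁)`; in two variables it is
`K(x,y) = K(x-y)`. -/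
def biotSavart (x : Torus) : Fin 2 → ℝ :=
  ![partialDeriv 1 green x, -partialDeriv 0 green x]

/-! ### The point vortices process -/

/-- A sample of two marked point processes on the half line. An index `Sum.inl n` stands for the
`n`-th initial vortex, `Sum.inr n` for the `n`-th vortex that the driving noise creates. Every index
carries the waiting time since the preceding arrival, a sign, and a position. -/
abbrev Sample : Type := ℕ ⊕ ℕ → ℝ × ℝ × Torus

/-- The uniform probability measure on `{1, -1}`. -/
def signLaw : Measure ℝ := (2⁻¹ : ℝ≥0∞) • (Measure.dirac 1 + Measure.dirac (-1))

/-- The law of one mark: independent exponential waiting time of rate `r`, uniform sign and uniform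
position. With independent marks of this law the arrival times are those of two independent Poisson
processes of rate `r`. -/
def markLaw (r : ℝ) : Measure (ℝ × ℝ × Torus) :=
  (expMeasure r).prod (signLaw.prod volume)

/-- The arrival times (points of the Poisson processes). -/
def arrival (d : Sample) : ℕ ⊕ ℕ → ℝ
  | Sum.inl n => ∑ m ∈ Finset.range (n + 1), (d (Sum.inl m)).1
  | Sum.inr n => ∑ m ∈ Finset.range (n + 1), (d (Sum.inr m)).1

/-- The vortices present at time `t`: the initial ones are those that arrive before `M` in the first
process, the others are present from their arrival time in the second process on. -/
def IsActive (M : ℝ) (d : Sample) : ℕ ⊕ ℕ → ℝ → Prop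
  | Sum.inl n, _ => arrival d (Sum.inl n) ≤ M
  | Sum.inr n, t => arrival d (Sum.inr n) ≤ t

/-- The intensity at time `t` of a vortex present at that time, in the scaling `1/√N`. An initial
vortex starts with intensity `± exp (-θ s) / √N`, where `s` is its arrival time in the first process;
a new one with `± 1 / √N`. All of them decay with rate `θ`. -/
def intensity (θ : ℝ) (N : ℕ) (d : Sample) : ℕ ⊕ ℕ → ℝ → ℝ
  | Sum.inl n, t =>
      (d (Sum.inl n)).2.1 * Real.exp (-θ * arrival d (Sum.inl n)) * Real.exp (-θ * t) / √N
  | Sum.inr n, t =>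
      (d (Sum.inr n)).2.1 * Real.exp (-θ * (t - arrival d (Sum.inr n))) / √N

open Classical in
/-- The velocity at time `t` of the `i`-th vortex, when the positions are `x`; it is zero as long as
the vortex is not present. -/
def velocity (θ M : ℝ) (N : ℕ) (d : Sample) (x : ℕ ⊕ ℕ → ℝ → Torus) (i : ℕ ⊕ ℕ) (t : ℝ) :
    Fin 2 → ℝ :=
  if IsActive M d i t then
    ∑ᶠ (j) (_ : j ≠ i ∧ IsActive M d j t), intensity θ N d j t • biotSavart (x i t - x j t)
  else 0

/-- `x` is a global solution of the equations of motion: distinct vortices never collide, and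
`x_i(t) = x_i(0) + ∫₀ᵗ velocity_i(s) ds` modulo `ℤ²` for all `i` and all `t ≥ 0`. -/
structure IsSolution (θ M : ℝ) (N : ℕ) (d : Sample) (x : ℕ ⊕ ℕ → ℝ → Torus) : Prop where
  ne : ∀ t, 0 ≤ t → ∀ i j, i ≠ j → IsActive M d i t → IsActive M d j t → x i t ≠ x j t
  integrable : ∀ i t, 0 ≤ t → IntervalIntegrable (velocity θ M N d x i) volume 0 t
  eq : ∀ i t, 0 ≤ t →
    x i t = (d i).2.2 + fun l => ((∫ s in (0 : ℝ)..t, velocity θ M N d x i s) l : UnitAddCircle)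

open Classical in
/-- The positions of the vortices: the solution of the equations of motion, which exists and is
unique for almost every sample (for the other samples the value is irrelevant). -/
def position (θ M : ℝ) (N : ℕ) (d : Sample) : ℕ ⊕ ℕ → ℝ → Torus :=
  if h : ∃ x, IsSolution θ M N d x then h.choose else fun i _ => (d i).2.2

/-- The Fourier coefficients `∫ exp (-2 π i k · x) dω` of the measure
`ω = ∑_{i present at t} ξ_i(t) δ_{x_i(t)}`. -/
def vorticity (θ M : ℝ) (N : ℕ) (d : Sample) (t : ℝ) (k : Fin 2 → ℤ) : ℂ :=
  ∑ᶠ (i) (_ : IsActive M d i t),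
    (intensity θ N d i t : ℂ) * UnitAddTorus.mFourier (-k) (position θ M N d i t)

end PointVortex

end

open MeasureTheory ProbabilityTheory Filter Topology Set
open scoped ENNReal NNReal Real
open Complex (I I_mul_im I_re abs_re_le_norm add_re exp_add exp_zero norm_I norm_real ofReal_div
  ofReal_exp ofReal_neg ofReal_re ofReal_zero re_ofReal_mul real_smul)
open ContinuousLinearMap (coe_coe det id_apply le_opNorm norm_smulRight_apply opNorm_le_bound proj
  smulRightL)
open ENNReal (coe_lt_top coe_ne_top coe_toNNReal div_ne_top le_tsum mul_lt_top mul_ne_top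
  mul_rpow_of_nonneg ofReal ofReal_add ofReal_inv_of_pos ofReal_le_ofReal ofReal_lt_one ofReal_mul
  ofReal_natCast ofReal_ne_top ofReal_ofNat ofReal_one ofReal_pow one_le_ofReal pow_ne_top
  rpow_le_rpow rpow_mul rpow_natCast sum_le_tsum tendsto_ofReal toReal_add toReal_mono toReal_mul
  toReal_ofNat toReal_ofReal toReal_pow tsum_add tsum_geometric tsum_le_tsum zero_rpow_of_pos)
open Finset (card_range erase_subset induction_on mem_coe mem_erase mul_sum range range_mono
  sum_add_distrib sum_congr sum_const sum_const_zero sum_disjSum sum_eq_zero sum_insert sum_le_sum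
  sum_mul sum_nonneg sum_pos sum_product sum_range_succ sum_sub_distrib sum_subset)
open Function (comp comp_apply comp_def support uncurry update update_of_ne update_self)
open Pi (single)
open Real (cos dist_eq exp exp_nat_mul exp_pos log norm_eq_abs norm_of_nonneg pi_gt_three rpow_add
  rpow_neg rpow_one rpow_pos_of_pos sin smoothTransition sq_sqrt sqrt_nonneg volume_Icc)
open Sum (inl inr)
open UnitAddTorus (mFourier)
open intervalIntegral (integral_congr integral_interval_sub_left integral_of_le integral_same
  integral_symm integral_zero_ae)

noncomputable section

namespace PointVortex

local notation:max "Idx" => ℕ ⊕ ℕ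
local notation:max "ℤ²" => Fin 2 → ℤ
local notation:max "ℝ²" => Fin 2 → ℝ

local notation:max "ℤ²₀" => {k : ℤ² // k ≠ 0}
local notation:max "ev" k:max => 4 * π ^ 2 * freqSq k
local notation:max "start" d:max => fun i => Prod.snd (Prod.snd (d i))

variable {α β δ θ M T a s t L C : ℝ} {N m n : ℕ} {d : Sample} {i j : Idx} {x : Idx → ℝ → Torus}
  {u v : ℝ²} {z : Torus} {g : Torus → ℝ} {k : Torus → ℝ²} {f : Sample → ℝ≥0∞}
  {q : ℝ≥0∞} [Fact (1 ≤ q)] {X : Type*} [MeasurableSpace X] (r : ℝ) [Fact (0 < r)]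

/-! ### Sobolev spaces on the torus -/

/-! The main tool is invariance. The Biot–Savart kernel is divergence free, so the motion preserves
the law of the sample: at a fixed time the positions are again independent and uniform, and
independent of arrival times and signs (`lintegral_flow`, `exists_measurable_position`). Moments of
the vorticity at a fixed time are therefore moments of sums of point masses at independent uniform
points with independent signs. Khinchine's inequality bounds those of the `H^α` norm, `α < -1`, by
moments of the sum of the squared intensities (`lintegral_energy_emp_pow_le`). That sum has a mean
bounded uniformly in `M` and `N`, because the rate `N * λ` is balanced by the factor `1 / N` and
`exp (-2 * θ * s)` is integrable (`exists_lintegral_mass_le`); higher moments are taken on the event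
that it is at most a constant.

Global existence rests on the Green function `G` of a pair. Since `K` is orthogonal to `∇G`, the
mutual interaction does not change `G (x_i - x_j)`; what remains are products of `K` at two
different differences of positions, which are integrable under the invariant law because `K` is in
`L¹`. So `G` stays bounded below and collisions are excluded almost surely
(`tendsto_measure_closeSet`). The argument runs on finitely many vortices with a truncated kernel.
Invariance for these flows comes from a splitting scheme of single pair moves, each with Jacobian at
least `1 - O(h²)` (`exists_lintegral_pair_le`).

The vorticity is a continuous path plus a path of jumps (`exists_continuous_part`). The continuous
path is the initial value plus the integral of a drift. In Fourier variables the interaction can be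
symmetrised, as `K` is odd, and boundedness of `|K(z)| |z|` makes the symmetrised kernel at most `C
* (1 + |k|²)`. A quadratic form in independent signs without diagonal has its second moment
controlled by the squared sum of squares (`lintegral_norm_quad_sq_le`). Hence the drift is square
integrable in time with values in `H^γ` for `γ < -3`, the continuous path is Hölder of exponent
`1/2` there, and the theorems of Rellich and Arzelà–Ascoli give compactness.

For the jumps, fourth moments of dyadic increments and chaining are used down to a mesh of order
`N⁻³`, where with high probability no cell contains two arrivals; one jump has size of order
`N^(-1/2)`. This gives a modulus of continuity up to an error vanishing as `N → ∞`. For each single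
`N` the jump path is a continuous function of the sample, hence tight, and
`exists_isCompact_of_modulus` joins all `N`. Adding a continuous path is a continuous operation for
`J₁`. Finally, a bound in `L^q` with values in `H^β`, `β > -1 - δ`, turns Skorokhod compactness into
compactness in the intersection (`isCompact_pathSpace`). -/

theorem freqSq_nonneg (k : ℤ²) : 0 ≤ freqSq k := by unfold freqSq; positivity

theorem freqSq_neg (k : ℤ²) : freqSq (-k) = freqSq k := by simp [freqSq]

theorem one_add_freqSq_pos (k : ℤ²) : 0 < 1 + freqSq k := by
  have := freqSq_nonneg k; linarith

theorem weight_pos (α : ℝ) (k : ℤ²) : 0 < weight α k :=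
  rpow_pos_of_pos (one_add_freqSq_pos k) _

theorem weight_sq (α : ℝ) (k : ℤ²) : weight α k ^ 2 = (1 + freqSq k) ^ α := by
  unfold weight
  rw [← Real.rpow_natCast, ← Real.rpow_mul (one_add_freqSq_pos k).le]
  norm_num

theorem weight_mono (h : α ≤ β) (k : ℤ²) : weight α k ≤ weight β k := by
  apply Real.rpow_le_rpow_of_exponent_le
  · linarith [freqSq_nonneg k]
  · linarith

theorem norm_sq_le_freqSq (k : ℤ²) : ‖k‖ ^ 2 ≤ freqSq k := by
  refine (pow_le_pow_left₀ (norm_nonneg _) ((pi_norm_le_iff_of_nonneg (sqrt_nonneg _)).2 fun i =>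
    Real.le_sqrt_of_sq_le ?_) 2).trans_eq (sq_sqrt (freqSq_nonneg k))
  rw [Int.norm_eq_abs, sq_abs, freqSq]
  fin_cases i <;> simp <;> positivity

/-- Comparison with the Eisenstein-type sum of `‖k‖ ^ (-2a)` in the sup norm; the origin, where that
term is degenerate, is left out. -/
theorem summable_one_add_freqSq_rpow (ha : 1 < a) :
    Summable fun k : ℤ² => (1 + freqSq k) ^ (-a) := by
  have h := EisensteinSeries.summable_one_div_norm_rpow (k := 2 * a) (by linarith)
  refine Summable.of_norm_bounded_eventually h ?_
  have : ({0} : Set ℤ²)ᶜ ∈ cofinite := (finite_singleton _).compl_mem_cofinite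
  filter_upwards [this] with k hk
  have hk' : 0 < ‖k‖ := norm_pos_iff.2 hk
  rw [norm_of_nonneg (Real.rpow_nonneg (one_add_freqSq_pos k).le _)]
  have e : ‖k‖ ^ (-(2 * a)) = (‖k‖ ^ 2) ^ (-a) := by
    rw [← Real.rpow_natCast, ← Real.rpow_mul hk'.le]; norm_num
  rw [e]
  apply Real.rpow_le_rpow_of_nonpos (by positivity)
  · linarith [norm_sq_le_freqSq k]
  · linarith

/-- `∑ (1 + |k|²)^α |u_k|²`, possibly infinite. -/
def energy (α : ℝ) (u : ℤ² → ℂ) : ℝ≥0∞ :=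
  ∑' k, ofReal (weight α k ^ 2) * ‖u k‖ₑ ^ 2

theorem enorm_sq_eq_energy (u : Sobolev α) : ‖u‖ₑ ^ 2 = energy α u.coeff := by
  have h := lp.hasSum_norm (p := 2) (by norm_num) (Sobolev.toL2 α u)
  have h1 : HasSum (fun k => weight α k ^ 2 * ‖u.coeff k‖ ^ 2) (‖u‖ ^ 2) := by
    convert h using 1
    · funext k
      simp only [toReal_ofNat, Real.rpow_ofNat]
      change _ = ‖weight α k • u.coeff k‖ ^ 2
      rw [norm_smul, mul_pow, norm_eq_abs, sq_abs]
    · simp only [toReal_ofNat, Real.rpow_ofNat]; rfl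
  have h2 : ‖u‖ₑ ^ 2 = ofReal (‖u‖ ^ 2) := by
    rw [← ofReal_norm, ofReal_pow (norm_nonneg _)]
  rw [h2, ← h1.tsum_eq, ENNReal.ofReal_tsum_of_nonneg (fun k => by positivity) h1.summable]
  refine tsum_congr fun k => ?_
  rw [ofReal_mul (by positivity), ofReal_pow (norm_nonneg (u.coeff k)), ofReal_norm]

theorem memℓp_of_energy_lt_top {u : ℤ² → ℂ} (h : energy α u ≠ ∞) :
    Memℓp (fun k => weight α k • u k) 2 := by
  apply memℓp_gen
  have := ENNReal.summable_toReal h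
  refine this.congr fun k => ?_
  rw [toReal_mul, toReal_ofReal (by positivity), toReal_pow, toReal_enorm, norm_smul, norm_eq_abs]
  simp [mul_pow]

/-- The element of `H^α` with given Fourier coefficients. -/
def Sobolev.ofCoeff {α : ℝ} (u : ℤ² → ℂ) (hs : ∀ k, u (-k) = star (u k))
    (h : energy α u ≠ ∞) : Sobolev α := ⟨u, hs, memℓp_of_energy_lt_top h⟩

@[simp] theorem Sobolev.coeff_ofCoeff {α : ℝ} (u : ℤ² → ℂ)
    (hs : ∀ k, u (-k) = star (u k)) (h : energy α u ≠ ∞) :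
    (Sobolev.ofCoeff u hs h).coeff = u := rfl

@[simp] theorem Sobolev.coeff_add {α : ℝ} (u v : Sobolev α) :
    (u + v).coeff = u.coeff + v.coeff := rfl

@[simp] theorem Sobolev.coeff_sub {α : ℝ} (u v : Sobolev α) :
    (u - v).coeff = u.coeff - v.coeff := rfl

@[simp] theorem Sobolev.coeff_zero {α : ℝ} : (0 : Sobolev α).coeff = 0 := rfl

@[simp] theorem Sobolev.coeff_smul (c : ℝ) (u : Sobolev α) : (c • u).coeff = c • u.coeff := rfl

theorem Sobolev.coeff_sum {ι : Type*} (s : Finset ι) (f : ι → Sobolev α) :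
    (∑ i ∈ s, f i).coeff = ∑ i ∈ s, (f i).coeff := by
  classical
  induction s using induction_on with
  | empty => simp
  | insert a s ha ih => rw [sum_insert ha, sum_insert ha, Sobolev.coeff_add, ih]

theorem Sobolev.coeff_neg_apply (u : Sobolev α) (k : ℤ²) : u.coeff (-k) = star (u.coeff k) :=
  u.2.1 k

theorem energy_mono (h : α ≤ β) (u : ℤ² → ℂ) : energy α u ≤ energy β u := by
  refine tsum_le_tsum fun k => ?_
  gcongr
  · exact (weight_pos α k).le
  · exact weight_mono h k

theorem edist_sq_eq_energy (u v : Sobolev α) : edist u v ^ 2 = energy α (u.coeff - v.coeff) := by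
  rw [edist_eq_enorm_sub, enorm_sq_eq_energy, Sobolev.coeff_sub]

theorem enorm_sub_sq_le {E : Type*} [NormedAddCommGroup E] (a b : E) :
    ‖a - b‖ₑ ^ 2 ≤ 2 * (‖a‖ₑ ^ 2 + ‖b‖ₑ ^ 2) := by
  have h : ‖a - b‖ ^ 2 ≤ 2 * (‖a‖ ^ 2 + ‖b‖ ^ 2) := by
    have := norm_sub_le a b
    nlinarith [norm_nonneg (a - b), norm_nonneg a, norm_nonneg b, sq_nonneg (‖a‖ - ‖b‖)]
  have := ofReal_le_ofReal h
  rwa [ofReal_mul (by norm_num), ofReal_add (by positivity) (by positivity),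
    ofReal_pow (norm_nonneg _), ofReal_pow (norm_nonneg _),
    ofReal_pow (norm_nonneg _), ofReal_norm, ofReal_norm, ofReal_norm,
    ofReal_ofNat] at this

theorem energy_sub_le (α : ℝ) (u v : ℤ² → ℂ) :
    energy α (u - v) ≤ 2 * (energy α u + energy α v) := by
  unfold energy
  rw [← tsum_add, ← ENNReal.tsum_mul_left]
  refine tsum_le_tsum fun k => ?_
  exact (mul_le_mul_right (enorm_sub_sq_le _ _) _).trans_eq (by ring)

theorem energy_add_le (α : ℝ) (u v : ℤ² → ℂ) :
    energy α (u + v) ≤ 2 * (energy α u + energy α v) := by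
  have h := energy_sub_le α u (-v)
  simpa [energy] using h

theorem measurable_energy (α : ℝ) {u : X → ℤ² → ℂ} (hu : ∀ k, Measurable fun x => u x k) :
    Measurable fun x => energy α (u x) := by
  unfold energy
  exact Measurable.tsum fun k => ((hu k).enorm.pow_const 2).const_mul _

theorem eventually_weight_sq_le (h : α < β) {ε : ℝ} (hε : 0 < ε) :
    ∀ᶠ k in cofinite, weight α k ^ 2 ≤ ε * weight β k ^ 2 := by
  have ht : Tendsto (fun k : ℤ² => 1 + freqSq k) cofinite atTop := by
    rw [← cocompact_eq_cofinite]
    exact tendsto_atTop_mono (fun k => (norm_sq_le_freqSq k).trans (by linarith))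
      ((tendsto_pow_atTop two_ne_zero).comp (tendsto_norm_cocompact_atTop (E := ℤ²)))
  filter_upwards [((tendsto_rpow_neg_atTop (sub_pos.2 h)).comp ht).eventually_le_const hε] with k hk
  have hpos := one_add_freqSq_pos k
  rw [weight_sq, weight_sq, show α = -(β - α) + β by ring, rpow_add hpos]
  gcongr
  simpa using hk

/-- The ratio of the two weights tends to zero at infinity, so `S` collects the finitely many
frequencies at which it exceeds `ε`. -/
theorem exists_energy_le_add_sum (h : α < β) {ε : ℝ} (hε : 0 < ε) : ∃ S : Finset ℤ², ∀ u,
    energy α u ≤ ofReal ε * energy β u + ∑ k ∈ S, ofReal (weight α k ^ 2) * ‖u k‖ₑ ^ 2 := by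
  have hS := eventually_cofinite.1 (eventually_weight_sq_le h hε)
  refine ⟨hS.toFinset, fun u => ?_⟩
  rw [sum_eq_tsum_indicator, energy, energy, ← ENNReal.tsum_mul_left, ← tsum_add]
  refine tsum_le_tsum fun k => ?_
  by_cases hk : weight α k ^ 2 ≤ ε * weight β k ^ 2
  · rw [← mul_assoc, ← ofReal_mul hε.le]
    exact (by gcongr : _ ≤ _).trans le_self_add
  · rw [indicator_of_mem (by simpa using hk)]; exact le_add_self

/-- An inequality of Ehrling type: on finitely many frequencies all the norms are comparable, so the
remainder can be measured in an arbitrarily weak norm. -/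
theorem exists_energy_le (h : α < β) (γ : ℝ) {ε : ℝ} (hε : 0 < ε) :
    ∃ C : ℝ, 0 < C ∧ ∀ u, energy α u ≤ ofReal ε * energy β u + ofReal C * energy γ u := by
  obtain ⟨S, hS⟩ := exists_energy_le_add_sum h hε
  refine ⟨∑ k ∈ S, weight α k ^ 2 / weight γ k ^ 2 + 1, by positivity, fun u => (hS u).trans ?_⟩
  gcongr
  refine le_trans ?_ (mul_le_mul_left (ofReal_le_ofReal (le_add_of_nonneg_right zero_le_one)) _)
  rw [ENNReal.ofReal_sum_of_nonneg fun k _ => by positivity, sum_mul]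
  refine sum_le_sum fun k _ => le_trans ?_ (mul_le_mul_right (le_tsum k) _)
  have := weight_pos γ k
  rw [← mul_assoc, ← ofReal_mul (by positivity), div_mul_cancel₀ _ (by positivity)]

/-! #### Topology of the Sobolev spaces -/

theorem Sobolev.isometry_toL2 (α : ℝ) : Isometry (Sobolev.toL2 α) :=
  AddMonoidHomClass.isometry_of_norm _ fun _ => rfl

theorem separableSpace_l2 : TopologicalSpace.SeparableSpace (lp (fun _ : ℤ² => ℂ) 2) := by
  rw [← TopologicalSpace.isSeparable_univ_iff]
  have h : (range fun k : ℤ² =>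
      (lp.single 2 k (1 : ℂ) : lp (fun _ : ℤ² => ℂ) 2)).Countable := countable_range _
  refine (h.isSeparable.span (R := ℂ)).closure.mono fun f _ => ?_
  refine mem_closure_of_tendsto (lp.hasSum_single (by norm_num) f) (.of_forall fun s => ?_)
  refine Submodule.sum_mem _ fun k _ => ?_
  have : lp.single 2 k (f k) = f k • (lp.single 2 k (1 : ℂ) : lp (fun _ : ℤ² => ℂ) 2) := by
    rw [← lp.single_smul]; simp
  rw [this]
  exact Submodule.smul_mem _ _ (Submodule.subset_span (mem_range_self k))

instance (α : ℝ) : SecondCountableTopology (Sobolev α) := by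
  have := separableSpace_l2
  have := UniformSpace.secondCountable_of_separable (lp (fun _ : ℤ² => ℂ) 2)
  exact (Sobolev.isometry_toL2 α).isUniformInducing.isInducing.secondCountableTopology

instance (α : ℝ) : MeasurableSpace (Sobolev α) := borel _

instance (α : ℝ) : BorelSpace (Sobolev α) := ⟨rfl⟩

/-- In a second countable space, measurability can be tested on the distances to points. -/
theorem measurable_of_measurable_edist {X Y : Type*} [MeasurableSpace X] [PseudoEMetricSpace Y]
    [SecondCountableTopology Y] [MeasurableSpace Y] [BorelSpace Y] {f : X → Y}
    (hf : ∀ y, Measurable fun x => edist (f x) y) : Measurable f := by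
  refine measurable_of_isOpen fun s hs => ?_
  choose! r hr hrs using EMetric.isOpen_iff.1 hs
  obtain ⟨t, hts, htc, htU⟩ := TopologicalSpace.isOpen_biUnion_countable s
    (fun y => Metric.eball y (r y)) fun _ _ => Metric.isOpen_eball
  have e : s = ⋃ y ∈ t, Metric.eball y (r y) := by
    rw [htU]
    refine Subset.antisymm (fun y hy => mem_biUnion hy (Metric.mem_eball_self (hr y hy))) ?_
    exact iUnion₂_subset hrs
  rw [e, preimage_iUnion₂]
  refine MeasurableSet.biUnion htc fun y _ => ?_
  exact measurableSet_lt (hf y) measurable_const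

theorem measurable_sobolev {f : X → Sobolev α}
    (hf : ∀ k, Measurable fun x => (f x).coeff k) : Measurable f := by
  refine measurable_of_measurable_edist fun y => ?_
  have h x : edist (f x) y = energy α ((f x).coeff - y.coeff) ^ (2⁻¹ : ℝ) := by
    rw [← edist_sq_eq_energy, ← rpow_natCast, ← rpow_mul]; norm_num
  simp only [h]
  exact (measurable_energy α fun k => (hf k).sub_const _).pow_const _

theorem Sobolev.continuous_coeff (k : ℤ²) : Continuous fun u : Sobolev α => u.coeff k := by
  have h : (fun u : Sobolev α => u.coeff k) = fun u => (weight α k)⁻¹ • (Sobolev.toL2 α u k) := by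
    funext u
    change _ = (weight α k)⁻¹ • weight α k • u.coeff k
    rw [inv_smul_smul₀ (weight_pos α k).ne']
  rw [h]
  have hc := (lp.lipschitzWith_one_eval (E := fun _ : ℤ² => ℂ) 2 k).continuous.comp
    (Sobolev.isometry_toL2 α).continuous
  exact Continuous.const_smul hc (weight α k)⁻¹

theorem lowerSemicontinuous_energy (β : ℝ) : LowerSemicontinuous (energy β) := by
  unfold energy
  refine lowerSemicontinuous_tsum fun k => Continuous.lowerSemicontinuous ?_
  exact ENNReal.continuous_const_mul ofReal_ne_top |>.comp
    ((ENNReal.continuous_pow 2).comp (continuous_apply k).enorm)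

/-- Rellich's theorem: bounded sets of `H^β` are relatively compact in `H^α` for `α < β`. -/
theorem isCompact_energy_le (h : α < β) (R : ℝ≥0) :
    IsCompact {u : Sobolev α | energy β u.coeff ≤ R} := by
  -- The energy ball is compact for pointwise convergence of coefficients, by Tychonoff and lower
  -- semicontinuity. On it the identity into `H^α` is continuous, because high frequencies
  -- contribute uniformly little.
  set B : Set (ℤ² → ℂ) := {u | (∀ k, u (-k) = star (u k)) ∧ energy β u ≤ R} with hB
  have hBc : IsCompact B := by
    have hK : IsCompact (Set.pi univ fun k : ℤ² =>
        Metric.closedBall (0 : ℂ) (√R / weight β k)) :=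
      isCompact_univ_pi fun k => isCompact_closedBall _ _
    refine hK.of_isClosed_subset ?_ ?_
    · rw [hB, ofPred_and]
      refine IsClosed.inter ?_ ((lowerSemicontinuous_energy β).isClosed_preimage _)
      simp only [ofPred_forall]
      exact isClosed_iInter fun k => isClosed_eq (continuous_apply _) (continuous_apply _).star
    · intro u hu k _
      have h1 := (le_tsum k).trans hu.2
      have hw := weight_pos β k
      rw [mem_closedBall_zero_iff, le_div_iff₀ hw]
      apply Real.le_sqrt_of_sq_le
      have h2 := toReal_mono coe_ne_top h1
      rw [toReal_mul, toReal_ofReal (by positivity), toReal_pow,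
        toReal_enorm, ENNReal.coe_toReal] at h2
      nlinarith
  have hfin (u : B) : energy α u.1 ≠ ∞ :=
    ((energy_mono h.le _).trans u.2.2 |>.trans_lt coe_lt_top).ne
  let F : B → Sobolev α := fun u => Sobolev.ofCoeff u.1 u.2.1 (hfin u)
  have hF : Continuous F := by
    rw [continuous_iff_continuousAt]
    intro u
    have hsq : Tendsto (fun v : B => energy α (v.1 - u.1)) (𝓝 u) (𝓝 0) := by
      rw [ENNReal.tendsto_nhds_zero]
      intro ε hε
      -- The factor `4 * R` bounds `energy β` of the difference of two elements of `B`.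
      obtain ⟨η, hη, hηε⟩ := ENNReal.exists_nnreal_pos_mul_lt (a := 4 * R) (by finiteness)
        (ENNReal.half_pos hε.ne').ne'
      obtain ⟨S, hS⟩ := exists_energy_le_add_sum h (NNReal.coe_pos.2 hη)
      have hcont : Continuous fun v : B => ∑ k ∈ S, ofReal (weight α k ^ 2) * ‖(v.1 - u.1) k‖ₑ ^ 2 :=
        continuous_finsetSum _ fun k _ => (ENNReal.continuous_const_mul ofReal_ne_top).comp
          ((ENNReal.continuous_pow 2).comp (Continuous.enorm
            (((continuous_apply k).comp continuous_subtype_val).sub continuous_const)))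
      have h0 := hcont.tendsto u
      simp only [sub_self, Pi.zero_apply, enorm_zero, ne_eq, OfNat.ofNat_ne_zero, not_false_eq_true,
        zero_pow, mul_zero, sum_const_zero] at h0
      filter_upwards [ENNReal.tendsto_nhds_zero.1 h0 _ (ENNReal.half_pos hε.ne')] with v hv
      have h4 : energy β (v.1 - u.1) ≤ 4 * R := (energy_sub_le β _ _).trans
        ((mul_le_mul_right (add_le_add v.2.2 u.2.2) 2).trans_eq (by ring))
      rw [← ENNReal.add_halves ε]
      refine (hS _).trans (add_le_add (le_trans ?_ hηε.le) hv)
      rw [ENNReal.ofReal_coe_nnreal]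
      gcongr
    rw [ContinuousAt, EMetric.tendsto_nhds]
    intro ε hε
    have hε2 : 0 < ε ^ 2 := ENNReal.pow_pos hε 2
    filter_upwards [hsq.eventually (gt_mem_nhds hε2)] with v hv
    have : edist (F v) (F u) ^ 2 < ε ^ 2 := by rw [edist_sq_eq_energy]; exact hv
    exact (ENNReal.pow_lt_pow_left_iff two_ne_zero).1 this
  have := isCompact_iff_isCompact_univ.1 hBc
  have h2 := this.image hF
  convert h2 using 1
  ext u
  simp only [mem_ofPred_eq, image_univ, mem_range, Subtype.exists]
  exact ⟨fun hu => ⟨u.coeff, ⟨u.coeff_neg_apply, hu⟩, rfl⟩, by rintro ⟨v, hv, rfl⟩; exact hv.2⟩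

/-! #### Dirac masses -/

theorem norm_mFourier_apply (k : ℤ²) (x : Torus) : ‖mFourier k x‖ = 1 := by
  simp [mFourier, Circle.norm_coe]

theorem energy_le_of_norm_le (u : ℤ² → ℂ) (hu : ∀ k, ‖u k‖ ≤ C) : energy α u ≤ (∑' k, ofReal (weight
    α k ^ 2)) * ofReal C ^ 2 := by
  unfold energy
  rw [← ENNReal.tsum_mul_right]
  refine tsum_le_tsum fun k => ?_
  gcongr
  rw [← ofReal_norm]
  exact ofReal_le_ofReal (hu k)

theorem tsum_weight_sq_ne_top (hα : α < -1) : ∑' k, ofReal (weight α k ^ 2) ≠ ∞ := by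
  have h := summable_one_add_freqSq_rpow (a := -α) (by linarith)
  simp only [weight_sq]
  rw [← ENNReal.ofReal_tsum_of_nonneg (fun k => Real.rpow_nonneg (one_add_freqSq_pos k).le _)
    (by simpa using h)]
  exact ofReal_ne_top

theorem energy_ne_top_of_norm_le (hα : α < -1) (u : ℤ² → ℂ)
    (hu : ∀ k, ‖u k‖ ≤ C) : energy α u ≠ ∞ := by
  refine ((energy_le_of_norm_le u hu).trans_lt ?_).ne
  exact mul_lt_top (tsum_weight_sq_ne_top hα).lt_top (by finiteness)

theorem star_mFourier_neg (k : ℤ²) (x : Torus) : mFourier (-(-k)) x = star (mFourier (-k) x) := by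
  rw [UnitAddTorus.mFourier_neg]; rfl

/-- The Dirac mass at `x`. -/
def dirac (α : ℝ) (hα : α < -1) (x : Torus) : Sobolev α :=
  Sobolev.ofCoeff (fun k => mFourier (-k) x) (fun k => star_mFourier_neg k x)
    (energy_ne_top_of_norm_le (C := 1) hα _ fun k => (norm_mFourier_apply (-k) x).le)

@[simp] theorem coeff_dirac (hα : α < -1) (x : Torus) (k : ℤ²) :
    (dirac α hα x).coeff k = mFourier (-k) x := rfl

/-! ### Skorokhod topology -/

section Skorokhod

variable {T : ℝ} {S : Type*}

theorem Cadlag.edist_def [PseudoEMetricSpace S] (f g : Cadlag T S) :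
    edist f g = ⨅ φ : Icc 0 T ≃o Icc 0 T, distortion f g φ := rfl

theorem Cadlag.exists_timeChange [PseudoEMetricSpace S] {f g : Cadlag T S} {ε : ℝ≥0∞} (h : edist f g
    < ε) : ∃ φ : Icc 0 T ≃o Icc 0 T, ∀ t, edist (φ t) t < ε ∧ edist (f t) (g (φ t)) < ε := by
  rw [Cadlag.edist_def, iInf_lt_iff] at h
  obtain ⟨φ, hφ⟩ := h
  exact ⟨φ, fun t => max_lt_iff.1 ((le_iSup (fun t => max (edist (φ t) t) (edist (f t) (g (φ t))))
    t).trans_lt hφ)⟩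

theorem Cadlag.edist_le_of_timeChange [PseudoEMetricSpace S] {f g : Cadlag T S} {ε : ℝ≥0∞}
    (φ : Icc 0 T ≃o Icc 0 T) (h1 : ∀ t, edist (φ t) t ≤ ε)
    (h2 : ∀ t, edist (f t) (g (φ t)) ≤ ε) : edist f g ≤ ε :=
  iInf_le_of_le φ (iSup_le fun t => max_le (h1 t) (h2 t))

theorem Cadlag.edist_le_of_forall [PseudoEMetricSpace S] {f g : Cadlag T S} {ε : ℝ≥0∞}
    (h : ∀ t, edist (f t) (g t) ≤ ε) : edist f g ≤ ε :=
  Cadlag.edist_le_of_timeChange (OrderIso.refl _) (by simp) (by simpa using h)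

/-- A continuous function as a cadlag function. -/
def Cadlag.ofContinuous [TopologicalSpace S] (c : C(Icc 0 T, S)) : Cadlag T S where
  toFun := c
  rightCont _ := c.continuous.continuousWithinAt
  leftLim t := ⟨c t, c.continuous.continuousWithinAt⟩

theorem Cadlag.continuous_ofContinuous [PseudoMetricSpace S] :
    Continuous (Cadlag.ofContinuous : C(Icc 0 T, S) → Cadlag T S) := by
  refine LipschitzWith.continuous (K := 1) fun c c' => ?_
  rw [ENNReal.coe_one, one_mul]
  refine Cadlag.edist_le_of_forall fun t => ?_
  rw [edist_dist, edist_dist]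
  exact ofReal_le_ofReal (ContinuousMap.dist_apply_le_dist t)

/-- The sum of a continuous and a cadlag function. -/
def Cadlag.addCont [NormedAddCommGroup S] (c : C(Icc 0 T, S)) (f : Cadlag T S) :
    Cadlag T S where
  toFun t := c t + f t
  rightCont t := c.continuous.continuousWithinAt.add (f.rightCont t)
  leftLim t := by
    obtain ⟨l, hl⟩ := f.leftLim t
    have hc : Tendsto c (𝓝[<] t) (𝓝 (c t)) := c.continuous.continuousWithinAt
    exact ⟨c t + l, hc.add hl⟩

/-- Addition is not continuous for `J₁` in general, since two jumps may need different time changes.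
With one continuous summand the time change of the other one serves both, by uniform continuity. -/
theorem Cadlag.continuous_addCont [NormedAddCommGroup S] :
    Continuous fun p : C(Icc 0 T, S) × Cadlag T S => Cadlag.addCont p.1 p.2 := by
  rw [continuous_iff_continuousAt]
  rintro ⟨c, f⟩
  rw [ContinuousAt, EMetric.tendsto_nhds]
  intro ε hε
  obtain ⟨ε', hε', hε3⟩ := exists_between hε
  set η := ε' / 3
  have hη : 0 < η := ENNReal.div_pos hε'.ne' (by simp)
  have hη3 : η + η + η < ε := by rwa [ENNReal.add_thirds]
  have huc := CompactSpace.uniformContinuous_of_continuous c.continuous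
  obtain ⟨δ, hδ, hc⟩ := EMetric.uniformContinuous_iff.1 huc η hη
  have h1 : ∀ᶠ p : C(Icc 0 T, S) × Cadlag T S in 𝓝 (c, f), edist p.1 c < η :=
    (continuous_fst.tendsto (c, f)).eventually (Metric.eball_mem_nhds c hη)
  have h2 : ∀ᶠ p : C(Icc 0 T, S) × Cadlag T S in 𝓝 (c, f), edist p.2 f < min η δ :=
    (continuous_snd.tendsto (c, f)).eventually (Metric.eball_mem_nhds f (lt_min hη hδ))
  filter_upwards [h1, h2] with p hp1 hp2
  obtain ⟨φ, hφ⟩ := Cadlag.exists_timeChange hp2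
  refine lt_of_le_of_lt (Cadlag.edist_le_of_timeChange φ (fun t => ?_) (fun t => ?_)) hη3
  · exact (hφ t).1.le.trans ((min_le_left _ _).trans (le_add_left le_rfl))
  · change edist (p.1 t + p.2 t) (c (φ t) + f (φ t)) ≤ _
    refine (edist_add_add_le _ _ _ _).trans ?_
    refine add_le_add ?_ ((hφ t).2.le.trans (min_le_left _ _))
    refine (edist_triangle _ (c t) _).trans (add_le_add ?_ ?_)
    · refine le_trans ?_ hp1.le
      rw [edist_dist, edist_dist]
      exact ofReal_le_ofReal (ContinuousMap.dist_apply_le_dist t)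
    · rw [edist_comm]
      exact (hc ((hφ t).1.trans_le (min_le_right _ _))).le

/-! #### Time changes -/

/-- A time change of `[0,T]` which moves finitely many separated points to given places nearby. -/
theorem exists_timeChange (hT : 0 < T) (m : ℕ) (a b : ℕ → ℝ) {r : ℝ} (hr : 0 < r) (h : ∀ n ∈
    range m, r ≤ a n ∧ r ≤ T - a n ∧ ∀ n' ∈ range m, n' ≠ n → r ≤ |a n - a n'|) (hb :
    ∑ n ∈ range m, |b n - a n| < r) : ∃ φ : Icc 0 T ≃o Icc 0 T, (∀ t, |(φ t : ℝ) - t| ≤ ∑ n ∈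
    range m, |b n - a n|) ∧ ∀ n < m, ∀ t, b n ≤ φ t ↔ a n ≤ t := by
  -- To the identity one adds a tent of radius `r` and height `b n - a n` at each `a n`. The tents
  -- vanish at `0`, at `T` and at the other points, and by `hb` their total slope is below `1`, so
  -- the sum remains strictly increasing.
  set hat : ℝ → ℝ := fun x => max 0 (1 - |x| / r) with hhat
  have hat_le x : |hat x| ≤ 1 := by
    rw [hhat, abs_of_nonneg (le_max_left _ _)]
    exact max_le zero_le_one (sub_le_self _ (by positivity))
  have hat_lip : ∀ x y, |hat x - hat y| ≤ |x - y| / r := by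
    intro x y
    have h := abs_max_sub_max_le_abs (1 - |x| / r) (1 - |y| / r) 0
    rw [max_comm _ (0 : ℝ), max_comm _ (0 : ℝ)] at h
    refine h.trans ?_
    rw [show 1 - |x| / r - (1 - |y| / r) = (|y| - |x|) / r by ring, abs_div, abs_of_pos hr,
      abs_sub_comm x y]
    exact div_le_div_of_nonneg_right (abs_abs_sub_abs_le y x) hr.le
  have hat_zero : ∀ x, r ≤ |x| → hat x = 0 := fun x hx => max_eq_left (by
    rw [sub_nonpos, le_div_iff₀ hr, one_mul]; exact hx)
  have hat_one : hat 0 = 1 := by simp [hhat]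
  set g : ℝ → ℝ := fun t => t + ∑ n ∈ range m, (b n - a n) * hat (t - a n) with hg
  set Sg := ∑ n ∈ range m, |b n - a n| with hSg
  have hgt : ∀ t, |g t - t| ≤ Sg := by
    intro t
    rw [hg]
    simp only [add_sub_cancel_left]
    refine (Finset.abs_sum_le_sum_abs _ _).trans (sum_le_sum fun n _ => ?_)
    rw [abs_mul]
    exact mul_le_of_le_one_right (abs_nonneg _) (hat_le _)
  have hmono : StrictMono g := by
    intro s t hst
    have h2 : |∑ n ∈ range m, (b n - a n) * hat (t - a n)
        - ∑ n ∈ range m, (b n - a n) * hat (s - a n)| ≤ Sg * ((t - s) / r) := by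
      rw [← sum_sub_distrib, hSg, sum_mul]
      refine (Finset.abs_sum_le_sum_abs _ _).trans (sum_le_sum fun n _ => ?_)
      rw [← mul_sub, abs_mul]
      gcongr
      refine (hat_lip _ _).trans ?_
      rw [sub_sub_sub_cancel_right, abs_of_pos (sub_pos.2 hst)]
    have h3 : Sg * ((t - s) / r) < t - s := by
      rw [mul_div_assoc', div_lt_iff₀ hr, mul_comm]
      exact mul_lt_mul_of_pos_left hb (sub_pos.2 hst)
    have := (abs_le.1 h2).1
    simp only [hg]
    linarith
  have hcont : Continuous g := by
    rw [hg]
    refine continuous_id.add (continuous_finsetSum _ fun n _ => ?_)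
    exact continuous_const.mul (by fun_prop)
  have hg0 : g 0 = 0 := by
    simp only [hg, zero_add]
    refine sum_eq_zero fun n hn => ?_
    rw [hat_zero, mul_zero]
    rw [zero_sub, abs_neg]
    exact (h n hn).1.trans (le_abs_self _)
  have hgT : g T = T := by
    simp only [hg, add_eq_left]
    refine sum_eq_zero fun n hn => ?_
    rw [hat_zero, mul_zero]
    exact (h n hn).2.1.trans (le_abs_self _)
  have hga : ∀ n ∈ range m, g (a n) = b n := by
    intro n hn
    simp only [hg]
    rw [Finset.sum_eq_single_of_mem n hn fun n' hn' hne => by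
      rw [hat_zero _ ((h n hn).2.2 n' hn' hne), mul_zero], sub_self, hat_one]
    ring
  have hmaps : ∀ t : Icc 0 T, g t ∈ Icc 0 T := by
    rintro ⟨t, ht0, htT⟩
    exact ⟨hg0.ge.trans (hmono.monotone ht0), (hmono.monotone htT).trans hgT.le⟩
  let G : Icc 0 T → Icc 0 T := fun t => ⟨g t, hmaps t⟩
  have hG : StrictMono G := fun s t h => hmono h
  have hGs : Function.Surjective G := by
    rintro ⟨y, hy⟩
    have := intermediate_value_Icc hT.le hcont.continuousOn
    rw [hg0, hgT] at this
    obtain ⟨x, hx, rfl⟩ := this hy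
    exact ⟨⟨x, hx⟩, rfl⟩
  refine ⟨hG.orderIsoOfSurjective G hGs, fun t => hgt t, fun n hn t => ?_⟩
  change b n ≤ g t ↔ _
  rw [← hga n (Finset.mem_range.2 hn), hmono.le_iff_le]

/-! #### Jump functions -/

/-- Times which are admissible as jump times of a function on `[0,T]`. -/
def GoodTimes (T : ℝ) : Set (ℕ → ℝ) :=
  {a | 0 < a 0 ∧ StrictMono a ∧ (∃ n, T < a n) ∧ ∀ n, a n ≠ T}

theorem sum_ite_le_eq_of_lt [AddCommMonoid S] {a : ℕ → ℝ} (ha : StrictMono a) (v : ℕ → S) {m' : ℕ}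
    (hm : T < a m) (hm' : T < a m') (ht : t ≤ T) : ∑ n ∈ range m, (if a n ≤ t then v n else
    0) = ∑ n ∈ range m', (if a n ≤ t then v n else 0) := by
  wlog h : m ≤ m' generalizing m m'
  · exact (this hm' hm (le_of_not_ge h)).symm
  refine sum_subset (range_mono h) fun n _ hn => ?_
  rw [if_neg]
  rw [Finset.mem_range, not_lt] at hn
  have := ha.monotone hn
  linarith

theorem ite_le_rightCont [TopologicalSpace S] (r : ℝ) (u v : S) (t : Icc 0 T) :
    ContinuousWithinAt (fun s : Icc 0 T => if r ≤ s then u else v) (Ici t) t := by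
  by_cases h : r ≤ t
  · refine (continuousWithinAt_const (b := u)).congr (fun s hs => ?_) (if_pos h)
    exact if_pos (h.trans hs)
  · push Not at h
    have : ∀ᶠ s : Icc 0 T in 𝓝 t, (s : ℝ) < r :=
      (continuous_subtype_val.tendsto t).eventually (gt_mem_nhds h)
    refine (continuousAt_const (y := v)).congr ?_ |>.continuousWithinAt
    filter_upwards [this] with s hs
    rw [if_neg (not_le.2 hs)]

theorem ite_le_leftLim [TopologicalSpace S] (r : ℝ) (u v : S) (t : Icc 0 T) :
    ∃ l, Tendsto (fun s : Icc 0 T => if r ≤ s then u else v) (𝓝[<] t) (𝓝 l) := by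
  by_cases h : r < t
  · refine ⟨u, tendsto_const_nhds.congr' ?_⟩
    have : ∀ᶠ s : Icc 0 T in 𝓝 t, r < (s : ℝ) :=
      (continuous_subtype_val.tendsto t).eventually (lt_mem_nhds h)
    filter_upwards [nhdsWithin_le_nhds this] with s hs
    rw [if_pos hs.le]
  · push Not at h
    refine ⟨v, tendsto_const_nhds.congr' ?_⟩
    filter_upwards [self_mem_nhdsWithin] with s hs
    have hs : (s : ℝ) < t := hs
    rw [if_neg (by linarith)]

/-- The function with jumps `v n` at the times `a n`. -/
def jumpFun [NormedAddCommGroup S] (a : GoodTimes T) (v : ℕ → S) : Cadlag T S where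
  toFun t := ∑ n ∈ range a.2.2.2.1.choose, if a.1 n ≤ t then v n else 0
  rightCont t := by
    unfold ContinuousWithinAt
    exact tendsto_finsetSum _ fun n _ => ite_le_rightCont (a.1 n) (v n) 0 t
  leftLim t := by
    choose l hl using fun n => ite_le_leftLim (a.1 n) (v n) (0 : S) t
    exact ⟨_, tendsto_finsetSum _ fun n _ => hl n⟩

theorem jumpFun_apply [NormedAddCommGroup S] (a : GoodTimes T) (v : ℕ → S) (hm : T < a.1 m) (t : Icc
    0 T) : jumpFun a v t = ∑ n ∈ range m, if a.1 n ≤ t then v n else 0 :=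
  sum_ite_le_eq_of_lt a.2.2.1 v a.2.2.2.1.choose_spec hm t.2.2

/-- Nearby jump times are matched by a time change close to the identity. A time change fixes `0`
and `T` and is injective, which is why admissible times are positive, distinct and different from
`T`. -/
theorem continuous_jumpFun [NormedAddCommGroup S] (hT : 0 < T) :
    Continuous fun p : GoodTimes T × (ℕ → S) => jumpFun p.1 p.2 := by
  rw [continuous_iff_continuousAt]
  rintro ⟨a, v⟩
  obtain ⟨ha0, ham, haT, hne⟩ := a.2
  classical
  obtain ⟨m, hm, hm'⟩ : ∃ m, T < a.1 m ∧ ∀ n < m, a.1 n < T :=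
    ⟨Nat.find haT, Nat.find_spec haT, fun n hn =>
      lt_of_le_of_ne (not_lt.1 (Nat.find_min haT hn)) (hne n)⟩
  have key : ∀ c : ℝ, 0 < c → ∀ᶠ r : ℝ in 𝓝[>] 0, r ≤ c := fun c hc => nhdsWithin_le_nhds (Iic_mem_nhds hc)
  obtain ⟨r, hr, hr'⟩ : ∃ r : ℝ, 0 < r ∧ ∀ n ∈ range m, r ≤ a.1 n ∧ r ≤ T - a.1 n ∧
      ∀ n' ∈ range m, n' ≠ n → r ≤ |a.1 n - a.1 n'| := by
    refine (Eventually.and ((eventually_all_finset _).2 fun n hn =>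
      (key _ (ha0.trans_le (ham.monotone (Nat.zero_le n)))).and ((key _ (sub_pos.2 (hm' n
        (Finset.mem_range.1 hn)))).and ((eventually_all_finset _).2 fun n' _ => ?_)))
      self_mem_nhdsWithin).exists.imp fun r h => h.symm
    rcases eq_or_ne n' n with h | h
    · exact .of_forall fun r hh => absurd h hh
    · exact (key _ (abs_pos.2 (sub_ne_zero.2 (ham.injective.ne h.symm)))).mono fun r hr _ => hr
  rw [ContinuousAt, EMetric.tendsto_nhds]
  intro ε hε
  obtain ⟨η, hη, hηε⟩ : ∃ η : ℝ, 0 < η ∧ ofReal η < ε := by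
    obtain ⟨c, hc, hc'⟩ := ENNReal.lt_iff_exists_nnreal_btwn.1 hε
    exact ⟨c, by exact_mod_cast hc, by simpa using hc'⟩
  have hcont n : Continuous fun p : GoodTimes T × (ℕ → S) => p.1.1 n :=
    (continuous_apply n).comp (continuous_subtype_val.comp continuous_fst)
  have f1 : ∀ᶠ p : GoodTimes T × (ℕ → S) in 𝓝 (a, v), T < p.1.1 m :=
    ((hcont m).tendsto _).eventually (lt_mem_nhds hm)
  have f2 : ∀ᶠ p : GoodTimes T × (ℕ → S) in 𝓝 (a, v),
      ∑ n ∈ range m, |p.1.1 n - a.1 n| < min r η := by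
    have hc : Continuous fun p : GoodTimes T × (ℕ → S) =>
        ∑ n ∈ range m, |p.1.1 n - a.1 n| :=
      continuous_finsetSum _ fun n _ => ((hcont n).sub continuous_const).abs
    have := hc.tendsto (a, v)
    simp only [sub_self, abs_zero, sum_const_zero] at this
    exact this.eventually (gt_mem_nhds (lt_min hr hη))
  have f3 : ∀ᶠ p : GoodTimes T × (ℕ → S) in 𝓝 (a, v), ∑ n ∈ range m, ‖v n - p.2 n‖ < η := by
    have hc : Continuous fun p : GoodTimes T × (ℕ → S) =>
        ∑ n ∈ range m, ‖v n - p.2 n‖ := by fun_prop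
    have := hc.tendsto (a, v)
    simp only [sub_self, norm_zero, sum_const_zero] at this
    exact this.eventually (gt_mem_nhds hη)
  filter_upwards [f1, f2, f3] with p hp1 hp2 hp3
  obtain ⟨φ, hφ1, hφ2⟩ := exists_timeChange hT m a.1 p.1.1 hr hr' (hp2.trans_le (min_le_left _ _))
  rw [edist_comm]
  refine lt_of_le_of_lt (Cadlag.edist_le_of_timeChange φ (ε := ofReal η)
    (fun t => ?_) fun t => ?_) hηε
  · rw [Subtype.edist_eq, edist_dist, dist_eq]
    exact ofReal_le_ofReal ((hφ1 t).trans (hp2.le.trans (min_le_right _ _)))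
  · rw [jumpFun_apply a v hm, jumpFun_apply p.1 p.2 hp1, edist_dist, dist_eq_norm,
      ← sum_sub_distrib]
    refine ofReal_le_ofReal ((norm_sum_le _ _).trans (le_trans ?_ hp3.le))
    refine sum_le_sum fun n hn => ?_
    simp only [hφ2 n (Finset.mem_range.1 hn) t]
    split_ifs
    · exact le_rfl
    · simp

/-! #### Compactness and convergence -/

theorem Cadlag.tendsto_apply [PseudoEMetricSpace S] {f : ℕ → Cadlag T S} {g : Cadlag T S}
    (h : Tendsto f atTop (𝓝 g)) {t : Icc 0 T} (ht : ContinuousAt g t) :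
    Tendsto (fun n => f n t) atTop (𝓝 (g t)) := by
  rw [EMetric.tendsto_nhds] at h ⊢
  intro ε hε
  have hε2 : 0 < ε / 2 := by simpa using hε.ne'
  obtain ⟨δ, hδ, hg⟩ := EMetric.tendsto_nhds_nhds.1 ht (ε / 2) hε2
  filter_upwards [h (min δ (ε / 2)) (lt_min hδ hε2)] with n hn
  obtain ⟨φ, hφ⟩ := Cadlag.exists_timeChange hn
  calc edist (f n t) (g t) ≤ edist (f n t) (g (φ t)) + edist (g (φ t)) (g t) := edist_triangle _ _ _
    _ < ε / 2 + ε / 2 := ENNReal.add_lt_add ((hφ t).2.trans_le (min_le_right _ _))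
        (hg ((hφ t).1.trans_le (min_le_left _ _)))
    _ = ε := ENNReal.add_halves ε

/-- Times with a left jump above a fixed size are isolated from the right, by right continuity, and
a set of reals with this property is countable. -/
theorem Cadlag.countable_not_continuousAt [PseudoEMetricSpace S] (f : Cadlag T S) :
    {t | ¬ ContinuousAt f t}.Countable := by
  choose l hl using f.leftLim
  have hsub : {t | ¬ ContinuousAt f t} ⊆ ⋃ n : ℕ, {t | (n : ℝ≥0∞)⁻¹ < edist (l t) (f t)} := by
    intro t ht
    by_contra hcon
    simp only [mem_iUnion, mem_ofPred_eq, not_exists, not_lt] at hcon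
    have h0 : edist (l t) (f t) = 0 :=
      le_antisymm (ge_of_tendsto' ENNReal.tendsto_inv_nat_nhds_zero hcon) zero_le
    refine ht (continuousAt_iff_continuous_left'_right'.2
      ⟨EMetric.tendsto_nhds.2 fun ε hε => ?_, (f.rightCont t).mono Ioi_subset_Ici_self⟩)
    filter_upwards [EMetric.tendsto_nhds.1 (hl t) ε hε] with s hs
    exact (edist_triangle _ (l t) _).trans_lt (by rwa [h0, add_zero])
  refine (countable_iUnion fun n => ?_).mono hsub
  set ε : ℝ≥0∞ := (n : ℝ≥0∞)⁻¹ with hεdef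
  set D := {t | ε < edist (l t) (f t)}
  refine Set.Countable.mono (fun t (ht : t ∈ D) => (⟨ht, ?_⟩ : t ∈ {x ∈ D | 𝓝[D ∩ Ioi x] x = ⊥}))
    countable_setOfPred_isolated_right_within
  -- To the right of `t` the values stay within `ε / 2` of `f t`, hence so do left limits and values
  -- at later points, and no jump larger than `ε` fits in.
  have e : ∀ᶠ s in 𝓝[>] t, edist (f s) (f t) < ε / 2 :=
    EMetric.tendsto_nhds.1 ((f.rightCont t).mono Ioi_subset_Ici_self) _ (by simp [hεdef])
  rw [inter_comm, nhdsWithin_inter', inf_principal_eq_bot]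
  filter_upwards [e, eventually_eventually_nhdsWithin.2 e, self_mem_nhdsWithin] with s h1 h2 hs hD
  rw [isOpen_Ioi.nhdsWithin_eq hs] at h2
  have : (𝓝[<] s).NeBot := nhdsLT_neBot_of_exists_lt ⟨t, hs⟩
  have h3 : edist (l s) (f t) ≤ ε / 2 := le_of_tendsto ((hl s).edist tendsto_const_nhds)
    (nhdsWithin_le_nhds (h2.mono fun _ => le_of_lt))
  refine not_le.2 (show ε < _ from hD) ?_
  rw [← ENNReal.add_halves ε]
  exact (edist_triangle _ (f t) _).trans (add_le_add h3 (by rw [edist_comm]; exact h1.le))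

theorem Cadlag.measurable [PseudoEMetricSpace S] [MeasurableSpace S] [BorelSpace S]
    (f : Cadlag T S) : Measurable f := by
  have hc := f.countable_not_continuousAt
  refine measurable_of_restrict_of_restrict_compl hc.measurableSet ?_ ?_
  · have := hc.to_subtype
    exact measurable_of_countable _
  · apply Continuous.measurable
    rw [continuous_iff_continuousAt]
    rintro ⟨t, ht⟩
    have : ContinuousAt f t := by simpa using ht
    exact this.comp continuous_subtype_val.continuousAt

theorem Cadlag.exists_norm_le [NormedAddCommGroup S] (f : Cadlag T S) : ∃ R, ∀ t, ‖f t‖ ≤ R := by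
  have hloc (t : Icc 0 T) : ∃ U ∈ 𝓝 t, ∃ C, ∀ s ∈ U, ‖f s‖ ≤ C := by
    obtain ⟨l, hl⟩ := f.leftLim t
    have e1 : ∀ᶠ s in 𝓝[<] t, ‖f s‖ < ‖l‖ + 1 := hl.norm.eventually (gt_mem_nhds (by simp))
    have e2 : ∀ᶠ s in 𝓝[≥] t, ‖f s‖ < ‖f t‖ + 1 :=
      (f.rightCont t).norm.eventually (gt_mem_nhds (by simp))
    rw [eventually_nhdsWithin_iff] at e1 e2
    refine ⟨_, e1.and e2, max (‖l‖ + 1) (‖f t‖ + 1), fun s hs => ?_⟩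
    rcases lt_or_ge s t with h | h
    · exact (hs.1 h).le.trans (le_max_left _ _)
    · exact (hs.2 h).le.trans (le_max_right _ _)
  choose U hU C hC using hloc
  obtain ⟨t, _, ht⟩ := isCompact_univ.elim_nhds_subcover U fun x _ => hU x
  obtain ⟨R, hR⟩ := (t.finite_toSet.image C).bddAbove
  refine ⟨R, fun s => ?_⟩
  obtain ⟨x, hx, hsx⟩ := mem_iUnion₂.1 (ht (mem_univ s))
  exact (hC x s hsx).trans (hR (mem_image_of_mem C hx))

theorem exists_norm_le_of_isCompact [NormedAddCommGroup S] {K : Set (Cadlag T S)}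
    (hK : IsCompact K) : ∃ R, ∀ f ∈ K, ∀ t, ‖f t‖ ≤ R := by
  obtain ⟨s, _, hs⟩ := hK.elim_nhds_subcover (fun f => Metric.eball f 1)
    fun f _ => Metric.eball_mem_nhds f one_pos
  choose C hC using fun f : Cadlag T S => f.exists_norm_le
  obtain ⟨R, hR⟩ := (s.finite_toSet.image C).bddAbove
  refine ⟨R + 1, fun f hf t => ?_⟩
  obtain ⟨g, hg, hfg⟩ := mem_iUnion₂.1 (hs hf)
  obtain ⟨φ, hφ⟩ := Cadlag.exists_timeChange (Metric.mem_eball.1 hfg)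
  have h1 : dist (f t) (g (φ t)) < 1 := by
    have := (hφ t).2
    rw [edist_dist] at this
    rwa [← ofReal_one, ENNReal.ofReal_lt_ofReal_iff one_pos] at this
  have h2 : ‖g (φ t)‖ ≤ R := (hC g _).trans (hR (mem_image_of_mem C hg))
  rw [dist_eq_norm] at h1
  have := norm_le_norm_add_norm_sub' (f t) (g (φ t))
  linarith

end Skorokhod

/-! ### Compact subsets of the path space -/

instance (T : ℝ) : IsFiniteMeasure (timeMeasure T) := by
  refine ⟨?_⟩
  rw [timeMeasure, Measure.comap_apply _ Subtype.val_injective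
    (fun s hs => measurableSet_Icc.subtype_image hs) _ MeasurableSet.univ, image_univ,
    Subtype.range_coe]
  exact measure_Icc_lt_top

instance (T : ℝ) : NullSingletonClass (timeMeasure T) := by
  refine ⟨fun t => ?_⟩
  rw [timeMeasure, Measure.comap_apply _ Subtype.val_injective
    (fun s hs => measurableSet_Icc.subtype_image hs) _ (measurableSet_singleton t)]
  simp

theorem Cadlag.ae_continuousAt {S : Type*} [PseudoEMetricSpace S] (f : Cadlag T S) :
    ∀ᵐ t ∂timeMeasure T, ContinuousAt f t :=
  f.countable_not_continuousAt.measure_zero _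

theorem enorm_eq_energy_rpow (u : Sobolev α) : ‖u‖ₑ = energy α u.coeff ^ (2⁻¹ : ℝ) := by
  rw [← enorm_sq_eq_energy, ← rpow_natCast, ← rpow_mul]
  norm_num

theorem ENNReal.rpow_half_add_le {p : ℝ} (hp : 1 ≤ p) (a b : ℝ≥0∞) :
    (a + b) ^ (p / 2) ≤ 2 ^ p * (a ^ (p / 2) + b ^ (p / 2)) := by
  have h (c : ℝ≥0∞) : c ^ (p / 2) = (c ^ (2⁻¹ : ℝ)) ^ p := by rw [← rpow_mul]; congr 1; ring
  rw [h, h a, h b]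
  refine (rpow_le_rpow (ENNReal.rpow_add_le_add_rpow a b (by norm_num) (by norm_num))
    (by linarith)).trans ((ENNReal.rpow_add_le_mul_rpow_add_rpow _ _ hp).trans ?_)
  gcongr
  · norm_num
  · linarith

/-- The convergence criterion for `L^q` paths: convergence in a weak norm and boundedness in a
strong norm imply convergence in between. -/
theorem tendsto_lintegral_energy_of_bounded {μ : Measure X} {γ p : ℝ} (hαβ : α < β) (hp : 1 ≤ p) {u
    : ℕ → X → ℤ² → ℂ} {R : ℝ≥0∞} (hR : R ≠ ∞) (hum : ∀ n k, Measurable fun x => u n x k) (hβ : ∀ n,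
    ∫⁻ x, energy β (u n x) ^ (p / 2) ∂μ ≤ R) (hγ : Tendsto (fun n => ∫⁻ x, energy γ (u n x) ^ (p /
    2) ∂μ) atTop (𝓝 0)) : Tendsto (fun n => ∫⁻ x, energy α (u n x) ^ (p / 2) ∂μ) atTop (𝓝 0) := by
  have hp2 : 0 < p / 2 := by linarith
  rw [ENNReal.tendsto_nhds_zero]
  intro ε hε
  have h2p : (2 : ℝ≥0∞) ^ p ≠ ∞ := by finiteness
  obtain ⟨η, hη, hηε⟩ : ∃ η : ℝ, 0 < η ∧ 2 ^ p * (ofReal η ^ (p / 2) * R) ≤ ε / 2 := by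
    have h : Tendsto (fun η : ℝ => 2 ^ p * (ofReal η ^ (p / 2) * R)) (𝓝[>] 0) (𝓝 0) := by
      have := (ENNReal.Tendsto.const_mul (a := 2 ^ p) (ENNReal.Tendsto.mul_const (b := R)
        ((ENNReal.continuous_ofReal.tendsto 0).ennrpow_const (p / 2)) (.inr hR)) (.inr h2p))
      simp only [ENNReal.ofReal_zero, zero_rpow_of_pos hp2, zero_mul, mul_zero] at this
      exact this.mono_left nhdsWithin_le_nhds
    obtain ⟨η, h1, h2⟩ := ((ENNReal.tendsto_nhds_zero.1 h (ε / 2) (by simpa using hε.ne')).and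
      self_mem_nhdsWithin).exists
    exact ⟨η, h2, h1⟩
  obtain ⟨C, hC, hint⟩ := exists_energy_le hαβ γ hη
  have hlim : Tendsto (fun n => 2 ^ p * (ofReal C ^ (p / 2) *
      ∫⁻ x, energy γ (u n x) ^ (p / 2) ∂μ)) atTop (𝓝 0) := by
    simpa using ENNReal.Tendsto.const_mul (a := 2 ^ p)
      (ENNReal.Tendsto.const_mul (a := ofReal C ^ (p / 2)) hγ (.inr (by finiteness))) (.inr h2p)
  filter_upwards [ENNReal.tendsto_nhds_zero.1 hlim (ε / 2) (by simpa using hε.ne')] with n hn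
  have hm β : Measurable fun x => energy β (u n x) ^ (p / 2) :=
    (measurable_energy β (hum n)).pow_const _
  calc ∫⁻ x, energy α (u n x) ^ (p / 2) ∂μ
      ≤ ∫⁻ x, 2 ^ p * (ofReal η ^ (p / 2) * energy β (u n x) ^ (p / 2)
          + ofReal C ^ (p / 2) * energy γ (u n x) ^ (p / 2)) ∂μ := by
        refine lintegral_mono fun x => ?_
        refine (rpow_le_rpow (hint (u n x)) hp2.le).trans ((ENNReal.rpow_half_add_le hp _ _).trans ?_)
        rw [mul_rpow_of_nonneg _ _ hp2.le, mul_rpow_of_nonneg _ _ hp2.le]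
    _ = 2 ^ p * (ofReal η ^ (p / 2) * ∫⁻ x, energy β (u n x) ^ (p / 2) ∂μ)
        + 2 ^ p * (ofReal C ^ (p / 2) * ∫⁻ x, energy γ (u n x) ^ (p / 2) ∂μ) := by
        rw [lintegral_const_mul' _ _ h2p, lintegral_add_left ((hm β).const_mul _),
          lintegral_const_mul _ (hm β), lintegral_const_mul _ (hm γ), mul_add]
    _ ≤ ε / 2 + ε / 2 := by
        refine add_le_add (le_trans ?_ hηε) hn
        gcongr
        exact hβ n
    _ = ε := ENNReal.add_halves ε

open Classical in
/-- The element of `H^α` with the Fourier coefficients `u`, or zero if there is none. -/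
def toSobolev (α : ℝ) (u : ℤ² → ℂ) : Sobolev α :=
  if h : (∀ k, u (-k) = star (u k)) ∧ energy α u ≠ ∞ then Sobolev.ofCoeff u h.1 h.2 else 0

theorem coeff_toSobolev {u : ℤ² → ℂ} (hs : ∀ k, u (-k) = star (u k))
    (h : energy α u ≠ ∞) : (toSobolev α u).coeff = u := by
  rw [toSobolev, dif_pos ⟨hs, h⟩, Sobolev.coeff_ofCoeff]

theorem measurable_toSobolev {u : X → ℤ² → ℂ}
    (hu : ∀ k, Measurable fun x => u x k) : Measurable fun x => toSobolev α (u x) := by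
  classical
  refine measurable_sobolev fun k => ?_
  have e x : (toSobolev α (u x)).coeff k
      = if (∀ k, u x (-k) = star (u x k)) ∧ energy α (u x) ≠ ∞ then u x k else 0 := by
    split_ifs with h
    · rw [coeff_toSobolev h.1 h.2]
    · rw [toSobolev, dif_neg h, Sobolev.coeff_zero, Pi.zero_apply]
  simp only [e]
  refine Measurable.ite (.inter (s₁ := {x | ∀ k, u x (-k) = star (u x k)}) ?_ ((measurable_energy α hu)
    (measurableSet_singleton ∞).compl)) (hu k) measurable_const
  rw [ofPred_forall]
  exact .iInter fun k => measurableSet_eq_fun (hu _) (continuous_star.measurable.comp (hu k))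

theorem eLpNorm_eq_lintegral_energy {μ : Measure X} {q : ℝ≥0∞} (hq0 : q ≠ 0) (hq : q ≠ ∞) (g : X →
    Sobolev α) : eLpNorm g q μ = (∫⁻ t, energy α (g t).coeff ^ (q.toReal / 2) ∂μ) ^ (1 / q.toReal)
    := by
  rw [eLpNorm_eq_lintegral_rpow_enorm_toReal hq0 hq]
  congr 1
  refine lintegral_congr fun t => ?_
  rw [enorm_eq_energy_rpow, ← rpow_mul]
  congr 1; ring

theorem isEmbedding_pathSpace : Topology.IsEmbedding (fun p : PathSpace T δ q => p.1) :=
  Topology.IsEmbedding.subtypeVal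

/-- Skorokhod convergence implies convergence in the weak norm at almost every time, and compactness
of `K` bounds the paths uniformly; dominated convergence then gives `L^q` convergence in `H^(-3-δ)`.
The bound in `H^β` passes to the limit by Fatou, and interpolation raises the convergence to
`H^(-1-δ)`. -/
theorem isCompact_pathSpace (hq : q ≠ ∞) {K : Set (Cadlag T (Sobolev (-3 - δ)))} (hK : IsCompact K)
    (hβ : -1 - δ < β) (R : ℝ≥0) : IsCompact {p : PathSpace T δ q | p.1.1 ∈ K ∧ ∫⁻ t, energy β (p.1.2
    t).coeff ^ (q.toReal / 2) ∂timeMeasure T ≤ R} := by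
  have hq1 : 1 ≤ q.toReal := by
    have := toReal_mono hq (Fact.out : 1 ≤ q); simpa using this
  have hq0 : q ≠ 0 := fun h => by simp [h] at hq1; linarith
  have hq2 : 0 < q.toReal / 2 := by linarith
  set μ := timeMeasure T
  rw [isEmbedding_pathSpace.isCompact_iff]
  refine IsSeqCompact.isCompact fun x hx => ?_
  choose p hp hpx using hx
  obtain ⟨f, hfK, φ, hφ, hf⟩ := hK.isSeqCompact fun n => (hp n).1
  set w := fun n => (p (φ n)).1.1
  have hconv : ∀ᵐ t ∂μ, Tendsto (fun n => w n t) atTop (𝓝 (f t)) :=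
    f.ae_continuousAt.mono fun t ht => Cadlag.tendsto_apply hf ht
  have hagree : ∀ᵐ t ∂μ, ∀ n, ((p n).1.1 t).coeff = ((p n).1.2 t).coeff :=
    ae_all_iff.2 fun n => (p n).2
  have hmf : ∀ (g : Cadlag T (Sobolev (-3 - δ))) k, Measurable fun t => (g t).coeff k := fun g k =>
    (Sobolev.continuous_coeff k).measurable.comp g.measurable
  have hpint n : ∫⁻ t, energy β (w n t).coeff ^ (q.toReal / 2) ∂μ ≤ R :=
    (lintegral_congr_ae (hagree.mono fun t ht => by simp only [w, ht])).trans_le (hp (φ n)).2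
  have hfint : ∫⁻ t, energy β (f t).coeff ^ (q.toReal / 2) ∂μ ≤ R := by
    calc ∫⁻ t, energy β (f t).coeff ^ (q.toReal / 2) ∂μ
        ≤ ∫⁻ t, liminf (fun n => energy β (w n t).coeff ^ (q.toReal / 2)) atTop ∂μ := by
          refine lintegral_mono_ae ?_
          filter_upwards [hconv] with t ht
          have hlsc : LowerSemicontinuous fun u => energy β u ^ (q.toReal / 2) :=
            (ENNReal.continuous_rpow_const.comp_lowerSemicontinuous (lowerSemicontinuous_energy β)
              (ENNReal.monotone_rpow_of_nonneg hq2.le))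
          refine le_of_forall_lt fun c hc => ?_
          obtain ⟨c', hc1, hc2⟩ := exists_between hc
          refine hc1.trans_le (le_liminf_of_le (by isBoundedDefault) ?_)
          exact ((tendsto_pi_nhds.2 fun k => ((Sobolev.continuous_coeff k).tendsto _).comp ht)
            |>.eventually (hlsc _ c' hc2)).mono fun _ h => h.le
      _ ≤ liminf (fun n => ∫⁻ t, energy β (w n t).coeff ^ (q.toReal / 2) ∂μ) atTop :=
          lintegral_liminf_le fun n => (measurable_energy β (hmf _)).pow_const _
      _ ≤ R := liminf_le_of_frequently_le' (Frequently.of_forall hpint)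
  -- The second component of the limit is read off from the Skorokhod limit, whose `β` energy is
  -- finite at almost every time.
  let g₀ : Icc 0 T → Sobolev (-1 - δ) := fun t => toSobolev (-1 - δ) (f t).coeff
  have hg₀ : ∀ᵐ t ∂μ, (g₀ t).coeff = (f t).coeff := by
    filter_upwards [ae_lt_top ((measurable_energy β (hmf f)).pow_const (q.toReal / 2))
      (hfint.trans_lt coe_lt_top).ne] with t ht
    refine coeff_toSobolev (f t).coeff_neg_apply fun h => ?_
    have := energy_mono hβ.le (f t).coeff
    rw [h, top_le_iff] at this
    rw [this, ENNReal.top_rpow_of_pos hq2] at ht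
    exact lt_irrefl _ ht
  have hg₀Lp : MemLp g₀ q μ := by
    refine ⟨(measurable_toSobolev (hmf f)).aestronglyMeasurable, ?_⟩
    rw [eLpNorm_eq_lintegral_energy hq0 hq]
    refine ENNReal.rpow_lt_top_of_nonneg (by positivity)
      ((lintegral_mono_ae (hg₀.mono fun t ht => ?_)).trans_lt (hfint.trans_lt coe_lt_top)).ne
    rw [ht]
    gcongr
    exact energy_mono hβ.le _
  set g : Lp (Sobolev (-1 - δ)) q μ := hg₀Lp.toLp g₀
  have hgf : ∀ᵐ t ∂μ, (f t).coeff = (g t).coeff := by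
    filter_upwards [hg₀Lp.coeFn_toLp, hg₀] with t h1 h2
    rw [h1, h2]
  refine ⟨(f, g), ⟨⟨(f, g), hgf⟩, ⟨hfK, (lintegral_congr_ae (hgf.mono fun t ht => ?_)).trans_le hfint⟩,
    rfl⟩, φ, hφ, ?_⟩
  · change energy β (g t).coeff ^ (q.toReal / 2) = _
    rw [← ht]
  change Tendsto (fun n => x (φ n)) atTop (𝓝 (f, g))
  simp only [← hpx]
  refine hf.prodMk_nhds ?_
  rw [tendsto_iff_edist_tendsto_0]
  -- convergence in the weak norm, by dominated convergence
  obtain ⟨C, hC⟩ := exists_norm_le_of_isCompact hK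
  have hweak : Tendsto (fun n => ∫⁻ t, energy (-3 - δ)
      ((w n t).coeff - (f t).coeff) ^ (q.toReal / 2) ∂μ) atTop (𝓝 0) := by
    have e n t : energy (-3 - δ) ((w n t).coeff - (f t).coeff) ^ (q.toReal / 2)
        = edist (w n t) (f t) ^ q.toReal := by
      rw [← edist_sq_eq_energy, ← rpow_natCast, ← rpow_mul]
      congr 1
      push_cast
      ring
    simp only [e]
    rw [← lintegral_zero (μ := μ)]
    refine tendsto_lintegral_of_dominated_convergence
      (fun _ => (ofReal C + ofReal C) ^ q.toReal) (fun n => ?_) (fun n => ?_) ?_ ?_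
    · exact (((w n).measurable.edist f.measurable)).pow_const _
    · refine .of_forall fun t => ?_
      refine rpow_le_rpow ?_ (by positivity)
      rw [edist_eq_enorm_sub]
      refine (enorm_sub_le).trans ?_
      rw [← ofReal_norm, ← ofReal_norm]
      exact add_le_add (ofReal_le_ofReal (hC _ (hp _).1 t)) (ofReal_le_ofReal (hC _ hfK t))
    · rw [lintegral_const]
      finiteness
    · filter_upwards [hconv] with t ht
      have := (tendsto_iff_edist_tendsto_0.1 ht).ennrpow_const q.toReal
      rwa [zero_rpow_of_pos (by linarith)] at this
  have hstrong n : ∫⁻ t, energy β ((w n t).coeff - (f t).coeff) ^ (q.toReal / 2) ∂μ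
      ≤ 2 ^ (q.toReal / 2) * (2 ^ q.toReal * (R + R)) := by
    calc ∫⁻ t, energy β ((w n t).coeff - (f t).coeff) ^ (q.toReal / 2) ∂μ
        ≤ ∫⁻ t, 2 ^ (q.toReal / 2) * (2 ^ q.toReal * (energy β (w n t).coeff ^ (q.toReal / 2)
            + energy β (f t).coeff ^ (q.toReal / 2))) ∂μ := by
          refine lintegral_mono fun t => (rpow_le_rpow (energy_sub_le β _ _) hq2.le).trans ?_
          rw [mul_rpow_of_nonneg _ _ hq2.le]
          gcongr
          exact ENNReal.rpow_half_add_le hq1 _ _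
      _ = 2 ^ (q.toReal / 2) * (2 ^ q.toReal * ((∫⁻ t, energy β (w n t).coeff ^ (q.toReal / 2) ∂μ)
            + ∫⁻ t, energy β (f t).coeff ^ (q.toReal / 2) ∂μ)) := by
          rw [lintegral_const_mul' _ _ (by finiteness), lintegral_const_mul' _ _ (by finiteness),
            lintegral_add_left ((measurable_energy β (hmf _)).pow_const _)]
      _ ≤ _ := by
          gcongr
          exact hpint _
  have hmain := tendsto_lintegral_energy_of_bounded hβ hq1 (by finiteness)
    (u := fun n t => (w n t).coeff - (f t).coeff)
    (fun n k => (hmf (w n) k).sub (hmf f k)) hstrong hweak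
  have hfinal := hmain.ennrpow_const (1 / q.toReal)
  rw [zero_rpow_of_pos (by positivity)] at hfinal
  refine hfinal.congr fun n => ?_
  rw [Lp.edist_def, eLpNorm_eq_lintegral_energy hq0 hq]
  congr 1
  refine lintegral_congr_ae ?_
  filter_upwards [hagree, hgf] with t h1 h2
  rw [Pi.sub_apply, Sobolev.coeff_sub, ← h1, ← h2]

/-! ### The Green function -/

/-- The covering map `ℝ² → 𝕋²`. -/
def toTorus (u : ℝ²) : Torus := fun l => (u l : UnitAddCircle)

/-- The squared Euclidean length. -/
def sqLen (u : ℝ²) : ℝ := u 0 ^ 2 + u 1 ^ 2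

local notation:max "shift" u:max n:max => sqLen (fun l => u l + n l)
local notation:max "lift" g:max => fun u => g (toTorus u)

theorem sqLen_nonneg (u : ℝ²) : 0 ≤ sqLen u := by unfold sqLen; positivity

theorem mFourier_toTorus (k : ℤ²) (u : ℝ²) : mFourier k (toTorus u) = Complex.exp (2 * π * I * (k 0
    * u 0)) * Complex.exp (2 * π * I * (k 1 * u 1)) := by
  simp only [mFourier, toTorus, ContinuousMap.coe_mk, Fin.prod_univ_two, fourier_coe_apply]
  congr 2 <;> (push_cast; ring)

theorem re_mFourier_toTorus (k : ℤ²) (u : ℝ²) :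
    (mFourier k (toTorus u)).re = cos (2 * π * (k 0 * u 0 + k 1 * u 1)) := by
  rw [mFourier_toTorus, ← exp_add]
  have : 2 * π * I * (k 0 * u 0) + 2 * π * I * (k 1 * u 1)
      = ((2 * π * (k 0 * u 0 + k 1 * u 1) : ℝ) : ℂ) * I := by
    push_cast; ring
  rw [this, Complex.exp_ofReal_mul_I_re]

/-! #### The heat kernel -/

/-- Up to a constant factor the terms are the norms of the terms of a Jacobi theta series, after
expanding the square. -/
theorem summable_gaussian_shift {c : ℝ} (hc : 0 < c) (a : ℝ) :
    Summable fun n : ℤ => exp (-c * (a + n) ^ 2) := by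
  have h := (summable_jacobiTheta₂_term_iff (I * (c * a / π)) (I * (c / π))).2 (by simp; positivity)
  have h2 := (h.norm).mul_left (exp (-c * a ^ 2))
  refine h2.congr fun n => ?_
  rw [norm_jacobiTheta₂_term, ← Real.exp_add]
  congr 1
  have e1 : (I * (c / π)).im = c / π := by
    rw [← ofReal_div, I_mul_im, ofReal_re]
  have e2 : (I * (c * a / π)).im = c * a / π := by
    rw [← Complex.ofReal_mul, ← ofReal_div, I_mul_im, ofReal_re]
  rw [e1, e2]
  field_simp
  ring

theorem tsum_theta (ht : 0 < t) (a : ℝ) :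
    ∑' n : ℤ, Complex.exp (-(4 * π ^ 2 * n ^ 2 * t) + 2 * π * I * (n * a))
      = (((4 * π * t) ^ (-(1 / 2) : ℝ) * ∑' n : ℤ, exp (-(4 * t)⁻¹ * (a + n) ^ 2) : ℝ) : ℂ) := by
  have hpos : (0 : ℝ) < 4 * π * t := by positivity
  have h := Complex.tsum_exp_neg_quadratic (a := ((4 * π * t : ℝ) : ℂ)) (by rwa [ofReal_re]) (I * a)
  have e1 : ∀ n : ℤ, -(4 * π ^ 2 * n ^ 2 * t) + 2 * π * I * (n * a)
      = -π * ((4 * π * t : ℝ) : ℂ) * n ^ 2 + 2 * π * (I * a) * n := by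
    intro n; push_cast; ring
  simp only [e1]
  rw [h, Complex.ofReal_mul ((4 * π * t) ^ (-(1 / 2) : ℝ)), Complex.ofReal_tsum]
  congr 1
  · rw [rpow_neg hpos.le, Complex.ofReal_inv, Complex.ofReal_cpow hpos.le, one_div]
    push_cast; rfl
  · rw [← (Equiv.neg ℤ).tsum_eq]
    refine tsum_congr fun n => ?_
    rw [ofReal_exp]
    congr 1
    have hI : I * (I * a) = -a := by
      rw [← mul_assoc, Complex.I_mul_I]; ring
    rw [hI]
    have hπ : (π : ℂ) ≠ 0 := by exact_mod_cast Real.pi_ne_zero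
    have ht' : (t : ℂ) ≠ 0 := by exact_mod_cast ht.ne'
    simp only [Equiv.neg_apply]
    push_cast
    field_simp
    ring

theorem norm_theta_term (t : ℝ) (a : ℝ) (n : ℤ) : ‖Complex.exp (-(4 * π ^ 2 * n ^ 2 * t) + 2 * π * I
    * (n * a))‖ = exp (-(4 * π ^ 2 * t) * (0 + n) ^ 2) := by
  rw [Complex.norm_exp]
  congr 1
  have : (-(4 * π ^ 2 * n ^ 2 * t) + 2 * π * I * (n * a) : ℂ)
      = ((-(4 * π ^ 2 * n ^ 2 * t) : ℝ) : ℂ) + ((2 * π * (n * a) : ℝ) : ℂ) * I := by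
    push_cast; ring
  rw [this, add_re, ofReal_re, re_ofReal_mul, I_re]
  ring

theorem hasSum_fin_two_mul {R : Type*} [NormedRing R] [CompleteSpace R] {f g : ℤ → R}
    (hf : Summable fun n => ‖f n‖) (hg : Summable fun n => ‖g n‖) :
    HasSum (fun k : ℤ² => f (k 0) * g (k 1)) ((∑' n, f n) * ∑' n, g n) := by
  rw [tsum_mul_tsum_of_summable_norm hf hg]
  have h := (summable_mul_of_summable_norm hf hg).hasSum
  exact (finTwoArrowEquiv ℤ).hasSum_iff.2 h

/-- Both sides are the heat kernel of the torus, on the left as a spectral series and on the right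
as a sum over images. They factor into one-dimensional sums, which agree by Poisson summation. -/
theorem hasSum_heat (ht : 0 < t) (u : ℝ²) :
    HasSum (fun k : ℤ² => exp (-(ev k * t)) * (mFourier k (toTorus u)).re)
      (∑' n : ℤ², exp (-shift u n / (4 * t)) / (4 * π * t)) := by
  have hpos : (0 : ℝ) < 4 * π * t := by positivity
  have hsum (a : ℝ) : Summable fun n : ℤ =>
      ‖Complex.exp (-(4 * π ^ 2 * n ^ 2 * t) + 2 * π * I * (n * a))‖ := by
    simp only [norm_theta_term]
    exact summable_gaussian_shift (by positivity) 0
  have h := hasSum_fin_two_mul (hsum (u 0)) (hsum (u 1))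
  rw [tsum_theta ht, tsum_theta ht, ← Complex.ofReal_mul] at h
  have hre := (Complex.hasSum_iff _ _).1 h |>.1
  rw [ofReal_re] at hre
  have hs2 (a : ℝ) : Summable fun n : ℤ => ‖exp (-(4 * t)⁻¹ * (a + n) ^ 2)‖ :=
    (summable_gaussian_shift (by positivity) a).norm
  have h2 := (hasSum_fin_two_mul (hs2 (u 0)) (hs2 (u 1))).mul_left (4 * π * t)⁻¹
  have e2 : (fun n : ℤ² => exp (-shift u n / (4 * t)) / (4 * π * t))
      = fun n => (4 * π * t)⁻¹ * (exp (-(4 * t)⁻¹ * (u 0 + n 0) ^ 2) *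
        exp (-(4 * t)⁻¹ * (u 1 + n 1) ^ 2)) := by
    funext n
    rw [← Real.exp_add, div_eq_inv_mul]
    congr 2
    unfold sqLen
    field_simp
    ring
  rw [e2, h2.tsum_eq]
  convert hre using 1
  · funext k
    rw [mFourier_toTorus, ← re_ofReal_mul]
    congr 1
    rw [ofReal_exp, ← exp_add, ← exp_add, ← exp_add]
    congr 1
    unfold freqSq
    push_cast
    ring
  · rw [mul_mul_mul_comm, ← rpow_add hpos]
    congr 1
    norm_num [Real.rpow_neg_one]

/-! #### The exponential integral -/

/-- `∫₀¹ exp (- s / 4 t) / (4 π t) dt`, the small time part of the logarithmic potential. -/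
def expInt (s : ℝ) : ℝ := ∫ t in Ioc (0 : ℝ) 1, exp (-s / (4 * t)) / (4 * π * t)

theorem exp_neg_le_inv_cube {x : ℝ} (hx : 0 < x) : exp (-x) ≤ 6 / x ^ 3 := by
  have h := Real.pow_div_factorial_le_exp x hx.le 3
  rw [Real.exp_neg, inv_eq_one_div, div_le_div_iff₀ (exp_pos x) (by positivity)]
  norm_num [Nat.factorial] at h
  linarith

theorem heat_term_le (hs : 0 < s) (ht : t ∈ Ioc (0 : ℝ) 1) :
    exp (-s / (4 * t)) / (4 * π * t) ≤ 96 / s ^ 3 := by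
  have ht0 := ht.1
  have h := exp_neg_le_inv_cube (x := s / (4 * t)) (by positivity)
  rw [← neg_div] at h
  have hπ : 1 ≤ π := by linarith [pi_gt_three]
  calc exp (-s / (4 * t)) / (4 * π * t)
      ≤ (6 / (s / (4 * t)) ^ 3) / (4 * π * t) := by gcongr
    _ = 96 / s ^ 3 * (t ^ 2 / π) := by field_simp; ring
    _ ≤ 96 / s ^ 3 * 1 := by
        gcongr
        rw [div_le_one (by positivity)]
        nlinarith [ht.2]
    _ = _ := mul_one _

theorem heat_term_deriv_le (hs : 0 < s) (ht : t ∈ Ioc (0 : ℝ) 1) :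
    exp (-s / (4 * t)) / (16 * π * t ^ 2) ≤ 24 / s ^ 3 := by
  have ht0 := ht.1
  have h := exp_neg_le_inv_cube (x := s / (4 * t)) (by positivity)
  rw [← neg_div] at h
  have hπ : 1 ≤ π := by linarith [pi_gt_three]
  calc exp (-s / (4 * t)) / (16 * π * t ^ 2)
      ≤ (6 / (s / (4 * t)) ^ 3) / (16 * π * t ^ 2) := by gcongr
    _ = 24 / s ^ 3 * (t / π) := by field_simp; ring
    _ ≤ 24 / s ^ 3 * 1 := by
        gcongr
        rw [div_le_one (by positivity)]
        linarith [ht.2]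
    _ = _ := mul_one _

theorem measurable_heat_term (s : ℝ) : Measurable fun t : ℝ => exp (-s / (4 * t)) / (4 * π * t) :=
  by fun_prop

theorem integrableOn_of_bounded_Ioc {f : ℝ → ℝ} (hf : Measurable f) (h : ∀ t ∈ Ioc (0 : ℝ) 1, ‖f t‖
    ≤ C) : IntegrableOn f (Ioc (0 : ℝ) 1) :=
  Measure.integrableOn_of_bounded (by simp) hf.aestronglyMeasurable
    ((ae_restrict_iff' measurableSet_Ioc).2 (.of_forall h))

theorem heat_term_nonneg (ht : t ∈ Ioc (0 : ℝ) 1) : 0 ≤ exp (-s / (4 * t)) / (4 * π * t) := by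
  have := ht.1; positivity

theorem integrableOn_heat_term (hs : 0 < s) :
    IntegrableOn (fun t : ℝ => exp (-s / (4 * t)) / (4 * π * t)) (Ioc 0 1) :=
  integrableOn_of_bounded_Ioc (measurable_heat_term s) (C := 96 / s ^ 3) fun t ht => by
    rw [norm_of_nonneg (heat_term_nonneg ht)]
    exact heat_term_le hs ht

theorem expInt_nonneg (s : ℝ) : 0 ≤ expInt s :=
  setIntegral_nonneg measurableSet_Ioc fun _ ht => heat_term_nonneg ht

theorem expInt_le (hs : 0 < s) : expInt s ≤ 96 / s ^ 3 := by
  have h := setIntegral_mono_on (integrableOn_heat_term hs)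
    (integrableOn_const (by simp)) measurableSet_Ioc fun t ht => heat_term_le hs ht
  simpa [expInt] using h

/-- The integrand is, up to sign, the exact `t`-derivative of `exp (-s / (4 * t)) / (4 * π * s)`.
This is why the derivative of `expInt` is elementary although `expInt` is not. -/
theorem integral_heat_term_deriv (hs : 0 < s) : ∫ t in Ioc (0 : ℝ) 1, -(exp (-s / (4 * t)) / (16 * π
    * t ^ 2)) = -(exp (-s / 4) / (4 * π * s)) := by
  rw [integral_neg, neg_inj, ← integral_of_le zero_le_one]
  have hder : ∀ t ∈ Ioo (0 : ℝ) 1, HasDerivAt (fun t => exp (-s / (4 * t)) / (4 * π * s))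
      (exp (-s / (4 * t)) / (16 * π * t ^ 2)) t := by
    intro t ht
    have ht0 : t ≠ 0 := ht.1.ne'
    have h1 : HasDerivAt (fun t : ℝ => -s / (4 * t)) (s / (4 * t ^ 2)) t := by
      have := ((hasDerivAt_id' t).const_mul 4).fun_inv (by simpa using ht0) |>.const_mul (-s)
      refine this.congr_deriv ?_
      field_simp
    have := h1.exp.div_const (4 * π * s)
    refine this.congr_deriv ?_
    field_simp
    ring
  have hint : IntervalIntegrable (fun t => exp (-s / (4 * t)) / (16 * π * t ^ 2)) volume 0 1 := by
    rw [intervalIntegrable_iff_integrableOn_Ioc_of_le zero_le_one]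
    refine integrableOn_of_bounded_Ioc (by fun_prop) (C := 24 / s ^ 3) fun t ht => ?_
    rw [norm_of_nonneg (by positivity)]
    exact heat_term_deriv_le hs ht
  have h0 : Tendsto (fun t => exp (-s / (4 * t)) / (4 * π * s)) (𝓝[>] 0) (𝓝 0) := by
    have hlim : Tendsto (fun t : ℝ => -s / (4 * t)) (𝓝[>] 0) atBot := by
      have : Tendsto (fun t : ℝ => (-s / 4) * t⁻¹) (𝓝[>] 0) atBot :=
        tendsto_inv_nhdsGT_zero.const_mul_atTop_of_neg (by linarith)
      refine this.congr fun t => ?_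
      rw [← div_eq_mul_inv, div_div]
    have := (Real.tendsto_exp_atBot.comp hlim).div_const (4 * π * s)
    simpa [comp_def] using this
  have h1 : Tendsto (fun t => exp (-s / (4 * t)) / (4 * π * s)) (𝓝[<] 1)
      (𝓝 (exp (-s / 4) / (4 * π * s))) := by
    have hc : ContinuousAt (fun t => exp (-s / (4 * t)) / (4 * π * s)) 1 := by
      have : (4 * (1 : ℝ)) ≠ 0 := by norm_num
      fun_prop (disch := assumption)
    have := hc.tendsto.mono_left (nhdsWithin_le_nhds (s := Iio (1 : ℝ)))
    simpa using this
  rw [intervalIntegral.integral_eq_sub_of_hasDerivAt_of_tendsto zero_lt_one hder hint h0 h1, sub_zero]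

theorem hasDerivAt_expInt (hs : 0 < s) : HasDerivAt expInt (-(exp (-s / 4) / (4 * π * s))) s := by
  rw [← integral_heat_term_deriv hs]
  have hset : Ioi (s / 2) ∈ 𝓝 s := Ioi_mem_nhds (by linarith)
  refine (hasDerivAt_integral_of_dominated_loc_of_deriv_le (μ := volume.restrict (Ioc (0 : ℝ) 1))
    (F := fun s t => exp (-s / (4 * t)) / (4 * π * t))
    (F' := fun s t => -(exp (-s / (4 * t)) / (16 * π * t ^ 2)))
    (bound := fun _ => 24 / (s / 2) ^ 3) hset ?_ (integrableOn_heat_term hs) ?_ ?_ ?_ ?_).2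
  · exact .of_forall fun s => (measurable_heat_term s).aestronglyMeasurable
  · exact Measurable.aestronglyMeasurable (by fun_prop)
  · refine (ae_restrict_iff' measurableSet_Ioc).2 (.of_forall fun t ht x hx => ?_)
    have hx : s / 2 < x := hx
    have hx0 : 0 < x := by linarith
    rw [norm_neg, norm_of_nonneg (by positivity)]
    refine (heat_term_deriv_le hx0 ht).trans ?_
    gcongr
  · exact integrableOn_const (by simp)
  · refine (ae_restrict_iff' measurableSet_Ioc).2 (.of_forall fun t ht x hx => ?_)
    have ht0 : t ≠ 0 := ht.1.ne'
    have h1 : HasDerivAt (fun x : ℝ => -x / (4 * t)) (-1 / (4 * t)) x :=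
      (hasDerivAt_id x).neg.div_const _
    have := h1.exp.div_const (4 * π * t)
    refine this.congr_deriv ?_
    field_simp
    ring

/-- On `(0, 1]` the derivative of `expInt` is at most that of `-c * log`, so the singularity at zero
is at least logarithmic. -/
theorem expInt_ge (hs : 0 < s) (hs1 : s ≤ 1) : -(exp (-1 / 4) / (4 * π)) * log s ≤ expInt s := by
  set c := exp (-1 / 4) / (4 * π) with hc
  have hder : ∀ x ∈ Ioi (0 : ℝ), HasDerivAt (fun x => expInt x + c * log x)
      (-(exp (-x / 4) / (4 * π * x)) + c * x⁻¹) x := fun x hx =>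
    (hasDerivAt_expInt hx).add ((Real.hasDerivAt_log (ne_of_gt hx)).const_mul c)
  have hanti : AntitoneOn (fun x => expInt x + c * log x) (Icc s 1) := by
    refine antitoneOn_of_deriv_nonpos (convex_Icc _ _) (fun x hx => ?_) (fun x hx => ?_) fun x hx => ?_
    · exact (hder x (hs.trans_le hx.1)).continuousAt.continuousWithinAt
    · rw [interior_Icc] at hx
      exact (hder x (hs.trans hx.1)).differentiableAt.differentiableWithinAt
    · rw [interior_Icc] at hx
      have hx0 : 0 < x := hs.trans hx.1
      rw [(hder x hx0).deriv]
      have : exp (-1 / 4) ≤ exp (-x / 4) := by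
        apply Real.exp_le_exp.2
        linarith [hx.2]
      have h2 : c * x⁻¹ ≤ exp (-x / 4) / (4 * π * x) := by
        rw [hc, ← div_eq_mul_inv, div_div]
        gcongr
      linarith
  have := hanti (left_mem_Icc.2 hs1) (right_mem_Icc.2 hs1) hs1
  simp only [Real.log_one, mul_zero, add_zero] at this
  linarith [expInt_nonneg 1]

/-! ### Smoothness of the Green function off the origin -/

set_option maxSynthPendingDepth 3 in
theorem contDiffOn_two_tsum {α E : Type*} [NormedAddCommGroup E] [NormedSpace ℝ E] {s : Set E} (hs :
    IsOpen s) (hs' : IsPreconnected s) {x₀ : E} (hx₀ : x₀ ∈ s) {b : α → ℝ} (hb : Summable b) {f : α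
    → E → ℝ} {f' : α → E → E →L[ℝ] ℝ} {f'' : α → E → E →L[ℝ] E →L[ℝ] ℝ} (h1 : ∀ n, ∀ x ∈ s,
    HasFDerivAt (f n) (f' n x) x) (h2 : ∀ n, ∀ x ∈ s, HasFDerivAt (f' n) (f'' n x) x) (hb1 : ∀ n, ∀
    x ∈ s, ‖f' n x‖ ≤ b n) (hb2 : ∀ n, ∀ x ∈ s, ‖f'' n x‖ ≤ b n) (hc : ∀ n, ContinuousOn (f'' n) s)
    (h0 : Summable fun n => f n x₀) : ContDiffOn ℝ 2 (fun x => ∑' n, f n x) s := by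
  have d1 : ∀ x ∈ s, HasFDerivAt (fun y => ∑' n, f n y) (∑' n, f' n x) x := fun x hx =>
    hasFDerivAt_tsum_of_isPreconnected hb hs hs' h1 hb1 hx₀ h0 hx
  have d2 : ∀ x ∈ s, HasFDerivAt (fun y => ∑' n, f' n y) (∑' n, f'' n x) x := fun x hx =>
    hasFDerivAt_tsum_of_isPreconnected hb hs hs' h2 hb2 hx₀
      (Summable.of_norm_bounded hb fun n => hb1 n x₀ hx₀) hx
  have e2 : (2 : WithTop ℕ∞) = 1 + 1 := by norm_num
  have e1 : (1 : WithTop ℕ∞) = 0 + 1 := by norm_num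
  rw [e2, contDiffOn_succ_iff_fderiv_of_isOpen hs]
  refine ⟨fun x hx => (d1 x hx).differentiableAt.differentiableWithinAt, by simp, ?_⟩
  refine ContDiffOn.congr (f := fun y => ∑' n, f' n y) ?_ fun x hx => (d1 x hx).fderiv
  rw [e1, contDiffOn_succ_iff_fderiv_of_isOpen hs]
  refine ⟨fun x hx => (d2 x hx).differentiableAt.differentiableWithinAt, by simp, ?_⟩
  refine ContDiffOn.congr (f := fun y => ∑' n, f'' n y) ?_ fun x hx => (d2 x hx).fderiv
  rw [contDiffOn_zero]
  exact continuousOn_tsum (F := E →L[ℝ] E →L[ℝ] ℝ) hc hb hb2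

/-- The derivative of `sqLen`, as a bilinear form. -/
def sqLenForm : ℝ² →L[ℝ] ℝ² →L[ℝ] ℝ :=
  ∑ l : Fin 2, (2 : ℝ) • (proj l : ℝ² →L[ℝ] ℝ).smulRight (proj l : ℝ² →L[ℝ] ℝ)

theorem sqLenForm_apply (v w : ℝ²) : sqLenForm v w = 2 * (v 0 * w 0 + v 1 * w 1) := by
  simp [sqLenForm, Fin.sum_univ_two]
  ring

theorem norm_sqLenForm_apply_le (v : ℝ²) : ‖sqLenForm v‖ ≤ 4 * ‖v‖ := by
  refine opNorm_le_bound _ (by positivity) fun w => ?_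
  rw [sqLenForm_apply]
  have hv := norm_le_pi_norm v
  have hw := norm_le_pi_norm w
  calc ‖2 * (v 0 * w 0 + v 1 * w 1)‖ ≤ 2 * (‖v 0‖ * ‖w 0‖ + ‖v 1‖ * ‖w 1‖) := by
        rw [norm_mul, Real.norm_two, ← norm_mul, ← norm_mul]
        gcongr; exact norm_add_le _ _
    _ ≤ 2 * (‖v‖ * ‖w‖ + ‖v‖ * ‖w‖) := by gcongr <;> solve_by_elim
    _ = 4 * ‖v‖ * ‖w‖ := by ring

theorem norm_sqLenForm_le : ‖sqLenForm‖ ≤ 4 :=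
  opNorm_le_bound _ (by norm_num) norm_sqLenForm_apply_le

theorem hasFDerivAt_sqLen_add (c u : ℝ²) :
    HasFDerivAt (fun u => sqLen (fun l => u l + c l)) (sqLenForm (u + c)) u := by
  have h (l : Fin 2) : HasFDerivAt (fun u : ℝ² => u l + c l) (proj l : ℝ² →L[ℝ] ℝ) u :=
    ((proj l : ℝ² →L[ℝ] ℝ).hasFDerivAt).add_const _
  refine (((h 0).pow 2).add ((h 1).pow 2)).congr_fderiv ?_
  ext w
  simp [sqLenForm_apply]
  ring

set_option maxSynthPendingDepth 3 in
theorem hasFDerivAt_sqLenForm_add (c u : ℝ²) :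
    HasFDerivAt (fun u => sqLenForm (u + c)) sqLenForm u :=
  (HasFDerivAt.comp (g := sqLenForm) u (sqLenForm.hasFDerivAt (x := u + c))
    ((hasFDerivAt_id u).add_const c) :)

theorem norm_sq_le_sqLen (v : ℝ²) : ‖v‖ ^ 2 ≤ sqLen v := by
  have h : ‖v‖ ≤ √(sqLen v) := by
    refine (pi_norm_le_iff_of_nonneg (by positivity)).2 fun l => ?_
    refine Real.abs_le_sqrt ?_
    unfold sqLen
    fin_cases l <;> simp <;> positivity
  calc ‖v‖ ^ 2 ≤ √(sqLen v) ^ 2 := by gcongr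
    _ = sqLen v := sq_sqrt (sqLen_nonneg v)

theorem sqLen_le_norm_sq (v : ℝ²) : sqLen v ≤ 2 * ‖v‖ ^ 2 := by
  have h0 := norm_le_pi_norm v 0
  have h1 := norm_le_pi_norm v 1
  rw [norm_eq_abs, ← abs_norm v, ← sq_le_sq] at h0 h1
  unfold sqLen
  linarith

theorem sqLen_pos (h : v ≠ 0) : 0 < sqLen v :=
  lt_of_lt_of_le (by have := norm_pos_iff.2 h; positivity) (norm_sq_le_sqLen v)

/-- The open square around the origin on which the Green function is expanded. -/
def cell : Set ℝ² := {u | ‖u‖ < 3 / 4}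

theorem isOpen_cell : IsOpen cell := isOpen_lt continuous_norm continuous_const

theorem convex_cell : Convex ℝ cell := by
  have : cell = Metric.ball 0 (3 / 4) := by ext; simp [cell]
  rw [this]; exact convex_ball _ _

theorem one_le_freqSq {n : ℤ²} (hn : n ≠ 0) : 1 ≤ freqSq n := by
  have : n 0 ≠ 0 ∨ n 1 ≠ 0 := by
    by_contra! h
    exact hn (by ext l; fin_cases l <;> simp [h.1, h.2])
  have key : ∀ m : ℤ, m ≠ 0 → (1 : ℝ) ≤ (m : ℝ) ^ 2 := fun m h => by
    exact_mod_cast (one_le_sq_iff_one_le_abs m).2 (Int.one_le_abs h)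
  unfold freqSq
  rcases this with h | h <;> nlinarith [key _ h, sq_nonneg (n 0 : ℝ), sq_nonneg (n 1 : ℝ)]

/-- A coordinate below `3 / 4` leaves `|a + m| ≥ |m| / 4` for every nonzero integer `m`. So only the
untranslated image is singular on the cell, while the cell still contains the closed square of half
side `1 / 2`. -/
theorem le_sqLen_shift (hu : u ∈ cell) {n : ℤ²} (hn : n ≠ 0) :
    (1 + freqSq n) / 32 ≤ shift u n := by
  have key : ∀ (a : ℝ) (m : ℤ), |a| < 3 / 4 → (m : ℝ) ^ 2 / 16 ≤ (a + m) ^ 2 := by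
    intro a m ha
    rcases eq_or_ne m 0 with rfl | hm
    · simp; positivity
    · have h1 : (1 : ℝ) ≤ |(m : ℝ)| := by exact_mod_cast Int.one_le_abs hm
      have h2 := abs_sub_abs_le_abs_add (m : ℝ) a
      rw [add_comm a, ← sq_abs (m + a : ℝ), ← sq_abs (m : ℝ)]
      nlinarith
  have hl l : |u l| < 3 / 4 := lt_of_le_of_lt (norm_le_pi_norm u l) hu
  have h0 := key _ (n 0) (hl 0)
  have h1 := key _ (n 1) (hl 1)
  have h3 := one_le_freqSq hn
  unfold sqLen
  unfold freqSq at h3 ⊢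
  simp only
  linarith

local notation:max "slope" s:max => exp (-s / 4) / (4 * π * s)

set_option maxSynthPendingDepth 3 in
-- Only the decay `s⁻²` matters, as it makes the lattice sum of first and second derivatives
-- converge; the constant is generous. The lower bound `1 / 32` is the one that `le_sqLen_shift`
-- provides.
theorem expInt_shift_bounds (hs : 1 / 32 ≤ s) (hv : sqLen v = s) : ‖(-(slope s))
    • sqLenForm v‖ ≤ 1000000 / s ^ 2 ∧ ‖(-(slope s)) • sqLenForm + ((exp (-s / 4)
    / (4 * π * s) * (1 / 4 + 1 / s)) • sqLenForm v).smulRight (sqLenForm v)‖ ≤ 1000000 / s ^ 2 := by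
  have hs0 : 0 < s := by linarith
  have he : slope s ≤ 32 / s ^ 4 := by
    have h := exp_neg_le_inv_cube (x := s / 4) (by positivity)
    rw [← neg_div] at h
    calc slope s ≤ (6 / (s / 4) ^ 3) / (4 * 3 * s) := by
          gcongr; exact Real.pi_gt_three.le
      _ = 32 / s ^ 4 := by field_simp; norm_num
  set p := slope s
  have hp0 : 0 ≤ p := by positivity
  have hv2 : ‖v‖ ^ 2 ≤ s := hv ▸ norm_sq_le_sqLen v
  have hv1 : ‖v‖ ≤ 33 * s := by nlinarith [norm_nonneg v, sq_nonneg (‖v‖ - 1)]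
  have hB := norm_sqLenForm_apply_le v
  have hi : 1 / s ≤ 32 := by rw [div_le_iff₀ hs0]; linarith
  refine ⟨?_, ?_⟩
  · rw [norm_smul, norm_neg, norm_of_nonneg hp0]
    calc p * ‖sqLenForm v‖ ≤ 32 / s ^ 4 * (132 * s) := by
          gcongr; linarith
      _ = 4224 / s ^ 2 * (1 / s) := by field_simp; norm_num
      _ ≤ 4224 / s ^ 2 * 32 := by gcongr
      _ ≤ 1000000 / s ^ 2 := by rw [div_mul_eq_mul_div]; gcongr; norm_num
  · have h1 : ‖(-p) • sqLenForm‖ ≤ 131072 / s ^ 2 := by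
      rw [norm_smul, norm_neg, norm_of_nonneg hp0]
      calc p * ‖sqLenForm‖ ≤ 32 / s ^ 4 * 4 := by gcongr; exact norm_sqLenForm_le
        _ = 128 / s ^ 2 * (1 / s) ^ 2 := by field_simp; norm_num
        _ ≤ 128 / s ^ 2 * 32 ^ 2 := by gcongr
        _ = 131072 / s ^ 2 := by ring
    have h2 : ‖((p * (1 / 4 + 1 / s)) • sqLenForm v).smulRight (sqLenForm v)‖ ≤ 540672 / s ^ 2 := by
      rw [norm_smulRight_apply, norm_smul, norm_of_nonneg (by positivity)]
      calc p * (1 / 4 + 1 / s) * ‖sqLenForm v‖ * ‖sqLenForm v‖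
          ≤ 32 / s ^ 4 * 33 * (4 * ‖v‖) * (4 * ‖v‖) := by gcongr; linarith
        _ = 16896 / s ^ 4 * ‖v‖ ^ 2 := by ring
        _ ≤ 16896 / s ^ 4 * s := by gcongr
        _ = 16896 / s ^ 2 * (1 / s) := by field_simp
        _ ≤ 16896 / s ^ 2 * 32 := by gcongr
        _ = 540672 / s ^ 2 := by ring
    calc _ ≤ 131072 / s ^ 2 + 540672 / s ^ 2 := (norm_add_le _ _).trans (add_le_add h1 h2)
      _ ≤ 1000000 / s ^ 2 := by rw [← add_div]; gcongr; norm_num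

theorem hasDerivAt_deriv_expInt (hs : 0 < s) : HasDerivAt (fun s => -(slope s))
    (slope s * (1 / 4 + 1 / s)) s := by
  have h1 : HasDerivAt (fun s : ℝ => exp (-s / 4)) (exp (-s / 4) * (-1 / 4)) s :=
    ((hasDerivAt_id' s).neg.div_const 4).exp
  have h2 : HasDerivAt (fun s : ℝ => 4 * π * s) (4 * π * 1) s := (hasDerivAt_id' s).const_mul _
  refine ((h1.div h2 (by positivity)).neg).congr_deriv ?_
  field_simp
  ring

/-- The contribution of the lattice translates to the singular part of the Green function. -/
def shiftSum (u : ℝ²) : ℝ :=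
  ∑' n : ℤ²₀, expInt (shift u n.1)

/-- The spectral part of the Green function. -/
def cosSum (u : ℝ²) : ℝ :=
  ∑' k : ℤ²₀, exp (-(ev k)) / (ev k) * cos (2 * π * (k.1 0 * u 0 + k.1 1 * u 1))

theorem summable_one_add_freqSq_inv_sq :
    Summable fun k : ℤ²₀ => ((1 + freqSq k.1) ^ 2)⁻¹ := by
  refine ((summable_one_add_freqSq_rpow (a := 2) (by norm_num)).subtype _).congr fun k => ?_
  have := one_add_freqSq_pos k.1
  simp only [comp]
  rw [rpow_neg this.le]
  norm_cast

theorem expInt_shift_le (hu : u ∈ cell) {n : ℤ²} (hn : n ≠ 0) :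
    ‖expInt (shift u n)‖ ≤ 3200000 * ((1 + freqSq n) ^ 2)⁻¹ := by
  have h := le_sqLen_shift hu hn
  have h1 := freqSq_nonneg n
  set s := shift u n
  have hs : 0 < s := lt_of_lt_of_le (by positivity) h
  rw [norm_of_nonneg (expInt_nonneg _)]
  calc expInt s ≤ 96 / s ^ 3 := expInt_le hs
    _ ≤ 96 / ((1 + freqSq n) / 32) ^ 3 := by gcongr
    _ = 3145728 * ((1 + freqSq n) ^ 2)⁻¹ * (1 / (1 + freqSq n)) := by field_simp; norm_num
    _ ≤ 3145728 * ((1 + freqSq n) ^ 2)⁻¹ * 1 := by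
      gcongr; rw [div_le_one (by positivity)]; linarith
    _ ≤ _ := by rw [mul_one]; gcongr; norm_num

theorem summable_expInt_shift (hu : u ∈ cell) :
    Summable fun n : ℤ²₀ => expInt (shift u n.1) :=
  Summable.of_norm_bounded (summable_one_add_freqSq_inv_sq.mul_left 3200000)
    fun n => expInt_shift_le hu n.2

set_option maxSynthPendingDepth 3 in
theorem contDiffOn_shiftSum : ContDiffOn ℝ 2 shiftSum cell := by
  have h0 : (0 : ℝ²) ∈ cell := by simp [cell]
  have hpos : ∀ (n : ℤ²₀), ∀ u ∈ cell,
      (1 + freqSq n.1) / 32 ≤ shift u n.1 := fun n u hu => le_sqLen_shift hu n.2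
  have hs : ∀ (n : ℤ²₀), ∀ u ∈ cell, 0 < shift u n.1 :=
    fun n u hu => lt_of_lt_of_le (by have := freqSq_nonneg n.1; positivity) (hpos n u hu)
  have hbound : ∀ (n : ℤ²₀), ∀ u ∈ cell,
      1000000 / shift u n.1 ^ 2 ≤ 1024000000 * ((1 + freqSq n.1) ^ 2)⁻¹ := by
    intro n u hu
    have h1 := freqSq_nonneg n.1
    calc 1000000 / shift u n.1 ^ 2 ≤ 1000000 / ((1 + freqSq n.1) / 32) ^ 2 := by
          gcongr; exact hpos n u hu
      _ = _ := by field_simp; norm_num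
  have h32 : ∀ (n : ℤ²₀), ∀ u ∈ cell, 1 / 32 ≤ shift u n.1 := fun n u hu =>
    le_trans (by have := freqSq_nonneg n.1; linarith) (hpos n u hu)
  refine contDiffOn_two_tsum isOpen_cell convex_cell.isPreconnected h0
    (summable_one_add_freqSq_inv_sq.mul_left 1024000000)
    (f' := fun n u => (-(slope (shift u n.1))) • sqLenForm (u + fun l => (n.1 l : ℝ)))
    (f'' := fun n u => (-(slope (shift u n.1))) • sqLenForm + ((slope (shift u n.1) *
        (1 / 4 + 1 / shift u n.1)) • sqLenForm (u + fun l => (n.1 l : ℝ))).smulRight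
        (sqLenForm (u + fun l => (n.1 l : ℝ))))
    ?_ ?_ ?_ ?_ ?_ (summable_expInt_shift h0)
  · intro n u hu
    exact (hasDerivAt_expInt (hs n u hu)).comp_hasFDerivAt u
      (hasFDerivAt_sqLen_add (fun l => (n.1 l : ℝ)) u)
  · intro n u hu
    exact HasFDerivAt.smul ((hasDerivAt_deriv_expInt (hs n u hu)).comp_hasFDerivAt u
      (hasFDerivAt_sqLen_add (fun l => (n.1 l : ℝ)) u))
      (hasFDerivAt_sqLenForm_add (fun l => (n.1 l : ℝ)) u)
  · exact fun n u hu => (expInt_shift_bounds (h32 n u hu) rfl).1.trans (hbound n u hu)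
  · exact fun n u hu => (expInt_shift_bounds (h32 n u hu) rfl).2.trans (hbound n u hu)
  · intro n
    have c0 : Continuous fun u : ℝ² => shift u n.1 := by
      unfold sqLen; fun_prop
    have c1 : Continuous fun u : ℝ² => sqLenForm (u + fun l => (n.1 l : ℝ)) := by fun_prop
    have c2 : ContinuousOn (fun u : ℝ² => exp (-shift u n.1 / 4) / (4 * π * shift u n.1)) cell :=
      ContinuousOn.div (c0.neg.div_const 4).rexp.continuousOn
        (continuous_const.mul c0).continuousOn fun u hu => by
        have := hs n u hu; positivity
    refine (c2.fun_neg.fun_smul continuousOn_const).fun_add ?_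
    have c3 : ContinuousOn (fun u : ℝ² => (1 : ℝ) / shift u n.1) cell :=
      ContinuousOn.div continuousOn_const c0.continuousOn fun u hu => (hs n u hu).ne'
    have c4 := (c2.fun_mul ((continuousOn_const (c := (1 / 4 : ℝ))).fun_add c3)).fun_smul
      c1.continuousOn
    exact ((smulRightL ℝ ℝ² (ℝ² →L[ℝ] ℝ)).continuous₂).comp_continuousOn (c4.prodMk c1.continuousOn)

set_option maxSynthPendingDepth 3 in
theorem contDiff_cosSum : ContDiff ℝ 2 cosSum := by
  let ℓ : ℤ² → ℝ² →L[ℝ] ℝ := fun k =>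
    (2 * π * k 0) • (proj 0 : ℝ² →L[ℝ] ℝ) + (2 * π * k 1) • (proj 1 : ℝ² →L[ℝ] ℝ)
  have hℓ k u : ℓ k u = 2 * π * (k 0 * u 0 + k 1 * u 1) := by
    simp [ℓ]; ring
  have hπ := pi_gt_three
  have hnorm : ∀ k, ‖ℓ k‖ ^ 2 ≤ 2 * (ev k) := by
    intro k
    have h1 : ‖ℓ k‖ ≤ 2 * π * (|(k 0 : ℝ)| + |(k 1 : ℝ)|) := by
      refine opNorm_le_bound _ (by positivity) fun u => ?_
      rw [hℓ, norm_mul, norm_of_nonneg (by positivity), mul_assoc (2 * π) _ ‖u‖]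
      gcongr
      refine (norm_add_le (k 0 * u 0 : ℝ) (k 1 * u 1)).trans ?_
      rw [norm_mul, norm_mul, add_mul]
      exact add_le_add (mul_le_mul_of_nonneg_left (norm_le_pi_norm u 0) (abs_nonneg _))
        (mul_le_mul_of_nonneg_left (norm_le_pi_norm u 1) (abs_nonneg _))
    calc ‖ℓ k‖ ^ 2 ≤ (2 * π * (|(k 0 : ℝ)| + |(k 1 : ℝ)|)) ^ 2 := by gcongr
      _ = 4 * π ^ 2 * (|(k 0 : ℝ)| + |(k 1 : ℝ)|) ^ 2 := by ring
      _ ≤ 4 * π ^ 2 * (2 * freqSq k) := by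
        gcongr
        unfold freqSq
        nlinarith [sq_nonneg (|(k 0 : ℝ)| - |(k 1 : ℝ)|), sq_abs (k 0 : ℝ), sq_abs (k 1 : ℝ)]
      _ = _ := by ring
  let a : ℤ² → ℝ := fun k =>
    exp (-(ev k)) / (ev k)
  have ha0 k : 0 ≤ a k := by have := freqSq_nonneg k; positivity
  have hab : ∀ k : ℤ²₀, a k * (1 + ‖ℓ k‖ ^ 2) ≤ 18 * ((1 + freqSq k.1) ^ 2)⁻¹ := by
    intro k
    have h1 := one_le_freqSq k.2
    have h2 := hnorm k.1
    have hy1 : 1 + freqSq k.1 ≤ ev k.1 := by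
      have : 36 ≤ 4 * π ^ 2 := by nlinarith
      nlinarith
    simp only [a]
    set y := ev k.1
    have hy : 1 ≤ y := by linarith
    have hy0 : 0 < y := by linarith
    calc exp (-y) / y * (1 + ‖ℓ k‖ ^ 2) ≤ (6 / y ^ 3) / y * (3 * y) := by
          gcongr
          · exact exp_neg_le_inv_cube hy0
          · linarith
      _ = 18 / y ^ 2 * (1 / y) := by field_simp; norm_num
      _ ≤ 18 / y ^ 2 * 1 := by gcongr; rw [div_le_one hy0]; exact hy
      _ ≤ 18 * ((1 + freqSq k.1) ^ 2)⁻¹ := by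
        rw [mul_one, div_eq_mul_inv]; gcongr
  have hab1 (k : ℤ²₀) : a k * ‖ℓ k‖ ≤ 18 * ((1 + freqSq k.1) ^ 2)⁻¹ := le_trans (mul_le_mul_of_nonneg_left
      (by nlinarith [sq_nonneg (‖ℓ k.1‖ - 1)]) (ha0 k)) (hab k)
  have hab2 (k : ℤ²₀) : a k * (‖ℓ k‖ * ‖ℓ k‖) ≤ 18 * ((1 + freqSq k.1) ^ 2)⁻¹ := le_trans
      (mul_le_mul_of_nonneg_left (by nlinarith) (ha0 k)) (hab k)
  have hab0 (k : ℤ²₀) : a k ≤ 18 * ((1 + freqSq k.1) ^ 2)⁻¹ :=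
    le_trans (by nlinarith [mul_nonneg (ha0 k.1) (sq_nonneg ‖ℓ k.1‖)]) (hab k)
  have e : cosSum = fun u => ∑' k : ℤ²₀, a k * cos (ℓ k u) := by
    ext u; simp only [cosSum, a, hℓ]
  rw [e, ← contDiffOn_univ]
  refine contDiffOn_two_tsum isOpen_univ isPreconnected_univ (mem_univ (0 : ℝ²))
    (summable_one_add_freqSq_inv_sq.mul_left 18)
    (f' := fun k u => (-(a k * sin (ℓ k u))) • ℓ k)
    (f'' := fun k u => ((-(a k * cos (ℓ k u))) • ℓ k).smulRight (ℓ k)) ?_ ?_ ?_ ?_ ?_ ?_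
  · intro k u _
    refine (((ℓ k).hasFDerivAt (x := u)).cos.const_mul (a k)).congr_fderiv ?_
    ext w; simp; ring
  · intro k u _
    have h := ((((ℓ k).hasFDerivAt (x := u)).sin.const_mul (a k)).neg).smul_const (ℓ k)
    refine h.congr_fderiv ?_
    rw [smul_smul, neg_smul]
  · intro k u _
    rw [norm_smul, norm_neg, norm_mul, norm_of_nonneg (ha0 k)]
    refine le_trans ?_ (hab1 k)
    gcongr
    exact mul_le_of_le_one_right (ha0 k) (Real.abs_sin_le_one _)
  · intro k u _
    rw [norm_smulRight_apply, norm_smul, norm_neg, norm_mul, norm_of_nonneg (ha0 k), mul_assoc]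
    refine le_trans ?_ (hab2 k)
    gcongr
    exact mul_le_of_le_one_right (ha0 k) (Real.abs_cos_le_one _)
  · intro k
    have c4 : Continuous fun u => (-(a k * cos (ℓ k u))) • ℓ k := by fun_prop
    exact (((smulRightL ℝ ℝ² (ℝ² →L[ℝ] ℝ)).continuous₂).comp
      (c4.prodMk continuous_const)).continuousOn
  · refine Summable.of_norm_bounded (summable_one_add_freqSq_inv_sq.mul_left 18) fun k => ?_
    rw [norm_mul, norm_of_nonneg (ha0 k)]
    exact le_trans (mul_le_of_le_one_right (ha0 k) (Real.abs_cos_le_one _)) (hab0 k)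

theorem tsum_ne_zero_eq {f : ℤ² → ℝ} (hf : Summable f) :
    ∑' k : ℤ²₀, f k.1 = ∑' k, f k - f 0 := by
  have h := hf.sum_add_tsum_subtype_compl {0}
  rw [Finset.sum_singleton] at h
  rw [← h, add_sub_cancel_left]
  exact (Equiv.subtypeEquivRight (by simp)).tsum_eq
    (fun k : {k : ℤ² // k ∉ ({0} : Finset ℤ²)} => f k.1)

theorem integrable_tsum_of_summable_integral_norm {α ι : Type*} [Countable ι] [MeasurableSpace α]
    {μ : Measure α} {F : ι → α → ℝ} (hm : ∀ i, Measurable (F i)) (hF : ∀ i, Integrable (F i) μ)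
    (hs : Summable fun i => ∫ a, ‖F i a‖ ∂μ) : Integrable (fun a => ∑' i, F i a) μ := by
  refine ⟨(Measurable.tsum hm).aestronglyMeasurable, ?_⟩
  calc ∫⁻ a, ‖∑' i, F i a‖ₑ ∂μ ≤ ∫⁻ a, ∑' i, ‖F i a‖ₑ ∂μ :=
        lintegral_mono fun a => enorm_tsum_le_tsum_enorm
    _ = ∑' i, ∫⁻ a, ‖F i a‖ₑ ∂μ := lintegral_tsum fun i => (hm i).enorm.aemeasurable
    _ = ∑' i, ofReal (∫ a, ‖F i a‖ ∂μ) := by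
        congr 1; ext i; rw [ofReal_integral_norm_eq_lintegral_enorm (hF i)]
    _ < ∞ := hs.tsum_ofReal_lt_top

/-- The expansion of the Green function near the origin. -/
theorem green_toTorus (hu : u ∈ cell) (hu0 : u ≠ 0) :
    green (toTorus u) = -expInt (sqLen u) + (1 - shiftSum u - cosSum u) := by
  set F2 : ℤ²₀ → ℝ → ℝ := fun k t => exp (-(ev k * t)) * (mFourier k.1 (toTorus u)).re with hF2
  set H : ℝ → ℝ := fun t => ∑' k, F2 k t with hH
  set F : ℤ² → ℝ → ℝ := fun n t =>
    exp (-shift u n / (4 * t)) / (4 * π * t) with hF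
  have hz : (fun l => u l + ((0 : ℤ²) l : ℝ)) = u := by ext l; simp
  have hpos : ∀ n : ℤ², 0 < shift u n := by
    intro n
    rcases eq_or_ne n 0 with rfl | hn
    · rw [hz]; exact sqLen_pos hu0
    · exact lt_of_lt_of_le (by have := freqSq_nonneg n; positivity) (le_sqLen_shift hu hn)
  have hFi n : IntegrableOn (F n) (Ioc 0 1) := integrableOn_heat_term (hpos n)
  have hFn n : ∫ t in Ioc (0 : ℝ) 1, ‖F n t‖ = expInt (shift u n) :=
    setIntegral_congr_fun measurableSet_Ioc fun t ht => norm_of_nonneg (heat_term_nonneg ht)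
  have hsumE : Summable fun n : ℤ² => expInt (shift u n) := by
    refine (Finset.summable_compl_iff ({0} : Finset ℤ²)).1 ?_
    exact ((Equiv.subtypeEquivRight (p := fun k : ℤ² => k ∉ ({0} : Finset ℤ²))
      (q := fun k => k ≠ 0) (by simp)).summable_iff).2 (summable_expInt_shift hu)
  have hFs : Summable fun n => ∫ t in Ioc (0 : ℝ) 1, ‖F n t‖ := by simpa only [hFn] using hsumE
  have hFm n : Measurable (F n) := measurable_heat_term _
  have hI1 : IntegrableOn (fun t => ∑' n, F n t) (Ioc 0 1) :=
    integrable_tsum_of_summable_integral_norm hFm hFi hFs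
  have hv1 : ∫ t in Ioc (0 : ℝ) 1, ∑' n, F n t = expInt (sqLen u) + shiftSum u := by
    rw [← integral_tsum_of_summable_integral_norm hFi hFs]
    have h := tsum_ne_zero_eq hsumE
    simp only [hz] at h
    have e n : ∫ t in Ioc (0 : ℝ) 1, F n t = expInt (shift u n) := rfl
    simp only [e]
    rw [shiftSum, h]; ring
  -- For `t ≤ 1` the spectral series is replaced by the sum over images minus the mode `k = 0`,
  -- whose integral over `(0, 1]` is the constant `1` of the result. For `t > 1` the spectral series
  -- already converges fast enough to be integrated termwise.
  have hHeq : ∀ t ∈ Ioc (0 : ℝ) 1, H t = ∑' n, F n t - 1 := by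
    intro t ht
    have h := hasSum_heat ht.1 u
    have h2 := tsum_ne_zero_eq h.summable
    rw [h.tsum_eq] at h2
    simp only [hH, hF, hF2]
    rw [h2]
    simp [freqSq, mFourier]
  have hH1 : IntegrableOn H (Ioc 0 1) :=
    (hI1.sub (integrableOn_const (by simp))).congr_fun (fun t ht => (hHeq t ht).symm)
      measurableSet_Ioc
  have hHv1 : ∫ t in Ioc (0 : ℝ) 1, H t = expInt (sqLen u) + shiftSum u - 1 := by
    rw [setIntegral_congr_fun measurableSet_Ioc hHeq, integral_sub hI1 (integrableOn_const (by simp)),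
      hv1]
    simp
  have hneg (k : ℤ²₀) : -(ev k) < 0 := by
    have := one_le_freqSq k.2
    have := Real.pi_pos
    rw [neg_lt_zero]; positivity
  have hexp (k : ℤ²₀) : (fun t : ℝ => exp (-(ev k * t))) = fun t => exp (-(ev k) * t) := by
    ext t; congr 1; ring
  have hE (k : ℤ²₀) : ∫ t in Ioi (1 : ℝ), exp (-(ev k * t)) = exp (-(ev k)) / (ev k) := by
    rw [hexp, integral_exp_mul_Ioi (hneg k), mul_one, neg_div_neg_eq]
  have hF2i k : IntegrableOn (F2 k) (Ioi 1) := by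
    have := integrableOn_exp_mul_Ioi (hneg k) 1
    rw [← hexp] at this
    exact this.mul_const _
  have hF2s : Summable fun k => ∫ t in Ioi (1 : ℝ), ‖F2 k t‖ := by
    have h := hasSum_heat zero_lt_one (0 : ℝ²)
    have h2 := h.summable.subtype {k | k ≠ 0}
    refine Summable.of_norm_bounded h2 fun k => ?_
    rw [norm_of_nonneg (integral_nonneg fun _ => norm_nonneg _)]
    have e0 : (mFourier k.1 (toTorus 0)).re = 1 := by simp [re_mFourier_toTorus]
    simp only [comp, e0, mul_one]
    calc ∫ t in Ioi (1 : ℝ), ‖F2 k t‖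
        ≤ ∫ t in Ioi (1 : ℝ), exp (-(ev k * t)) := by
          refine setIntegral_mono_on (hF2i k).norm ?_ measurableSet_Ioi fun t _ => ?_
          · rw [hexp]; exact integrableOn_exp_mul_Ioi (hneg k) 1
          · rw [norm_mul, norm_of_nonneg (exp_pos _).le]
            exact mul_le_of_le_one_right (exp_pos _).le
              ((abs_re_le_norm _).trans (norm_mFourier_apply _ _).le)
      _ ≤ exp (-(ev k)) := by
          rw [hE]
          refine div_le_self (exp_pos _).le ?_
          have := one_le_freqSq k.2
          have : 36 ≤ 4 * π ^ 2 := by nlinarith [pi_gt_three]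
          nlinarith
  have hF2m k : Measurable (F2 k) := by simp only [F2]; fun_prop
  have hH2 : IntegrableOn H (Ioi 1) := integrable_tsum_of_summable_integral_norm hF2m hF2i hF2s
  have hHv2 : ∫ t in Ioi (1 : ℝ), H t = cosSum u := by
    rw [hH, ← integral_tsum_of_summable_integral_norm hF2i hF2s, cosSum]
    congr 1; ext k
    simp only [F2]
    rw [integral_mul_const, hE, re_mFourier_toTorus]
  have hsplit : ∫ t in Ioi (0 : ℝ), H t = (expInt (sqLen u) + shiftSum u - 1) + cosSum u := by
    rw [← Ioc_union_Ioi_eq_Ioi (zero_le_one (α := ℝ)), setIntegral_union (Ioc_disjoint_Ioi le_rfl)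
      measurableSet_Ioi hH1 hH2, hHv1, hHv2]
  rw [green, hsplit]; ring

/-! ### Representatives of points of the torus -/

theorem toTorus_add (u v : ℝ²) : toTorus (u + v) = toTorus u + toTorus v := by
  ext l; simp [toTorus]

theorem toTorus_sub (u v : ℝ²) : toTorus (u - v) = toTorus u - toTorus v := by
  ext l; simp [toTorus]

theorem toTorus_neg (u : ℝ²) : toTorus (-u) = -toTorus u := by
  ext l; simp [toTorus]

theorem toTorus_zero : toTorus 0 = 0 := by ext l; simp [toTorus]

theorem toTorus_single (j : Fin 2) (h : ℝ) :
    toTorus (single j h) = single j (h : UnitAddCircle) := by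
  ext l
  rcases eq_or_ne l j with rfl | hl
  · simp [toTorus]
  · simp [toTorus, hl]

theorem continuous_toTorus : Continuous toTorus :=
  continuous_pi fun l => (AddCircle.continuous_mk' 1).comp (continuous_apply l)

theorem norm_toTorus_le (u : ℝ²) : ‖toTorus u‖ ≤ ‖u‖ := by
  refine (pi_norm_le_iff_of_nonneg (norm_nonneg u)).2 fun l => ?_
  refine le_trans ?_ (norm_le_pi_norm u l)
  rw [toTorus, UnitAddCircle.norm_eq]
  simpa using round_le (u l) 0

theorem exists_toTorus_eq (z : Torus) : ∃ u, toTorus u = z ∧ ‖u‖ ≤ 1 / 2 ∧ ‖z‖ = ‖u‖ := by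
  have h l : ∃ a : ℝ, (a : UnitAddCircle) = z l ∧ |a| ≤ 1 / 2 ∧ ‖z l‖ = |a| := by
    obtain ⟨b, hb⟩ := QuotientAddGroup.mk_surjective (z l)
    refine ⟨b - round b, ?_, abs_sub_round b, ?_⟩
    · rw [← hb, AddCircle.coe_sub]
      have : ((round b : ℝ) : UnitAddCircle) = 0 := by simp
      rw [this, sub_zero]
    · rw [← hb]; exact UnitAddCircle.norm_eq
  choose a h1 h2 h3 using h
  refine ⟨a, funext h1, (pi_norm_le_iff_of_nonneg (by norm_num)).2 h2, ?_⟩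
  refine le_antisymm ((pi_norm_le_iff_of_nonneg (norm_nonneg _)).2 fun l => ?_)
    ((pi_norm_le_iff_of_nonneg (norm_nonneg _)).2 fun l => ?_)
  · rw [h3]; exact norm_le_pi_norm a l
  · rw [norm_eq_abs, ← h3]; exact norm_le_pi_norm z l

/-! ### The skew gradient of a function on the torus -/

/-- `∇^⊥ g = (∂₂ g, -∂₁ g)`. -/
def skewGrad (g : Torus → ℝ) (z : Torus) : ℝ² :=
  ![partialDeriv 1 g z, -partialDeriv 0 g z]

theorem partialDeriv_toTorus (h : DifferentiableAt ℝ (lift g) u) (j : Fin 2) :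
    partialDeriv j g (toTorus u) = fderiv ℝ (lift g) u (single j 1) := by
  have h1 : HasDerivAt (fun t : ℝ => u + t • (single j 1 : ℝ²)) (single j 1) 0 := by
    simpa using ((hasDerivAt_id' (0 : ℝ)).smul_const (single j (1 : ℝ) : ℝ²)).const_add u
  have h2 : HasFDerivAt (lift g) (fderiv ℝ (lift g) u) (u + (0 : ℝ) • (single j 1 : ℝ²)) := by
    simpa using h.hasFDerivAt
  have h3 := h2.comp_hasDerivAt (0 : ℝ) h1
  rw [partialDeriv, ← h3.deriv]
  congr 1
  ext t
  simp only [comp]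
  rw [toTorus_add, ← Pi.single_smul, smul_eq_mul, mul_one, toTorus_single]

theorem fderiv_comp_toTorus (h : DifferentiableAt ℝ (lift g) u) (w : ℝ²) :
    fderiv ℝ (lift g) u w = skewGrad g (toTorus u) 0 * w 1 - skewGrad g (toTorus u) 1 * w 0 := by
  have e : w = w 0 • (single 0 1 : ℝ²) + w 1 • (single 1 1 : ℝ²) := by
    ext l; fin_cases l <;> simp
  conv_lhs => rw [e]
  rw [map_add, map_smul, map_smul, ← partialDeriv_toTorus h, ← partialDeriv_toTorus h]
  simp [skewGrad]
  ring

theorem norm_skewGrad_le (h : DifferentiableAt ℝ (lift g) u) :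
    ‖skewGrad g (toTorus u)‖ ≤ ‖fderiv ℝ (lift g) u‖ := by
  refine (pi_norm_le_iff_of_nonneg (norm_nonneg _)).2 fun l => ?_
  have hs (j : Fin 2) : ‖(single j 1 : ℝ²)‖ = 1 := by
    rw [Pi.norm_single, norm_one]
  fin_cases l
  · simp only [skewGrad, Fin.zero_eta, Matrix.cons_val_zero, partialDeriv_toTorus h]
    exact (le_opNorm _ _).trans (by rw [hs, mul_one])
  · simp only [skewGrad, Fin.mk_one, Matrix.cons_val_one, Matrix.cons_val_fin_one,
      partialDeriv_toTorus h, norm_neg]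
    exact (le_opNorm _ _).trans (by rw [hs, mul_one])

theorem skewGrad_neg (hg : ∀ z, g (-z) = g z) (z : Torus) : skewGrad g (-z) = -skewGrad g z := by
  have h : ∀ j, partialDeriv j g (-z) = -partialDeriv j g z := by
    intro j
    have e : (fun h : ℝ => g (-z + single j (h : UnitAddCircle)))
        = fun h : ℝ => (fun h : ℝ => g (z + single j (h : UnitAddCircle))) (-h) := by
      ext h
      rw [← hg]
      congr 1
      rw [neg_add, neg_neg, AddCircle.coe_neg, Pi.single_neg]
    have h2 := deriv_comp_neg (fun h : ℝ => g (z + single j (h : UnitAddCircle))) 0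
    rw [neg_zero] at h2
    rw [partialDeriv, e]
    exact h2
  ext l
  fin_cases l <;> simp [skewGrad, h]

theorem green_neg (z : Torus) : green (-z) = green z := by
  have h (k : ℤ²) : (mFourier k (-z)).re = (mFourier k z).re := by
    obtain ⟨u, rfl, -⟩ := exists_toTorus_eq z
    rw [← toTorus_neg, re_mFourier_toTorus, re_mFourier_toTorus, ← Real.cos_neg]
    congr 1
    simp only [Pi.neg_apply]
    ring
  unfold green
  simp only [h]

theorem biotSavart_eq_skewGrad : biotSavart = skewGrad green := rfl

theorem biotSavart_neg (z : Torus) : biotSavart (-z) = -biotSavart z := skewGrad_neg green_neg z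

theorem contDiffOn_expInt : ContDiffOn ℝ 2 expInt (Ioi 0) := by
  have e2 : (2 : WithTop ℕ∞) = 1 + 1 := by norm_num
  rw [e2, contDiffOn_succ_iff_deriv_of_isOpen isOpen_Ioi]
  refine ⟨fun s hs => (hasDerivAt_expInt hs).differentiableAt.differentiableWithinAt, by simp, ?_⟩
  refine ContDiffOn.congr (f := fun s => -(exp (-s / 4) / (4 * π * s))) ?_
    fun s hs => (hasDerivAt_expInt hs).deriv
  refine (ContDiffOn.div (by fun_prop) (by fun_prop) fun s hs => ?_).neg
  have : (0 : ℝ) < s := hs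
  positivity

/-- The regular part of the Green function near the origin. -/
def greenRegular (u : ℝ²) : ℝ := 1 - shiftSum u - cosSum u

theorem contDiffOn_greenRegular : ContDiffOn ℝ 2 greenRegular cell :=
  (contDiffOn_const.sub contDiffOn_shiftSum).sub contDiff_cosSum.contDiffOn

theorem contDiff_sqLen : ContDiff ℝ 2 sqLen := by unfold sqLen; fun_prop

theorem toTorus_eventuallyEq_cell (hv : v ∈ cell) (hv0 : v ≠ 0) :
    (fun u => green (toTorus u)) =ᶠ[𝓝 v] fun u => -expInt (sqLen u) + greenRegular u := by
  filter_upwards [isOpen_cell.mem_nhds hv, isOpen_ne.mem_nhds hv0] with u hu hu0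
  exact green_toTorus hu hu0

theorem contDiffAt_green_of_mem_cell (hv : v ∈ cell) (hv0 : v ≠ 0) :
    ContDiffAt ℝ 2 (fun u => green (toTorus u)) v := by
  refine ContDiffAt.congr_of_eventuallyEq ?_ (toTorus_eventuallyEq_cell hv hv0)
  have h1 : ContDiffAt ℝ 2 expInt (sqLen v) :=
    contDiffOn_expInt.contDiffAt (Ioi_mem_nhds (sqLen_pos hv0))
  exact (h1.comp v contDiff_sqLen.contDiffAt).neg.add
    (contDiffOn_greenRegular.contDiffAt (isOpen_cell.mem_nhds hv))

theorem mem_cell_of_norm_le (hv : ‖v‖ ≤ 1 / 2) : v ∈ cell :=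
  lt_of_le_of_lt hv (by norm_num)

theorem contDiffAt_comp_toTorus_of_eq {n : WithTop ℕ∞} (h : toTorus u = toTorus v) (hv : ContDiffAt
    ℝ n (lift g) v) : ContDiffAt ℝ n (lift g) u := by
  have e : (lift g) = (lift g) ∘ fun w => w - (u - v) := by
    ext w
    simp only [comp]
    rw [toTorus_sub, toTorus_sub, h, sub_self, sub_zero]
  rw [e]
  refine ContDiffAt.comp u (by simpa using hv) (by fun_prop)

theorem contDiffAt_green (hu : toTorus u ≠ 0) : ContDiffAt ℝ 2 (fun u => green (toTorus u)) u := by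
  obtain ⟨v, hv, hv1, -⟩ := exists_toTorus_eq (toTorus u)
  refine contDiffAt_comp_toTorus_of_eq hv.symm
    (contDiffAt_green_of_mem_cell (mem_cell_of_norm_le hv1) ?_)
  rintro rfl
  exact hu (by rw [← hv, toTorus_zero])

theorem isCompact_halfCell : IsCompact {u : ℝ² | ‖u‖ ≤ 1 / 2} := by
  have : {u : ℝ² | ‖u‖ ≤ 1 / 2} = Metric.closedBall 0 (1 / 2) := by ext; simp
  rw [this]; exact isCompact_closedBall _ _

/-- The gradient of the singular part is of order `|u| / |u|²` and the rest of the Green function is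
`C²` on a neighbourhood of a compact square. The bound yields integrability of the kernel and
boundedness of the symmetrised interaction. -/
theorem exists_norm_biotSavart_le : ∃ C : ℝ, 0 ≤ C ∧ ∀ z : Torus, ‖biotSavart z‖ * ‖z‖ ≤ C := by
  have hc : ContinuousOn (fderiv ℝ greenRegular) cell :=
    contDiffOn_greenRegular.continuousOn_fderiv_of_isOpen isOpen_cell (by norm_num)
  obtain ⟨C, hC⟩ := isCompact_halfCell.exists_bound_of_continuousOn
    (hc.mono fun u hu => mem_cell_of_norm_le hu)
  refine ⟨max C 0 + 1, by positivity, fun z => ?_⟩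
  obtain ⟨u, rfl, hu1, hu2⟩ := exists_toTorus_eq z
  rcases eq_or_ne u 0 with rfl | hu0
  · simp [toTorus_zero]; positivity
  have hcell := mem_cell_of_norm_le hu1
  have hd : DifferentiableAt ℝ (fun u => green (toTorus u)) u :=
    (contDiffAt_green_of_mem_cell hcell hu0).differentiableAt (by norm_num)
  have hs := sqLen_pos hu0
  have hlen := norm_sq_le_sqLen u
  have hn := norm_pos_iff.2 hu0
  have hf : HasFDerivAt (fun u => green (toTorus u))
      (-((-(exp (-sqLen u / 4) / (4 * π * sqLen u))) • sqLenForm u)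
        + fderiv ℝ greenRegular u) u := by
    refine HasFDerivAt.congr_of_eventuallyEq ?_ (toTorus_eventuallyEq_cell hcell hu0)
    have h0 : HasFDerivAt sqLen (sqLenForm u) u := by
      simpa using hasFDerivAt_sqLen_add 0 u
    exact ((hasDerivAt_expInt hs).comp_hasFDerivAt u h0).neg.add
      ((contDiffOn_greenRegular.contDiffAt (isOpen_cell.mem_nhds hcell)).differentiableAt
        (by norm_num)).hasFDerivAt
  have hb := norm_skewGrad_le hd
  rw [hf.fderiv] at hb
  rw [biotSavart_eq_skewGrad, hu2]
  have hA : ‖-((-(exp (-sqLen u / 4) / (4 * π * sqLen u))) • sqLenForm u)‖ * ‖u‖ ≤ 1 := by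
    rw [norm_neg, norm_smul, norm_neg, norm_of_nonneg (by positivity)]
    calc exp (-sqLen u / 4) / (4 * π * sqLen u) * ‖sqLenForm u‖ * ‖u‖
        ≤ 1 / (4 * 1 * sqLen u) * (4 * ‖u‖) * ‖u‖ := by
          gcongr
          · exact Real.exp_le_one_iff.2 (by linarith)
          · linarith [pi_gt_three]
          · exact norm_sqLenForm_apply_le u
      _ = ‖u‖ ^ 2 / sqLen u := by field_simp
      _ ≤ 1 := by rw [div_le_one hs]; exact hlen
  have hB : ‖fderiv ℝ greenRegular u‖ * ‖u‖ ≤ max C 0 := by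
    have h1 := (hC u hu1).trans (le_max_left C 0)
    nlinarith [norm_nonneg (fderiv ℝ greenRegular u), le_max_right C 0]
  calc ‖skewGrad green (toTorus u)‖ * ‖u‖
      ≤ (‖-((-(exp (-sqLen u / 4) / (4 * π * sqLen u))) • sqLenForm u)‖
        + ‖fderiv ℝ greenRegular u‖) * ‖u‖ := by
        gcongr; exact hb.trans (norm_add_le _ _)
    _ ≤ max C 0 + 1 := by rw [add_mul]; linarith

theorem exists_green_le (L : ℝ) : ∃ r > 0, ∀ z : Torus, z ≠ 0 → ‖z‖ < r → green z ≤ -L := by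
  obtain ⟨C, hC⟩ := isCompact_halfCell.exists_bound_of_continuousOn
    (contDiffOn_greenRegular.continuousOn.mono fun u hu => mem_cell_of_norm_le hu)
  set c := exp (-1 / 4) / (4 * π) with hc
  have hc0 : 0 < c := by positivity
  refine ⟨min (1 / 2) (exp (-(|L + C| / c) / 2) / 2), by positivity, fun z hz hzr => ?_⟩
  obtain ⟨u, rfl, hu1, hu2⟩ := exists_toTorus_eq z
  have hu0 : u ≠ 0 := by rintro rfl; exact hz toTorus_zero
  have hs := sqLen_pos hu0
  rw [hu2] at hzr
  have hle : sqLen u ≤ exp (-(|L + C| / c)) := by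
    have h1 := (hzr.trans_le (min_le_right _ _)).le
    have h2 : ‖u‖ ^ 2 ≤ (exp (-(|L + C| / c) / 2) / 2) ^ 2 := by gcongr
    have h3 : exp (-(|L + C| / c) / 2) ^ 2 = exp (-(|L + C| / c)) := by
      rw [← exp_nat_mul]; congr 1; push_cast; ring
    have := sqLen_le_norm_sq u
    rw [div_pow, h3] at h2
    linarith [exp_pos (-(|L + C| / c))]
  have hs1 : sqLen u ≤ 1 := hle.trans (Real.exp_le_one_iff.2 (by rw [neg_nonpos]; positivity))
  have hlog : log (sqLen u) ≤ -(|L + C| / c) := (Real.log_le_iff_le_exp hs).2 hle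
  have he := expInt_ge hs hs1
  have hR := (abs_le.1 (hC u hu1)).2
  rw [green_toTorus (mem_cell_of_norm_le hu1) hu0]
  have h4 : c * (|L + C| / c) = |L + C| := by field_simp
  have h5 : c * (|L + C| / c) ≤ c * (-log (sqLen u)) := by gcongr; linarith
  have h6 := le_abs_self (L + C)
  unfold greenRegular at hR
  rw [← hc] at he
  linarith

/-! ### Truncation of the Green function -/

theorem skewGrad_toTorus (h : DifferentiableAt ℝ (lift g) u) :
    skewGrad g (toTorus u) = ![fderiv ℝ (lift g) u (single 1 1),
      -fderiv ℝ (lift g) u (single 0 1)] := by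
  rw [skewGrad, partialDeriv_toTorus h, partialDeriv_toTorus h]

theorem contDiff_skewGrad (hg : ContDiff ℝ 2 lift g) :
    ContDiff ℝ 1 fun u => skewGrad g (toTorus u) := by
  have hd u : DifferentiableAt ℝ (lift g) u := hg.contDiffAt.differentiableAt (by norm_num)
  have hf : ContDiff ℝ 1 (fderiv ℝ lift g) := hg.fderiv_right (by norm_num)
  simp only [skewGrad_toTorus (hd _)]
  rw [contDiff_pi]
  intro l
  fin_cases l
  · exact hf.clm_apply contDiff_const
  · exact (hf.clm_apply contDiff_const).neg

/-- A skew gradient is divergence free because second derivatives are symmetric. -/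
theorem trace_fderiv_skewGrad (hg : ContDiff ℝ 2 lift g) (u : ℝ²) : fderiv ℝ (fun u
    => skewGrad g (toTorus u)) u (single 0 1) 0 + fderiv ℝ (fun u => skewGrad g (toTorus u)) u
    (single 1 1) 1 = 0 := by
  have hd u : DifferentiableAt ℝ (lift g) u := hg.contDiffAt.differentiableAt (by norm_num)
  have hf : ContDiff ℝ 1 (fderiv ℝ lift g) := hg.fderiv_right (by norm_num)
  have hF : HasFDerivAt (fderiv ℝ lift g) (fderiv ℝ (fderiv ℝ lift g) u) u :=
    (hf.contDiffAt.differentiableAt (by norm_num)).hasFDerivAt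
  have hk := ((contDiff_skewGrad hg).contDiffAt (x := u)).differentiableAt (by norm_num)
  have h0 : ∀ w, fderiv ℝ (fun u => skewGrad g (toTorus u)) u w 0
      = fderiv ℝ (fderiv ℝ lift g) u w (single 1 1) := by
    intro w
    have h1 := (hasFDerivAt_pi'.1 hk.hasFDerivAt) 0
    have h2 := hF.clm_apply (hasFDerivAt_const (single 1 1 : ℝ²) u)
    have e : (fun x => skewGrad g (toTorus x) 0) = fun x => fderiv ℝ (lift g) x (single 1 1) := by
      ext x; rw [skewGrad_toTorus (hd x)]; rfl
    rw [e] at h1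
    have := DFunLike.congr_fun (h1.unique h2) w
    simpa using this
  have h1 w : fderiv ℝ (fun u => skewGrad g (toTorus u)) u w 1
      = -fderiv ℝ (fderiv ℝ lift g) u w (single 0 1) := by
    have h1 := (hasFDerivAt_pi'.1 hk.hasFDerivAt) 1
    have h2 := (hF.clm_apply (hasFDerivAt_const (single 0 1 : ℝ²) u)).fun_neg
    have e : (fun x => skewGrad g (toTorus x) 1) = fun x => -fderiv ℝ (lift g) x (single 0 1) := by
      ext x; rw [skewGrad_toTorus (hd x)]; rfl
    rw [e] at h1
    have := DFunLike.congr_fun (h1.unique h2) w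
    simpa using this
  rw [h0, h1]
  have hsym := (hg.contDiffAt (x := u)).isSymmSndFDerivAt (by simp)
  rw [hsym.eq, add_neg_cancel]

theorem exists_lipschitz_skewGrad (hg : ContDiff ℝ 2 lift g) : ∃ C : ℝ, 0 ≤ C ∧ (∀
    z, ‖skewGrad g z‖ ≤ C) ∧ ∀ z w, ‖skewGrad g z - skewGrad g w‖ ≤ C * ‖z - w‖ := by
  have hk := contDiff_skewGrad hg
  obtain ⟨B, hB⟩ := (isCompact_closedBall (0 : ℝ²) 1).exists_bound_of_continuousOn
    hk.continuous.continuousOn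
  obtain ⟨B', hB'⟩ := (isCompact_closedBall (0 : ℝ²) 1).exists_bound_of_continuousOn
    (hk.continuous_fderiv (by norm_num)).continuousOn
  refine ⟨max (max B B') 0, le_max_right _ _, fun z => ?_, fun z w => ?_⟩
  · obtain ⟨u, rfl, hu, -⟩ := exists_toTorus_eq z
    exact (hB u (by simp; linarith)).trans ((le_max_left _ _).trans (le_max_left _ _))
  · obtain ⟨u, rfl, hu, -⟩ := exists_toTorus_eq w
    obtain ⟨a, ha, ha1, ha2⟩ := exists_toTorus_eq (z - toTorus u)
    have hz : z = toTorus (u + a) := by rw [toTorus_add, ha]; abel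
    rw [ha2, hz]
    have := (convex_closedBall (0 : ℝ²) 1).norm_image_sub_le_of_norm_fderiv_le
      (f := fun u => skewGrad g (toTorus u)) (C := max (max B B') 0) (x := u) (y := u + a)
      (fun x _ => hk.contDiffAt.differentiableAt (by norm_num))
      (fun x hx => (hB' x hx).trans ((le_max_right _ _).trans (le_max_left _ _)))
      (by simp; linarith) (by simp; exact (norm_add_le _ _).trans (by linarith))
    simpa using this

/-- A smooth nondecreasing function, equal to `s` for `s ≥ -L` and constant for `s ≤ -L - 1`. -/
def softFloor (L s : ℝ) : ℝ := -L + ∫ r in (-L)..s, smoothTransition (r + L + 1)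

theorem continuous_smoothTransition_add (L : ℝ) :
    Continuous fun r : ℝ => smoothTransition (r + L + 1) :=
  Real.smoothTransition.continuous.comp (by fun_prop)

theorem hasDerivAt_softFloor (L s : ℝ) :
    HasDerivAt (softFloor L) (smoothTransition (s + L + 1)) s :=
  ((continuous_smoothTransition_add L).integral_hasStrictDerivAt (-L) s).hasDerivAt.const_add _

theorem contDiff_softFloor (L : ℝ) : ContDiff ℝ 2 (softFloor L) := by
  have e2 : (2 : WithTop ℕ∞) = 1 + 1 := by norm_num
  rw [e2, contDiff_succ_iff_deriv]
  refine ⟨fun s => (hasDerivAt_softFloor L s).differentiableAt, by simp, ?_⟩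
  rw [show deriv (softFloor L) = fun s => smoothTransition (s + L + 1) from
    funext fun s => (hasDerivAt_softFloor L s).deriv]
  exact (Real.smoothTransition.contDiff (n := 1)).comp (by fun_prop)

theorem softFloor_of_le (h : s ≤ -L - 1) : softFloor L s = softFloor L (-L - 1) := by
  unfold softFloor
  have hi := fun a b => (continuous_smoothTransition_add L).intervalIntegrable (μ := volume) a b
  rw [← intervalIntegral.integral_add_adjacent_intervals (hi (-L) (-L - 1)) (hi (-L - 1) s)]
  have : ∫ r in (-L - 1)..s, smoothTransition (r + L + 1) = 0 := by
    rw [integral_symm, neg_eq_zero]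
    refine (integral_congr (g := fun _ => 0) fun r hr => ?_).trans (by simp)
    rw [uIcc_of_le h] at hr
    exact Real.smoothTransition.zero_of_nonpos (by linarith [hr.2])
  rw [this, add_zero]

theorem le_softFloor (L s : ℝ) : s ≤ softFloor L s := by
  have hm : Antitone fun s => softFloor L s - s := by
    refine antitone_of_hasDerivAt_nonpos (f' := fun s => smoothTransition (s + L + 1) - 1)
      (fun s => (hasDerivAt_softFloor L s).sub (hasDerivAt_id' s)) fun s => ?_
    simpa using Real.smoothTransition.le_one _
  rcases le_total s (-L) with h | h
  · have := hm h
    simp [softFloor] at this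
    unfold softFloor
    linarith
  · unfold softFloor
    rw [integral_congr (g := fun _ => (1 : ℝ))]
    · simp
    · intro r hr
      rw [uIcc_of_le h] at hr
      exact Real.smoothTransition.one_of_one_le (by linarith [hr.1])

theorem monotone_softFloor (L : ℝ) : Monotone (softFloor L) :=
  monotone_of_hasDerivAt_nonneg (hasDerivAt_softFloor L) fun _ => Real.smoothTransition.nonneg _

theorem lt_of_lt_softFloor (h : -L < softFloor L s) : -L < s := by
  by_contra! hle
  have := monotone_softFloor L hle
  simp [softFloor] at this h
  linarith

/-- The Green function with its singularity removed. -/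
def regGreen (L : ℝ) (z : Torus) : ℝ :=
  -- The value at the origin is the constant that `softFloor L` takes below `-L - 1`. As `green`
  -- tends to `-∞` at the origin, the function is constant nearby and hence smooth.
  if z = 0 then softFloor L (-L - 1) else softFloor L (green z)

/-- The Biot-Savart kernel with its singularity removed. -/
def regKernel (L : ℝ) : Torus → ℝ² := skewGrad (regGreen L)

theorem regGreen_neg (L : ℝ) (z : Torus) : regGreen L (-z) = regGreen L z := by
  simp [regGreen, green_neg]

theorem regKernel_neg (L : ℝ) (z : Torus) : regKernel L (-z) = -regKernel L z :=
  skewGrad_neg (regGreen_neg L) z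

theorem regKernel_zero (L : ℝ) : regKernel L 0 = 0 := by
  have h := regKernel_neg L 0
  rw [neg_zero, eq_neg_iff_add_eq_zero] at h
  simpa [← two_smul ℝ] using h

theorem regGreen_eventuallyEq (hu : toTorus u ≠ 0) :
    (fun u => regGreen L (toTorus u)) =ᶠ[𝓝 u] fun u => softFloor L (green (toTorus u)) := by
  filter_upwards [(isOpen_ne.preimage continuous_toTorus).mem_nhds hu] with v hv
  simp [regGreen, show toTorus v ≠ 0 from hv]

theorem contDiff_regGreen (L : ℝ) : ContDiff ℝ 2 fun u => regGreen L (toTorus u) := by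
  rw [contDiff_iff_contDiffAt]
  intro u
  by_cases hu : toTorus u = 0
  · obtain ⟨r, hr, h⟩ := exists_green_le (L + 1)
    have : (fun u => regGreen L (toTorus u)) =ᶠ[𝓝 u] fun _ => softFloor L (-L - 1) := by
      have hopen : IsOpen {v | ‖toTorus v‖ < r} :=
        isOpen_lt continuous_toTorus.norm continuous_const
      filter_upwards [hopen.mem_nhds (by simpa [hu] using hr)] with v hv
      by_cases hv0 : toTorus v = 0
      · simp [regGreen, hv0]
      · simp only [regGreen, hv0, if_false]
        exact softFloor_of_le (by linarith [h _ hv0 hv])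
    exact contDiffAt_const.congr_of_eventuallyEq this
  · exact ((contDiff_softFloor L).contDiffAt.comp u (contDiffAt_green hu)).congr_of_eventuallyEq
      (regGreen_eventuallyEq hu)

/-- By the chain rule truncation multiplies the kernel by a scalar in `[0, 1]`. So the truncated
kernel is parallel to the true one and dominated by it, uniformly in `L`. -/
theorem regKernel_eq_smul (L : ℝ) (hz : z ≠ 0) :
    regKernel L z = smoothTransition (green z + L + 1) • biotSavart z := by
  obtain ⟨u, rfl, -⟩ := exists_toTorus_eq z
  have hd : DifferentiableAt ℝ (fun u => green (toTorus u)) u :=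
    (contDiffAt_green hz).differentiableAt (by norm_num)
  have hd' : DifferentiableAt ℝ (fun u => regGreen L (toTorus u)) u :=
    (contDiff_regGreen L).contDiffAt.differentiableAt (by norm_num)
  have hf : fderiv ℝ (fun u => regGreen L (toTorus u)) u
      = smoothTransition (green (toTorus u) + L + 1) • fderiv ℝ (fun u => green (toTorus u)) u := by
    rw [(regGreen_eventuallyEq hz).fderiv_eq]
    exact ((hasDerivAt_softFloor L _).comp_hasFDerivAt u hd.hasFDerivAt).fderiv
  rw [regKernel, biotSavart_eq_skewGrad, skewGrad_toTorus hd, skewGrad_toTorus hd', hf]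
  ext l
  fin_cases l <;> simp

theorem norm_regKernel_le (L : ℝ) (z : Torus) : ‖regKernel L z‖ ≤ ‖biotSavart z‖ := by
  rcases eq_or_ne z 0 with rfl | hz
  · rw [regKernel_zero, norm_zero]; positivity
  · rw [regKernel_eq_smul L hz, norm_smul,
      norm_of_nonneg (Real.smoothTransition.nonneg _)]
    exact mul_le_of_le_one_left (norm_nonneg _) (Real.smoothTransition.le_one _)

theorem ne_zero_of_lt_regGreen (h : -L < regGreen L z) : z ≠ 0 := by
  rintro rfl
  rw [regGreen, if_pos rfl] at h
  have := lt_of_lt_softFloor h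
  linarith

theorem lt_green_of_lt_regGreen (h : -L < regGreen L z) : -L < green z := by
  have hz := ne_zero_of_lt_regGreen h
  rw [regGreen, if_neg hz] at h
  exact lt_of_lt_softFloor h

theorem regKernel_eq_of_le_green (hz : z ≠ 0) (h : -L ≤ green z) :
    regKernel L z = biotSavart z := by
  rw [regKernel_eq_smul L hz, Real.smoothTransition.one_of_one_le (by linarith), one_smul]

theorem green_le_of_regGreen_le (hz : z ≠ 0) (h : regGreen L z ≤ a) : green z ≤ a := by
  rw [regGreen, if_neg hz] at h
  exact (le_softFloor L _).trans h

/-- The quotient map from the plane is open. -/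
theorem isOpenQuotientMap_toTorus : IsOpenQuotientMap toTorus where
  surjective z := (exists_toTorus_eq z).imp fun _ h => h.1
  continuous := continuous_toTorus
  isOpenMap := IsOpenMap.piMap (fun _ => QuotientAddGroup.isOpenMap_coe) (by simp)

theorem continuous_of_comp_toTorus {Y : Type*} [TopologicalSpace Y] {g : Torus → Y}
    (h : Continuous lift g) : Continuous g :=
  isOpenQuotientMap_toTorus.isQuotientMap.continuous_iff.2 h

theorem continuous_regKernel (L : ℝ) : Continuous (regKernel L) :=
  continuous_of_comp_toTorus (contDiff_skewGrad (contDiff_regGreen L)).continuous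

theorem continuousOn_green : ContinuousOn green {0}ᶜ := by
  intro z hz
  have hL : ∃ L, -L < green z := ⟨-green z + 1, by linarith⟩
  obtain ⟨u, rfl, -⟩ := exists_toTorus_eq z
  have h1 : Tendsto (fun u => green (toTorus u)) (𝓝 u) (𝓝 (green (toTorus u))) :=
    (contDiffAt_green hz).continuousAt
  have h2 : Tendsto green (map toTorus (𝓝 u)) (𝓝 (green (toTorus u))) := h1
  have h3 := isOpenQuotientMap_toTorus.isOpenMap.nhds_le u
  exact (h2.mono_left h3).mono_left nhdsWithin_le_nhds

theorem measurable_green : Measurable green :=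
  measurable_of_continuousOn_compl_singleton 0 continuousOn_green

theorem continuousOn_biotSavart : ContinuousOn biotSavart {0}ᶜ := by
  intro z hz
  have hc : ContinuousAt green z := (continuousOn_green).continuousAt
    (isOpen_compl_singleton.mem_nhds hz)
  have hev : biotSavart =ᶠ[𝓝 z] regKernel (-green z + 1) := by
    filter_upwards [hc.eventually (lt_mem_nhds (show green z - 1 < green z by linarith)),
      isOpen_compl_singleton.mem_nhds hz] with w hw hw0
    exact (regKernel_eq_of_le_green hw0 (by linarith)).symm
  exact ((continuous_regKernel _).continuousAt.congr hev.symm).continuousWithinAt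

theorem measurable_biotSavart : Measurable biotSavart :=
  measurable_of_continuousOn_compl_singleton 0 continuousOn_biotSavart

/-! ### Integrability of the Biot–Savart kernel -/

instance : IsProbabilityMeasure (volume : Measure UnitAddCircle) :=
  ⟨UnitAddCircle.measure_univ⟩

instance : IsProbabilityMeasure (volume : Measure Torus) :=
  inferInstanceAs (IsProbabilityMeasure (Measure.pi fun _ : Fin 2 => (volume : Measure UnitAddCircle)))

theorem biotSavart_zero : biotSavart 0 = 0 := by
  have h := biotSavart_neg 0
  rw [neg_zero, eq_neg_iff_add_eq_zero] at h
  simpa [← two_smul ℝ] using h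

theorem lintegral_inv_sqrt_norm_lt_top : ∫⁻ x : UnitAddCircle, (‖x‖ₑ⁻¹) ^ (1 / 2 : ℝ) < ∞ := by
  rw [← UnitAddCircle.lintegral_preimage (-(1 / 2))]
  have hi : IntegrableOn (fun a : ℝ => |a| ^ (-(1 / 2) : ℝ)) (Ioc (-(1 / 2)) (1 / 2)) := by
    have h0 : IntegrableOn (fun a : ℝ => a ^ (-(1 / 2) : ℝ)) (Ioc 0 (1 / 2)) :=
      (intervalIntegral.intervalIntegrable_rpow' (by norm_num)).1
    have h1 : IntegrableOn (fun a : ℝ => |a| ^ (-(1 / 2) : ℝ)) (Ioc 0 (1 / 2)) :=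
      h0.congr_fun (fun a ha => by simp only [abs_of_pos ha.1]) measurableSet_Ioc
    have h2 : IntegrableOn (fun a : ℝ => |a| ^ (-(1 / 2) : ℝ)) (Ico (-(1 / 2)) 0) := by
      have := (Measure.measurePreserving_neg (volume : Measure ℝ)).integrableOn_comp_preimage
        (MeasurableEquiv.neg ℝ).measurableEmbedding (s := Ioc 0 (1 / 2)) |>.2 h1
      simpa [comp_def] using this
    have h3 : Ioc (-(1 / 2) : ℝ) (1 / 2) ⊆ Ico (-(1 / 2)) 0 ∪ (Ioc 0 (1 / 2) ∪ {0}) := by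
      intro x hx
      rcases lt_trichotomy x 0 with h | h | h
      · exact Or.inl ⟨hx.1.le, h⟩
      · exact Or.inr (Or.inr h)
      · exact Or.inr (Or.inl ⟨h, hx.2⟩)
    refine (h2.union (h1.union ?_)).mono_set h3
    rw [IntegrableOn, Measure.restrict_singleton]
    simp
  have h := hi.2
  rw [HasFiniteIntegral] at h
  refine lt_of_le_of_lt (le_of_eq ?_) h
  rw [show (-(1 / 2) + 1 : ℝ) = 1 / 2 by norm_num]
  refine setLIntegral_congr_fun_ae measurableSet_Ioc ?_
  filter_upwards [Measure.ae_ne volume (0 : ℝ)] with a ha0 ha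
  have h1 : ‖(a : UnitAddCircle)‖ = |a| := by
    rw [AddCircle.norm_coe_eq_abs_iff 1 one_ne_zero, abs_one]
    exact abs_le.2 ⟨ha.1.le, ha.2⟩
  have ha1 : 0 < |a| := abs_pos.2 ha0
  rw [Real.enorm_of_nonneg (by positivity), ← ofReal_norm, h1, ← ofReal_inv_of_pos ha1,
    ENNReal.ofReal_rpow_of_pos (by positivity), rpow_neg ha1.le, Real.inv_rpow ha1.le]

/-- In the sup norm `1 / ‖z‖` is at most the product of the inverse square roots of the coordinates,
and each factor is integrable on the circle. -/
theorem lintegral_inv_norm_lt_top : ∫⁻ z : Torus, ‖z‖ₑ⁻¹ < ∞ := by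
  have hm (z : Torus) l : (‖z‖ₑ⁻¹) ^ (1 / 2 : ℝ) ≤ (‖z l‖ₑ⁻¹) ^ (1 / 2 : ℝ) := by
    gcongr
    rw [← ofReal_norm, ← ofReal_norm]
    exact ofReal_le_ofReal (norm_le_pi_norm z l)
  have hle (z : Torus) : ‖z‖ₑ⁻¹ ≤ (‖z 0‖ₑ⁻¹) ^ (1 / 2 : ℝ) * (‖z 1‖ₑ⁻¹) ^ (1 / 2 : ℝ) := by
    have : ‖z‖ₑ⁻¹ = (‖z‖ₑ⁻¹) ^ (1 / 2 : ℝ) * (‖z‖ₑ⁻¹) ^ (1 / 2 : ℝ) := by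
      rw [← ENNReal.rpow_add_of_nonneg _ _ (by norm_num) (by norm_num)]
      norm_num
    rw [this]
    exact mul_le_mul' (hm z 0) (hm z 1)
  have hmeas : Measurable fun x : UnitAddCircle => (‖x‖ₑ⁻¹) ^ (1 / 2 : ℝ) := by fun_prop
  have h := (volume_preserving_finTwoArrow UnitAddCircle).lintegral_comp
    (f := fun p : UnitAddCircle × UnitAddCircle =>
      (‖p.1‖ₑ⁻¹) ^ (1 / 2 : ℝ) * (‖p.2‖ₑ⁻¹) ^ (1 / 2 : ℝ)) (by fun_prop)
  refine lt_of_le_of_lt (lintegral_mono hle) ?_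
  refine lt_of_eq_of_lt h ?_
  rw [Measure.volume_eq_prod, lintegral_prod_mul hmeas.aemeasurable hmeas.aemeasurable]
  exact mul_lt_top lintegral_inv_sqrt_norm_lt_top lintegral_inv_sqrt_norm_lt_top

theorem lintegral_norm_biotSavart_lt_top : ∫⁻ z : Torus, ‖biotSavart z‖ₑ < ∞ := by
  obtain ⟨C, hC0, hC⟩ := exists_norm_biotSavart_le
  have hle : ∀ z : Torus, ‖biotSavart z‖ₑ ≤ ofReal C * ‖z‖ₑ⁻¹ := by
    intro z
    rcases eq_or_ne z 0 with rfl | hz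
    · simp [biotSavart_zero]
    · have hn := norm_pos_iff.2 hz
      rw [← ofReal_norm, ← ofReal_norm, ← ofReal_inv_of_pos hn, ← ofReal_mul hC0]
      refine ofReal_le_ofReal ?_
      rw [← div_eq_mul_inv, le_div_iff₀ hn]
      exact hC z
  refine lt_of_le_of_lt (lintegral_mono hle) ?_
  rw [lintegral_const_mul' _ _ ofReal_ne_top]
  exact mul_lt_top ENNReal.ofReal_lt_top lintegral_inv_norm_lt_top

theorem tendsto_volume_green_le :
    Tendsto (fun L : ℕ => volume {z : Torus | green z ≤ -(L / 2 : ℝ)}) atTop (𝓝 0) := by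
  have hi : ⋂ L : ℕ, {z : Torus | green z ≤ -(L / 2 : ℝ)} = ∅ := by
    ext z
    simp only [mem_iInter, mem_ofPred_eq, mem_empty_iff_false, iff_false, not_forall, not_le]
    obtain ⟨n, hn⟩ := exists_nat_gt (-2 * green z)
    exact ⟨n, by linarith⟩
  have := tendsto_measure_iInter_atTop (μ := (volume : Measure Torus))
    (s := fun L : ℕ => {z : Torus | green z ≤ -(L / 2 : ℝ)})
    (fun L => (measurableSet_le measurable_green measurable_const).nullMeasurableSet)
    (fun a b hab z hz => le_trans (b := -(b / 2 : ℝ)) hz (by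
      have : (a : ℝ) ≤ b := by exact_mod_cast hab
      linarith)) ⟨0, measure_ne_top _ _⟩
  rwa [hi, measure_empty] at this

/-! ### Ordinary differential equations with parameters -/

section Picard

variable {D V : Type*} [MeasurableSpace D] [NormedAddCommGroup V] [NormedSpace ℝ V]
  [CompleteSpace V] [MeasurableSpace V] [BorelSpace V] [SecondCountableTopology V]

theorem measurable_setIntegral_Ioc {f : D × ℝ → V} (hf : Measurable f) :
    Measurable fun p : D × ℝ => ∫ s in Ioc 0 p.2, f (p.1, s) := by
  have hs : MeasurableSet {q : (D × ℝ) × ℝ | q.2 ∈ Ioc 0 q.1.2} := by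
    have h1 : MeasurableSet {q : (D × ℝ) × ℝ | 0 < q.2} := measurableSet_lt (by fun_prop) (by fun_prop)
    have h2 : MeasurableSet {q : (D × ℝ) × ℝ | q.2 ≤ q.1.2} :=
      measurableSet_le (by fun_prop) (by fun_prop)
    exact h1.inter h2
  have hm : StronglyMeasurable
      ({q : (D × ℝ) × ℝ | q.2 ∈ Ioc 0 q.1.2}.indicator fun q => f (q.1.1, q.2)) :=
    ((hf.comp (by fun_prop)).indicator hs).stronglyMeasurable
  have h := (hm.integral_prod_right' (ν := (volume : Measure ℝ))).measurable
  have e : (fun p : D × ℝ => ∫ s in Ioc 0 p.2, f (p.1, s)) = fun x => ∫ y : ℝ,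
      {q : (D × ℝ) × ℝ | q.2 ∈ Ioc 0 q.1.2}.indicator (fun q => f (q.1.1, q.2)) (x, y) := by
    ext p
    rw [← integral_indicator measurableSet_Ioc]
    rfl
  rw [e]; exact h

/-- Picard iterates of the integral equation `y(t) = ∫₀ᵗ F(s, y(s)) ds`. -/
def picard (F : D → ℝ → V → V) : ℕ → D → ℝ → V
  | 0, _, _ => 0
  | m + 1, d, t => ∫ s in Ioc 0 t, F d s (picard F m d s)

variable {F : D → ℝ → V → V} (hF : Measurable fun p : D × ℝ × V => F p.1 p.2.1 p.2.2)
  {B C : ℝ} (hB : ∀ d s y, ‖F d s y‖ ≤ B) (hC0 : 0 ≤ C)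
  (hC : ∀ d s y y', ‖F d s y - F d s y'‖ ≤ C * ‖y - y'‖)

include hF in
theorem measurable_picard (m : ℕ) : Measurable fun p : D × ℝ => picard F m p.1 p.2 := by
  induction m with
  | zero => exact measurable_const
  | succ m ih =>
    exact measurable_setIntegral_Ioc (f := fun p => F p.1 p.2 (picard F m p.1 p.2))
      (hF.comp (measurable_fst.prodMk (measurable_snd.prodMk ih)))

include hF hB in
theorem integrableOn_of_bounded_field {y : D → ℝ → V} (hy : Measurable fun p : D × ℝ => y p.1 p.2)
    (d : D) (a b : ℝ) : IntegrableOn (fun s => F d s (y d s)) (Ioc a b) := by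
  have hm : Measurable fun s => F d s (y d s) :=
    hF.comp (measurable_const.prodMk (measurable_id.prodMk (hy.comp (by fun_prop : Measurable fun s
        : ℝ => (d, s)))))
  exact Measure.integrableOn_of_bounded (M := B) (by simp) hm.aestronglyMeasurable
    (.of_forall fun s => hB d s _)

include hF hB hC0 hC in
theorem norm_picard_succ_sub_le (m : ℕ) (d : D) (ht : 0 ≤ t) :
    ‖picard F (m + 1) d t - picard F m d t‖ ≤ B * C ^ m * t ^ (m + 1) / (m + 1).factorial := by
  induction m generalizing t with
  | zero =>
    simp only [picard, sub_zero, zero_add, pow_zero, mul_one, pow_one, Nat.factorial_one,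
      Nat.cast_one, div_one]
    have := norm_setIntegral_le_of_norm_le_const (μ := volume) (s := Ioc 0 t)
      (f := fun s => F d s 0) (C := B) (by simp) fun s _ => hB d s _
    simpa [ht] using this
  | succ m ih =>
    have hi := fun n => integrableOn_of_bounded_field hF hB (measurable_picard hF n) d 0 t
    rw [picard, picard, ← integral_sub (hi _) (hi _)]
    have hle : ∀ s ∈ Ioc 0 t, ‖F d s (picard F (m + 1) d s) - F d s (picard F m d s)‖
        ≤ B * C ^ (m + 1) / (m + 1).factorial * s ^ (m + 1) := by
      intro s hs
      refine (hC d s _ _).trans ?_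
      calc C * ‖picard F (m + 1) d s - picard F m d s‖
          ≤ C * (B * C ^ m * s ^ (m + 1) / (m + 1).factorial) := by gcongr; exact ih hs.1.le
        _ = _ := by ring
    calc ‖∫ s in Ioc 0 t, (F d s (picard F (m + 1) d s) - F d s (picard F m d s))‖
        ≤ ∫ s in Ioc 0 t, B * C ^ (m + 1) / (m + 1).factorial * s ^ (m + 1) := by
          refine norm_integral_le_of_norm_le ?_
            ((ae_restrict_iff' measurableSet_Ioc).2 (.of_forall hle))
          exact (by fun_prop : Continuous fun s : ℝ =>
            B * C ^ (m + 1) / (m + 1).factorial * s ^ (m + 1)).integrableOn_Ioc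
      _ = B * C ^ (m + 1) * t ^ (m + 1 + 1) / (m + 1 + 1).factorial := by
          rw [← integral_of_le ht, intervalIntegral.integral_const_mul, integral_pow,
            Nat.factorial_succ (m + 1)]
          push_cast
          have : ((m + 1).factorial : ℝ) ≠ 0 := by positivity
          field_simp
          ring

include hF hB hC0 hC in
-- The solution is built as a limit of Picard iterates, rather than by an abstract fixed point,
-- because joint measurability in the parameter and time then passes to the limit.
theorem exists_measurable_integral_curve : ∃ Y : D → ℝ → V, (Measurable fun p : D × ℝ => Y p.1 p.2)
    ∧ ∀ d t, 0 ≤ t → Y d t = ∫ s in 0..t, F d s (Y d s) := by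
  have hneg : ∀ m d t, t ≤ 0 → picard F m d t = 0 := by
    intro m d t ht
    cases m with
    | zero => rfl
    | succ m => simp [picard, Ioc_eq_empty_of_le ht]
  have hconv d t : ∃ y, Tendsto (fun m => picard F m d t) atTop (𝓝 y) := by
    rcases le_total t 0 with ht | ht
    · exact ⟨0, tendsto_const_nhds.congr fun m => (hneg m d t ht).symm⟩
    · have hs : Summable fun m : ℕ => B * C ^ m * t ^ (m + 1) / (m + 1).factorial := by
        refine Summable.of_norm_bounded
          ((Real.summable_pow_div_factorial (C * t)).mul_left (|B| * t)) fun m => ?_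
        rw [norm_div, norm_mul, norm_mul, norm_pow, norm_pow, norm_eq_abs, norm_of_nonneg hC0,
          norm_of_nonneg ht]
        rw [norm_of_nonneg (Nat.cast_nonneg _)]
        have h1 : ((m.factorial : ℕ) : ℝ) ≤ ((m + 1).factorial : ℕ) := by
          exact_mod_cast Nat.factorial_le (Nat.le_succ m)
        have h0 : (0 : ℝ) < (m.factorial : ℕ) := by positivity
        calc |B| * C ^ m * t ^ (m + 1) / ((m + 1).factorial : ℕ)
            ≤ |B| * C ^ m * t ^ (m + 1) / (m.factorial : ℕ) := by gcongr
          _ = _ := by rw [mul_pow]; ring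
      refine cauchySeq_tendsto_of_complete (cauchySeq_of_summable_dist (Summable.of_nonneg_of_le
        (fun _ => dist_nonneg) (fun m => ?_) hs))
      rw [dist_comm, dist_eq_norm]
      exact norm_picard_succ_sub_le hF hB hC0 hC m d ht
  choose Y hY using hconv
  have hYm : Measurable fun p : D × ℝ => Y p.1 p.2 :=
    measurable_of_tendsto_metrizable (measurable_picard hF) (tendsto_pi_nhds.2 fun p => hY p.1 p.2)
  refine ⟨Y, hYm, fun d t ht => ?_⟩
  have h1 : Tendsto (fun m => picard F (m + 1) d t) atTop (𝓝 (Y d t)) :=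
    (hY d t).comp (tendsto_add_atTop_nat 1)
  have h2 : Tendsto (fun m => picard F (m + 1) d t) atTop (𝓝 (∫ s in Ioc 0 t, F d s (Y d s))) := by
    refine tendsto_integral_of_dominated_convergence (fun _ => B)
      (fun m => (integrableOn_of_bounded_field hF hB (measurable_picard hF m) d 0 t).1)
      (integrableOn_const (by simp)) (fun m => .of_forall fun s => hB d s _)
      (.of_forall fun s => ?_)
    rw [tendsto_iff_norm_sub_tendsto_zero]
    have h3 := ((tendsto_iff_norm_sub_tendsto_zero.1 (hY d s)).const_mul C)
    rw [mul_zero] at h3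
    exact squeeze_zero (fun _ => norm_nonneg _) (fun m => hC d s _ _) h3
  rw [integral_of_le ht]
  exact tendsto_nhds_unique h1 h2

end Picard

/-- An integral form of Gronwall's inequality. -/
theorem eq_zero_of_le_integral {u : ℝ → ℝ} (hC : 0 ≤ C) (hu : ContinuousOn u (Icc 0 T))
    (h0 : ∀ t ∈ Icc 0 T, 0 ≤ u t) (h : ∀ t ∈ Icc 0 T, u t ≤ C * ∫ s in 0..t, u s) :
    ∀ t ∈ Icc 0 T, u t = 0 := by
  intro t ht
  have hT : 0 ≤ T := ht.1.trans ht.2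
  obtain ⟨K, hK⟩ := isCompact_Icc.exists_bound_of_continuousOn hu
  have hint : ∀ t ∈ Icc 0 T, IntervalIntegrable u volume 0 t := fun t ht =>
    (hu.mono (by rw [uIcc_of_le ht.1]; exact Icc_subset_Icc_right ht.2)).intervalIntegrable
  have key (m : ℕ) : ∀ t ∈ Icc 0 T, u t ≤ K * (C * t) ^ m / m.factorial := by
    induction m with
    | zero =>
      intro t ht
      simpa using (le_abs_self _).trans (hK t ht)
    | succ m ih =>
      intro t ht
      refine (h t ht).trans ?_
      have h1 : ∫ s in 0..t, u s ≤ ∫ s in 0..t, K * (C * s) ^ m / m.factorial :=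
        intervalIntegral.integral_mono_on ht.1 (hint t ht)
          ((by fun_prop : Continuous fun s : ℝ => K * (C * s) ^ m / m.factorial).intervalIntegrable
            _ _)
          fun s hs => ih s ⟨hs.1, hs.2.trans ht.2⟩
      have h2 : ∫ s in 0..t, K * (C * s) ^ m / m.factorial
          = K * C ^ m / m.factorial * (t ^ (m + 1) / (m + 1)) := by
        have e : (fun s : ℝ => K * (C * s) ^ m / m.factorial)
            = fun s => K * C ^ m / m.factorial * s ^ m := by ext s; rw [mul_pow]; ring
        rw [e, intervalIntegral.integral_const_mul, integral_pow]
        simp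
      calc C * ∫ s in 0..t, u s ≤ C * (K * C ^ m / m.factorial * (t ^ (m + 1) / (m + 1))) := by
            gcongr; exact h1.trans h2.le
        _ = K * (C * t) ^ (m + 1) / (m + 1).factorial := by
            rw [Nat.factorial_succ, mul_pow]
            push_cast
            have : (m.factorial : ℝ) ≠ 0 := by positivity
            field_simp
            ring
  have hlim : Tendsto (fun m : ℕ => K * (C * t) ^ m / m.factorial) atTop (𝓝 0) := by
    have := (FloorSemiring.tendsto_pow_div_factorial_atTop (C * t)).const_mul K
    simpa [mul_div_assoc] using this
  exact le_antisymm (ge_of_tendsto' hlim fun m => key m t ht) (h0 t ht)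

/-! ### Pair interactions on the torus -/

/-- The drift of the `i`-th particle under pair interactions with coefficients `c`. -/
def pairDrift {ι : Type*} (A : Finset ι) (c : ι → ι → ℝ → ℝ) (k : Torus → ℝ²)
    (x : ι → Torus) (i : ι) (s : ℝ) : ℝ² :=
  ∑ j ∈ A, c i j s • k (x i - x j)

theorem norm_pairDrift_le {ι : Type*} {A : Finset ι} {c : ι → ι → ℝ → ℝ} {K : ℝ} (hc : ∀ i j s, |c i
    j s| ≤ 1) (hk : ∀ z, ‖k z‖ ≤ K) (x : ι → Torus) (i : ι) (s : ℝ) : ‖pairDrift A c k x i s‖ ≤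
    A.card * K := by
  refine (norm_sum_le_of_le A fun j _ => ?_).trans (by rw [sum_const, nsmul_eq_mul])
  rw [norm_smul]
  exact (mul_le_mul (hc i j s) (hk _) (norm_nonneg _) zero_le_one).trans (by rw [one_mul])

/-- The unknowns are displacements in the plane, starting from zero, and not points of the torus;
the equation then lives in a finite-dimensional vector space. -/
theorem exists_pair_flow {ι D : Type*} [MeasurableSpace D] (A : Finset ι) (c : D → ι → ι → ℝ → ℝ)
    (hcm : ∀ i j, Measurable fun p : D × ℝ => c p.1 i j p.2) (hc : ∀ d i j s, |c d i j s| ≤ 1) (x₀ :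
    D → ι → Torus) (hx₀ : ∀ i, Measurable fun d => x₀ d i) (k : Torus → ℝ²) (hk : Continuous k) (hC0
    : 0 ≤ C) (hkC : ∀ z, ‖k z‖ ≤ C) (hkL : ∀ z w, ‖k z - k w‖ ≤ C * ‖z - w‖) : ∃ Y : D → ℝ → ι → ℝ²,
    (∀ i, Measurable fun p : D × ℝ => Y p.1 p.2 i) ∧ (∀ d t, ∀ i ∉ A, Y d t i = 0) ∧ ∀ d t, 0 ≤ t →
    ∀ i ∈ A, Y d t i = ∫ s in 0..t, pairDrift A (c d) k (fun i => x₀ d i + toTorus (Y d s i))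
    i s := by
  classical
  -- Particles outside `A` are given displacement zero, so that the state space is indexed by the
  -- finite set `A` only.
  let ext : (A → ℝ²) → ι → ℝ² := fun y i => if h : i ∈ A then y ⟨i, h⟩ else 0
  let F : D → ℝ → (A → ℝ²) → A → ℝ² := fun d s y i =>
    pairDrift A (c d) k (fun i => x₀ d i + toTorus (ext y i)) i s
  have hextm i : Measurable fun y : A → ℝ² => ext y i := by
    by_cases h : i ∈ A
    · simp only [ext, h, dif_pos]; fun_prop
    · simp only [ext, h, dif_neg, not_false_eq_true]; fun_prop
  have hFm : Measurable fun p : D × ℝ × (A → ℝ²) => F p.1 p.2.1 p.2.2 := by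
    refine measurable_pi_lambda _ fun i => ?_
    refine Finset.measurable_sum _ fun j _ => ?_
    have h1 : Measurable fun p : D × ℝ × (A → ℝ²) => c p.1 i j p.2.1 :=
      (hcm i j).comp (by fun_prop : Measurable fun p : D × ℝ × (A → ℝ²) => (p.1, p.2.1))
    have h2 i : Measurable fun p : D × ℝ × (A → ℝ²) =>
        x₀ p.1 i + toTorus (ext p.2.2 i) :=
      ((hx₀ i).comp measurable_fst).add
        (continuous_toTorus.measurable.comp ((hextm i).comp (by fun_prop)))
    exact h1.smul (hk.measurable.comp ((h2 i).sub (h2 j)))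
  have hFb d s y : ‖F d s y‖ ≤ A.card * C :=
    (pi_norm_le_iff_of_nonneg (by positivity)).2 fun i => norm_pairDrift_le (hc d) hkC _ _ _
  have hextn : ∀ (y y' : A → ℝ²) i, ‖ext y i - ext y' i‖ ≤ ‖y - y'‖ := by
    intro y y' i
    by_cases h : i ∈ A
    · simp only [ext, h, dif_pos]; exact norm_le_pi_norm (y - y') ⟨i, h⟩
    · simp [ext, h]
  have hFL d s y y' : ‖F d s y - F d s y'‖ ≤ (A.card * (2 * C)) * ‖y - y'‖ := by
    refine (pi_norm_le_iff_of_nonneg (by positivity)).2 fun i => ?_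
    simp only [F, pairDrift, Pi.sub_apply]
    rw [← sum_sub_distrib]
    refine (norm_sum_le_of_le A (f := fun j => _) fun j _ => ?_).trans
      (by rw [sum_const, nsmul_eq_mul, mul_assoc])
    rw [← smul_sub, norm_smul]
    refine (mul_le_of_le_one_left (norm_nonneg _) (hc d i j s)).trans ((hkL _ _).trans ?_)
    rw [mul_comm 2 C, mul_assoc]
    gcongr
    have e : x₀ d i + toTorus (ext y i) - (x₀ d j + toTorus (ext y j))
        - (x₀ d i + toTorus (ext y' i) - (x₀ d j + toTorus (ext y' j)))
        = toTorus (ext y i - ext y' i) - toTorus (ext y j - ext y' j) := by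
      rw [toTorus_sub, toTorus_sub]; abel
    rw [e, two_mul]
    refine (norm_sub_le _ _).trans (add_le_add ?_ ?_)
    · exact (norm_toTorus_le _).trans (hextn y y' i)
    · exact (norm_toTorus_le _).trans (hextn y y' j)
  obtain ⟨Y, hYm, hY⟩ := exists_measurable_integral_curve hFm hFb (by positivity) hFL
  refine ⟨fun d t => ext (Y d t), fun i => (hextm i).comp hYm, fun d t i hi => by simp [ext, hi],
    fun d t ht i hi => ?_⟩
  have h := congrFun (hY d t ht) ⟨i, hi⟩
  have hint : IntervalIntegrable (fun s => F d s (Y d s)) volume 0 t := by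
    rw [intervalIntegrable_iff_integrableOn_Ioc_of_le ht]
    exact integrableOn_of_bounded_field hFm hFb hYm d 0 t
  have hp := ContinuousLinearMap.intervalIntegral_comp_comm
    (proj (R := ℝ) (φ := fun _ : A => ℝ²) ⟨i, hi⟩) hint
  simp only [ext, hi, dif_pos]
  rw [h]
  exact hp.symm

/-! ### Near preservation of the volume by one pair interaction -/

/-- The fundamental square `(0,1]²`. -/
def unitSquare : Set ℝ² := univ.pi fun _ => Ioc 0 1

theorem measurableSet_unitSquare : MeasurableSet unitSquare :=
  MeasurableSet.univ_pi fun _ => measurableSet_Ioc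

theorem measurePreserving_toTorus :
    MeasurePreserving toTorus (volume.restrict unitSquare) volume := by
  have h := measurePreserving_pi (fun _ : Fin 2 => (volume : Measure ℝ).restrict (Ioc 0 1))
    (fun _ : Fin 2 => (volume : Measure UnitAddCircle)) (f := fun _ => QuotientAddGroup.mk)
    fun _ => by simpa using UnitAddCircle.measurePreserving_mk 0
  rw [← Measure.restrict_pi_pi] at h
  exact h

theorem toTorus_add_int (u : ℝ²) (n : ℤ²) : toTorus (u + fun l => (n l : ℝ)) = toTorus u := by
  ext l; simp [toTorus]

theorem exists_int_of_toTorus_eq (h : toTorus u = toTorus v) :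
    ∃ n : ℤ², u = v + fun l => (n l : ℝ) := by
  have : ∀ l, ∃ n : ℤ, u l = v l + n := by
    intro l
    have hl : ((u l : ℝ) : UnitAddCircle) = (v l : ℝ) := congrFun h l
    rw [QuotientAddGroup.eq] at hl
    obtain ⟨n, hn⟩ := AddSubgroup.mem_zmultiples_iff.1 hl
    refine ⟨-n, ?_⟩
    simp at hn ⊢
    linarith
  choose n hn using this
  exact ⟨n, funext hn⟩

/-- Cut `E` into its pieces in the integer translates of the unit square and move all pieces back.
Injectivity modulo the lattice means that every point of the square is covered at most once. -/
theorem setLIntegral_comp_toTorus_le {E : Set ℝ²} (hE : MeasurableSet E) (hinj : InjOn toTorus E) {f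
    : Torus → ℝ≥0∞} (hf : Measurable f) : ∫⁻ u in E, f (toTorus u) ≤ ∫⁻ z, f z := by
  have hF : Measurable fun u => f (toTorus u) := hf.comp continuous_toTorus.measurable
  have h1 u : E.indicator (fun u => f (toTorus u)) u ≤ ∑' n : ℤ²,
      E.indicator (fun u => f (toTorus u)) u * unitSquare.indicator 1 (u - fun l => (n l : ℝ)) := by
    have hmem : (u - fun l => (((⌈u l⌉ - 1 : ℤ)) : ℝ)) ∈ unitSquare := by
      intro l _
      have := Int.ceil_lt_add_one (u l)
      have := Int.le_ceil (u l)
      simp only [Pi.sub_apply]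
      push_cast
      exact ⟨by linarith, by linarith⟩
    refine le_trans (le_of_eq ?_) (le_tsum (fun l => ⌈u l⌉ - 1))
    rw [indicator_of_mem hmem, Pi.one_apply, mul_one]
  have hshift (n : ℤ²) : ∫⁻ u, E.indicator (fun u => f (toTorus u)) u *
      unitSquare.indicator 1 (u - fun l => (n l : ℝ))
      = ∫⁻ u in unitSquare, E.indicator 1 (u + fun l => (n l : ℝ)) * f (toTorus u) := by
    rw [← lintegral_add_right_eq_self _ (fun l => (n l : ℝ)), ← lintegral_indicator
      measurableSet_unitSquare]
    congr 1
    ext u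
    rw [add_sub_cancel_right]
    by_cases hu : u ∈ unitSquare <;> by_cases hE : (u + fun l => (n l : ℝ)) ∈ E <;>
      simp [hu, hE, toTorus_add_int]
  have hone u : ∑' n : ℤ², E.indicator (1 : ℝ² → ℝ≥0∞) (u + fun l => (n l : ℝ)) ≤ 1 := by
    by_cases h : ∃ n : ℤ², (u + fun l => (n l : ℝ)) ∈ E
    · obtain ⟨n, hn⟩ := h
      rw [tsum_eq_single n]
      · exact indicator_le_self' (fun _ _ => zero_le) _
      · intro m hm
        refine indicator_of_notMem (fun hmE => hm ?_) _
        have := hinj hmE hn (by rw [toTorus_add_int, toTorus_add_int])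
        ext l
        have h2 := congrFun this l
        simpa using h2
    · push Not at h
      simp [fun n => indicator_of_notMem (h n) (1 : ℝ² → ℝ≥0∞)]
  have hmE (n : ℤ²) : Measurable fun u : ℝ² =>
      E.indicator (1 : ℝ² → ℝ≥0∞) (u + fun l => (n l : ℝ)) :=
    (measurable_one.indicator hE).comp (measurable_id.add_const _)
  calc ∫⁻ u in E, f (toTorus u) = ∫⁻ u, E.indicator (fun u => f (toTorus u)) u :=
        (lintegral_indicator hE _).symm
    _ ≤ ∫⁻ u, ∑' n : ℤ², E.indicator (fun u => f (toTorus u)) u *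
        unitSquare.indicator 1 (u - fun l => (n l : ℝ)) := lintegral_mono h1
    _ = ∑' n : ℤ², ∫⁻ u, E.indicator (fun u => f (toTorus u)) u *
        unitSquare.indicator 1 (u - fun l => (n l : ℝ)) := by
        refine lintegral_tsum fun n => ((hF.indicator hE).mul ?_).aemeasurable
        exact (measurable_one.indicator measurableSet_unitSquare).comp (measurable_id.sub_const _)
    _ = ∑' n : ℤ², ∫⁻ u in unitSquare,
        E.indicator 1 (u + fun l => (n l : ℝ)) * f (toTorus u) := by simp only [hshift]
    _ = ∫⁻ u in unitSquare, ∑' n : ℤ², E.indicator 1 (u + fun l => (n l : ℝ)) * f (toTorus u) :=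
        (lintegral_tsum fun n => ((hmE n).mul hF).aemeasurable).symm
    _ ≤ ∫⁻ u in unitSquare, f (toTorus u) := by
        refine lintegral_mono fun u => ?_
        rw [ENNReal.tsum_mul_right]
        exact mul_le_of_le_one_left zero_le (hone u)
    _ = ∫⁻ z, f z := measurePreserving_toTorus.lintegral_comp hf

/-- The term linear in `s` is the trace, which vanishes; the Jacobian deviates from `1` only to
second order. -/
theorem det_one_add_smul (M : ℝ² →L[ℝ] ℝ²) (s : ℝ) (htr : M (single 0 1) 0 + M (single 1 1) 1 = 0) :
    (ContinuousLinearMap.id ℝ ℝ² + s • M).det = 1 + s ^ 2 * (M (single 0 1) 0 * M (single 1 1) 1 - M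
    (single 1 1) 0 * M (single 0 1) 1) := by
  rw [det, ← LinearMap.det_toMatrix', Matrix.det_fin_two]
  simp only [LinearMap.toMatrix'_apply, coe_coe, add_apply,
    id_apply, smul_apply, Pi.add_apply, Pi.smul_apply,
    smul_eq_mul]
  simp
  linear_combination s * htr

/-- For small `s` the map `z ↦ z + s K(z - w)` is injective on the torus, and its Jacobian is at
least `1 - O(s²)` because `K` is divergence free. The missing first order term is essential: about
`1 / h` moves of size `h` then change volumes by a factor `1 + O(h)` in total. -/
theorem exists_lintegral_pair_le (hg : ContDiff ℝ 2 lift g) :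
    ∃ C : ℝ, 0 ≤ C ∧ ∃ σ₀ > 0, ∀ s : ℝ, |s| ≤ σ₀ → ∀ w : Torus, ∀ f : Torus → ℝ≥0∞, Measurable f →
      ∫⁻ z, f (z + toTorus (s • skewGrad g (z - w))) ≤ ofReal (1 + C * s ^ 2) * ∫⁻ z, f z := by
  obtain ⟨Λ, hΛ0, -, hΛ⟩ := exists_lipschitz_skewGrad hg
  set K : ℝ² → ℝ² := fun u => skewGrad g (toTorus u) with hK
  have hKc : ContDiff ℝ 1 K := contDiff_skewGrad hg
  have hKL u v : ‖K u - K v‖ ≤ Λ * ‖u - v‖ := (hΛ _ _).trans (by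
    rw [← toTorus_sub]; gcongr; exact norm_toTorus_le _)
  have hKd u : HasFDerivAt K (fderiv ℝ K u) u :=
    (hKc.contDiffAt.differentiableAt (by norm_num)).hasFDerivAt
  have hM u : ‖fderiv ℝ K u‖ ≤ Λ :=
    norm_fderiv_le_of_lipschitz ℝ (C := ⟨Λ, hΛ0⟩) (LipschitzWith.of_dist_le_mul fun a b => by
      rw [dist_eq_norm, dist_eq_norm]; exact hKL a b)
  have hent : ∀ u (a b : Fin 2), |fderiv ℝ K u (single a 1) b| ≤ Λ := by
    intro u a b
    refine (norm_le_pi_norm (fderiv ℝ K u (single a 1)) b).trans ?_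
    refine ((fderiv ℝ K u).le_opNorm _).trans ?_
    rw [Pi.norm_single, norm_one, mul_one]; exact hM u
  -- The bound on `s` makes `s • K` Lipschitz with constant `1 / 2`, whence injectivity. With `y =
  -- s² Λ² ≤ 1 / 4` the Jacobian is at least `1 - 2y`, and `(1 + 4y)(1 - 2y) ≥ 1`.
  refine ⟨4 * Λ ^ 2, by positivity, 1 / (2 * (Λ + 1)), by positivity, fun s hs => ?_⟩
  have hsΛ : |s| * Λ ≤ 1 / 2 := by
    calc |s| * Λ ≤ 1 / (2 * (Λ + 1)) * (Λ + 1) := by gcongr; linarith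
      _ = 1 / 2 := by field_simp
  have hs2 : s ^ 2 * Λ ^ 2 ≤ 1 / 4 := by
    have := pow_le_pow_left₀ (by positivity) hsΛ 2
    rw [mul_pow, sq_abs] at this
    linarith
  set φ : ℝ² → ℝ² := fun u => u + s • K u with hφ
  have hφd u : HasFDerivAt φ (ContinuousLinearMap.id ℝ ℝ² + s • fderiv ℝ K u) u := (hasFDerivAt_id
      u).add ((hKd u).const_smul s)
  have hdet : ∀ u, 1 - 2 * (s ^ 2 * Λ ^ 2)
      ≤ (ContinuousLinearMap.id ℝ ℝ² + s • fderiv ℝ K u).det := by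
    intro u
    rw [det_one_add_smul _ s (trace_fderiv_skewGrad hg u)]
    have h1 := abs_le.1 ((abs_mul _ _).le.trans (mul_le_mul (hent u 0 0) (hent u 1 1) (abs_nonneg _) hΛ0))
    have h2 := abs_le.1 ((abs_mul _ _).le.trans (mul_le_mul (hent u 1 0) (hent u 0 1) (abs_nonneg _) hΛ0))
    nlinarith [sq_nonneg s]
  have hinjφ : ∀ u v (n : ℤ²), φ u = φ v + (fun l => (n l : ℝ)) → u = v + fun l => (n l : ℝ) := by
    intro u v n h
    set v' := v + fun l => (n l : ℝ)
    have hKv : K v' = K v := by simp only [hK, v', toTorus_add_int]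
    have h2 : u - v' = s • (K v' - K u) := by
      have : u + s • K u = v + s • K v + fun l => (n l : ℝ) := h
      rw [smul_sub, hKv, eq_sub_iff_add_eq, ← sub_eq_zero]
      rw [← sub_eq_zero] at this
      rw [← this]
      simp only [v']
      abel
    have h3 : ‖u - v'‖ ≤ 1 / 2 * ‖u - v'‖ := by
      conv_lhs => rw [h2, norm_smul]
      calc ‖s‖ * ‖K v' - K u‖ ≤ |s| * (Λ * ‖v' - u‖) := by gcongr; exact le_rfl; exact hKL _ _
        _ = |s| * Λ * ‖u - v'‖ := by rw [norm_sub_rev]; ring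
        _ ≤ 1 / 2 * ‖u - v'‖ := by gcongr
    have h4 : ‖u - v'‖ = 0 := by linarith [norm_nonneg (u - v')]
    exact sub_eq_zero.1 (norm_eq_zero.1 h4)
  have hinj : InjOn φ unitSquare := fun u _ v _ h => by
    have h0 : (fun l => (((0 : ℤ²) l : ℤ) : ℝ)) = 0 := by ext l; simp
    have := hinjφ u v 0 (by rw [h0, add_zero]; exact h)
    rwa [h0, add_zero] at this
  have hinj2 : InjOn toTorus (φ '' unitSquare) := by
    rintro _ ⟨u, hu, rfl⟩ _ ⟨v, hv, rfl⟩ h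
    obtain ⟨n, hn⟩ := exists_int_of_toTorus_eq h
    have h1 := hinjφ u v n hn
    have hn0 : n = 0 := by
      ext l
      have h2 := congrFun h1 l
      have h3 := hu l (mem_univ l)
      have h4 := hv l (mem_univ l)
      simp only [Pi.add_apply] at h2
      have h5 : (n l : ℝ) < 1 := by linarith [h3.2, h4.1]
      have h6 : (-1 : ℝ) < n l := by linarith [h3.1, h4.2]
      have h7 : n l < 1 := by exact_mod_cast h5
      have h8 : -1 < n l := by exact_mod_cast h6
      simp only [Pi.zero_apply]; omega
    rw [hn, hn0]; ext l; simp
  have key : ∀ f : Torus → ℝ≥0∞, Measurable f →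
      ∫⁻ z, f (z + toTorus (s • skewGrad g z)) ≤ ofReal (1 + 4 * Λ ^ 2 * s ^ 2) * ∫⁻ z, f z := by
    intro f hf
    have hm : Measurable fun z => f (z + toTorus (s • skewGrad g z)) := by
      have hk : Continuous (skewGrad g) := continuous_of_comp_toTorus hKc.continuous
      exact hf.comp (measurable_id.add
        (continuous_toTorus.measurable.comp (hk.measurable.const_smul s)))
    have himg : MeasurableSet (φ '' unitSquare) :=
      measurable_image_of_fderivWithin measurableSet_unitSquare
        (fun u _ => (hφd u).hasFDerivWithinAt) hinj
    calc ∫⁻ z, f (z + toTorus (s • skewGrad g z))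
        = ∫⁻ u in unitSquare, f (toTorus (φ u)) := by
          rw [← measurePreserving_toTorus.lintegral_comp hm]
          simp only [hφ, hK, toTorus_add]
      _ ≤ ∫⁻ u in unitSquare, ofReal (1 + 4 * Λ ^ 2 * s ^ 2) *
          (ofReal |(ContinuousLinearMap.id ℝ ℝ² + s • fderiv ℝ K u).det| * f (toTorus (φ u))) := by
          refine lintegral_mono fun u => ?_
          rw [← mul_assoc, ← ofReal_mul (by positivity)]
          refine le_mul_of_one_le_left zero_le ?_
          rw [one_le_ofReal]
          have h1 := (hdet u).trans (le_abs_self _)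
          have h2 : 1 ≤ (1 + 4 * Λ ^ 2 * s ^ 2) * (1 - 2 * (s ^ 2 * Λ ^ 2)) := by
            nlinarith [mul_nonneg (sq_nonneg s) (sq_nonneg Λ)]
          exact h2.trans (by gcongr)
      _ = ofReal (1 + 4 * Λ ^ 2 * s ^ 2) * ∫⁻ u in φ '' unitSquare, f (toTorus u) := by
          rw [lintegral_const_mul' _ _ ofReal_ne_top,
            lintegral_image_eq_lintegral_abs_det_fderiv_mul volume measurableSet_unitSquare
              (fun u _ => (hφd u).hasFDerivWithinAt) hinj]
      _ ≤ _ := by gcongr; exact setLIntegral_comp_toTorus_le himg hinj2 hf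
  intro w f hf
  have h := key (fun z => f (z + w)) (hf.comp (measurable_id.add_const w))
  rw [lintegral_add_right_eq_self] at h
  refine le_trans (le_of_eq ?_) h
  rw [← lintegral_add_right_eq_self _ w]
  congr 1
  ext z
  rw [add_sub_cancel_right]
  congr 1
  abel

/-! ### The law of the samples -/

instance : IsProbabilityMeasure signLaw where
  measure_univ := by
    simp only [signLaw, Measure.smul_apply, Measure.add_apply, measure_univ, smul_eq_mul]
    rw [one_add_one_eq_two, ENNReal.inv_mul_cancel (by norm_num) (by norm_num)]

instance (r : ℝ) [hr : Fact (0 < r)] : IsProbabilityMeasure (expMeasure r) :=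
  isProbabilityMeasure_expMeasure hr.out

instance : IsProbabilityMeasure (markLaw r) := by
  unfold markLaw; infer_instance

/-- The law of independent marks with rate `r`. -/
def sampleLaw (r : ℝ) : Measure Sample := Measure.infinitePi fun _ : Idx => markLaw r

instance : IsProbabilityMeasure (sampleLaw r) := by
  unfold sampleLaw; infer_instance

instance : BorelSpace (ℝ × ℝ × Torus) := inferInstance

instance : BorelSpace Sample := by
  have : ∀ i : Idx, BorelSpace ((fun _ : Idx => ℝ × ℝ × Torus) i) := fun _ =>
    inferInstanceAs (BorelSpace (ℝ × ℝ × Torus))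
  exact @Pi.borelSpace Idx (fun _ => ℝ × ℝ × Torus) _ _ _ _ this

theorem measurable_update_sample (i : Idx) :
    Measurable fun p : Sample × (ℝ × ℝ × Torus) => update p.1 i p.2 := by
  refine measurable_pi_lambda _ fun j => ?_
  rcases eq_or_ne j i with rfl | h
  · simpa using measurable_snd
  · simp only [update_of_ne h]; fun_prop

/-- Resampling one mark independently does not change the law. In this form Fubini's theorem is
available for a single index of the infinite product. -/
theorem map_update_sampleLaw (i : Idx) :
    ((sampleLaw r).prod (markLaw r)).map (fun p => update p.1 i p.2) = sampleLaw r := by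
  refine Measure.eq_infinitePi (fun _ : Idx => markLaw r) fun s t ht => ?_
  rw [Measure.map_apply (measurable_update_sample i) (MeasurableSet.pi s.countable_toSet fun j _ => ht j)]
  by_cases hi : i ∈ s
  · have e : (fun p : Sample × (ℝ × ℝ × Torus) => update p.1 i p.2) ⁻¹' (s : Set Idx).pi t
        = ((s.erase i : Finset Idx) : Set Idx).pi t ×ˢ t i := by
      ext ⟨x, z⟩
      simp only [mem_preimage, Set.mem_pi, mem_coe, mem_prod, mem_erase]
      constructor
      · intro h
        refine ⟨fun j hj => ?_, by simpa using h i hi⟩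
        simpa [update_of_ne hj.1] using h j hj.2
      · rintro ⟨h1, h2⟩ j hj
        rcases eq_or_ne j i with rfl | hji
        · simpa using h2
        · simpa [update_of_ne hji] using h1 j ⟨hji, hj⟩
    rw [e, Measure.prod_prod, sampleLaw, Measure.infinitePi_pi _ fun j _ => ht j,
      Finset.prod_erase_mul s _ hi]
  · have e : (fun p : Sample × (ℝ × ℝ × Torus) => update p.1 i p.2) ⁻¹' (s : Set Idx).pi t
        = (s : Set Idx).pi t ×ˢ univ := by
      ext ⟨x, z⟩
      simp only [mem_preimage, Set.mem_pi, mem_coe, mem_prod, mem_univ, and_true]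
      refine forall₂_congr fun j hj => ?_
      rw [update_of_ne (by rintro rfl; exact hi hj)]
    rw [e, Measure.prod_prod, measure_univ, mul_one, sampleLaw, Measure.infinitePi_pi _ fun j _ => ht j]

theorem lintegral_update (i : Idx) (hf : Measurable f) : ∫⁻ d, f d ∂sampleLaw r = ∫⁻ d, ∫⁻ g, ∫⁻ a,
    ∫⁻ z, f (update d i (g, a, z)) ∂volume ∂signLaw ∂expMeasure r ∂sampleLaw r := by
  have hfu : Measurable fun p : Sample × (ℝ × ℝ × Torus) => f (update p.1 i p.2) :=
    hf.comp (measurable_update_sample i)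
  conv_lhs => rw [← map_update_sampleLaw r i]
  rw [lintegral_map hf (measurable_update_sample i), lintegral_prod _ hfu.aemeasurable]
  congr 1
  ext d
  have h1 : Measurable fun m : ℝ × ℝ × Torus => f (update d i m) :=
    hfu.comp (by fun_prop : Measurable fun m => (d, m))
  rw [markLaw, lintegral_prod _ h1.aemeasurable]
  congr 1
  ext g
  exact lintegral_prod _ (h1.comp (by fun_prop : Measurable fun m : ℝ × Torus => (g, m))).aemeasurable

/-! ### Sequences of pair interactions -/

/-- A function of the sample which does not depend on the positions. -/
def PosInvariant {X : Type*} (a : Sample → X) : Prop :=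
  ∀ d e : Sample, (∀ i, (d i).1 = (e i).1 ∧ (d i).2.1 = (e i).2.1) → a d = a e

/-- The displacement of the position of `i` by the interaction with `j`, with coefficient `a`. -/
def pairMove (k : Torus → ℝ²) (q : (Sample → ℝ) × Idx × Idx) (d : Sample) : Sample :=
  update d q.2.1 ((d q.2.1).1, (d q.2.1).2.1,
    (d q.2.1).2.2 + toTorus (q.1 d • k ((d q.2.1).2.2 - (d q.2.2).2.2)))

theorem pairMove_fst (k : Torus → ℝ²) (q : (Sample → ℝ) × Idx × Idx) (d : Sample)
    (i : Idx) : (pairMove k q d i).1 = (d i).1 ∧ (pairMove k q d i).2.1 = (d i).2.1 := by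
  rcases eq_or_ne i q.2.1 with rfl | h
  · simp [pairMove]
  · simp [pairMove, update_of_ne h]

theorem measurable_pairMove (hk : Measurable k)
    {q : (Sample → ℝ) × Idx × Idx} (hq : Measurable q.1) : Measurable (pairMove k q) := by
  have hp i : Measurable fun d : Sample => (d i).2.2 := by fun_prop
  have h : Measurable fun d : Sample => ((d q.2.1).1, (d q.2.1).2.1,
      (d q.2.1).2.2 + toTorus (q.1 d • k ((d q.2.1).2.2 - (d q.2.2).2.2))) :=
    (by fun_prop : Measurable fun d : Sample => (d q.2.1).1).prodMk
      ((by fun_prop : Measurable fun d : Sample => (d q.2.1).2.1).prodMk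
        ((hp _).add (continuous_toTorus.measurable.comp (hq.smul (hk.comp ((hp _).sub (hp _)))))))
  exact (measurable_update_sample q.2.1).comp (measurable_id.prodMk h)

/-- With all other marks frozen, the coefficient does not see the position being moved, so the move
is exactly the map of `hpair` with `w` the position of the partner. -/
theorem lintegral_pairMove_le (hk : Measurable k) {σ₀ σ : ℝ} (hσ : σ ≤ σ₀) (hC : 0 ≤ C) (hpair : ∀ s
    : ℝ, |s| ≤ σ₀ → ∀ w : Torus, ∀ f : Torus → ℝ≥0∞, Measurable f → ∫⁻ z, f (z + toTorus (s • k (z -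
    w))) ≤ ofReal (1 + C * s ^ 2) * ∫⁻ z, f z) {q : (Sample → ℝ) × Idx × Idx} (hqm : Measurable q.1)
    (hqi : PosInvariant q.1) (hqs : ∀ d, |q.1 d| ≤ σ) (hqne : q.2.1 ≠ q.2.2) (hf : Measurable f) :
    ∫⁻ d, f (pairMove k q d) ∂sampleLaw r ≤ ofReal (1 + C * σ ^ 2) * ∫⁻ d, f d ∂sampleLaw r := by
  obtain ⟨a, i, j⟩ := q
  simp only at hqm hqi hqs hqne
  rw [lintegral_update r i hf, lintegral_update r i (f := fun d => f (pairMove k (a, i, j) d))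
    (hf.comp (measurable_pairMove hk hqm)), ← lintegral_const_mul' _ _ ofReal_ne_top]
  refine lintegral_mono fun d => ?_
  rw [← lintegral_const_mul' _ _ ofReal_ne_top]
  refine lintegral_mono fun g => ?_
  rw [← lintegral_const_mul' _ _ ofReal_ne_top]
  refine lintegral_mono fun b => ?_
  have hinv : ∀ z, a (update d i (g, b, z)) = a (update d i (g, b, 0)) := by
    intro z
    refine hqi _ _ fun l => ?_
    rcases eq_or_ne l i with rfl | h
    · simp
    · simp [update_of_ne h]
  have e z : pairMove k (a, i, j) (update d i (g, b, z))
      = update d i (g, b, z + toTorus (a (update d i (g, b, 0)) • k (z - (d j).2.2))) := by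
    simp only [pairMove, update_self, Function.update_idem, hinv z, update_of_ne (Ne.symm hqne)]
  simp only [e]
  have hs := hqs (update d i (g, b, 0))
  have hfm : Measurable fun z => f (update d i (g, b, z)) :=
    hf.comp ((measurable_update_sample i).comp
      (by fun_prop : Measurable fun z : Torus => (d, (g, b, z))))
  refine (hpair _ (hs.trans hσ) (d j).2.2 _ hfm).trans ?_
  gcongr ofReal (1 + C * ?_) * _
  rw [← sq_abs]
  gcongr

/-- Consecutive pair interactions. -/
def runMoves (k : Torus → ℝ²) (ℓ : List ((Sample → ℝ) × Idx × Idx)) (d : Sample) :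
    Sample :=
  ℓ.foldl (fun d q => pairMove k q d) d

theorem runMoves_fst (k : Torus → ℝ²) (ℓ : List ((Sample → ℝ) × Idx × Idx)) (d : Sample)
    (i : Idx) : (runMoves k ℓ d i).1 = (d i).1 ∧ (runMoves k ℓ d i).2.1 = (d i).2.1 := by
  induction ℓ generalizing d with
  | nil => simp [runMoves]
  | cons q ℓ ih =>
    have := ih (pairMove k q d)
    rw [(pairMove_fst k q d i).1, (pairMove_fst k q d i).2] at this
    exact this

theorem measurable_runMoves (hk : Measurable k) {ℓ : List ((Sample → ℝ) × Idx × Idx)} (hℓ : ∀ q ∈ ℓ,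
    Measurable q.1) : Measurable (runMoves k ℓ) := by
  induction ℓ with
  | nil => exact measurable_id
  | cons q ℓ ih =>
    exact (ih fun p hp => hℓ p (List.mem_cons_of_mem _ hp)).comp
      (measurable_pairMove hk (hℓ q List.mem_cons_self))

theorem lintegral_runMoves_le (hk : Measurable k) {σ₀ σ : ℝ} (hσ : σ ≤ σ₀) (hC : 0 ≤ C) (hpair : ∀ s
    : ℝ, |s| ≤ σ₀ → ∀ w : Torus, ∀ f : Torus → ℝ≥0∞, Measurable f → ∫⁻ z, f (z + toTorus (s • k (z -
    w))) ≤ ofReal (1 + C * s ^ 2) * ∫⁻ z, f z) {ℓ : List ((Sample → ℝ) × Idx × Idx)} (hℓ : ∀ q ∈ ℓ,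
    Measurable q.1 ∧ PosInvariant q.1 ∧ (∀ d, |q.1 d| ≤ σ) ∧ q.2.1 ≠ q.2.2) (hf : Measurable f) : ∫⁻
    d, f (runMoves k ℓ d) ∂sampleLaw r ≤ ofReal (1 + C * σ ^ 2) ^ ℓ.length * ∫⁻ d, f d ∂sampleLaw r
    := by
  induction ℓ with
  | nil => simp [runMoves]
  | cons q ℓ ih =>
    have hq := hℓ q List.mem_cons_self
    have hℓ' : ∀ p ∈ ℓ, _ := fun p hp => hℓ p (List.mem_cons_of_mem _ hp)
    calc ∫⁻ d, f (runMoves k (q :: ℓ) d) ∂sampleLaw r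
        ≤ ofReal (1 + C * σ ^ 2) * ∫⁻ d, f (runMoves k ℓ d) ∂sampleLaw r :=
          lintegral_pairMove_le r hk hσ hC hpair hq.1 hq.2.1 hq.2.2.1 hq.2.2.2
            (f := fun d => f (runMoves k ℓ d))
            (hf.comp (measurable_runMoves hk fun p hp => (hℓ' p hp).1))
      _ ≤ _ := by
          rw [List.length_cons, pow_succ' (ofReal _), mul_assoc]
          gcongr
          exact ih hℓ'

/-- Moves performed one after the other agree to second order with the sum of the same moves
evaluated at the initial positions, since earlier moves shift the arguments of the kernel by `O(σ)`
only. -/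
theorem norm_runMoves_sub_le {K : ℝ} (hK : 0 ≤ K) (hk : ∀ z, ‖k z‖ ≤ K) (hkL : ∀ z w, ‖k z - k w‖ ≤
    K * ‖z - w‖) {σ : ℝ} (hσ : 0 ≤ σ) {ℓ : List ((Sample → ℝ) × Idx × Idx)} (hℓ : ∀ q ∈ ℓ,
    PosInvariant q.1 ∧ ∀ d, |q.1 d| ≤ σ) (d : Sample) (i : Idx) : ‖(runMoves k ℓ d i).2.2 - (d
    i).2.2‖ ≤ ℓ.length * (σ * K) ∧ ‖(runMoves k ℓ d i).2.2 - (d i).2.2 - toTorus (ℓ.map fun q => if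
    q.2.1 = i then q.1 d • k ((d i).2.2 - (d q.2.2).2.2) else 0).sum‖ ≤ ℓ.length ^ 2 * (2 * K ^ 2 *
    σ ^ 2) := by
  induction ℓ using List.reverseRecOn generalizing i with
  | nil => simp [runMoves, toTorus_zero]
  | append_singleton ℓ q ih =>
    have hℓ' : ∀ p ∈ ℓ, _ := fun p hp => hℓ p (List.mem_append_left _ hp)
    have hq := hℓ q (by simp)
    have ih := ih hℓ'
    set e := runMoves k ℓ d with he
    have hrun : runMoves k (ℓ ++ [q]) d = pairMove k q e := by
      simp [runMoves, he]
    have hae : q.1 e = q.1 d := hq.1 _ _ fun l => runMoves_fst k ℓ d l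
    have hlen : ((ℓ ++ [q]).length : ℝ) = ℓ.length + 1 := by simp
    rw [hrun, hlen, List.map_append, List.sum_append]
    obtain ⟨a, i', j⟩ := q
    simp only at hq hae
    by_cases hi : i' = i
    · subst hi
      have hv : (pairMove k (a, i', j) e i').2.2
          = (e i').2.2 + toTorus (a d • k ((e i').2.2 - (e j).2.2)) := by
        simp [pairMove, hae]
      have hmv : ‖toTorus (a d • k ((e i').2.2 - (e j).2.2))‖ ≤ σ * K := by
        refine (norm_toTorus_le _).trans ?_
        rw [norm_smul]
        exact mul_le_mul (hq.2 d) (hk _) (norm_nonneg _) hσ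
      rw [hv]
      constructor
      · calc ‖(e i').2.2 + toTorus (a d • k ((e i').2.2 - (e j).2.2)) - (d i').2.2‖
            = ‖((e i').2.2 - (d i').2.2) + toTorus (a d • k ((e i').2.2 - (e j).2.2))‖ := by
              congr 1; abel
          _ ≤ ℓ.length * (σ * K) + σ * K := (norm_add_le _ _).trans (add_le_add (ih i').1 hmv)
          _ = _ := by ring
      · simp only [List.map_cons, List.map_nil, List.sum_singleton, if_true]
        set S := (ℓ.map fun q => if q.2.1 = i' then q.1 d • k ((d i').2.2 - (d q.2.2).2.2) else 0).sum
        have hdiff : ‖toTorus (a d • k ((e i').2.2 - (e j).2.2))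
            - toTorus (a d • k ((d i').2.2 - (d j).2.2))‖ ≤ σ * (K * (2 * (ℓ.length * (σ * K)))) := by
          rw [← toTorus_sub, ← smul_sub]
          refine (norm_toTorus_le _).trans ?_
          rw [norm_smul]
          refine mul_le_mul (hq.2 d) ((hkL _ _).trans ?_) (norm_nonneg _) hσ
          gcongr
          calc ‖(e i').2.2 - (e j).2.2 - ((d i').2.2 - (d j).2.2)‖
              = ‖((e i').2.2 - (d i').2.2) - ((e j).2.2 - (d j).2.2)‖ := by congr 1; abel
            _ ≤ _ := (norm_sub_le _ _).trans (add_le_add (ih i').1 (ih j).1)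
            _ = _ := by ring
        calc ‖(e i').2.2 + toTorus (a d • k ((e i').2.2 - (e j).2.2)) - (d i').2.2
              - toTorus (S + a d • k ((d i').2.2 - (d j).2.2))‖
            = ‖((e i').2.2 - (d i').2.2 - toTorus S) + (toTorus (a d • k ((e i').2.2 - (e j).2.2))
                - toTorus (a d • k ((d i').2.2 - (d j).2.2)))‖ := by
              rw [toTorus_add]; congr 1; abel
          _ ≤ ℓ.length ^ 2 * (2 * K ^ 2 * σ ^ 2) + σ * (K * (2 * (ℓ.length * (σ * K)))) :=
              (norm_add_le _ _).trans (add_le_add (ih i').2 hdiff)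
          _ ≤ (ℓ.length + 1) ^ 2 * (2 * K ^ 2 * σ ^ 2) := by
              have : 0 ≤ K ^ 2 * σ ^ 2 := by positivity
              have h2 : (0 : ℝ) ≤ ℓ.length := Nat.cast_nonneg _
              nlinarith [mul_nonneg h2 this]
    · have hv : (pairMove k (a, i', j) e i) = e i := by
        simp [pairMove, update_of_ne (Ne.symm hi)]
      rw [hv]
      simp only [List.map_cons, List.map_nil, List.sum_singleton, hi, if_false, add_zero]
      constructor
      · exact (ih i).1.trans (by gcongr; linarith)
      · exact (ih i).2.trans (by gcongr; linarith)

/-! ### Preservation of the law by the flow -/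

theorem intervalIntegrable_of_bounded {E : Type*} [NormedAddCommGroup E] {f : ℝ → E} (hf :
    AEStronglyMeasurable f) (h : ∀ s, ‖f s‖ ≤ C) (a b : ℝ) : IntervalIntegrable f volume a b := by
  rw [intervalIntegrable_iff]
  exact Measure.integrableOn_of_bounded (M := C) (by simp [uIoc]) hf (.of_forall h)

section PairFlow

variable {ι : Type*} {A : Finset ι} {c : ι → ι → ℝ → ℝ} (hcm : ∀ i j, Measurable (c i j))
  (hc : ∀ i j s, |c i j s| ≤ 1) {k : Torus → ℝ²} (hkc : Continuous k) {K : ℝ} (hK : 0 ≤ K)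
  (hk : ∀ z, ‖k z‖ ≤ K) (hkL : ∀ z w, ‖k z - k w‖ ≤ K * ‖z - w‖) {x₀ : ι → Torus}
  {y : ℝ → ι → ℝ²} (hym : ∀ i, Measurable fun t => y t i)
  (hy : ∀ t, 0 ≤ t → ∀ i, y t i
    = ∫ s in 0..t, pairDrift A c k (fun i => x₀ i + toTorus (y s i)) i s)

include hcm hc hkc hk hym in
theorem intervalIntegrable_pair (i j : ι) (a b : ℝ) : IntervalIntegrable (fun s => c i j s • k (x₀ i
    + toTorus (y s i) - (x₀ j + toTorus (y s j)))) volume a b := by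
  have hx i : Measurable fun s => x₀ i + toTorus (y s i) :=
    measurable_const.add (continuous_toTorus.measurable.comp (hym i))
  refine intervalIntegrable_of_bounded
    ((hcm i j).smul (hkc.measurable.comp ((hx i).sub (hx j)))).aestronglyMeasurable (C := K)
    (fun s => ?_) a b
  change ‖c i j s • k (x₀ i + toTorus (y s i) - (x₀ j + toTorus (y s j)))‖ ≤ K
  rw [norm_smul]
  exact (mul_le_mul (hc i j s) (hk _) (norm_nonneg _) zero_le_one).trans (by rw [one_mul])

include hcm hc hkc hk hym in
theorem intervalIntegrable_pairDrift (i : ι) (a b : ℝ) : IntervalIntegrable (fun s => pairDrift A c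
    k (fun i => x₀ i + toTorus (y s i)) i s) volume a b := by
  have := IntervalIntegrable.sum A fun j _ =>
    intervalIntegrable_pair hcm hc hkc hk (x₀ := x₀) hym i j a b
  simpa [pairDrift, Finset.sum_fn] using this

include hcm hc hkc hk hym hy in
theorem pair_flow_sub {t' : ℝ} (ht : 0 ≤ t) (htt' : t ≤ t') (i : ι) :
    y t' i - y t i = ∫ s in t..t', pairDrift A c k (fun i => x₀ i + toTorus (y s i)) i s := by
  have hi := intervalIntegrable_pairDrift (A := A) hcm hc hkc hk (x₀ := x₀) hym i
  rw [hy t ht, hy t' (ht.trans htt'), integral_interval_sub_left (hi 0 t') (hi 0 t)]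

include hcm hc hkc hk hym hy in
theorem norm_pair_flow_sub_le {t' : ℝ} (ht : 0 ≤ t) (htt' : t ≤ t') (i : ι) :
    ‖y t' i - y t i‖ ≤ A.card * K * (t' - t) := by
  rw [pair_flow_sub hcm hc hkc hk hym hy ht htt']
  have := intervalIntegral.norm_integral_le_of_norm_le_const (a := t) (b := t')
    (C := A.card * K) (f := fun s => pairDrift A c k (fun i => x₀ i + toTorus (y s i)) i s)
    fun s _ => norm_pairDrift_le hc hk _ i s
  rwa [abs_of_nonneg (by linarith)] at this

include hcm hc hkc hk hym hy hK hkL in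
-- Over one step the particles move by `O(h)`, so freezing the kernel at the initial positions costs
-- `O(h²)`, the same order as the error of successive moves.
theorem norm_pair_flow_step_le {t' : ℝ} (ht : 0 ≤ t) (htt' : t ≤ t') (i : ι) : ‖y t' i - y t i - ∑ j
    ∈ A, (∫ s in t..t', c i j s) • k (x₀ i + toTorus (y t i) - (x₀ j + toTorus (y t j)))‖ ≤ 2 *
    A.card ^ 2 * K ^ 2 * (t' - t) ^ 2 := by
  rw [pair_flow_sub hcm hc hkc hk hym hy ht htt']
  simp only [pairDrift]
  rw [intervalIntegral.integral_finsetSum fun j _ =>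
    intervalIntegrable_pair hcm hc hkc hk (x₀ := x₀) hym i j t t', ← sum_sub_distrib]
  have h0 : 0 ≤ t' - t := by linarith
  refine (norm_sum_le_of_le A (f := fun j => _) (n := fun _ => 2 * A.card * K ^ 2 * (t' - t) ^ 2)
    fun j _ => ?_).trans (by rw [sum_const, nsmul_eq_mul]; apply le_of_eq; ring)
  have hci : IntervalIntegrable (c i j) volume t t' :=
    intervalIntegrable_of_bounded (hcm i j).aestronglyMeasurable (hc i j) t t'
  rw [← intervalIntegral.integral_smul_const, ← intervalIntegral.integral_sub
    (intervalIntegrable_pair hcm hc hkc hk (x₀ := x₀) hym i j t t')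
    ⟨hci.1.smul_const _, hci.2.smul_const _⟩]
  have := intervalIntegral.norm_integral_le_of_norm_le_const (a := t) (b := t')
    (C := K * (2 * (A.card * K * (t' - t))))
    (f := fun s => c i j s • k (x₀ i + toTorus (y s i) - (x₀ j + toTorus (y s j)))
      - c i j s • k (x₀ i + toTorus (y t i) - (x₀ j + toTorus (y t j)))) fun s hs => by
    rw [uIoc_of_le htt'] at hs
    rw [← smul_sub, norm_smul]
    refine (mul_le_of_le_one_left (norm_nonneg _) (hc i j s)).trans ((hkL _ _).trans ?_)
    gcongr
    have e : x₀ i + toTorus (y s i) - (x₀ j + toTorus (y s j))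
        - (x₀ i + toTorus (y t i) - (x₀ j + toTorus (y t j)))
        = toTorus (y s i - y t i) - toTorus (y s j - y t j) := by
      rw [toTorus_sub, toTorus_sub]; abel
    rw [e, two_mul]
    have hb l : ‖toTorus (y s l - y t l)‖ ≤ A.card * K * (t' - t) :=
      ((norm_toTorus_le _).trans (norm_pair_flow_sub_le hcm hc hkc hk hym hy ht hs.1.le l)).trans
        (by gcongr; exact hs.2)
    exact (norm_sub_le _ _).trans (add_le_add (hb i) (hb j))
  rw [abs_of_nonneg h0] at this
  exact this.trans (le_of_eq (by ring))

end PairFlow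

/-- The sample with its positions replaced. -/
def setPos (d : Sample) (x : Idx → Torus) : Sample := fun i => ((d i).1, (d i).2.1, x i)

theorem continuous_setPos : Continuous fun p : Sample × (Idx → Torus) => setPos p.1 p.2 :=
  continuous_pi fun i => by unfold setPos; fun_prop

/-- The moves of one time step of the splitting scheme. -/
def stepMoves (A : Finset Idx) (c : Sample → Idx → Idx → ℝ → ℝ) (t t' : ℝ) :
    List ((Sample → ℝ) × Idx × Idx) :=
  A.offDiag.toList.map fun p => (fun d => ∫ s in t..t', c d p.1 p.2 s, p)

/-- The splitting scheme with step `h`. -/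
def scheme (A : Finset Idx) (c : Sample → Idx → Idx → ℝ → ℝ) (k : Torus → ℝ²)
    (h : ℝ) : ℕ → Sample → Sample
  | 0, d => d
  | m + 1, d => runMoves k (stepMoves A c (m * h) ((m + 1) * h)) (scheme A c k h m d)

theorem scheme_fst (A : Finset Idx) (c : Sample → Idx → Idx → ℝ → ℝ)
    (k : Torus → ℝ²) (h : ℝ) (m : ℕ) (d : Sample) (i : Idx) :
    (scheme A c k h m d i).1 = (d i).1 ∧ (scheme A c k h m d i).2.1 = (d i).2.1 := by
  induction m with
  | zero => simp [scheme]
  | succ m ih =>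
    have := runMoves_fst k (stepMoves A c (m * h) ((m + 1) * h)) (scheme A c k h m d) i
    rw [ih.1, ih.2] at this
    exact this

section Flow

variable {A : Finset Idx} {c : Sample → Idx → Idx → ℝ → ℝ}
  (hcm : ∀ i j, Measurable fun p : Sample × ℝ => c p.1 i j p.2)
  (hc : ∀ d i j s, |c d i j s| ≤ 1) (hcp : PosInvariant c) (hcA : ∀ d, ∀ i ∉ A, ∀ j s, c d i j s = 0)
  (hcd : ∀ d i s, c d i i s = 0)

include hcm hc hcp in
theorem stepMoves_spec {t' : ℝ} (htt' : t ≤ t') : ∀ q ∈ stepMoves A c t t',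
    Measurable q.1 ∧ PosInvariant q.1 ∧ (∀ d, |q.1 d| ≤ t' - t) ∧ q.2.1 ≠ q.2.2 := by
  intro q hq
  obtain ⟨⟨i, j⟩, hp, rfl⟩ := List.mem_map.1 hq
  have hp' := Finset.mem_offDiag.1 (Finset.mem_toList.1 hp)
  refine ⟨?_, fun d d' h => ?_, fun d => ?_, hp'.2.2⟩
  · have := ((hcm i j).stronglyMeasurable).integral_prod_right' (ν := volume.restrict (Ioc t t'))
    simp only [integral_of_le htt']
    exact this.measurable
  · simp only [hcp d d' h]
  · have := intervalIntegral.norm_integral_le_of_norm_le_const (a := t) (b := t') (C := 1)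
      (f := fun s => c d i j s) fun s _ => hc d i j s
    rwa [one_mul, abs_of_nonneg (by linarith)] at this

include hcA hcd in
theorem sum_stepMoves (t t' : ℝ) (d : Sample) (i : Idx) (v : Idx → ℝ²) :
    ((stepMoves A c t t').map fun q => if q.2.1 = i then q.1 d • v q.2.2 else 0).sum
      = ∑ j ∈ A, (∫ s in t..t', c d i j s) • v j := by
  rw [stepMoves, List.map_map, Finset.sum_map_toList]
  have h1 : ∀ p ∈ A ×ˢ A, p ∉ A.offDiag → ((fun q : (Sample → ℝ) × Idx × Idx =>
      if q.2.1 = i then q.1 d • v q.2.2 else 0) ∘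
      fun p : Idx × Idx => (fun d => ∫ s in t..t', c d p.1 p.2 s, p)) p = 0 := by
    rintro ⟨a, b⟩ hp hq
    have : a = b := by
      by_contra hab
      exact hq (Finset.mem_offDiag.2 ⟨(Finset.mem_product.1 hp).1, (Finset.mem_product.1 hp).2, hab⟩)
    subst this
    simp [hcd]
  rw [sum_subset (fun p hp => by
    have := Finset.mem_offDiag.1 hp
    exact Finset.mem_product.2 ⟨this.1, this.2.1⟩) h1, sum_product]
  simp only [comp_def]
  by_cases hi : i ∈ A
  · rw [Finset.sum_eq_single i]
    · simp
    · intro b _ hb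
      simp [hb]
    · exact fun h => absurd hi h
  · rw [sum_eq_zero, sum_eq_zero]
    · intro j _; simp [hcA d i hi]
    · intro a ha
      have : a ≠ i := by rintro rfl; exact hi ha
      simp [this]

variable {g : Torus → ℝ} (hg : ContDiff ℝ 2 lift g)
  {Y : Sample → ℝ → Idx → ℝ²} (hYm : ∀ i, Measurable fun p : Sample × ℝ => Y p.1 p.2 i)
  (hY : ∀ d t, 0 ≤ t → ∀ i, Y d t i
    = ∫ s in 0..t, pairDrift A (c d) (skewGrad g) (fun i => (d i).2.2 + toTorus (Y d s i)) i s)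

include hcm hc hcp hcA hcd hYm hY in
-- A discrete Gronwall argument: each step adds a local error `O(h²)` and amplifies the previous
-- error by at most `1 + 2 * A.card * K * h`. Over a fixed time the total error is `O(h)`.
theorem norm_scheme_sub_le {K : ℝ} (hK : 0 ≤ K) (hk : ∀ z, ‖skewGrad g z‖ ≤ K) (hkL : ∀ z w,
    ‖skewGrad g z - skewGrad g w‖ ≤ K * ‖z - w‖) (hkc : Continuous (skewGrad g)) {h : ℝ} (hh : 0 ≤
    h) (d : Sample) (m : ℕ) (i : Idx) : ‖(scheme A c (skewGrad g) h m d i).2.2 - ((d i).2.2 +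
    toTorus (Y d (m * h) i))‖ ≤ (2 * K ^ 2 * (A.offDiag.card ^ 2 + A.card ^ 2)) * h ^ 2 * m * (1 + 2
    * A.card * K * h) ^ m := by
  set β := 2 * K ^ 2 * ((A.offDiag.card : ℝ) ^ 2 + A.card ^ 2)
  set α := 2 * A.card * K
  have hβ : 0 ≤ β := by positivity
  have hα : 0 ≤ α := by positivity
  have hcmd i j : Measurable (c d i j) :=
    (hcm i j).comp (by fun_prop : Measurable fun s : ℝ => (d, s))
  have hYmd i : Measurable fun t => Y d t i :=
    (hYm i).comp (by fun_prop : Measurable fun s : ℝ => (d, s))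
  induction m generalizing i with
  | zero => simp [scheme, hY d 0 le_rfl, toTorus_zero]
  | succ m ih =>
    set e := scheme A c (skewGrad g) h m d with he
    set x : ℝ → Idx → Torus := fun t i => (d i).2.2 + toTorus (Y d t i) with hx
    set E := β * h ^ 2 * m * (1 + α * h) ^ m with hE
    have hE0 : 0 ≤ E := by positivity
    have hmh : (m : ℝ) * h ≤ (m + 1) * h := by nlinarith
    have hstep : ((m : ℝ) + 1) * h - m * h = h := by ring
    have hspec := stepMoves_spec (A := A) hcm hc hcp hmh
    have h1 := (norm_runMoves_sub_le hK hk hkL hh (ℓ := stepMoves A c (m * h) ((m + 1) * h))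
      (fun q hq => ⟨(hspec q hq).2.1, fun d => by
        have := (hspec q hq).2.2.1 d; rwa [hstep] at this⟩) e i).2
    rw [sum_stepMoves hcA hcd (m * h) ((m + 1) * h) e i
      fun j => skewGrad g ((e i).2.2 - (e j).2.2)] at h1
    have hce : c e = c d := hcp _ _ fun l => scheme_fst A c (skewGrad g) h m d l
    rw [hce] at h1
    have hlen : (stepMoves A c (m * h) ((m + 1) * h)).length = A.offDiag.card := by
      simp [stepMoves]
    rw [hlen] at h1
    have h2 := norm_pair_flow_step_le hcmd (hc d) hkc hK hk hkL (x₀ := start d) hYmd (hY d)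
      (by positivity : (0 : ℝ) ≤ m * h) hmh i
    rw [hstep] at h2
    set Se := ∑ j ∈ A, (∫ s in (m * h)..((m + 1) * h), c d i j s) •
      skewGrad g ((e i).2.2 - (e j).2.2)
    set Sx := ∑ j ∈ A, (∫ s in (m * h)..((m + 1) * h), c d i j s) •
      skewGrad g (x (m * h) i - x (m * h) j)
    have h3 : ‖Se - Sx‖ ≤ A.card * (h * (K * (2 * E))) := by
      simp only [Se, Sx]
      rw [← sum_sub_distrib]
      refine (norm_sum_le_of_le A (f := fun j => _) (n := fun _ => h * (K * (2 * E)))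
        fun j _ => ?_).trans (by rw [sum_const, nsmul_eq_mul])
      rw [← smul_sub, norm_smul]
      have hci := intervalIntegral.norm_integral_le_of_norm_le_const (a := m * h)
        (b := (m + 1) * h) (C := 1) (f := fun s => c d i j s) fun s _ => hc d i j s
      rw [one_mul, hstep, abs_of_nonneg hh] at hci
      refine mul_le_mul hci ((hkL _ _).trans ?_) (norm_nonneg _) hh
      gcongr
      calc ‖(e i).2.2 - (e j).2.2 - (x (m * h) i - x (m * h) j)‖
          = ‖((e i).2.2 - x (m * h) i) - ((e j).2.2 - x (m * h) j)‖ := by congr 1; abel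
        _ ≤ E + E := (norm_sub_le _ _).trans (add_le_add (ih i) (ih j))
        _ = 2 * E := by ring
    set R := runMoves (skewGrad g) (stepMoves A c (m * h) ((m + 1) * h)) e
    have hpush : (((m + 1 : ℕ) : ℝ)) = (m : ℝ) + 1 := by push_cast; ring
    change ‖(R i).2.2 - ((d i).2.2 + toTorus (Y d ((m + 1 : ℕ) * h) i))‖ ≤ _
    rw [hpush]
    calc ‖(R i).2.2 - ((d i).2.2 + toTorus (Y d ((m + 1) * h) i))‖
        = ‖(((R i).2.2 - (e i).2.2 - toTorus Se) + ((e i).2.2 - x (m * h) i)) +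
          (toTorus (Se - Sx) - toTorus (Y d ((m + 1) * h) i - Y d (m * h) i - Sx))‖ := by
          simp only [toTorus_sub, hx]; congr 1; abel
      _ ≤ (A.offDiag.card ^ 2 * (2 * K ^ 2 * h ^ 2) + E) +
          (A.card * (h * (K * (2 * E))) + 2 * A.card ^ 2 * K ^ 2 * h ^ 2) := by
          refine (norm_add_le _ _).trans (add_le_add ((norm_add_le _ _).trans
            (add_le_add h1 (ih i))) ((norm_sub_le _ _).trans (add_le_add ?_ ?_)))
          · exact (norm_toTorus_le _).trans h3
          · exact (norm_toTorus_le _).trans h2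
      _ = (1 + α * h) * E + β * h ^ 2 := by simp only [α, β]; ring
      _ ≤ (1 + α * h) * E + β * h ^ 2 * (1 + α * h) ^ (m + 1) := by
          refine add_le_add le_rfl (le_mul_of_one_le_right (by positivity) (one_le_pow₀ ?_))
          linarith [mul_nonneg hα hh]
      _ = β * h ^ 2 * (m + 1) * (1 + α * h) ^ (m + 1) := by rw [hE]; ring

include hcm hc hcp in
theorem measurable_scheme (hk : Measurable k) {h : ℝ} (hh : 0 ≤ h) (m : ℕ) :
    Measurable (scheme A c k h m) := by
  induction m with
  | zero => exact measurable_id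
  | succ m ih =>
    exact (measurable_runMoves hk fun q hq => (stepMoves_spec hcm hc hcp
      (by nlinarith : (m : ℝ) * h ≤ (m + 1) * h) q hq).1).comp ih

include hcm hc hcp in
theorem lintegral_scheme_le (hk : Measurable k) {σ₀ h : ℝ} (hh : 0 ≤ h) (hσ : h ≤ σ₀) (hC : 0 ≤ C)
    (hpair : ∀ s : ℝ, |s| ≤ σ₀ → ∀ w : Torus, ∀ f : Torus → ℝ≥0∞, Measurable f → ∫⁻ z, f (z +
    toTorus (s • k (z - w))) ≤ ofReal (1 + C * s ^ 2) * ∫⁻ z, f z) (m : ℕ) (hf : Measurable f) : ∫⁻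
    d, f (scheme A c k h m d) ∂sampleLaw r ≤ ofReal (1 + C * h ^ 2) ^ (A.offDiag.card * m) * ∫⁻ d, f
    d ∂sampleLaw r := by
  induction m generalizing f with
  | zero => simp [scheme]
  | succ m ih =>
    have hmh : (m : ℝ) * h ≤ (m + 1) * h := by nlinarith
    have hspec := stepMoves_spec (A := A) hcm hc hcp hmh
    rw [show ((m : ℝ) + 1) * h - m * h = h by ring] at hspec
    have hlen : (stepMoves A c (m * h) ((m + 1) * h)).length = A.offDiag.card := by
      simp [stepMoves]
    calc ∫⁻ d, f (scheme A c k h (m + 1) d) ∂sampleLaw r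
        ≤ ofReal (1 + C * h ^ 2) ^ (A.offDiag.card * m) *
          ∫⁻ d, f (runMoves k (stepMoves A c (m * h) ((m + 1) * h)) d) ∂sampleLaw r :=
          ih (hf.comp (measurable_runMoves hk fun q hq => (hspec q hq).1))
      _ ≤ ofReal (1 + C * h ^ 2) ^ (A.offDiag.card * m) *
          (ofReal (1 + C * h ^ 2) ^ A.offDiag.card * ∫⁻ d, f d ∂sampleLaw r) := by
          gcongr
          have := lintegral_runMoves_le r hk hσ hC hpair hspec hf
          rwa [hlen] at this
      _ = _ := by rw [← mul_assoc, ← pow_add, mul_add, mul_one]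

include hYm in
theorem measurable_setPos_flow (t : ℝ) :
    Measurable fun d => setPos d fun i => (d i).2.2 + toTorus (Y d t i) := by
  refine measurable_pi_lambda _ fun i => ?_
  have h : Measurable fun d => Y d t i := (hYm i).comp (by fun_prop : Measurable fun d => (d, t))
  exact (by fun_prop : Measurable fun d : Sample => (d i).1).prodMk
    ((by fun_prop : Measurable fun d : Sample => (d i).2.1).prodMk
      ((by fun_prop : Measurable fun d : Sample => (d i).2.2).add
        (continuous_toTorus.measurable.comp h)))

include hcm hc hcp hcA hcd hg hYm hY in
-- The scheme converges pointwise to the flow, and `m + 1` steps of length `t / (m + 1)` multiply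
-- integrals by at most the exponential of a constant times the step length, which tends to `1`.
theorem lintegral_flow_continuous_le (ht : 0 ≤ t) {f : Sample → ℝ≥0} (hf : Continuous f) {b : ℝ≥0}
    (hb : ∀ d, f d ≤ b) : ∫⁻ d, f (setPos d fun i => (d i).2.2 + toTorus (Y d t i)) ∂sampleLaw r ≤
    ∫⁻ d, f d ∂sampleLaw r := by
  obtain ⟨K, hK, hk, hkL⟩ := exists_lipschitz_skewGrad hg
  obtain ⟨C, hC, σ₀, hσ₀, hpair⟩ := exists_lintegral_pair_le hg
  have hkc : Continuous (skewGrad g) := continuous_of_comp_toTorus (contDiff_skewGrad hg).continuous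
  set h : ℕ → ℝ := fun m => t / (m + 1) with hh
  have hh0 m : 0 ≤ h m := by positivity
  have hhm (m : ℕ) : ((m + 1 : ℕ) : ℝ) * h m = t := by
    simp only [hh]; push_cast; field_simp
  have hlim0 : Tendsto h atTop (𝓝 0) := by
    have := (tendsto_one_div_add_atTop_nhds_zero_nat (𝕜 := ℝ)).const_mul t
    simpa [hh, div_eq_mul_inv] using this
  have hconv : ∀ d, Tendsto (fun m => scheme A c (skewGrad g) (h m) (m + 1) d) atTop
      (𝓝 (setPos d fun i => (d i).2.2 + toTorus (Y d t i))) := by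
    intro d
    rw [tendsto_pi_nhds]
    intro i
    have e m : scheme A c (skewGrad g) (h m) (m + 1) d i
        = ((d i).1, (d i).2.1, (scheme A c (skewGrad g) (h m) (m + 1) d i).2.2) := by
      have := scheme_fst A c (skewGrad g) (h m) (m + 1) d i
      rw [← this.1, ← this.2]
    refine Tendsto.congr (fun m => (e m).symm) ?_
    clear e
    refine tendsto_const_nhds.prodMk_nhds (tendsto_const_nhds.prodMk_nhds ?_)
    rw [tendsto_iff_norm_sub_tendsto_zero]
    have hb : ∀ m, ‖(scheme A c (skewGrad g) (h m) (m + 1) d i).2.2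
        - ((d i).2.2 + toTorus (Y d t i))‖
        ≤ (2 * K ^ 2 * (A.offDiag.card ^ 2 + A.card ^ 2)) * t * exp (2 * A.card * K * t) * h m := by
      intro m
      have := norm_scheme_sub_le hcm hc hcp hcA hcd hYm hY hK hk hkL hkc (hh0 m) d (m + 1) i
      rw [hhm] at this
      refine this.trans ?_
      have h1 : (1 + 2 * A.card * K * h m) ^ (m + 1) ≤ exp (2 * A.card * K * t) := by
        calc (1 + 2 * A.card * K * h m) ^ (m + 1) ≤ exp (2 * A.card * K * h m) ^ (m + 1) := by
              refine pow_le_pow_left₀ (by have := hh0 m; positivity) ?_ _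
              rw [add_comm]; exact Real.add_one_le_exp _
          _ = exp (2 * A.card * K * t) := by
              rw [← exp_nat_mul, ← hhm m]; congr 1; ring
      have h2 := hhm m
      calc (2 * K ^ 2 * (A.offDiag.card ^ 2 + A.card ^ 2)) * h m ^ 2 * ((m + 1 : ℕ) : ℝ) *
            (1 + 2 * A.card * K * h m) ^ (m + 1)
          = (2 * K ^ 2 * (A.offDiag.card ^ 2 + A.card ^ 2)) * (((m + 1 : ℕ) : ℝ) * h m) * h m *
            (1 + 2 * A.card * K * h m) ^ (m + 1) := by ring
        _ ≤ (2 * K ^ 2 * (A.offDiag.card ^ 2 + A.card ^ 2)) * t * h m *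
            exp (2 * A.card * K * t) := by
            rw [h2]
            exact mul_le_mul_of_nonneg_left h1 (by have := hh0 m; positivity)
        _ = _ := by ring
    refine squeeze_zero (fun _ => norm_nonneg _) hb ?_
    simpa using hlim0.const_mul ((2 * K ^ 2 * (A.offDiag.card ^ 2 + A.card ^ 2)) * t *
          exp (2 * A.card * K * t))
  have hfm : Measurable fun d => (f d : ℝ≥0∞) := hf.measurable.coe_nnreal_ennreal
  have hL : Tendsto (fun m => ∫⁻ d, f (scheme A c (skewGrad g) (h m) (m + 1) d) ∂sampleLaw r) atTop
      (𝓝 (∫⁻ d, f (setPos d fun i => (d i).2.2 + toTorus (Y d t i)) ∂sampleLaw r)) := by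
    refine tendsto_lintegral_of_dominated_convergence (fun _ => (b : ℝ≥0∞))
      (fun m => hfm.comp (measurable_scheme hcm hc hcp hkc.measurable (hh0 m) (m + 1)))
      (fun m => .of_forall fun d => ?_) (by simp) (.of_forall fun d => ?_)
    · exact ENNReal.coe_le_coe.2 (hb _)
    · exact ENNReal.tendsto_coe.2 ((hf.tendsto _).comp (hconv d))
  have hR : Tendsto (fun m => ofReal (exp (C * A.offDiag.card * t * h m)) *
      ∫⁻ d, f d ∂sampleLaw r) atTop (𝓝 (∫⁻ d, f d ∂sampleLaw r)) := by
    have h1 : Tendsto (fun m => exp (C * A.offDiag.card * t * h m)) atTop (𝓝 1) := by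
      have := (hlim0.const_mul (C * A.offDiag.card * t)).rexp
      simpa using this
    have h2 := ENNReal.Tendsto.mul_const (tendsto_ofReal h1)
      (b := ∫⁻ d, f d ∂sampleLaw r) (Or.inl (by simp))
    simpa using h2
  refine le_of_tendsto_of_tendsto hL hR ?_
  filter_upwards [hlim0.eventually (ge_mem_nhds hσ₀)] with m hm
  refine (lintegral_scheme_le r hcm hc hcp hkc.measurable (hh0 m) hm hC hpair (m + 1) hfm).trans ?_
  gcongr
  rw [← ofReal_pow (by positivity)]
  refine ofReal_le_ofReal ?_
  calc (1 + C * h m ^ 2) ^ (A.offDiag.card * (m + 1))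
      ≤ exp (C * h m ^ 2) ^ (A.offDiag.card * (m + 1)) := by
        gcongr; rw [add_comm]; exact Real.add_one_le_exp _
    _ = exp (C * A.offDiag.card * t * h m) := by
        rw [← exp_nat_mul, ← hhm m]; congr 1; push_cast; ring

include hcm hc hcp hcA hcd hg hYm hY in
/-- The flow of a divergence free pair interaction preserves the law of the samples. -/
theorem lintegral_flow (ht : 0 ≤ t) (hf : Measurable f) : ∫⁻ d, f (setPos d fun i => (d i).2.2 +
    toTorus (Y d t i)) ∂sampleLaw r = ∫⁻ d, f d ∂sampleLaw r := by
  have hm := measurable_setPos_flow hYm t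
  set Ψ : Sample → Sample := fun d => setPos d fun i => (d i).2.2 + toTorus (Y d t i) with hΨ
  have : IsProbabilityMeasure ((sampleLaw r).map Ψ) := Measure.isProbabilityMeasure_map hm.aemeasurable
  have heq : (sampleLaw r).map Ψ = sampleLaw r := by
    refine ext_of_forall_lintegral_eq_of_IsFiniteMeasure fun f => ?_
    have hfm : Measurable fun d => (f d : ℝ≥0∞) := (f.continuous.measurable).coe_nnreal_ennreal
    rw [lintegral_map hfm hm]
    set b : ℝ≥0 := nndist f 0
    have hb : ∀ d, f d ≤ b := BoundedContinuousFunction.NNReal.upper_bound f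
    refine le_antisymm
      (lintegral_flow_continuous_le r hcm hc hcp hcA hcd hg hYm hY ht f.continuous hb) ?_
    -- Applied to `b - f` the inequality gives the reverse one, since both measures have total mass
    -- one.
    have h1 := lintegral_flow_continuous_le r hcm hc hcp hcA hcd hg hYm hY ht
      (f := fun d => b - f d) (continuous_const.sub f.continuous) (b := b) fun d => tsub_le_self
    have hle d : (f d : ℝ≥0∞) ≤ b := by exact_mod_cast hb d
    simp only [ENNReal.coe_sub] at h1
    have hfΨ : Measurable fun d => (f (setPos d fun i => (d i).2.2 + toTorus (Y d t i)) : ℝ≥0∞) :=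
      hfm.comp hm
    rw [lintegral_sub hfΨ, lintegral_sub hfm] at h1
    · simp only [lintegral_const, measure_univ, mul_one] at h1
      have h2 : ∫⁻ d, (f d : ℝ≥0∞) ∂sampleLaw r ≤ b := (lintegral_mono hle).trans (by simp)
      have h3 : ∫⁻ d, (f (Ψ d) : ℝ≥0∞) ∂sampleLaw r ≤ b :=
        (lintegral_mono fun d => hle (Ψ d)).trans (by simp)
      exact (ENNReal.sub_le_sub_iff_left h2 coe_ne_top).1 h1
    · exact ((lintegral_mono hle).trans_lt (by simp)).ne
    · exact .of_forall hle
    · exact ((lintegral_mono fun d => hle (Ψ d)).trans_lt (by simp)).ne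
    · exact .of_forall fun d => hle (Ψ d)
  rw [← lintegral_map hf hm, heq]

end Flow

/-! ### Arrival times -/

theorem lintegral_expMeasure (r : ℝ) {φ : ℝ → ℝ≥0∞} (hφ : Measurable φ) :
    ∫⁻ x, φ x ∂expMeasure r = ∫⁻ x, exponentialPDF r x * φ x := by
  rw [expMeasure, gammaMeasure]
  exact lintegral_withDensity_eq_lintegral_mul _ (measurable_exponentialPDFReal r).ennreal_ofReal hφ

/-- The density `r * exp (-r * y)` of the first point and the contribution `r * (1 - exp (-r * y))`
of a point placed after a uniform start add up to the constant `r`: the renewal density of a Poisson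
process. -/
theorem lintegral_exp_add_renewal (r : ℝ) (hr : 0 < r) {φ : ℝ → ℝ≥0∞} (hφ : Measurable φ) :
    (∫⁻ x, φ x ∂expMeasure r) + ofReal r * ∫⁻ x in Ici (0 : ℝ), ∫⁻ g, φ (x + g) ∂expMeasure r
      = ofReal r * ∫⁻ x in Ici (0 : ℝ), φ x := by
  have hp : Measurable (exponentialPDF r) := (measurable_exponentialPDFReal r).ennreal_ofReal
  have h1 : ∫⁻ x in Ici (0 : ℝ), ∫⁻ g, φ (x + g) ∂expMeasure r
      = ∫⁻ y, φ y * ∫⁻ g in Iic y, exponentialPDF r g := by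
    have hi x : ∫⁻ g, φ (x + g) ∂expMeasure r = ∫⁻ g, exponentialPDF r g * φ (x + g) :=
      lintegral_expMeasure r (φ := fun g => φ (x + g)) (by fun_prop)
    simp only [hi]
    rw [lintegral_lintegral_swap (by fun_prop)]
    have h2 : ∀ g, ∫⁻ x in Ici (0 : ℝ), exponentialPDF r g * φ (x + g)
        = ∫⁻ y, (Ici g).indicator (fun y => exponentialPDF r g * φ y) y := by
      intro g
      rw [← lintegral_add_right_eq_self (fun y => (Ici g).indicator _ y) g,
        ← lintegral_indicator measurableSet_Ici]
      refine lintegral_congr fun x => ?_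
      by_cases hx : 0 ≤ x
      · rw [indicator_of_mem (mem_Ici.2 hx), indicator_of_mem (mem_Ici.2 (by linarith))]
      · rw [indicator_of_notMem (by simpa using hx), indicator_of_notMem (by simpa using hx)]
    simp only [h2]
    rw [lintegral_lintegral_swap]
    · refine lintegral_congr fun y => ?_
      rw [← lintegral_indicator measurableSet_Iic, ← lintegral_const_mul _
        (hp.indicator measurableSet_Iic)]
      refine lintegral_congr fun g => ?_
      by_cases hx : g ≤ y
      · rw [indicator_of_mem (mem_Ici.2 hx), indicator_of_mem (mem_Iic.2 hx), mul_comm]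
      · rw [indicator_of_notMem (by simpa using hx), indicator_of_notMem (by simpa using hx), mul_zero]
    · have : Measurable fun p : ℝ × ℝ => {p : ℝ × ℝ | p.1 ≤ p.2}.indicator
          (fun p => exponentialPDF r p.1 * φ p.2) p :=
        Measurable.indicator (by fun_prop) (measurableSet_le measurable_fst measurable_snd)
      refine this.aemeasurable.congr (.of_forall fun p => ?_)
      simp [uncurry, indicator]
  have hF : ∀ y, ∫⁻ g in Iic y, exponentialPDF r g
      = ofReal (if 0 ≤ y then 1 - exp (-(r * y)) else 0) :=
    lintegral_exponentialPDF_eq_antiDeriv hr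
  simp only [h1, lintegral_expMeasure r hφ, hF]
  have hm : Measurable fun y => φ y * ofReal (if 0 ≤ y then 1 - exp (-(r * y)) else 0) :=
    hφ.mul (Measurable.ennreal_ofReal (Measurable.ite measurableSet_Ici (by fun_prop)
      measurable_const))
  rw [← lintegral_const_mul _ hm, ← lintegral_add_left (by fun_prop),
    ← lintegral_indicator measurableSet_Ici, ← lintegral_const_mul _ (hφ.indicator measurableSet_Ici)]
  refine lintegral_congr fun y => ?_
  by_cases hy : 0 ≤ y
  · have he : exp (-(r * y)) ≤ 1 := Real.exp_le_one_iff.2 (by nlinarith)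
    rw [exponentialPDF_of_nonneg hy, if_pos hy, indicator_of_mem (mem_Ici.2 hy), mul_left_comm,
      ← ofReal_mul hr.le, mul_comm (φ y), ← add_mul, ← ofReal_add (by positivity)
      (mul_nonneg hr.le (by linarith))]
    congr 2; ring
  · rw [exponentialPDF_of_neg (by linarith), if_neg hy, indicator_of_notMem (by simpa using hy)]
    simp

/-- The expected number of renewals weighted by `φ` is at most `r ∫ φ`. -/
theorem sum_lintegral_gaps_le (r : ℝ) [hr : Fact (0 < r)] {ι : ℕ → Idx} (hι : ι.Injective) (a : ℕ)
    {w : Sample → ℝ≥0∞} (hw : Measurable w) (hwa : ∀ d n y, a ≤ n → w (update d (ι n) y) = w d) (m :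
    ℕ) {φ : ℝ → ℝ≥0∞} (hφ : Measurable φ) : ∑ l ∈ range m, ∫⁻ d, w d * φ (∑ j ∈ Finset.range
    (l + 1), (d (ι (a + j))).1) ∂sampleLaw r ≤ (∫⁻ d, w d ∂sampleLaw r) * (ofReal r * ∫⁻ x in Ici (0
    : ℝ), φ x) := by
  induction m generalizing φ with
  | zero => simp
  | succ m ih =>
    have hPm : Measurable fun x => ∫⁻ g, φ (x + g) ∂expMeasure r :=
      Measurable.lintegral_prod_right' (f := fun p : ℝ × ℝ => φ (p.1 + p.2)) (by fun_prop)
    -- Integrating out the last gap replaces `φ` by its average over one more exponential shift and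
    -- shortens the sum by one gap. The renewal identity then closes the induction.
    have key : ∀ l, ∫⁻ d, w d * φ (∑ j ∈ range (l + 1), (d (ι (a + j))).1) ∂sampleLaw r
        = ∫⁻ d, w d * ∫⁻ g, φ (∑ j ∈ range l, (d (ι (a + j))).1 + g) ∂expMeasure r
          ∂sampleLaw r := by
      intro l
      rw [lintegral_update r (ι (a + l)) (by fun_prop)]
      refine lintegral_congr fun d => ?_
      have : ∀ y, (∑ j ∈ range (l + 1), (update d (ι (a + l)) y (ι (a + j))).1)
          = ∑ j ∈ range l, (d (ι (a + j))).1 + y.1 := by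
        intro y
        rw [sum_range_succ, update_self]
        congr 1
        refine sum_congr rfl fun j hj => ?_
        rw [update_of_ne]
        intro h
        have := hι h
        have := Finset.mem_range.1 hj
        omega
      simp only [this, hwa d (a + l) _ (Nat.le_add_right a l), lintegral_const, measure_univ, mul_one]
      rw [lintegral_const_mul _ (by fun_prop)]
    rw [Finset.sum_range_succ', key 0, ← lintegral_exp_add_renewal r hr.out hφ, mul_add, add_comm]
    refine add_le_add (le_of_eq ?_) ?_
    · simp [lintegral_mul_const _ hw]
    · refine le_trans (le_of_eq (sum_congr rfl fun l _ => key (l + 1))) ?_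
      exact ih hPm

theorem arrival_inl (d : Sample) (n : ℕ) :
    arrival d (inl n) = ∑ m ∈ range (n + 1), (d (inl m)).1 := rfl

theorem arrival_inr (d : Sample) (n : ℕ) :
    arrival d (inr n) = ∑ m ∈ range (n + 1), (d (inr m)).1 := rfl

theorem measurable_arrival (i : Idx) : Measurable fun d => arrival d i := by
  rcases i with n | n
  · simp only [arrival_inl]; fun_prop
  · simp only [arrival_inr]; fun_prop

theorem tsum_lintegral_arrival_le (r : ℝ) [hr : Fact (0 < r)] {ι : ℕ → Idx}
    (hι : ι = inl ∨ ι = inr) {φ : ℝ → ℝ≥0∞} (hφ : Measurable φ) :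
    ∑' n, ∫⁻ d, φ (arrival d (ι n)) ∂sampleLaw r ≤ ofReal r * ∫⁻ x in Ici (0 : ℝ), φ x := by
  have h : ι.Injective ∧ ∀ d n, arrival d (ι n) = ∑ m ∈ range (n + 1), (d (ι m)).1 := by
    rcases hι with rfl | rfl
    · exact ⟨Sum.inl_injective, fun _ _ => rfl⟩
    · exact ⟨Sum.inr_injective, fun _ _ => rfl⟩
  rw [ENNReal.tsum_eq_iSup_nat]
  refine iSup_le fun m => ?_
  simpa [h.2] using sum_lintegral_gaps_le r h.1 0 (w := fun _ => 1) measurable_const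
    (fun _ _ _ _ => rfl) m hφ

/-- The almost sure properties of a sample. -/
structure RegularSample (d : Sample) : Prop where
  gap_pos : ∀ i, 0 < (d i).1
  abs_sign : ∀ i, |(d i).2.1| = 1
  tendsto_inl : Tendsto (fun n => arrival d (inl n)) atTop atTop
  tendsto_inr : Tendsto (fun n => arrival d (inr n)) atTop atTop

theorem ae_sampleLaw_eval {p : ℝ × ℝ × Torus → Prop}
    (hp : ∀ᵐ y ∂markLaw r, p y) : ∀ᵐ d ∂sampleLaw r, ∀ i, p (d i) :=
  ae_all_iff.2 fun i => (measurePreserving_eval_infinitePi (fun _ : Idx => markLaw r)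
    i).quasiMeasurePreserving.ae hp

theorem ae_signLaw : ∀ᵐ a ∂signLaw, |a| = 1 := by
  unfold signLaw
  refine Measure.ae_smul_measure ?_ _
  rw [ae_add_measure_iff, ae_dirac_eq, ae_dirac_eq]
  simp

theorem ae_expMeasure_pos (r : ℝ) : ∀ᵐ g ∂expMeasure r, 0 < g := by
  rw [ae_iff, ← lintegral_indicator_one (by measurability), lintegral_expMeasure r
    (measurable_one.indicator (by measurability)), lintegral_eq_zero_iff (by
      exact ((measurable_exponentialPDFReal r).ennreal_ofReal).mul
        (measurable_one.indicator (by measurability)))]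
  filter_upwards [compl_mem_ae_iff.2 (measure_singleton (0 : ℝ))] with x hx
  rcases lt_or_gt_of_ne (show x ≠ 0 from hx) with h | h
  · simp [exponentialPDF_of_neg h]
  · simp [indicator, h]

/-- The expected number of arrivals below any level is finite, so almost surely only finitely many
of them occur there. -/
theorem ae_tendsto_arrival {ι : ℕ → Idx} (hι : ι = inl ∨ ι = inr) : ∀ᵐ d ∂sampleLaw r, Tendsto (fun
    n => arrival d (ι n)) atTop atTop := by
  have h : ∀ᵐ d ∂sampleLaw r, ∀ b : ℕ, ∀ᶠ n in atTop, d ∉ {d | arrival d (ι n) ≤ b} := by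
    refine ae_all_iff.2 fun b => ae_eventually_notMem (ne_top_of_le_ne_top ?_
      (le_trans (le_of_eq (tsum_congr fun n => ?_)) (tsum_lintegral_arrival_le r hι
        (φ := (Iic (b : ℝ)).indicator 1) (measurable_one.indicator measurableSet_Iic))))
    · refine mul_ne_top ofReal_ne_top ?_
      rw [lintegral_indicator_one measurableSet_Iic, Measure.restrict_apply measurableSet_Iic,
        inter_comm, Ici_inter_Iic, volume_Icc]
      exact ofReal_ne_top
    · exact (lintegral_indicator_one (measurable_arrival (ι n) measurableSet_Iic)).symm
  filter_upwards [h] with d hd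
  refine tendsto_atTop.2 fun b => ?_
  obtain ⟨m, hm⟩ := exists_nat_ge b
  filter_upwards [hd m] with n hn
  exact hm.trans (le_of_lt (not_le.1 hn))

theorem ae_regularSample : ∀ᵐ d ∂sampleLaw r, RegularSample d := by
  have h1 : ∀ᵐ y ∂markLaw r, 0 < y.1 := Measure.quasiMeasurePreserving_fst.ae (ae_expMeasure_pos r)
  have h2 : ∀ᵐ y ∂markLaw r, |y.2.1| = 1 := Measure.quasiMeasurePreserving_snd.ae
    (Measure.quasiMeasurePreserving_fst.ae ae_signLaw)
  filter_upwards [ae_sampleLaw_eval r h1, ae_sampleLaw_eval r h2, ae_tendsto_arrival r (.inl rfl),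
    ae_tendsto_arrival r (.inr rfl)] with d h1 h2 h3 h4 using ⟨h1, h2, h3, h4⟩

theorem ae_arrival_ne (r T : ℝ) [Fact (0 < r)] : ∀ᵐ d ∂sampleLaw r, ∀ n, arrival d (inr n) ≠ T := by
  refine ae_all_iff.2 fun n => ?_
  have h := (le_tsum n).trans (tsum_lintegral_arrival_le r (.inr rfl)
    (φ := ({T} : Set ℝ).indicator 1) (measurable_one.indicator (measurableSet_singleton T)))
  rw [lintegral_indicator_one (measurableSet_singleton T), measure_singleton, mul_zero] at h
  rw [ae_iff, ← lintegral_indicator_one (show MeasurableSet _ by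
    simpa [compl_def] using measurableSet_eq_fun (measurable_arrival (inr n)) measurable_const)]
  refine le_antisymm (le_trans (le_of_eq (lintegral_congr fun d => ?_)) h) zero_le
  by_cases hd : arrival d (inr n) = T <;> simp [indicator, hd]

theorem RegularSample.strictMono_inr (hd : RegularSample d) :
    StrictMono fun n => arrival d (inr n) :=
  strictMono_nat_of_lt_succ fun n => by
    rw [arrival_inr, arrival_inr, sum_range_succ _ (n + 1)]
    linarith [hd.gap_pos (inr (n + 1))]

theorem RegularSample.arrival_pos (hd : RegularSample d) (i : Idx) : 0 < arrival d i := by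
  rcases i with n | n
  · exact sum_pos (fun m _ => hd.gap_pos _) ⟨0, by simp⟩
  · exact sum_pos (fun m _ => hd.gap_pos _) ⟨0, by simp⟩

/-! ### Absence of collisions -/

/-- The velocity `w` is only bounded and measurable, so the curve is merely Lipschitz; `g` along it
is absolutely continuous, which suffices for the fundamental theorem of calculus. The derivative of
`g` in direction `w` is the cross product of its skew gradient with `w`. -/
theorem enorm_comp_toTorus_sub_le (hg : ContDiff ℝ 2 lift g) (u₀ : ℝ²) {w : ℝ → ℝ²}
    (hw : Measurable w) {B : ℝ} (hB : ∀ s, ‖w s‖ ≤ B) (ht : 0 ≤ t) : ‖g (toTorus (u₀ + ∫ s in (0 :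
    ℝ)..t, w s)) - g (toTorus u₀)‖ₑ ≤ ∫⁻ s in Icc 0 t, ‖skewGrad g (toTorus (u₀ + ∫ s' in (0 :
    ℝ)..s, w s')) 0 * w s 1 - skewGrad g (toTorus (u₀ + ∫ s' in 0..s, w s')) 1 * w s 0‖ₑ := by
  obtain ⟨C, hC0, hC, -⟩ := exists_lipschitz_skewGrad hg
  have hB0 : 0 ≤ B := (norm_nonneg _).trans (hB 0)
  have hd : Differentiable ℝ lift g := hg.differentiable (by norm_num)
  have hcross (u v : ℝ²) : |u 0 * v 1 - u 1 * v 0| ≤ 2 * ‖u‖ * ‖v‖ := by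
    have h a b : |u a * v b| ≤ ‖u‖ * ‖v‖ := by
      rw [abs_mul]
      exact mul_le_mul (norm_le_pi_norm u a) (norm_le_pi_norm v b) (abs_nonneg _) (norm_nonneg _)
    linarith [abs_sub (u 0 * v 1) (u 1 * v 0), h 0 1, h 1 0]
  have hF : LipschitzWith (2 * C).toNNReal lift g :=
    lipschitzWith_of_nnnorm_fderiv_le hd fun u => by
      rw [← NNReal.coe_le_coe, Real.coe_toNNReal _ (by positivity), coe_nnnorm]
      refine opNorm_le_bound _ (by positivity) fun v => ?_
      rw [fderiv_comp_toTorus (hd u)]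
      exact (hcross _ _).trans (by gcongr; exact hC _)
  have hi := intervalIntegrable_of_bounded hw.aestronglyMeasurable hB
  have hU : LipschitzWith B.toNNReal fun t => u₀ + ∫ s in 0..t, w s :=
    LipschitzWith.of_dist_le_mul fun t t' => by
      rw [dist_add_left, dist_comm, dist_eq_norm, integral_interval_sub_left (hi _ _)
        (hi _ _), Real.coe_toNNReal _ hB0, dist_eq, abs_sub_comm]
      exact intervalIntegral.norm_integral_le_of_norm_le_const fun s _ => hB s
  have hac := ((hF.comp hU).lipschitzOnWith (s := uIcc 0 t)).absolutelyContinuousOnInterval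
  have h0 := hac.integral_deriv_eq_sub
  simp only [comp_apply, integral_same, add_zero] at h0
  rw [← h0, integral_of_le ht]
  refine (enorm_integral_le_lintegral_enorm _).trans ?_
  rw [restrict_Ioc_eq_restrict_Icc]
  refine le_of_eq (setLIntegral_congr_fun_ae measurableSet_Icc ?_)
  filter_upwards [(hi 0 t).ae_hasDerivAt_integral] with s hs hst
  rw [← uIcc_of_le ht] at hst
  have h1 := (hs hst 0 left_mem_uIcc).const_add u₀
  have h2 := (hd (u₀ + ∫ s' in 0..s, w s')).hasFDerivAt.comp_hasDerivAt s h1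
  rw [fderiv_comp_toTorus (hd _)] at h2
  rw [← h2.deriv]

/-- The bound for the rate of change of the Green function of a pair of vortices. -/
def pairRate (A : Finset Idx) (i j : Idx) (x : Idx → Torus) : ℝ≥0∞ :=
  2 * ∑ l ∈ (A.erase i).erase j,
    ‖biotSavart (x i - x j)‖ₑ * (‖biotSavart (x i - x l)‖ₑ + ‖biotSavart (x j - x l)‖ₑ)

theorem measurable_pairRate {α : Type*} [MeasurableSpace α] (A : Finset Idx) (i j : Idx)
    {x : α → Idx → Torus} (hx : ∀ i, Measurable fun p => x p i) :
    Measurable fun p => pairRate A i j (x p) := by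
  unfold pairRate
  have h (i j : Idx) : Measurable fun p => ‖biotSavart (x p i - x p j)‖ₑ :=
      (measurable_biotSavart.comp ((hx i).sub (hx j))).enorm
  refine measurable_const.mul (Finset.measurable_fun_sum _ fun l _ => ?_)
  exact (h i j).mul ((h i l).add (h j l))

/-- The mutual interaction of `i` and `j` is parallel to `K(x_i - x_j)` and drops out of the cross
product, even though the two coefficients differ. So the square of the kernel, which is not
integrable, never appears: every remaining product involves a third vortex. -/
theorem enorm_cross_pairDrift_le {A : Finset Idx} {c : Idx → Idx → ℝ → ℝ} (hc : ∀ i j s, |c i j s| ≤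
    1) (L : ℝ) (x : Idx → Torus) (hi : i ∈ A) (hj : j ∈ A) (hij : i ≠ j) (s : ℝ) : ‖regKernel L (x i
    - x j) 0 * (pairDrift A c (regKernel L) x i s - pairDrift A c (regKernel L) x j s) 1 - regKernel
    L (x i - x j) 1 * (pairDrift A c (regKernel L) x i s - pairDrift A c (regKernel L) x j s) 0‖ₑ ≤
    pairRate A i j x := by
  set k := regKernel L
  have e : pairDrift A c k x i s - pairDrift A c k x j s = (c i j s + c j i s) • k (x i - x j)
      + ∑ l ∈ (A.erase i).erase j, (c i l s • k (x i - x l) - c j l s • k (x j - x l)) := by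
    have hj' : j ∈ A.erase i := Finset.mem_erase.2 ⟨hij.symm, hj⟩
    have h0 : k (x i - x i) = 0 := by rw [sub_self]; exact regKernel_zero L
    have h0' : k (x j - x j) = 0 := by rw [sub_self]; exact regKernel_zero L
    have hn : k (x j - x i) = -k (x i - x j) := by rw [← neg_sub]; exact regKernel_neg L _
    simp only [pairDrift]
    rw [← sum_sub_distrib, ← Finset.add_sum_erase A _ hi, ← Finset.add_sum_erase _ _ hj', h0, h0',
      hn]
    module
  set S := ∑ l ∈ (A.erase i).erase j, (c i l s • k (x i - x l) - c j l s • k (x j - x l))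
  have hk : ‖k (x i - x j)‖ ≤ ‖biotSavart (x i - x j)‖ := norm_regKernel_le L _
  have hS : ‖S‖ ≤ ∑ l ∈ (A.erase i).erase j, (‖biotSavart (x i - x l)‖ + ‖biotSavart (x j - x l)‖) := by
    refine norm_sum_le_of_le _ fun l _ => (norm_sub_le _ _).trans ?_
    have h i : ‖c i l s • k (x i - x l)‖ ≤ ‖biotSavart (x i - x l)‖ := by
      rw [norm_smul]
      exact (mul_le_mul (hc _ _ _) (norm_regKernel_le L _) (norm_nonneg _) zero_le_one).trans_eq
        (one_mul _)
    exact add_le_add (h i) (h j)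
  have h1 : ‖k (x i - x j) 0 * S 1 - k (x i - x j) 1 * S 0‖ ≤ 2 * (‖k (x i - x j)‖ * ‖S‖) := by
    have h a b : |k (x i - x j) a * S b| ≤ ‖k (x i - x j)‖ * ‖S‖ := by
      rw [abs_mul]
      exact mul_le_mul (norm_le_pi_norm (k (x i - x j)) a) (norm_le_pi_norm S b) (abs_nonneg _)
          (norm_nonneg _)
    rw [norm_eq_abs]
    linarith [abs_sub (k (x i - x j) 0 * S 1) (k (x i - x j) 1 * S 0), h 0 1, h 1 0]
  have h2 : k (x i - x j) 0 * (pairDrift A c k x i s - pairDrift A c k x j s) 1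
      - k (x i - x j) 1 * (pairDrift A c k x i s - pairDrift A c k x j s) 0
      = k (x i - x j) 0 * S 1 - k (x i - x j) 1 * S 0 := by
    rw [e]; simp only [Pi.add_apply, Pi.smul_apply, smul_eq_mul]; ring
  rw [h2, ← ofReal_norm]
  refine (ofReal_le_ofReal (h1.trans (mul_le_mul_of_nonneg_left
    (mul_le_mul hk hS (norm_nonneg _) (norm_nonneg _)) zero_le_two))).trans (le_of_eq ?_)
  rw [pairRate, ofReal_mul zero_le_two, mul_sum,
    ENNReal.ofReal_sum_of_nonneg fun _ _ => by positivity]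
  congr 1
  · simp
  · refine sum_congr rfl fun l _ => ?_
    rw [ofReal_mul (norm_nonneg _), ofReal_add (norm_nonneg _) (norm_nonneg _)]
    simp only [ofReal_norm]

instance : (volume : Measure Torus).IsNegInvariant :=
  Measure.pi.isNegInvariant fun _ : Fin 2 => (volume : Measure UnitAddCircle)

/-- Independence of the positions of three vortices. -/
theorem lintegral_pos_sub_mul {l : Idx} (hij : i ≠ j) (hil : i ≠ l) (hjl : j ≠ l) {f h : Torus →
    ℝ≥0∞} (hf : Measurable f) (hh : Measurable h) : ∫⁻ d, f ((d i).2.2 - (d j).2.2) * h ((d i).2.2 -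
    (d l).2.2) ∂sampleLaw r = (∫⁻ z, f z) * ∫⁻ z, h z := by
  rw [lintegral_update r j (by fun_prop)]
  have e (x : Torus) : ∫⁻ z, f (x - z) = ∫⁻ z, f z := lintegral_sub_left_eq_self f x
  have e' (x : Torus) : ∫⁻ z, h (x - z) = ∫⁻ z, h z := lintegral_sub_left_eq_self h x
  simp only [update_self, update_of_ne hij, update_of_ne hjl.symm]
  have : ∀ d : Sample, ∫⁻ z, f ((d i).2.2 - z) * h ((d i).2.2 - (d l).2.2)
      = (∫⁻ z, f z) * h ((d i).2.2 - (d l).2.2) := fun d => by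
    rw [lintegral_mul_const _ (by fun_prop), e]
  simp only [this, lintegral_const, measure_univ, mul_one]
  rw [lintegral_const_mul _ (by fun_prop)]
  congr 1
  rw [lintegral_update r l (by fun_prop)]
  simp only [update_self, update_of_ne hil, e', lintegral_const, measure_univ, mul_one]

theorem lintegral_pos_sub (hij : i ≠ j) {f : Torus → ℝ≥0∞} (hf : Measurable f) : ∫⁻ d, f ((d i).2.2
    - (d j).2.2) ∂sampleLaw r = ∫⁻ z, f z := by
  have e (x : Torus) : ∫⁻ z, f (x - z) = ∫⁻ z, f z := lintegral_sub_left_eq_self f x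
  rw [lintegral_update r j (by fun_prop)]
  simp only [update_self, update_of_ne hij, e, lintegral_const, measure_univ, mul_one]

/-- Among three independent uniform points two differences with a common point are independent, so
each product integrates to the square of the `L¹` norm of the kernel. Oddness of the kernel brings
the second product into this form. -/
theorem lintegral_pairRate_le (A : Finset Idx) (hij : i ≠ j) : ∫⁻ d, pairRate A i j (fun i => (d
    i).2.2) ∂sampleLaw r ≤ 4 * A.card * (∫⁻ z, ‖biotSavart z‖ₑ) ^ 2 := by
  have hK : Measurable fun z => ‖biotSavart z‖ₑ := measurable_biotSavart.enorm
  unfold pairRate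
  have hm (i j : Idx) : Measurable fun d : Sample => ‖biotSavart ((d i).2.2 - (d j).2.2)‖ₑ :=
      hK.comp (by fun_prop)
  have hm2 l : Measurable fun d : Sample => ‖biotSavart ((d i).2.2 - (d j).2.2)‖ₑ
      * (‖biotSavart ((d i).2.2 - (d l).2.2)‖ₑ + ‖biotSavart ((d j).2.2 - (d l).2.2)‖ₑ) := (hm i
          j).mul ((hm i l).add (hm j l))
  rw [lintegral_const_mul _ (Finset.measurable_fun_sum _ fun l _ => hm2 l),
    lintegral_finsetSum _ fun l _ => hm2 l]
  have h1 : ∀ l ∈ (A.erase i).erase j, ∫⁻ d : Sample, ‖biotSavart ((d i).2.2 - (d j).2.2)‖ₑ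
      * (‖biotSavart ((d i).2.2 - (d l).2.2)‖ₑ + ‖biotSavart ((d j).2.2 - (d l).2.2)‖ₑ) ∂sampleLaw r
      = 2 * (∫⁻ z, ‖biotSavart z‖ₑ) ^ 2 := by
    intro l hl
    simp only [mem_erase] at hl
    simp only [mul_add]
    rw [lintegral_add_left (show Measurable fun d : Sample => _ * _ from (hm i j).mul (hm i l)),
      lintegral_pos_sub_mul r hij (Ne.symm hl.2.1) (Ne.symm hl.1) hK hK]
    have : ∀ d : Sample, ‖biotSavart ((d i).2.2 - (d j).2.2)‖ₑ = ‖biotSavart ((d j).2.2 - (d i).2.2)‖ₑ :=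
      fun d => by rw [← neg_sub, biotSavart_neg, enorm_neg]
    simp only [this]
    rw [lintegral_pos_sub_mul r hij.symm (Ne.symm hl.1) (Ne.symm hl.2.1) hK hK, ← two_mul, sq]
  rw [sum_congr rfl h1, sum_const, nsmul_eq_mul]
  have hcard : (((A.erase i).erase j).card : ℝ≥0∞) ≤ A.card := by
    exact_mod_cast Finset.card_le_card ((erase_subset _ _).trans (erase_subset _ _))
  calc _ ≤ 2 * ((A.card : ℝ≥0∞) * (2 * (∫⁻ z, ‖biotSavart z‖ₑ) ^ 2)) := by gcongr
    _ = _ := by ring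

/-! ### The truncated and regularised system -/

/-- The first `n` vortices of either kind. -/
def lowIdx (n : ℕ) : Finset Idx := (range n).disjSum (range n)

theorem inl_mem_lowIdx : inl m ∈ lowIdx n ↔ m < n := by simp [lowIdx]

theorem inr_mem_lowIdx : inr m ∈ lowIdx n ↔ m < n := by simp [lowIdx]

theorem measurableSet_isActive (M : ℝ) (i : Idx) :
    MeasurableSet {p : Sample × ℝ | IsActive M p.1 i p.2} := by
  rcases i with m | m
  · exact measurableSet_le ((measurable_arrival (.inl m)).comp measurable_fst) measurable_const
  · exact measurableSet_le ((measurable_arrival (.inr m)).comp measurable_fst) measurable_snd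

theorem measurable_intensity (θ : ℝ) (N : ℕ) (i : Idx) :
    Measurable fun p : Sample × ℝ => intensity θ N p.1 i p.2 := by
  have h : Measurable fun p : Sample × ℝ => arrival p.1 i := (measurable_arrival i).comp measurable_fst
  rcases i with m | m
  · simp only [intensity]; fun_prop
  · simp only [intensity]; fun_prop

theorem posInvariant_arrival : PosInvariant arrival := by
  intro d d' h
  funext i
  rcases i with m | m
  · simp only [arrival_inl, (h _).1]
  · simp only [arrival_inr, (h _).1]

theorem posInvariant_intensity (θ : ℝ) (N : ℕ) : PosInvariant (intensity θ N) := by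
  intro d d' h
  funext i t
  rcases i with m | m <;> simp only [intensity, posInvariant_arrival d d' h, (h _).2]

theorem posInvariant_isActive (M : ℝ) : PosInvariant (IsActive M) := by
  intro d d' h
  funext i t
  rcases i with m | m <;> simp only [IsActive, posInvariant_arrival d d' h]

open Classical in
/-- The coefficients of the interaction of the first `n` vortices. -/
def coef (θ M : ℝ) (N n : ℕ) (d : Sample) (i j : Idx) (t : ℝ) : ℝ :=
  if i ∈ lowIdx n ∧ j ≠ i ∧ IsActive M d i t ∧ IsActive M d j t then
    -- Clamping makes the coefficients bounded for every sample. It changes nothing for regular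
    -- samples, where intensities of active vortices are at most `1` in absolute value.
    max (-1) (min 1 (intensity θ N d j t)) else 0

theorem measurable_coef (θ M : ℝ) (N n : ℕ) (i j : Idx) :
    Measurable fun p : Sample × ℝ => coef θ M N n p.1 i j p.2 := by
  unfold coef
  have h := measurable_intensity θ N j
  refine Measurable.ite ?_ (by fun_prop) measurable_const
  exact (MeasurableSet.const _).inter ((MeasurableSet.const _).inter
    ((measurableSet_isActive M i).inter (measurableSet_isActive M j)))

theorem abs_coef_le (θ M : ℝ) (N n : ℕ) (d : Sample) (i j : Idx) (t : ℝ) :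
    |coef θ M N n d i j t| ≤ 1 := by
  unfold coef
  split_ifs
  · exact abs_le.2 ⟨le_max_left _ _, max_le (by norm_num) (min_le_left _ _)⟩
  · simp

theorem posInvariant_coef (θ M : ℝ) (N n : ℕ) : PosInvariant (coef θ M N n) := by
  intro d d' h
  unfold coef
  rw [posInvariant_isActive M d d' h, posInvariant_intensity θ N d d' h]

theorem exists_truncFlow (θ M : ℝ) (N n : ℕ) (L : ℝ) : ∃ Y : Sample → ℝ → Idx → ℝ², (∀ i, Measurable
    fun p : Sample × ℝ => Y p.1 p.2 i) ∧ ∀ d t, 0 ≤ t → ∀ i, Y d t i = ∫ s in 0..t, pairDrift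
    (lowIdx n) (coef θ M N n d) (regKernel L) (fun i => (d i).2.2 + toTorus (Y d s i)) i s := by
  obtain ⟨C, hC0, hC, hCL⟩ := exists_lipschitz_skewGrad (contDiff_regGreen L)
  obtain ⟨Y, hYm, hY0, hY⟩ := exists_pair_flow (lowIdx n) (coef θ M N n) (measurable_coef θ M N n)
    (abs_coef_le θ M N n) (fun d i => (d i).2.2) (fun i => by fun_prop) (regKernel L)
    (continuous_regKernel L) hC0 hC hCL
  refine ⟨Y, hYm, fun d t ht i => ?_⟩
  by_cases hi : i ∈ lowIdx n
  · exact hY d t ht i hi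
  · simp [hY0 d t i hi, pairDrift, coef, hi]

/-- The displacements in the truncated system with regularised kernel. -/
def truncFlow (θ M : ℝ) (N n : ℕ) (L : ℝ) : Sample → ℝ → Idx → ℝ² :=
  (exists_truncFlow θ M N n L).choose

theorem measurable_truncFlow (θ M : ℝ) (N n : ℕ) (L : ℝ) (i : Idx) :
    Measurable fun p : Sample × ℝ => truncFlow θ M N n L p.1 p.2 i :=
  (exists_truncFlow θ M N n L).choose_spec.1 i

/-- The positions in the truncated system with regularised kernel. -/
def truncPos (θ M : ℝ) (N n : ℕ) (L : ℝ) (d : Sample) (t : ℝ) (i : Idx) : Torus :=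
  (d i).2.2 + toTorus (truncFlow θ M N n L d t i)

theorem truncFlow_eq (θ M : ℝ) (N n : ℕ) (L : ℝ) (d : Sample) (ht : 0 ≤ t) (i : Idx) :
    truncFlow θ M N n L d t i = ∫ s in 0..t, pairDrift (lowIdx n) (coef θ M N n d)
        (regKernel L) (truncPos θ M N n L d s) i s :=
  (exists_truncFlow θ M N n L).choose_spec.2 d t ht i

theorem measurable_truncPos (θ M : ℝ) (N n : ℕ) (L : ℝ) (i : Idx) :
    Measurable fun p : Sample × ℝ => truncPos θ M N n L p.1 p.2 i :=
  (by fun_prop : Measurable fun p : Sample × ℝ => (p.1 i).2.2).add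
    (continuous_toTorus.measurable.comp (measurable_truncFlow θ M N n L i))

theorem lintegral_truncPos (θ M : ℝ) (N n : ℕ) (L r : ℝ) [Fact (0 < r)] (ht : 0 ≤ t)
    (hf : Measurable f) :
    ∫⁻ d, f (setPos d (truncPos θ M N n L d t)) ∂sampleLaw r = ∫⁻ d, f d ∂sampleLaw r :=
  lintegral_flow r (A := lowIdx n) (measurable_coef θ M N n) (abs_coef_le θ M N n)
    (posInvariant_coef θ M N n)
    (fun d i hi j s => by simp [coef, hi]) (fun d i s => by simp [coef]) (contDiff_regGreen L)
    (measurable_truncFlow θ M N n L) (fun d t ht i => truncFlow_eq θ M N n L d ht i) ht hf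

/-- The samples for which two of the first `n` vortices come close before time `a`. -/
def closeSet (θ M : ℝ) (N n a : ℕ) (L : ℝ) : Set Sample :=
  {d | ∃ i ∈ lowIdx n, ∃ j ∈ lowIdx n, i ≠ j ∧ ∃ t ∈ Icc (0 : ℝ) a,
    regGreen L (truncPos θ M N n L d t i - truncPos θ M N n L d t j) ≤ -L}

theorem enorm_regGreen_truncPos_sub_le (θ M : ℝ) (N n : ℕ) (L : ℝ) (d : Sample) (ht : 0 ≤ t) (hi : i
    ∈ lowIdx n) (hj : j ∈ lowIdx n) (hij : i ≠ j) : ‖regGreen L (truncPos θ M N n L d t i - truncPos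
    θ M N n L d t j) - regGreen L ((d i).2.2 - (d j).2.2)‖ₑ ≤ ∫⁻ s in Icc 0 t, pairRate (lowIdx n) i
    j (truncPos θ M N n L d s) := by
  obtain ⟨u₀, hu₀, -⟩ := exists_toTorus_eq ((d i).2.2 - (d j).2.2)
  obtain ⟨C, hC0, hC, hCL⟩ := exists_lipschitz_skewGrad (contDiff_regGreen L)
  have hcm i j : Measurable (coef θ M N n d i j) :=
    (measurable_coef θ M N n i j).comp (by fun_prop : Measurable fun s : ℝ => (d, s))
  have hxm i : Measurable fun s => truncPos θ M N n L d s i :=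
    (measurable_truncPos θ M N n L i).comp (by fun_prop : Measurable fun s : ℝ => (d, s))
  set v : Idx → ℝ → ℝ² := fun i s =>
    pairDrift (lowIdx n) (coef θ M N n d) (regKernel L) (truncPos θ M N n L d s) i s
  have hvm i : Measurable (v i) := Finset.measurable_fun_sum _ fun j _ =>
    (hcm i j).smul ((continuous_regKernel L).measurable.comp ((hxm i).sub (hxm j)))
  have hvb i s : ‖v i s‖ ≤ (lowIdx n).card * C := norm_pairDrift_le (abs_coef_le θ M N n d) hC _ i s
  have hvi i t : IntervalIntegrable (v i) volume 0 t :=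
    intervalIntegrable_of_bounded (hvm i).aestronglyMeasurable (hvb i) 0 t
  have hpos : ∀ s, 0 ≤ s → toTorus (u₀ + ∫ s' in 0..s, (v i s' - v j s'))
      = truncPos θ M N n L d s i - truncPos θ M N n L d s j := by
    intro s hs
    rw [intervalIntegral.integral_sub (hvi i s) (hvi j s), toTorus_add, toTorus_sub, hu₀, truncPos,
      truncPos, truncFlow_eq θ M N n L d hs i, truncFlow_eq θ M N n L d hs j]
    abel
  have h := enorm_comp_toTorus_sub_le (contDiff_regGreen L) u₀ ((hvm i).sub (hvm j))
    (B := (lowIdx n).card * C + (lowIdx n).card * C)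
    (fun s => (norm_sub_le _ _).trans (add_le_add (hvb i s) (hvb j s))) ht
  simp only [Pi.sub_apply] at h
  rw [hpos t ht, hu₀] at h
  refine h.trans (setLIntegral_mono' measurableSet_Icc fun s hs => ?_)
  rw [hpos s hs.1]
  exact enorm_cross_pairDrift_le (abs_coef_le θ M N n d) L (truncPos θ M N n L d s) hi hj hij s

/-- To reach the level `-L` a pair must either start below `-L / 2` or lose at least `L / 2` on the
way, and the loss is bounded by the integral of the rate. Coinciding starting points are listed
separately, since the value of `green` at the origin carries no information. -/
theorem closeSet_subset (θ M : ℝ) (N n a : ℕ) (L : ℕ) : closeSet θ M N n a L ⊆ ⋃ p ∈ (lowIdx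
    n).offDiag, (({d | (d p.1).2.2 - (d p.2).2.2 ∈ {z | green z ≤ -(L / 2 : ℝ)}} ∪ {d | (d p.1).2.2
    - (d p.2).2.2 ∈ ({0} : Set Torus)}) ∪ {d | ofReal (L / 2) ≤ ∫⁻ s in Icc (0 : ℝ) a, pairRate
    (lowIdx n) p.1 p.2 (truncPos θ M N n L d s)}) := by
  rintro d ⟨i, hi, j, hj, hij, t, ht, h⟩
  refine mem_biUnion (x := (i, j)) (Finset.mem_offDiag.2 ⟨hi, hj, hij⟩) ?_
  by_contra hcon
  simp only [mem_union, not_or, mem_ofPred_eq, mem_singleton_iff, not_le] at hcon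
  obtain ⟨⟨h1, h2⟩, h3⟩ := hcon
  have h4 : -(L / 2 : ℝ) < regGreen L ((d i).2.2 - (d j).2.2) := by
    by_contra h'
    exact absurd (green_le_of_regGreen_le h2 (not_lt.1 h')) (not_le.2 h1)
  have h5 := enorm_regGreen_truncPos_sub_le θ M N n L d ht.1 hi hj hij
  have h6 : ofReal (L / 2) ≤ ‖regGreen L (truncPos θ M N n L d t i - truncPos θ M N n L d t j)
        - regGreen L ((d i).2.2 - (d j).2.2)‖ₑ := by
    rw [← ofReal_norm]
    refine ofReal_le_ofReal ?_
    rw [norm_eq_abs, le_abs']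
    left; linarith
  exact absurd ((h6.trans h5).trans (lintegral_mono_set (Icc_subset_Icc_right ht.2))) (not_le.2 h3)

theorem measurable_pairRate_truncPos (θ M : ℝ) (N n : ℕ) (L : ℝ) (i j : Idx) :
    Measurable fun p : Sample × ℝ => pairRate (lowIdx n) i j (truncPos θ M N n L p.1 p.2) :=
  measurable_pairRate _ i j fun i => measurable_truncPos θ M N n L i

theorem lintegral_pairRate_truncPos_le (θ M : ℝ) (N n a : ℕ) (L r : ℝ) [Fact (0 < r)] (hij : i ≠ j)
    : ∫⁻ d, (∫⁻ s in Icc (0 : ℝ) a, pairRate (lowIdx n) i j (truncPos θ M N n L d s)) ∂sampleLaw r ≤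
    a * (4 * (lowIdx n).card * (∫⁻ z, ‖biotSavart z‖ₑ) ^ 2) := by
  rw [lintegral_lintegral_swap (measurable_pairRate_truncPos θ M N n L i j).aemeasurable]
  have h : ∀ s ∈ Icc (0 : ℝ) a, ∫⁻ d, pairRate (lowIdx n) i j (truncPos θ M N n L d s) ∂sampleLaw r
      ≤ 4 * (lowIdx n).card * (∫⁻ z, ‖biotSavart z‖ₑ) ^ 2 := by
    intro s hs
    have h := lintegral_truncPos θ M N n L r hs.1 (measurable_pairRate (lowIdx n) i j
      (x := fun d i => (d i).2.2) fun i => by fun_prop)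
    simp only [setPos] at h
    exact h.le.trans (lintegral_pairRate_le r _ hij)
  refine (setLIntegral_mono' measurableSet_Icc h).trans_eq ?_
  rw [setLIntegral_const, volume_Icc, mul_comm]
  simp

theorem volume_singleton_zero : volume ({0} : Set Torus) = 0 := by
  have h : volume ({0} : Set UnitAddCircle) = 0 := by
    have := AddCircle.volume_closedBall (T := 1) (x := (0 : UnitAddCircle)) 0
    simpa using this
  rw [volume_pi, Measure.pi_singleton]
  simp [h]

theorem sampleLaw_pos_sub_mem (hij : i ≠ j) {S : Set Torus}
    (hS : MeasurableSet S) : sampleLaw r {d | (d i).2.2 - (d j).2.2 ∈ S} = volume S := by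
  have hm : Measurable fun d : Sample => (d i).2.2 - (d j).2.2 := by fun_prop
  rw [← lintegral_indicator_one hS, ← lintegral_pos_sub r hij (measurable_one.indicator hS)]
  exact (lintegral_indicator_one (hm hS)).symm

/-- The truncated kernel is dominated by the true one and its flow preserves the law, so the
expected rate is bounded independently of `L`. Markov's inequality makes the probability of a loss
of `L / 2` of order `1 / L`. -/
theorem tendsto_measure_closeSet (θ M : ℝ) (N n a : ℕ) (r : ℝ) [Fact (0 < r)] :
    Tendsto (fun L : ℕ => sampleLaw r (closeSet θ M N n a L)) atTop (𝓝 0) := by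
  set κ := ∫⁻ z, ‖biotSavart z‖ₑ
  have hκ : κ ≠ ∞ := lintegral_norm_biotSavart_lt_top.ne
  set B : ℝ≥0∞ := a * (4 * (lowIdx n).card * κ ^ 2)
  have hB : B ≠ ∞ := mul_ne_top (by simp) (mul_ne_top
    (mul_ne_top (by simp) (by simp)) (pow_ne_top hκ))
  have hbound : ∀ L : ℕ, 0 < L → sampleLaw r (closeSet θ M N n a L) ≤ ∑ p ∈ (lowIdx n).offDiag,
      (volume {z : Torus | green z ≤ -(L / 2 : ℝ)} + B / ofReal (L / 2)) := by
    intro L hL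
    refine (measure_mono (closeSet_subset θ M N n a L)).trans
      ((measure_biUnion_finset_le _ _).trans (sum_le_sum fun p hp => ?_))
    have hp' := (Finset.mem_offDiag.1 hp).2.2
    refine (measure_union_le _ _).trans (add_le_add ((measure_union_le _ _).trans ?_) ?_)
    · rw [sampleLaw_pos_sub_mem r hp' (measurableSet_le measurable_green measurable_const),
        sampleLaw_pos_sub_mem r hp' (measurableSet_singleton 0), volume_singleton_zero, add_zero]
    · have hL' : (0 : ℝ) < L / 2 := by positivity
      have hjm := measurable_pairRate_truncPos θ M N n L p.1 p.2
      refine (meas_ge_le_lintegral_div (μ := sampleLaw r) ?_ (by simpa using hL')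
        ofReal_ne_top).trans (ENNReal.div_le_div_right ?_ _)
      · exact (hjm.lintegral_prod_right' (ν := volume.restrict (Icc (0 : ℝ) a))).aemeasurable
      · exact lintegral_pairRate_truncPos_le θ M N n a L r hp'
  have hdiv : Tendsto (fun L : ℕ => B / ofReal (L / 2)) atTop (𝓝 0) := by
    have h1 : Tendsto (fun L : ℕ => ofReal ((L : ℝ) / 2)) atTop (𝓝 ∞) :=
      ENNReal.tendsto_ofReal_atTop.comp (tendsto_natCast_atTop_atTop.atTop_div_const (by norm_num))
    simpa using ENNReal.Tendsto.div tendsto_const_nhds (.inr ENNReal.top_ne_zero) h1 (.inr hB)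
  have hlim : Tendsto (fun L : ℕ => ∑ p ∈ (lowIdx n).offDiag,
      (volume {z : Torus | green z ≤ -(L / 2 : ℝ)} + B / ofReal (L / 2))) atTop (𝓝 0) := by
    have := tendsto_finsetSum (lowIdx n).offDiag fun p _ => tendsto_volume_green_le.add hdiv
    simpa using this
  exact tendsto_of_tendsto_of_tendsto_of_le_of_le' tendsto_const_nhds hlim (.of_forall fun _ => zero_le)
    ((eventually_gt_atTop 0).mono hbound)

/-! ### Existence and uniqueness of the motion -/

theorem RegularSample.abs_intensity_le (hd : RegularSample d) (hθ : 0 < θ) (hN : 1 ≤ N) (ht : 0 ≤ t)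
    (hi : IsActive M d i t) : |intensity θ N d i t| ≤ 1 := by
  have hs : (1 : ℝ) ≤ √N := Real.one_le_sqrt.2 (by exact_mod_cast hN)
  have he : ∀ {x : ℝ}, x ≤ 0 → |exp x| ≤ 1 := fun {x} h => by
    rw [abs_of_pos (exp_pos x)]; exact Real.exp_le_one_iff.2 h
  have hpos := hd.arrival_pos i
  rcases i with m | m <;>
    simp only [intensity, abs_div, abs_mul, hd.abs_sign, one_mul, abs_of_nonneg (sqrt_nonneg _)] <;>
    refine div_le_one_of_le₀ (le_trans ?_ hs) (by positivity)
  · exact mul_le_one₀ (he (by nlinarith)) (abs_nonneg _) (he (by nlinarith))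
  · have : arrival d (inr m) ≤ t := hi
    exact he (by nlinarith)

/-- All vortices present up to time `a` are among the first `n`. -/
def ActiveBelow (M : ℝ) (d : Sample) (a : ℝ) (n : ℕ) : Prop :=
  ∀ t ≤ a, ∀ i, IsActive M d i t → i ∈ lowIdx n

theorem RegularSample.eventually_activeBelow (hd : RegularSample d) (M a : ℝ) :
    ∀ᶠ n in atTop, ActiveBelow M d a n := by
  obtain ⟨n₁, h₁⟩ := eventually_atTop.1 (hd.tendsto_inl.eventually_gt_atTop M)
  obtain ⟨n₂, h₂⟩ := eventually_atTop.1 (hd.tendsto_inr.eventually_gt_atTop a)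
  filter_upwards [eventually_ge_atTop n₁, eventually_ge_atTop n₂] with n hn₁ hn₂ t ht i hi
  rcases i with m | m
  · rw [inl_mem_lowIdx]
    by_contra h
    exact absurd (h₁ m (by omega)) (not_lt.2 hi)
  · rw [inr_mem_lowIdx]
    by_contra h
    have : arrival d (inr m) ≤ t := hi
    linarith [h₂ m (by omega)]

theorem velocity_eq_pairDrift (hd : RegularSample d) (hθ : 0 < θ) (hN : 1 ≤ N) (ht : 0 ≤ t) (hact :
    ∀ i, IsActive M d i t → i ∈ lowIdx n) (hk : ∀ i j, i ≠ j → IsActive M d i t → IsActive M d j t →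
    k (x i t - x j t) = biotSavart (x i t - x j t)) (i : Idx) : velocity θ M N d x i t = pairDrift
    (lowIdx n) (coef θ M N n d) k (fun i => x i t) i t := by
  classical
  unfold velocity pairDrift
  split_ifs with hi
  · have hs : (support fun j => ∑ᶠ _ : j ≠ i ∧ IsActive M d j t,
        intensity θ N d j t • biotSavart (x i t - x j t)) ⊆ lowIdx n := by
      intro j hj
      by_contra h
      refine hj ?_
      have : ¬ (j ≠ i ∧ IsActive M d j t) := fun h' => h (hact j h'.2)
      simp only [finsum_eq_if, if_neg this]
    rw [finsum_eq_finsetSum_of_support_subset _ hs]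
    refine sum_congr rfl fun j _ => ?_
    rw [finsum_eq_if]
    by_cases h : j ≠ i ∧ IsActive M d j t
    · have hle := abs_le.1 (hd.abs_intensity_le hθ hN ht h.2)
      rw [if_pos h, coef, if_pos ⟨hact i hi, h.1, hi, h.2⟩, min_eq_right hle.2, max_eq_right hle.1,
        hk i j h.1.symm hi h.2]
    · have h' : ¬ (i ∈ lowIdx n ∧ j ≠ i ∧ IsActive M d i t ∧ IsActive M d j t) := fun h'' =>
        h ⟨h''.2.1, h''.2.2.2⟩
      rw [if_neg h, coef, if_neg h', zero_smul]
  · refine (sum_eq_zero fun j _ => ?_).symm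
    have h' : ¬ (i ∈ lowIdx n ∧ j ≠ i ∧ IsActive M d i t ∧ IsActive M d j t) := fun h'' => hi h''.2.2.1
    rw [coef, if_neg h', zero_smul]

/-- A solution of the equations of motion up to time `a`. -/
structure IsSolutionOn (θ M : ℝ) (N : ℕ) (d : Sample) (a : ℝ) (x : Idx → ℝ → Torus) : Prop where
  ne : ∀ t ∈ Icc (0 : ℝ) a, ∀ i j, i ≠ j → IsActive M d i t → IsActive M d j t → x i t ≠ x j t
  integrable : ∀ i, ∀ t ∈ Icc (0 : ℝ) a, IntervalIntegrable (velocity θ M N d x i) volume 0 t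
  eq : ∀ i, ∀ t ∈ Icc (0 : ℝ) a, x i t = (d i).2.2 + toTorus (∫ s in 0..t, velocity θ M N d x i s)

theorem IsSolution.isSolutionOn (h : IsSolution θ M N d x) (a : ℝ) : IsSolutionOn θ M N d a x :=
  ⟨fun t ht => h.ne t ht.1, fun i t ht => h.integrable i t ht.1, fun i t ht => h.eq i t ht.1⟩

/-- Off the exceptional set all active pairs stay where the truncated and the true kernel coincide,
and for large `n` no active vortex is omitted. -/
theorem isSolutionOn_truncPos (hd : RegularSample d) (hθ : 0 < θ) (hN : 1 ≤ N) {a : ℕ} (hact :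
    ActiveBelow M d a n) (hL : d ∉ closeSet θ M N n a L) : IsSolutionOn θ M N d a fun i t =>
    truncPos θ M N n L d t i := by
  have hlt : ∀ t ∈ Icc (0 : ℝ) a, ∀ i j, i ≠ j → IsActive M d i t → IsActive M d j t →
      -L < regGreen L (truncPos θ M N n L d t i - truncPos θ M N n L d t j) := by
    intro t ht i j hij hi hj
    by_contra h
    exact hL ⟨i, hact t ht.2 i hi, j, hact t ht.2 j hj, hij, t, ht, not_lt.1 h⟩
  have hv : ∀ t ∈ Icc (0 : ℝ) a, ∀ i, velocity θ M N d (fun i t => truncPos θ M N n L d t i) i t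
      = pairDrift (lowIdx n) (coef θ M N n d) (regKernel L) (truncPos θ M N n L d t) i t := by
    intro t ht i
    refine velocity_eq_pairDrift hd hθ hN ht.1 (hact t ht.2) (fun i j hij hi hj => ?_) i
    have := hlt t ht i j hij hi hj
    exact regKernel_eq_of_le_green (ne_zero_of_lt_regGreen this) (lt_green_of_lt_regGreen this).le
  obtain ⟨C, -, hC, -⟩ := exists_lipschitz_skewGrad (contDiff_regGreen L)
  have hsub : ∀ t ∈ Icc (0 : ℝ) a, uIoc 0 t ⊆ Icc 0 (a : ℝ) := fun t ht => by
    rw [uIoc_of_le ht.1]; exact fun s hs => ⟨hs.1.le, hs.2.trans ht.2⟩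
  refine ⟨fun t ht i j hij hi hj => ?_, fun i t ht => ?_, fun i t ht => ?_⟩
  · exact sub_ne_zero.1 (ne_zero_of_lt_regGreen (hlt t ht i j hij hi hj))
  · have h := intervalIntegrable_pairDrift (A := lowIdx n) (c := coef θ M N n d)
      (k := regKernel L) (x₀ := start d) (y := truncFlow θ M N n L d) (K := C)
      (fun i j => (measurable_coef θ M N n i j).comp (by fun_prop : Measurable fun s : ℝ => (d, s)))
      (abs_coef_le θ M N n d) (continuous_regKernel L) hC
      (fun i => (measurable_truncFlow θ M N n L i).comp (by fun_prop : Measurable fun s : ℝ => (d, s)))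
      i 0 t
    exact h.congr fun s hs => (hv s (hsub t ht hs) i).symm
  · rw [truncPos, truncFlow_eq θ M N n L d ht.1 i]
    congr 2
    refine intervalIntegral.integral_congr_ae (.of_forall fun s hs => ?_)
    exact (hv s (hsub t ht hs) i).symm

theorem isClosed_isActive (M : ℝ) (d : Sample) (i : Idx) : IsClosed {t | IsActive M d i t} := by
  rcases i with m | m
  · exact isClosed_const
  · exact isClosed_Ici

theorem IsSolutionOn.continuousOn (h : IsSolutionOn θ M N d a x) (i : Idx) :
    ContinuousOn (fun t => ∫ s in 0..t, velocity θ M N d x i s) (Icc (0 : ℝ) a) := by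
  rcases lt_or_ge a 0 with ha | ha
  · simp [Icc_eq_empty (not_le.2 ha)]
  have := intervalIntegral.continuousOn_primitive_interval' (h.integrable i a ⟨ha, le_rfl⟩)
    (left_mem_uIcc)
  rwa [uIcc_of_le ha] at this

/-- The times at which both vortices of a pair are active form a compact set, on which `green` of
their difference is continuous because they never meet. -/
theorem IsSolutionOn.exists_le_green (h : IsSolutionOn θ M N d a x) (hact : ActiveBelow M d a n) :
    ∃ L, ∀ t ∈ Icc (0 : ℝ) a, ∀ i j, i ≠ j → IsActive M d i t → IsActive M d j t →
      -L ≤ green (x i t - x j t) := by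
  have hx i : ContinuousOn (x i) (Icc (0 : ℝ) a) :=
    (continuousOn_const.add (continuous_toTorus.comp_continuousOn (h.continuousOn i))).congr (h.eq i)
  have hb : ∀ p : Idx × Idx, ∃ C, 0 ≤ C ∧ (p.1 ≠ p.2 → ∀ t ∈ Icc (0 : ℝ) a, IsActive M d p.1 t →
      IsActive M d p.2 t → -C ≤ green (x p.1 t - x p.2 t)) := by
    rintro ⟨i, j⟩
    by_cases hij : i = j
    · exact ⟨0, le_rfl, fun h => absurd hij h⟩
    have hc : IsCompact (Icc (0 : ℝ) a ∩ ({t | IsActive M d i t} ∩ {t | IsActive M d j t})) :=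
      isCompact_Icc.inter_right ((isClosed_isActive M d i).inter (isClosed_isActive M d j))
    have hg : ContinuousOn (fun t => green (x i t - x j t))
        (Icc (0 : ℝ) a ∩ ({t | IsActive M d i t} ∩ {t | IsActive M d j t})) :=
      continuousOn_green.comp (((hx i).mono inter_subset_left).sub ((hx j).mono inter_subset_left))
        fun t ht => sub_ne_zero.2 (h.ne t ht.1 i j hij ht.2.1 ht.2.2)
    obtain ⟨C, hC⟩ := hc.exists_bound_of_continuousOn hg
    exact ⟨|C|, abs_nonneg C, fun _ t ht hi hj => by
      linarith [(abs_le.1 (hC t ⟨ht, hi, hj⟩)).1, le_abs_self C]⟩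
  choose C hC0 hC using hb
  refine ⟨∑ p ∈ lowIdx n ×ˢ lowIdx n, C p, fun t ht i j hij hi hj => ?_⟩
  have h1 := Finset.single_le_sum (f := C) (fun p _ => hC0 p) (Finset.mem_product.2
    ⟨hact t ht.2 i hi, hact t ht.2 j hj⟩ : (i, j) ∈ lowIdx n ×ˢ lowIdx n)
  linarith [hC (i, j) hij t ht hi hj]

/-- On a bounded time interval both solutions stay above a common level of the Green function, hence
both solve the same truncated system, which is Lipschitz; Gronwall's inequality applies. -/
theorem IsSolutionOn.unique (hd : RegularSample d) (hθ : 0 < θ) (hN : 1 ≤ N) {x' : Idx → ℝ → Torus}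
    (h : IsSolutionOn θ M N d a x) (h' : IsSolutionOn θ M N d a x') : ∀ t ∈ Icc (0 : ℝ) a, ∀ i, x i t = x'
    i t := by
  obtain ⟨n, hact⟩ := (hd.eventually_activeBelow M a).exists
  obtain ⟨L₁, hL₁⟩ := h.exists_le_green hact
  obtain ⟨L₂, hL₂⟩ := h'.exists_le_green hact
  set L := max L₁ L₂
  obtain ⟨C, hC0, hC, hCL⟩ := exists_lipschitz_skewGrad (contDiff_regGreen L)
  have hv : ∀ {y : Idx → ℝ → Torus} {L' : ℝ}, L' ≤ L → IsSolutionOn θ M N d a y →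
      (∀ t ∈ Icc (0 : ℝ) a, ∀ i j, i ≠ j → IsActive M d i t → IsActive M d j t →
        -L' ≤ green (y i t - y j t)) → ∀ t ∈ Icc (0 : ℝ) a, ∀ i, velocity θ M N d y i t
      = pairDrift (lowIdx n) (coef θ M N n d) (regKernel L) (fun i => y i t) i t := by
    intro y L' hL' hy hgr t ht i
    refine velocity_eq_pairDrift hd hθ hN ht.1 (hact t ht.2) (fun i j hij hi hj => ?_) i
    exact regKernel_eq_of_le_green (sub_ne_zero.2 (hy.ne t ht i j hij hi hj))
      (by linarith [hgr t ht i j hij hi hj])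
  have hv₁ := hv (le_max_left _ _) h hL₁
  have hv₂ := hv (le_max_right _ _) h' hL₂
  set e : Idx → ℝ → ℝ := fun i t => ‖(∫ s in 0..t, velocity θ M N d x i s)
    - ∫ s in 0..t, velocity θ M N d x' i s‖
  set U : ℝ → ℝ := fun t => ∑ i ∈ lowIdx n, e i t
  have hec i : ContinuousOn (e i) (Icc (0 : ℝ) a) :=
    ((h.continuousOn i).sub (h'.continuousOn i)).norm
  have hUc : ContinuousOn U (Icc (0 : ℝ) a) := continuousOn_finsetSum _ fun i _ => hec i
  have heU : ∀ i ∈ lowIdx n, ∀ t, e i t ≤ U t := fun i hi t =>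
    Finset.single_le_sum (f := fun i => e i t) (fun _ _ => norm_nonneg _) hi
  have hxe : ∀ i, ∀ t ∈ Icc (0 : ℝ) a, ‖x i t - x' i t‖ ≤ e i t := by
    intro i t ht
    rw [h.eq i t ht, h'.eq i t ht, add_sub_add_left_eq_sub, ← toTorus_sub]
    exact norm_toTorus_le _
  have hdiff : ∀ i ∈ lowIdx n, ∀ t ∈ Icc (0 : ℝ) a,
      ‖velocity θ M N d x i t - velocity θ M N d x' i t‖ ≤ (lowIdx n).card * (C * 2) * U t := by
    intro i hi t ht
    rw [hv₁ t ht, hv₂ t ht, pairDrift, pairDrift, ← sum_sub_distrib]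
    refine (norm_sum_le_of_le _ (f := fun j => _) (n := fun _ => C * 2 * U t) fun j hj => ?_).trans_eq
      (by rw [sum_const, nsmul_eq_mul]; ring)
    rw [← smul_sub, norm_smul]
    refine (mul_le_mul (abs_coef_le θ M N n d i j t) (hCL _ _) (norm_nonneg _) zero_le_one).trans ?_
    rw [one_mul, mul_assoc]
    refine mul_le_mul_of_nonneg_left ?_ hC0
    have : x i t - x j t - (x' i t - x' j t) = (x i t - x' i t) - (x j t - x' j t) := by abel
    rw [this]
    linarith [norm_sub_le (x i t - x' i t) (x j t - x' j t), hxe i t ht, hxe j t ht, heU i hi t,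
      heU j hj t]
  have hle : ∀ t ∈ Icc (0 : ℝ) a, U t ≤ ((lowIdx n).card * ((lowIdx n).card * (C * 2)))
      * ∫ s in 0..t, U s := by
    intro t ht
    have hUi : IntervalIntegrable U volume 0 t :=
      (hUc.mono (by rw [uIcc_of_le ht.1]; exact Icc_subset_Icc_right ht.2)).intervalIntegrable
    rw [mul_assoc, ← nsmul_eq_mul, ← sum_const]
    refine sum_le_sum fun i hi => ?_
    simp only [e]
    rw [← intervalIntegral.integral_sub (h.integrable i t ht) (h'.integrable i t ht),
      ← intervalIntegral.integral_const_mul]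
    refine intervalIntegral.norm_integral_le_of_norm_le ht.1 (.of_forall fun s hs => ?_)
      (hUi.const_mul _)
    exact hdiff i hi s ⟨hs.1.le, hs.2.trans ht.2⟩
  have hU0 := eq_zero_of_le_integral (by positivity) hUc
    (fun t _ => sum_nonneg fun _ _ => norm_nonneg _) hle
  intro t ht i
  by_cases hi : i ∈ lowIdx n
  · have h1 := (hxe i t ht).trans (heU i hi t)
    rw [hU0 t ht] at h1
    exact sub_eq_zero.1 (norm_le_zero_iff.1 h1)
  · have h0 (y : Idx → ℝ → Torus) : ∫ s in 0..t, velocity θ M N d y i s = 0 := by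
      refine integral_zero_ae (.of_forall fun s hs => ?_)
      rw [uIoc_of_le ht.1] at hs
      exact if_neg fun hact' => hi (hact s (hs.2.trans ht.2) i hact')
    rw [h.eq i t ht, h'.eq i t ht, h0, h0]

theorem velocity_congr {x' : Idx → ℝ → Torus} (h : ∀ i, x i t = x' i t) (i : Idx) : velocity θ M N d
    x i t = velocity θ M N d x' i t := by
  simp only [velocity, h]

/-- Compatible solutions on all bounded intervals give a global solution. -/
theorem exists_isSolution (hd : RegularSample d) (hθ : 0 < θ) (hN : 1 ≤ N) (h : ∀ a : ℕ, ∃ x,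
    IsSolutionOn θ M N d a x) : ∃ x, IsSolution θ M N d x := by
  choose x hx using h
  have hmono : ∀ a b : ℕ, a ≤ b → ∀ t ∈ Icc (0 : ℝ) a, ∀ i, x b i t = x a i t := fun a b hab =>
    IsSolutionOn.unique hd hθ hN ⟨fun t ht => (hx b).ne t ⟨ht.1, ht.2.trans (by exact_mod_cast hab)⟩,
      fun i t ht => (hx b).integrable i t ⟨ht.1, ht.2.trans (by exact_mod_cast hab)⟩,
      fun i t ht => (hx b).eq i t ⟨ht.1, ht.2.trans (by exact_mod_cast hab)⟩⟩ (hx a)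
  set y : Idx → ℝ → Torus := fun i t => x ⌈t⌉₊ i t
  have hy : ∀ a : ℕ, ∀ t ∈ Icc (0 : ℝ) a, ∀ i, y i t = x a i t := fun a t ht i =>
    (hmono ⌈t⌉₊ a (Nat.ceil_le.2 ht.2) t ⟨ht.1, Nat.le_ceil t⟩ i).symm
  have hv : ∀ a : ℕ, ∀ t ∈ Icc (0 : ℝ) a, ∀ i,
      velocity θ M N d y i t = velocity θ M N d (x a) i t := fun a t ht =>
    velocity_congr (hy a t ht)
  have hm : ∀ {t : ℝ}, 0 ≤ t → t ∈ Icc (0 : ℝ) ⌈t⌉₊ := fun ht => ⟨ht, Nat.le_ceil _⟩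
  have hsub : ∀ {t : ℝ}, 0 ≤ t → ∀ s ∈ uIoc 0 t, s ∈ Icc (0 : ℝ) ⌈t⌉₊ := fun {t} ht s hs => by
    rw [uIoc_of_le ht] at hs; exact ⟨hs.1.le, hs.2.trans (Nat.le_ceil _)⟩
  refine ⟨y, fun t ht i j hij hi hj => (hx _).ne t (hm ht) i j hij hi hj, fun i t ht => ?_,
    fun i t ht => ?_⟩
  · exact ((hx ⌈t⌉₊).integrable i t (hm ht)).congr fun s hs => (hv _ s (hsub ht s hs) i).symm
  · refine ((hx ⌈t⌉₊).eq i t (hm ht)).trans ?_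
    rw [← intervalIntegral.integral_congr_ae (.of_forall fun s hs =>
      hv _ s (hsub ht s hs) i)]
    rfl

/-- The level is chosen so large, depending on `n`, that the exceptional set has probability at most
`2⁻¹ ^ n`. By Borel–Cantelli almost every sample is in only finitely many of them, and uniqueness
identifies the truncated motion with the true one. -/
theorem ae_eventually_position_eq (hθ : 0 < θ) (M : ℝ) (hN : 1 ≤ N) (r : ℝ) [Fact (0 < r)] : ∃ L : ℕ
    → ℕ → ℝ, ∀ᵐ d ∂sampleLaw r, RegularSample d ∧ IsSolution θ M N d (position θ M N d) ∧ ∀ a : ℕ,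
    ∀ᶠ n in atTop, ∀ t ∈ Icc (0 : ℝ) a, ∀ i, position θ M N d i t = truncPos θ M N n (L a n) d t i
    := by
  have hex : ∀ a n : ℕ, ∃ L : ℝ, sampleLaw r (closeSet θ M N n a L) ≤ 2⁻¹ ^ n := by
    intro a n
    have h0 : (0 : ℝ≥0∞) < 2⁻¹ ^ n := ENNReal.pow_pos (by simp) n
    obtain ⟨L, hL⟩ := ((tendsto_measure_closeSet θ M N n a r).eventually_le_const h0).exists
    exact ⟨L, hL⟩
  choose L hL using hex
  refine ⟨L, ?_⟩
  have hbc : ∀ᵐ d ∂sampleLaw r, ∀ a : ℕ, ∀ᶠ n in atTop, d ∉ closeSet θ M N n a (L a n) := by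
    refine ae_all_iff.2 fun a => ae_eventually_notMem (ne_top_of_le_ne_top ?_ (tsum_le_tsum (hL a)))
    rw [tsum_geometric]
    simp
  filter_upwards [hbc, ae_regularSample r] with d hd hreg
  have hev (a : ℕ) : ∀ᶠ n in atTop,
      IsSolutionOn θ M N d a fun i t => truncPos θ M N n (L a n) d t i := by
    filter_upwards [hd a, hreg.eventually_activeBelow M a] with n hn hact
    exact isSolutionOn_truncPos hreg hθ hN hact hn
  have hsol : ∃ x, IsSolution θ M N d x := exists_isSolution hreg hθ hN fun a => by
    obtain ⟨n, hn⟩ := (hev a).exists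
    exact ⟨_, hn⟩
  have hpos : IsSolution θ M N d (position θ M N d) := by
    rw [position, dif_pos hsol]; exact hsol.choose_spec
  refine ⟨hreg, hpos, fun a => ?_⟩
  filter_upwards [hev a] with n hn t ht i
  exact IsSolutionOn.unique hreg hθ hN (hpos.isSolutionOn a) hn t ht i

/-- A jointly measurable version of the positions, and the invariance of the law. -/
theorem exists_measurable_position (hθ : 0 < θ) (M : ℝ) (hN : 1 ≤ N) (r T : ℝ) [Fact (0 < r)] : ∃ X
    : Sample → ℝ → Idx → Torus, (∀ i, Measurable fun p : Sample × ℝ => X p.1 p.2 i) ∧ (∀ᵐ d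
    ∂sampleLaw r, RegularSample d ∧ IsSolution θ M N d fun i t => position θ M N d i t) ∧ (∀ᵐ d
    ∂sampleLaw r, ∀ t ∈ Icc 0 T, ∀ i, X d t i = position θ M N d i t) ∧ ∀ t ∈ Icc 0 T, ∀ f : Sample
    → ℝ≥0∞, Measurable f → ∫⁻ d, f (setPos d (X d t)) ∂sampleLaw r ≤ ∫⁻ d, f d ∂sampleLaw r := by
  obtain ⟨L, hL⟩ := ae_eventually_position_eq hθ M hN r
  obtain ⟨a, ha⟩ := exists_nat_ge T
  -- `position` is defined by choice, so its measurability is obtained only off a measurable null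
  -- set, as a limit of truncated positions.
  obtain ⟨G, hGs, hGm, hG0⟩ := exists_measurable_superset_of_null (ae_iff.1 hL)
  have hG : ∀ d ∉ G, _ := fun d hd => by_contra fun h => hd (hGs h)
  classical
  set S : Set (Sample × ℝ) := Gᶜ ×ˢ Icc 0 T
  have hS : MeasurableSet S := hGm.compl.prod measurableSet_Icc
  set X : Sample → ℝ → Idx → Torus := fun d t i =>
    if (d, t) ∈ S then position θ M N d i t else (d i).2.2
  have hXae : ∀ᵐ d ∂sampleLaw r, d ∉ G := by rw [ae_iff]; simpa using hG0
  have hX : ∀ d ∉ G, ∀ t ∈ Icc 0 T, ∀ i, X d t i = position θ M N d i t := fun d hd t ht i =>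
    if_pos ⟨hd, ht⟩
  refine ⟨X, fun i => ?_, ?_, ?_, fun t ht f hf => ?_⟩
  · refine measurable_of_tendsto_metrizable (f := fun n p => if p ∈ S then
      truncPos θ M N n (L a n) p.1 p.2 i else (p.1 i).2.2) (fun n => Measurable.ite hS
        (measurable_truncPos θ M N n (L a n) i) (by fun_prop)) (tendsto_pi_nhds.2 fun p => ?_)
    by_cases hp : p ∈ S
    · simp only [X, if_pos hp]
      refine tendsto_const_nhds.congr' ?_
      filter_upwards [(hG p.1 hp.1).2.2 a] with n hn
      exact hn p.2 ⟨hp.2.1, hp.2.2.trans ha⟩ i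
    · simp only [X, if_neg hp]
      exact tendsto_const_nhds
  · filter_upwards [hL] with d hd using ⟨hd.1, hd.2.1⟩
  · filter_upwards [hXae] with d hd using hX d hd
  · have h1 n : Measurable fun d => f (setPos d (truncPos θ M N n (L a n) d t)) :=
      hf.comp (continuous_setPos.measurable.comp (measurable_id.prodMk (measurable_pi_lambda _ fun i =>
        (measurable_truncPos θ M N n (L a n) i).comp (by fun_prop : Measurable fun d => (d, t)))))
    -- The truncated flows preserve the law exactly and are eventually equal to `X` almost surely.
    -- Fatou then yields an inequality, which is all that the moment bounds need.
    have h2 := lintegral_liminf_le (μ := sampleLaw r) (u := atTop) h1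
    simp only [lintegral_truncPos θ M N _ _ r ht.1 hf, liminf_const] at h2
    refine le_trans (lintegral_mono_ae ?_) h2
    filter_upwards [hXae] with d hd
    refine le_of_eq ?_
    have : (fun n => f (setPos d (truncPos θ M N n (L a n) d t))) =ᶠ[atTop]
        fun _ => f (setPos d (X d t)) := by
      filter_upwards [(hG d hd).2.2 a] with n hn
      congr 2
      funext i
      rw [hX d hd t ht i]
      exact (hn t ⟨ht.1, ht.2.trans ha⟩ i).symm
    rw [liminf_congr this, liminf_const]

/-! ### Moments of sums with random signs -/

/-- The sample with the sign at one index reversed. -/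
def flip (i : Idx) (d : Sample) : Sample := update d i ((d i).1, -(d i).2.1, (d i).2.2)

theorem measurable_flip (i : Idx) : Measurable (flip i) :=
  (measurable_update_sample i).comp (measurable_id.prodMk
    (by fun_prop : Measurable fun d : Sample => ((d i).1, -(d i).2.1, (d i).2.2)))

theorem lintegral_flip (i : Idx) (hf : Measurable f) :
    ∫⁻ d, f (flip i d) ∂sampleLaw r = ∫⁻ d, f d ∂sampleLaw r := by
  rw [lintegral_update r i (f := fun d => f (flip i d)) (hf.comp (measurable_flip i)),
    lintegral_update r i hf]
  refine lintegral_congr fun d => lintegral_congr fun g => ?_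
  have e : ∀ a z, flip i (update d i (g, a, z)) = update d i (g, -a, z) := by
    intro a z; simp [flip]
  simp only [e]
  have hm : Measurable fun a : ℝ => ∫⁻ z, f (update d i (g, a, z)) := by
    refine Measurable.lintegral_prod_right' (f := fun p : ℝ × Torus => f (update d i (g, p)))
      (hf.comp ((measurable_update_sample i).comp
        (by fun_prop : Measurable fun p : ℝ × Torus => (d, (g, p)))))
  simp only [signLaw, lintegral_smul_measure, lintegral_add_measure]
  have hm' : Measurable fun a : ℝ => ∫⁻ z, f (update d i (g, -a, z)) := hm.comp measurable_neg
  rw [lintegral_dirac' _ hm, lintegral_dirac' _ hm, lintegral_dirac' _ hm', lintegral_dirac' _ hm',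
    neg_neg, add_comm]

/-- The law is invariant under reversing one sign, so only the average over that sign has to be
bounded. -/
theorem lintegral_le_of_flip (i : Idx) {g : Sample → ℝ≥0∞} (hf : Measurable f) (hg : Measurable g)
    (h : ∀ d, f d + f (flip i d) ≤ 2 * g d) : ∫⁻ d, f d ∂sampleLaw r ≤ ∫⁻ d, g d ∂sampleLaw r := by
  have h1 := lintegral_mono (μ := sampleLaw r) h
  rw [lintegral_add_left hf, lintegral_flip r i hf, ← two_mul, lintegral_const_mul _ hg] at h1
  exact (ENNReal.mul_le_mul_iff_right (by simp) (by simp)).1 h1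

/-- A function of the sample which does not depend on the signs. -/
def FlipInvariant {X : Type*} (w : Sample → X) : Prop := ∀ i d, w (flip i d) = w d

/-- A family of functions, each of them odd in the sign of its own index only. -/
def FlipOdd {E : Type*} [Neg E] (y : Sample → Idx → E) : Prop :=
  ∀ i j d, y (flip i d) j = if j = i then -y d j else y d j

theorem FlipOdd.mul {E : Type*} [Ring E] {y h : Sample → Idx → E} (hy : FlipOdd y)
    (hh : FlipInvariant h) : FlipOdd fun d j => y d j * h d j := fun i j d => by
  simp only [hy i j d, hh i d]; split_ifs <;> simp

theorem FlipOdd.sum_eq {E : Type*} [AddCommGroup E] {y : Sample → Idx → E} (hy : FlipOdd y) {A :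
    Finset Idx} {a : Idx} (ha : a ∉ A) (d : Sample) : ∑ j ∈ A, y (flip a d) j = ∑ j ∈ A, y d j :=
  sum_congr rfl fun j hj => by rw [hy, if_neg (by rintro rfl; exact ha hj)]

theorem FlipOdd.sq {y : Sample → Idx → ℝ} (hy : FlipOdd y) (j : Idx) :
    FlipInvariant fun d => y d j ^ 2 := fun i d => by
  simp only [hy i j d]; split_ifs <;> simp

theorem enorm_add_sq_add_neg (a b : ℂ) : ‖a + b‖ₑ ^ 2 + ‖-a + b‖ₑ ^ 2 = 2 * (‖a‖ₑ ^ 2 + ‖b‖ₑ ^ 2) :=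
    by
  have h := parallelogram_law_with_norm ℝ b a
  have h2 : ‖a + b‖ ^ 2 + ‖-a + b‖ ^ 2 = 2 * (‖a‖ ^ 2 + ‖b‖ ^ 2) := by
    rw [add_comm a, neg_add_eq_sub]; linarith
  simp only [← ofReal_norm]
  rw [← ofReal_pow (norm_nonneg _), ← ofReal_pow (norm_nonneg _),
    ← ofReal_pow (norm_nonneg _), ← ofReal_pow (norm_nonneg _),
    ← ofReal_add (by positivity) (by positivity), ← ofReal_add (by positivity)
    (by positivity), h2, ofReal_mul (by norm_num), ofReal_ofNat]

section Moments

variable (r : ℝ) [Fact (0 < r)] {w : Sample → ℝ≥0∞}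

/-- Signs are averaged out one at a time with `cosh y ≤ exp (y² / 2)`. The weight `w` absorbs the
factors already treated, which no longer depend on signs. -/
theorem lintegral_exp_sum_le (A : Finset Idx) (hw : Measurable w) (hwi : FlipInvariant w)
    {y : Sample → Idx → ℝ} (hym : ∀ j, Measurable fun d => y d j) (hy : FlipOdd y) :
    ∫⁻ d, w d * ofReal (exp (∑ j ∈ A, y d j)) ∂sampleLaw r
      ≤ ∫⁻ d, w d * ofReal (exp (∑ j ∈ A, y d j ^ 2 / 2)) ∂sampleLaw r := by
  classical
  induction A using induction_on generalizing w with
  | empty => simp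
  | insert a A ha ih =>
    have h1 : ∫⁻ d, w d * ofReal (exp (∑ j ∈ insert a A, y d j)) ∂sampleLaw r
        ≤ ∫⁻ d, (w d * ofReal (exp (y d a ^ 2 / 2)))
          * ofReal (exp (∑ j ∈ A, y d j)) ∂sampleLaw r := by
      refine lintegral_le_of_flip r a (by fun_prop) (by fun_prop) fun d => ?_
      simp only [sum_insert ha, hy.sum_eq ha, hy a a d, if_true, hwi a d, Real.exp_add]
      rw [← mul_add, ← ofReal_add (by positivity) (by positivity), ← add_mul, mul_assoc,
        mul_left_comm 2, ← ofReal_mul (by positivity), ← ofReal_ofNat 2,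
        ← ofReal_mul (by positivity)]
      gcongr w d * ofReal ?_
      have := Real.cosh_le_exp_half_sq (y d a)
      rw [Real.cosh_eq] at this
      nlinarith [exp_pos (∑ j ∈ A, y d j)]
    refine h1.trans ((ih (w := fun d => w d * ofReal (exp (y d a ^ 2 / 2)))
      (by fun_prop) fun i d => ?_).trans_eq (lintegral_congr fun d => ?_))
    · simp only [hwi i d]; congr 4; exact hy.sq a i d
    · rw [sum_insert ha, Real.exp_add, mul_assoc, ofReal_mul (by positivity)]

/-- The constant of the inequality for the moments of order `2 m`. -/
def khinchine (m : ℕ) : ℝ≥0∞ := ofReal ((2 * m).factorial * (2 * exp (1 / 2)))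

/-- Khinchine's inequality. Dividing by the root of the sum of squares, which is unaffected by
signs, reduces it to a normalised sum `z`; then `z ^ (2m) ≤ (2m)! (exp z + exp (-z))`, and each
exponential has mean at most `exp (1 / 2)`. -/
theorem lintegral_sum_pow_le (m : ℕ) (A : Finset Idx) (hw : Measurable w) (hwi : FlipInvariant w)
    {y : Sample → Idx → ℝ} (hym : ∀ j, Measurable fun d => y d j) (hy : FlipOdd y) :
    ∫⁻ d, w d * ofReal ((∑ j ∈ A, y d j) ^ (2 * m)) ∂sampleLaw r
      ≤ khinchine m * ∫⁻ d, w d * ofReal ((∑ j ∈ A, y d j ^ 2) ^ m) ∂sampleLaw r := by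
  set B : Sample → ℝ := fun d => ∑ j ∈ A, y d j ^ 2
  have hB0 d : 0 ≤ B d := sum_nonneg fun j _ => sq_nonneg _
  have hBm : Measurable B := by fun_prop
  have hBi : FlipInvariant B := fun i d => sum_congr rfl fun j _ => hy.sq j i d
  set w' : Sample → ℝ≥0∞ := fun d => w d * ofReal (B d ^ m)
  have hw' : Measurable w' := by fun_prop
  have hwi' : FlipInvariant w' := fun i d => by simp only [w', hwi i d, hBi i d]
  have hexp : ∀ s : ℝ, |s| = 1 → ∫⁻ d, w' d * ofReal
      (exp (∑ j ∈ A, y d j * (s * (√(B d))⁻¹))) ∂sampleLaw r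
      ≤ ofReal (exp (1 / 2)) * ∫⁻ d, w' d ∂sampleLaw r := by
    intro s hs
    refine (lintegral_exp_sum_le r A hw' hwi' (y := fun d j => y d j * (s * (√(B d))⁻¹))
      (fun j => by have := hym j; fun_prop) (hy.mul (h := fun d _ => s * (√(B d))⁻¹) fun i d => by
        funext j; simp only [hBi i d])).trans ?_
    rw [← lintegral_const_mul _ hw']
    refine lintegral_mono fun d => ?_
    rw [mul_comm]
    gcongr
    have : ∑ j ∈ A, (y d j * (s * (√(B d))⁻¹)) ^ 2 / 2 = s ^ 2 * (B d * (B d)⁻¹) / 2 := by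
      simp only [mul_pow, inv_pow, sq_sqrt (hB0 d)]
      rw [← Finset.sum_div, ← sum_mul]; ring
    rw [this, ← sq_abs, hs]
    have := mul_inv_le_one (a := B d)
    linarith
  have hpt d : w d * ofReal ((∑ j ∈ A, y d j) ^ (2 * m))
      ≤ ofReal ((2 * m).factorial) * (w' d * ofReal
        (exp (∑ j ∈ A, y d j * (1 * (√(B d))⁻¹))) + w' d * ofReal
        (exp (∑ j ∈ A, y d j * (-1 * (√(B d))⁻¹)))) := by
    set z := (∑ j ∈ A, y d j) * (√(B d))⁻¹
    have e1 : ∑ j ∈ A, y d j * (1 * (√(B d))⁻¹) = z := by rw [← sum_mul]; simp [z]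
    have e2 : ∑ j ∈ A, y d j * (-1 * (√(B d))⁻¹) = -z := by rw [← sum_mul]; simp [z]
    have hz : (∑ j ∈ A, y d j) ^ (2 * m) = B d ^ m * z ^ (2 * m) := by
      -- If the sum of squares vanishes then all terms do, and both sides agree; the exponent zero
      -- is treated apart because of `0 ^ 0 = 1`.
      rcases (hB0 d).eq_or_lt with h0 | h0
      · have hy0 : ∀ j ∈ A, y d j = 0 := fun j hj => by
          have := (Finset.sum_eq_zero_iff_of_nonneg fun j _ => sq_nonneg (y d j)).1 h0.symm j hj
          simpa using this
        rcases Nat.eq_zero_or_pos m with rfl | hm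
        · simp
        · rw [sum_eq_zero hy0, ← h0, zero_pow (by omega), zero_pow (by omega), zero_mul]
      · rw [pow_mul z, mul_pow, inv_pow, sq_sqrt h0.le, ← mul_pow, pow_mul]
        congr 1; field_simp
    rw [e1, e2, ← mul_add, ← ofReal_add (by positivity) (by positivity), hz]
    simp only [w']
    rw [mul_assoc (w d), mul_left_comm, ← ofReal_mul (pow_nonneg (hB0 d) m),
      ← ofReal_mul (by positivity)]
    gcongr w d * ?_
    refine ofReal_le_ofReal ?_
    have h1 := Real.pow_div_factorial_le_exp |z| (abs_nonneg z) (2 * m)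
    rw [div_le_iff₀ (by positivity), (even_two_mul m).pow_abs] at h1
    have h2 : exp |z| ≤ exp z + exp (-z) := by
      rcases abs_cases z with h | h <;> rw [h.1] <;> linarith [exp_pos z, exp_pos (-z)]
    have h3 := h1.trans (mul_le_mul_of_nonneg_right h2 (by positivity))
    calc B d ^ m * z ^ (2 * m) ≤ B d ^ m * ((exp z + exp (-z)) * (2 * m).factorial) :=
          mul_le_mul_of_nonneg_left h3 (pow_nonneg (hB0 d) m)
      _ = _ := by ring
  refine (lintegral_mono hpt).trans ?_
  have hm (s : ℝ) : Measurable fun d => w' d * ofReal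
      (exp (∑ j ∈ A, y d j * (s * (√(B d))⁻¹))) := by fun_prop
  rw [lintegral_const_mul _ (show Measurable fun d => _ + _ from (hm _).add (hm _)),
      lintegral_add_left (hm _)]
  refine (mul_le_mul_right (add_le_add (hexp 1 (by simp)) (hexp (-1) (by simp))) _).trans_eq ?_
  rw [khinchine, ofReal_mul (by positivity), ofReal_mul (by positivity)]
  simp only [w', ofReal_ofNat]
  ring

/-- The sum of the squares of the intensities. -/
def sqSum {E : Type*} [NormedAddCommGroup E] (A : Finset Idx) (ξ : Idx → E) : ℝ≥0∞ :=
  ∑ j ∈ A, ‖ξ j‖ₑ ^ 2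

/-- The Fourier coefficients of a finite sum of point masses. -/
def emp (ξ : Idx → ℝ) (A : Finset Idx) (x : Idx → Torus) (k : ℤ²) : ℂ :=
  ∑ j ∈ A, (ξ j : ℂ) * mFourier (-k) (x j)

/-- Hölder's inequality with weights `p`, that is Jensen's inequality for the power `m`, on finite
sums and then in the limit. -/
theorem tsum_mul_pow_le {ι : Type*} (p f : ι → ℝ≥0∞) (hm : 1 ≤ m) :
    (∑' i, p i * f i) ^ m ≤ (∑' i, p i) ^ (m - 1) * ∑' i, p i * f i ^ m := by
  have hm' : (1 : ℝ) ≤ m := by exact_mod_cast hm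
  refine le_of_tendsto' (ENNReal.Tendsto.pow (n := m) (ENNReal.summable (f := fun i => p i * f i)).hasSum)
    fun s => ?_
  have h := rpow_le_rpow (ENNReal.inner_le_weight_mul_Lp_of_nonneg s hm' p f)
    (by positivity : (0 : ℝ) ≤ m)
  rw [mul_rpow_of_nonneg _ _ (by positivity), ← rpow_mul, ← rpow_mul,
    inv_mul_cancel₀ (by positivity), ENNReal.rpow_one, sub_mul, one_mul,
    inv_mul_cancel₀ (by positivity), ← Nat.cast_one (R := ℝ), ← Nat.cast_sub hm] at h
  simp only [rpow_natCast] at h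
  refine h.trans ?_
  gcongr
  · exact sum_le_tsum s
  · exact sum_le_tsum (f := fun i => p i * f i ^ m) s

theorem lintegral_norm_emp_pow_le (hm : 1 ≤ m) (A : Finset Idx) (hw : Measurable w) (hwi :
    FlipInvariant w) {ξ : Sample → Idx → ℝ} (hξm : ∀ j, Measurable fun d => ξ d j) (hξ : FlipOdd ξ)
    (k : ℤ²) : ∫⁻ d, w d * (‖emp (ξ d) A (start d) k‖ₑ ^ 2) ^ m ∂sampleLaw r ≤ 2 ^ m *
    khinchine m * ∫⁻ d, w d * sqSum A (ξ d) ^ m ∂sampleLaw r := by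
  have hpart : ∀ h : Torus → ℝ, Measurable h → (∀ z, |h z| ≤ 1) →
      ∫⁻ d, w d * ofReal ((∑ j ∈ A, ξ d j * h (d j).2.2) ^ (2 * m)) ∂sampleLaw r
        ≤ khinchine m * ∫⁻ d, w d * sqSum A (ξ d) ^ m ∂sampleLaw r := by
    intro h hh hh1
    refine (lintegral_sum_pow_le r m A hw hwi (y := fun d j => ξ d j * h (d j).2.2)
      (fun j => (hξm j).mul (hh.comp (by fun_prop))) (hξ.mul (h := fun d j => h (d j).2.2)
        fun i d => ?_)).trans ?_
    · funext j
      by_cases hj : j = i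
      · subst hj; simp [flip]
      · simp [flip, update_of_ne hj]
    · gcongr with d
      rw [ofReal_pow (sum_nonneg fun j _ => sq_nonneg _),
        ENNReal.ofReal_sum_of_nonneg fun j _ => sq_nonneg _, sqSum]
      gcongr with j
      rw [← ofReal_norm, ← ofReal_pow (norm_nonneg _), mul_pow, norm_eq_abs, sq_abs]
      refine ofReal_le_ofReal (mul_le_of_le_one_right (sq_nonneg _) ?_)
      rw [← sq_abs]
      exact pow_le_one₀ (abs_nonneg _) (hh1 _)
  have hF : Continuous (mFourier (-k) : Torus → ℂ) := (mFourier (-k)).continuous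
  have h1 := hpart (fun z => (mFourier (-k) z).re) (by fun_prop)
    fun z => (abs_re_le_norm _).trans (norm_mFourier_apply _ z).le
  have h2 := hpart (fun z => (mFourier (-k) z).im) (by fun_prop)
    fun z => (Complex.abs_im_le_norm _).trans (norm_mFourier_apply _ z).le
  have hpt d : w d * (‖emp (ξ d) A (start d) k‖ₑ ^ 2) ^ m
      ≤ 2 ^ (m - 1) * (w d * ofReal ((∑ j ∈ A, ξ d j *
        (mFourier (-k) (d j).2.2).re) ^ (2 * m)) + w d * ofReal ((∑ j ∈ A, ξ d j *
        (mFourier (-k) (d j).2.2).im) ^ (2 * m))) := by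
    have hre : (emp (ξ d) A (start d) k).re
        = ∑ j ∈ A, ξ d j * (mFourier (-k) (d j).2.2).re := by simp [emp]
    have him : (emp (ξ d) A (start d) k).im
        = ∑ j ∈ A, ξ d j * (mFourier (-k) (d j).2.2).im := by simp [emp]
    rw [← ofReal_norm, ← ofReal_pow (norm_nonneg _), Complex.sq_norm, Complex.normSq_apply, hre,
      him, ← mul_add, mul_left_comm, ← ofReal_add (by rw [pow_mul]; positivity)
      (by rw [pow_mul]; positivity), ← ofReal_pow (by nlinarith)]
    gcongr w d * ?_
    rw [← ofReal_ofNat 2, ← ofReal_pow (by norm_num), ← ofReal_mul (by positivity)]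
    refine ofReal_le_ofReal ?_
    rw [pow_mul, pow_mul, ← sq, ← sq]
    exact add_pow_le (sq_nonneg _) (sq_nonneg _) m
  refine (lintegral_mono hpt).trans ?_
  have hm1 : ∀ h : Torus → ℝ, Measurable h → Measurable fun d : Sample =>
      w d * ofReal ((∑ j ∈ A, ξ d j * h (d j).2.2) ^ (2 * m)) := fun h hh => by fun_prop
  have hre := hm1 (fun z => (mFourier (-k) z).re) (by fun_prop)
  have him := hm1 (fun z => (mFourier (-k) z).im) (by fun_prop)
  rw [lintegral_const_mul _ (show Measurable fun d => _ + _ from hre.add him), lintegral_add_left hre]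
  refine (mul_le_mul_right (add_le_add h1 h2) _).trans ?_
  obtain ⟨m, rfl⟩ := Nat.exists_eq_add_of_le' hm
  rw [← two_mul, ← mul_assoc, ← mul_assoc, Nat.add_sub_cancel, pow_succ]

theorem measurable_emp (A : Finset Idx) {ξ : X → Idx → ℝ} (hξ : ∀ j, Measurable fun d => ξ d j) {x :
    X → Idx → Torus} (hx : ∀ j, Measurable fun d => x d j) (k : ℤ²) : Measurable fun d => emp (ξ d)
    A (x d) k :=
  Finset.measurable_fun_sum _ fun j _ => (Complex.measurable_ofReal.comp (hξ j)).mul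
    ((mFourier (-k)).continuous.measurable.comp (hx j))

theorem measurable_sqSum (A : Finset Idx) {ξ : X → Idx → ℝ}
    (hξ : ∀ j, Measurable fun d => ξ d j) : Measurable fun d => sqSum A (ξ d) :=
  Finset.measurable_fun_sum _ fun j _ => (hξ j).enorm.pow_const 2

/-- The constant of the inequality for the moments of the Sobolev norm. -/
def empConst (α : ℝ) (m : ℕ) : ℝ≥0∞ := (∑' k, ofReal (weight α k ^ 2)) ^ m * (2 ^ m * khinchine m)

theorem empConst_ne_top (hα : α < -1) (m : ℕ) : empConst α m ≠ ∞ :=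
  mul_ne_top (pow_ne_top (tsum_weight_sq_ne_top hα)) (mul_ne_top (by simp) ofReal_ne_top)

theorem lintegral_energy_emp_pow_le (α : ℝ) (hm : 1 ≤ m) (A : Finset Idx) (hw : Measurable w) (hwi :
    FlipInvariant w) {ξ : Sample → Idx → ℝ} (hξm : ∀ j, Measurable fun d => ξ d j) (hξ : FlipOdd ξ)
    : ∫⁻ d, w d * energy α (emp (ξ d) A start d) ^ m ∂sampleLaw r ≤ empConst α m * ∫⁻ d,
    w d * sqSum A (ξ d) ^ m ∂sampleLaw r := by
  set p : ℤ² → ℝ≥0∞ := fun k => ofReal (weight α k ^ 2)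
  have hem k : Measurable fun d : Sample => emp (ξ d) A (start d) k :=
    measurable_emp A hξm (fun j => by fun_prop) k
  have hkm k : Measurable fun d : Sample => w d * (‖emp (ξ d) A (start d) k‖ₑ ^ 2) ^ m := hw.mul
      (((hem k).enorm.pow_const 2).pow_const m)
  calc ∫⁻ d, w d * energy α (emp (ξ d) A start d) ^ m ∂sampleLaw r
      ≤ ∫⁻ d, (∑' k, p k) ^ (m - 1) * ∑' k, p k *
        (w d * (‖emp (ξ d) A (start d) k‖ₑ ^ 2) ^ m) ∂sampleLaw r := by
        refine lintegral_mono fun d => ?_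
        simp only [mul_left_comm _ (w d)]
        rw [ENNReal.tsum_mul_left, mul_left_comm]
        gcongr
        exact tsum_mul_pow_le p _ hm
    _ = (∑' k, p k) ^ (m - 1) * ∑' k, p k * ∫⁻ d, w d *
        (‖emp (ξ d) A (start d) k‖ₑ ^ 2) ^ m ∂sampleLaw r := by
        rw [lintegral_const_mul _ (Measurable.tsum fun k => (hkm k).const_mul _),
          lintegral_tsum fun k => ((hkm k).const_mul _).aemeasurable]
        simp only [lintegral_const_mul _ (hkm _)]
    _ ≤ (∑' k, p k) ^ (m - 1) * ∑' k, p k * (2 ^ m * khinchine m *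
        ∫⁻ d, w d * sqSum A (ξ d) ^ m ∂sampleLaw r) := by
        gcongr with k
        exact lintegral_norm_emp_pow_le r hm A hw hwi hξm hξ k
    _ = _ := by
        rw [ENNReal.tsum_mul_right, empConst, ← mul_assoc, ← pow_succ, Nat.sub_add_cancel hm, mul_assoc,
          mul_assoc, mul_assoc]

/-- Terms that are odd in different signs are orthogonal; the parallelogram law removes the cross
terms one index at a time. -/
theorem lintegral_norm_sum_sq_le (A : Finset Idx) (hw : Measurable w) (hwi : FlipInvariant w)
    {y : Sample → Idx → ℂ} (hym : ∀ j, Measurable fun d => y d j) (hy : FlipOdd y) :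
    ∫⁻ d, w d * ‖∑ j ∈ A, y d j‖ₑ ^ 2 ∂sampleLaw r ≤ ∫⁻ d, w d * sqSum A (y d) ∂sampleLaw r := by
  classical
  induction A using induction_on with
  | empty => simp [sqSum]
  | insert a A ha ih =>
    have h1 : Measurable fun d => w d * ‖y d a‖ₑ ^ 2 := by fun_prop
    calc _ ≤ ∫⁻ d, (w d * ‖y d a‖ₑ ^ 2 + w d * ‖∑ j ∈ A, y d j‖ₑ ^ 2) ∂sampleLaw r := by
          refine lintegral_le_of_flip r a (by fun_prop) (by fun_prop) fun d => ?_
          simp only [sum_insert ha, hy.sum_eq ha, hy a a d, if_true, hwi a d]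
          rw [← mul_add, ← mul_add, mul_left_comm, enorm_add_sq_add_neg]
      _ ≤ ∫⁻ d, w d * ‖y d a‖ₑ ^ 2 ∂sampleLaw r + ∫⁻ d, w d * sqSum A (y d) ∂sampleLaw r := by
          rw [lintegral_add_left h1]; gcongr
      _ = _ := by
          rw [← lintegral_add_left h1]
          simp only [sqSum, sum_insert ha, mul_add]

/-- In the part of the sum containing a new index the sign of that index factors out, while the rest
does not involve it, so the two are orthogonal. Conditionally the new part is linear in the other
signs. The factor `2 * h` bounds `H d a j + H d j a`. -/
theorem lintegral_norm_quad_sq_le (A : Finset Idx) (hw : Measurable w) (hwi : FlipInvariant w) {ξ :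
    Sample → Idx → ℝ} (hξm : ∀ j, Measurable fun d => ξ d j) (hξ : FlipOdd ξ) {H : Sample → Idx →
    Idx → ℂ} (hHm : ∀ i j, Measurable fun d => H d i j) (hH : FlipInvariant H) {h : ℝ≥0∞} (hh : ∀ d
    i j, ‖H d i j‖ₑ ≤ h) : ∫⁻ d, w d * ‖∑ p ∈ A.offDiag, (ξ d p.1 : ℂ) * ξ d p.2 * H d p.1 p.2‖ₑ ^ 2
    ∂sampleLaw r ≤ (2 * h) ^ 2 * ∫⁻ d, w d * sqSum A (ξ d) ^ 2 ∂sampleLaw r := by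
  classical
  induction A using induction_on with
  | empty => simp
  | insert a A ha ih =>
    set Q : Sample → ℂ := fun d => ∑ p ∈ A.offDiag, (ξ d p.1 : ℂ) * ξ d p.2 * H d p.1 p.2
    set y : Sample → Idx → ℂ := fun d j => (ξ d j : ℂ) * (H d a j + H d j a)
    have hc : FlipOdd fun d j => (ξ d j : ℂ) := fun i j d => by
      simp only [hξ i j d]; split_ifs <;> simp
    have hy : FlipOdd y := hc.mul (h := fun d j => H d a j + H d j a) fun i d => by
      funext j; simp only [hH i d]
    have hym j : Measurable fun d => y d j := by fun_prop
    have hQm : Measurable Q := by fun_prop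
    have hQi d : Q (flip a d) = Q d := sum_congr rfl fun p hp => by
      have hp' := Finset.mem_offDiag.1 hp
      rw [hξ, hξ, if_neg (by rintro h; exact ha (h ▸ hp'.1)), if_neg (by rintro h; exact ha (h ▸ hp'.2.1)),
        hH a d]
    have hsplit : ∀ d, ∑ p ∈ (insert a A).offDiag, (ξ d p.1 : ℂ) * ξ d p.2 * H d p.1 p.2
        = ξ d a * ∑ j ∈ A, y d j + Q d := by
      intro d
      have h1 (B : Finset Idx) : ∑ p ∈ B.offDiag, (ξ d p.1 : ℂ) * ξ d p.2 * H d p.1 p.2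
          = ∑ i ∈ B, ∑ j ∈ B, if i = j then 0 else (ξ d i : ℂ) * ξ d j * H d i j := by
        have e : B.offDiag = (B ×ˢ B).filter fun p => ¬ p.1 = p.2 := by ext p; simp [and_assoc]
        rw [e, Finset.sum_filter, sum_product]
        refine sum_congr rfl fun i _ => sum_congr rfl fun j _ => ?_
        split_ifs <;> rfl
      have h2 : ∀ j ∈ A, j ≠ a := fun j hj => by rintro rfl; exact ha hj
      simp only [Q, h1, sum_insert ha, if_true, zero_add, sum_add_distrib, ← add_assoc]
      congr 1
      rw [mul_sum, ← sum_add_distrib]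
      refine sum_congr rfl fun j hj => ?_
      rw [if_neg (h2 j hj).symm, if_neg (h2 j hj)]
      simp only [y]; ring
    have hL : ∫⁻ d, (w d * ‖ξ d a‖ₑ ^ 2) * ‖∑ j ∈ A, y d j‖ₑ ^ 2 ∂sampleLaw r
        ≤ (2 * h) ^ 2 * ∫⁻ d, (w d * ‖ξ d a‖ₑ ^ 2) * sqSum A (ξ d) ∂sampleLaw r := by
      have hwm : Measurable fun d => w d * ‖ξ d a‖ₑ ^ 2 := by have := hξm a; fun_prop
      refine (lintegral_norm_sum_sq_le r A hwm (fun i d => ?_) hym hy).trans ?_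
      · simp only [hwi i d, hξ i a d]; split_ifs <;> simp
      · rw [← lintegral_const_mul _ (show Measurable fun d => _ * _ from hwm.mul (measurable_sqSum A hξm))]
        refine lintegral_mono fun d => ?_
        rw [mul_left_comm]
        gcongr w d * ‖ξ d a‖ₑ ^ 2 * ?_
        rw [sqSum, sqSum, mul_sum]
        refine sum_le_sum fun j _ => ?_
        rw [← mul_pow]
        gcongr
        rw [enorm_mul, mul_comm, ← ofReal_norm (ξ d j : ℂ), norm_real, ofReal_norm]
        gcongr
        rw [two_mul]
        exact (enorm_add_le _ _).trans (add_le_add (hh d a j) (hh d j a))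
    calc _ ≤ ∫⁻ d, ((w d * ‖ξ d a‖ₑ ^ 2) * ‖∑ j ∈ A, y d j‖ₑ ^ 2 + w d * ‖Q d‖ₑ ^ 2) ∂sampleLaw r := by
          simp only [hsplit]
          refine lintegral_le_of_flip r a (by fun_prop) (by fun_prop) fun d => ?_
          simp only [hy.sum_eq ha, hξ a a d, if_true, hwi a d, hQi, ofReal_neg, neg_mul]
          rw [← mul_add, enorm_add_sq_add_neg, mul_assoc, ← mul_add, mul_left_comm, enorm_mul, mul_pow,
            ← ofReal_norm (ξ d a : ℂ), norm_real, ofReal_norm]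
      _ ≤ (2 * h) ^ 2 * ∫⁻ d, (w d * ‖ξ d a‖ₑ ^ 2) * sqSum A (ξ d) ∂sampleLaw r
          + (2 * h) ^ 2 * ∫⁻ d, w d * sqSum A (ξ d) ^ 2 ∂sampleLaw r := by
          rw [lintegral_add_right _ (by fun_prop)]; gcongr
      _ ≤ _ := by
          have hs := measurable_sqSum A hξm
          rw [← mul_add, ← lintegral_add_right _ (by fun_prop)]
          gcongr with d
          rw [mul_assoc, ← mul_add]
          gcongr
          -- Both parts fit into one square: `x * S + S² ≤ (x + S)²`.
          rw [sqSum, sqSum, sum_insert ha, sq (‖ξ d a‖ₑ ^ 2 + _), add_mul, sq (∑ j ∈ A, _)]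
          gcongr <;> simp

end Moments

/-! ### Compact sets of paths -/

section Compactness

variable {T : ℝ} {S : Type*} [PseudoMetricSpace S]

/-- Continuous paths with values in `Q` and dyadic modulus of continuity `ε`. -/
def modSet (Q : Set S) (ε : ℕ → ℝ≥0∞) : Set C(Icc 0 T, S) :=
  {g | (∀ t, g t ∈ Q) ∧ ∀ l s t, dist s t ≤ T / 2 ^ l → edist (g s) (g t) ≤ ε l}

/-- An Arzelà–Ascoli argument along an ultrafilter: pointwise limits exist in the compact set `Q`,
the modulus passes to the limit, and a finite net makes the convergence uniform. The paths may be
discontinuous, provided that their excess `η` over the modulus vanishes along the ultrafilter. -/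
theorem exists_limit_of_modulus (hT : 0 < T) {α : Type*} (F : Ultrafilter α) (φ : α → Icc 0 T
    → S) {Q : Set S} (hQ : IsCompact Q) {ε : ℕ → ℝ≥0∞} (hε : Tendsto ε atTop (𝓝 0)) (hQF : ∀ᶠ a in
    F, ∀ t, φ a t ∈ Q) (hmod : ∀ l, ∀ η > 0, ∀ᶠ a in F, ∀ s t, dist s t ≤ T / 2 ^ l → edist (φ a s)
    (φ a t) ≤ ε l + η) : ∃ g ∈ modSet (T := T) Q ε, ∀ η > 0, ∀ᶠ a in F, ∀ t, edist (φ a t) (g t) ≤ η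
    := by
  have hlim t : ∃ x ∈ Q, Tendsto (fun a => φ a t) F (𝓝 x) :=
    isCompact_iff_ultrafilter_le_nhds.1 hQ (F.map fun a => φ a t)
      (le_principal_iff.2 (hQF.mono fun a h => h t))
  choose g hgQ hg using hlim
  have hgm : ∀ l s t, dist s t ≤ T / 2 ^ l → edist (g s) (g t) ≤ ε l := fun l s t hst =>
    le_of_forall_gt_imp_ge_of_dense fun b hb => by
      obtain ⟨η, hη, hb'⟩ := ENNReal.lt_iff_exists_add_pos_lt.1 hb
      refine le_of_tendsto ((hg s).edist (hg t)) ?_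
      filter_upwards [hmod l η (by exact_mod_cast hη)] with a ha
      exact (ha s t hst).trans hb'.le
  have hgc : Continuous g := by
    refine continuous_iff_continuousAt.2 fun t => EMetric.tendsto_nhds.2 fun e he => ?_
    obtain ⟨l, hl⟩ := (hε.eventually_lt_const he).exists
    filter_upwards [Metric.closedBall_mem_nhds t (by positivity : 0 < T / 2 ^ l)] with s hs
    exact (hgm l s t hs).trans_lt hl
  refine ⟨⟨g, hgc⟩, ⟨hgQ, hgm⟩, fun η hη => ?_⟩
  have hη' : 0 < η / 4 := ENNReal.div_pos hη.ne' (by simp)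
  obtain ⟨l, hl⟩ := (hε.eventually_le_const hη').exists
  obtain ⟨A, -, hA, hcov⟩ := (isCompact_univ (X := Icc 0 T)).finite_cover_balls
    (by positivity : 0 < T / 2 ^ l)
  have hfin : ∀ᶠ a in F, ∀ s ∈ A, edist (φ a s) (g s) ≤ η / 4 :=
    (eventually_all_finite hA).2 fun s _ => by
      have := (hg s).edist (tendsto_const_nhds (x := g s))
      rw [edist_self] at this
      exact this.eventually_le_const hη'
  filter_upwards [hfin, hmod l _ hη'] with a h1 h2 t
  obtain ⟨s, hs, hst⟩ := mem_iUnion₂.1 (hcov (mem_univ t))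
  have hst' : dist t s ≤ T / 2 ^ l := (Metric.mem_ball.1 hst).le
  calc edist (φ a t) (g t) ≤ edist (φ a t) (φ a s) + edist (φ a s) (g s) + edist (g s) (g t) :=
        edist_triangle4 _ _ _ _
    _ ≤ (η / 4 + η / 4) + η / 4 + η / 4 := by
        gcongr
        · exact (h2 t s hst').trans (by gcongr)
        · exact h1 s hs
        · exact (hgm l s t (by rwa [dist_comm])).trans hl
    _ = η := by
        rw [← two_mul, add_assoc, ← two_mul, ← two_mul, ← mul_assoc]
        norm_num
        exact ENNReal.mul_div_cancel (by simp) (by simp)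

theorem isCompact_modSet (hT : 0 < T) {Q : Set S} (hQ : IsCompact Q) {ε : ℕ → ℝ≥0∞}
    (hε : Tendsto ε atTop (𝓝 0)) : IsCompact (modSet (T := T) Q ε) := by
  refine isCompact_iff_ultrafilter_le_nhds.2 fun F hF => ?_
  have hF' : ∀ᶠ g in F, g ∈ modSet (T := T) Q ε := le_principal_iff.1 hF
  obtain ⟨g, hg, h⟩ := exists_limit_of_modulus hT F (fun g t => g t) hQ hε (hF'.mono fun g h => h.1)
    fun l η _ => hF'.mono fun g h s t hst => (h.2 l s t hst).trans le_self_add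
  refine ⟨g, hg, ?_⟩
  refine (Metric.nhds_basis_closedBall.ge_iff).2 fun e he => ?_
  filter_upwards [h (ofReal e) (by simpa using he)] with f hf
  exact (ContinuousMap.dist_le he.le).2 fun t => (edist_le_ofReal he.le).1 (hf t)

/-- An ultrafilter on the union of the `K n` either contains one of them or escapes to large `n`. In
the second case the excess `η n` disappears and the limit is a continuous path, so adding the
compact set of continuous paths with modulus `ε` makes the union compact. -/
theorem exists_isCompact_of_modulus (hT : 0 < T) {Q : Set S} (hQ : IsCompact Q) {ε η : ℕ → ℝ≥0∞} (hε
    : Tendsto ε atTop (𝓝 0)) (hη : Tendsto η atTop (𝓝 0)) {K : ℕ → Set (Cadlag T S)} (hK : ∀ n,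
    IsCompact (K n)) (h : ∀ᶠ n in atTop, ∀ f ∈ K n, (∀ t, f t ∈ Q) ∧ ∀ l s t, dist s t ≤ T / 2 ^ l →
    edist (f s) (f t) ≤ ε l + η n) : ∃ K' : Set (Cadlag T S), IsCompact K' ∧ ∀ n, K n ⊆ K' := by
  have hc := (isCompact_modSet hT hQ hε).image Cadlag.continuous_ofContinuous
  refine ⟨Cadlag.ofContinuous '' modSet Q ε ∪ ⋃ n, K n, isCompact_iff_ultrafilter_le_nhds.2
    fun F hF => ?_, fun n => (subset_iUnion K n).trans subset_union_right⟩
  rcases Ultrafilter.union_mem_iff.1 (le_principal_iff.1 hF) with h0 | h0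
  · obtain ⟨g, hg, hle⟩ := isCompact_iff_ultrafilter_le_nhds.1 hc F (le_principal_iff.2 h0)
    exact ⟨g, .inl hg, hle⟩
  by_cases hn : ∃ n, K n ∈ F
  · obtain ⟨n, hn⟩ := hn
    obtain ⟨g, hg, hle⟩ := isCompact_iff_ultrafilter_le_nhds.1 (hK n) F (le_principal_iff.2 hn)
    exact ⟨g, .inr (mem_iUnion.2 ⟨n, hg⟩), hle⟩
  push Not at hn
  have htail : ∀ m, ∀ᶠ f in F, ∃ n, m ≤ n ∧ f ∈ K n := by
    intro m
    have h1 : ∀ᶠ f in F, ∀ n ∈ range m, f ∉ K n :=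
      (range m).eventually_all.2 fun n _ => Ultrafilter.compl_mem_iff_notMem.2 (hn n)
    filter_upwards [h1, h0] with f hf hf0
    obtain ⟨n, hfn⟩ := mem_iUnion.1 hf0
    exact ⟨n, not_lt.1 fun hlt => hf n (Finset.mem_range.2 hlt) hfn, hfn⟩
  obtain ⟨m, hm⟩ := eventually_atTop.1 h
  obtain ⟨g, hg, hlim⟩ := exists_limit_of_modulus hT F (fun f t => f t) hQ hε
    ((htail m).mono fun f ⟨n, hn, hf⟩ => (hm n hn f hf).1) fun l e he => by
      obtain ⟨m', hm'⟩ := eventually_atTop.1 (hη.eventually_le_const he)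
      filter_upwards [htail (max m m')] with f ⟨n, hn, hf⟩ s t hst
      exact ((hm n (le_of_max_le_left hn) f hf).2 l s t hst).trans
        (by gcongr; exact hm' n (le_of_max_le_right hn))
  refine ⟨Cadlag.ofContinuous g, .inl ⟨g, hg, rfl⟩, ?_⟩
  refine Metric.nhds_basis_closedEBall.ge_iff.2 fun e he => ?_
  filter_upwards [hlim e he] with f hf
  exact Cadlag.edist_le_of_forall hf

end Compactness

/-- Chaining along dyadic partitions. -/
theorem edist_le_of_dyadic {E : Type*} [PseudoEMetricSpace E] (hT : 0 < T) (f : ℝ → E) (L : ℕ) (D :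
    ℕ → ℝ≥0∞) {η : ℝ≥0∞} (hD : ∀ l ≤ L, ∀ j : ℕ, j < 2 ^ l → edist (f (j * (T / 2 ^ l))) (f ((j + 1
    : ℕ) * (T / 2 ^ l))) ≤ D l) (hη : ∀ j : ℕ, j < 2 ^ L → ∀ t ∈ Icc (j * (T / 2 ^ L)) ((j + 1 : ℕ)
    * (T / 2 ^ L)), edist (f t) (f (j * (T / 2 ^ L))) ≤ η) (l : ℕ) (hs : s ∈ Icc 0 T) (ht : t ∈ Icc
    0 T) (hst : |s - t| ≤ T / 2 ^ l) : edist (f s) (f t) ≤ 2 * ∑' m, D (l + m) + 3 * η := by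
  wlog hle : s ≤ t generalizing s t
  · rw [edist_comm]; exact this ht hs (by rwa [abs_sub_comm]) (le_of_not_ge hle)
  have hst' : t - s ≤ T / 2 ^ l := by rwa [abs_sub_comm, abs_of_nonneg (by linarith)] at hst
  set n : ℕ → ℝ → ℕ := fun m s => ⌊s / (T / 2 ^ m)⌋₊
  have hh (m : ℕ) : 0 < T / 2 ^ m := by positivity
  have hn1 : ∀ m, ∀ s ∈ Icc 0 T, n m s * (T / 2 ^ m) ≤ s := fun m s hs => by
    rw [← le_div_iff₀ (hh m)]; exact Nat.floor_le (div_nonneg hs.1 (hh m).le)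
  have hn2 : ∀ m, ∀ s ∈ Icc 0 T, s ≤ (n m s + 1 : ℕ) * (T / 2 ^ m) := fun m s hs => by
    rw [← div_le_iff₀ (hh m)]; push_cast; exact (Nat.lt_floor_add_one _).le
  have hnle : ∀ m, ∀ s ∈ Icc 0 T, n m s ≤ 2 ^ m := fun m s hs => by
    have h1 := (hn1 m s hs).trans hs.2
    rw [mul_div_assoc', div_le_iff₀ (by positivity), mul_comm T] at h1
    exact_mod_cast le_of_mul_le_mul_right h1 hT
  have hhalf m s : n m s = n (m + 1) s / 2 := by
    simp only [n]
    rw [← Nat.floor_div_ofNat]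
    congr 1
    rw [pow_succ]; field_simp
  -- the last partition
  have hlast : ∀ s ∈ Icc 0 T, edist (f s) (f (n L s * (T / 2 ^ L))) ≤ η := by
    intro s hs
    rcases (hnle L s hs).lt_or_eq with h | h
    · exact hη _ h s ⟨hn1 L s hs, hn2 L s hs⟩
    · have : s = n L s * (T / 2 ^ L) := by
        refine le_antisymm ?_ (hn1 L s hs)
        rw [h]; push_cast; field_simp; exact hs.2
      rw [← this, edist_self]; exact zero_le
  have hchain : ∀ s ∈ Icc 0 T, ∀ p, l + p = L →
      edist (f (n l s * (T / 2 ^ l))) (f (n L s * (T / 2 ^ L))) ≤ ∑ m ∈ range p, D (l + (m + 1)) := by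
    intro s hs p
    suffices ∀ p, l + p ≤ L → edist (f (n l s * (T / 2 ^ l))) (f (n (l + p) s * (T / 2 ^ (l + p))))
        ≤ ∑ m ∈ range p, D (l + (m + 1)) by
      rintro rfl; exact this p le_rfl
    intro p
    induction p with
    | zero => simp
    | succ p ih =>
      intro hp
      rw [sum_range_succ]
      refine (edist_triangle _ _ _).trans (add_le_add (ih (by omega)) ?_)
      have e := hhalf (l + p) s
      have e2 : (n (l + p) s : ℝ) * (T / 2 ^ (l + p))
          = (2 * n (l + p) s : ℕ) * (T / 2 ^ (l + p + 1)) := by push_cast; rw [pow_succ]; field_simp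
      rw [e2, ← add_assoc]
      rcases Nat.mod_two_eq_zero_or_one (n (l + p + 1) s) with h | h
      · rw [show 2 * n (l + p) s = n (l + p + 1) s by omega, edist_self]; exact zero_le
      · have hle := hnle (l + p + 1) s hs
        have := hD (l + p + 1) (by omega) (2 * n (l + p) s) (by rw [pow_succ] at hle ⊢; omega)
        rwa [show 2 * n (l + p) s + 1 = n (l + p + 1) s by omega] at this
  have hadj : ∀ m, t - s ≤ T / 2 ^ m → n m t = n m s ∨ (n m t = n m s + 1 ∧ n m s < 2 ^ m) := by
    intro m hm
    have h1 : n m s ≤ n m t := Nat.floor_mono (div_le_div_of_nonneg_right hle (hh m).le)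
    have h2 : n m t ≤ n m s + 1 := by
      have : n m t < n m s + 1 + 1 := by
        refine (Nat.floor_lt (div_nonneg ht.1 (hh m).le)).2 ?_
        have h3 : t / (T / 2 ^ m) ≤ s / (T / 2 ^ m) + 1 := by
          rw [div_add_one (hh m).ne']
          exact div_le_div_of_nonneg_right (by linarith) (hh m).le
        have : s / (T / 2 ^ m) < n m s + 1 := Nat.lt_floor_add_one _
        push_cast; linarith
      omega
    have h3 := hnle m t ht
    omega
  have hmain : ∀ m, t - s ≤ T / 2 ^ m → ∀ d, (∀ j : ℕ, j < 2 ^ m → edist (f (j * (T / 2 ^ m)))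
      (f ((j + 1 : ℕ) * (T / 2 ^ m))) ≤ d) → edist (f (n m s * (T / 2 ^ m))) (f (n m t * (T / 2 ^
          m))) ≤ d := by
    intro m hm d hd
    rcases hadj m hm with h | ⟨h, h'⟩
    · rw [h, edist_self]; exact zero_le
    · rw [h]; exact hd _ h'
  rcases le_or_gt l L with hl | hl
  · obtain ⟨p, hp⟩ := Nat.exists_eq_add_of_le hl
    have hsum : D l + ∑ m ∈ range p, D (l + (m + 1)) ≤ ∑' m, D (l + m) := by
      rw [add_comm]
      refine (Finset.sum_range_succ' (fun m => D (l + m)) p).symm.le.trans ?_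
      exact sum_le_tsum _
    have a1 := hlast s hs
    have a2 := hlast t ht
    have b1 := hchain s hs p hp.symm
    have b2 := hchain t ht p hp.symm
    have c1 := hmain l hst' (D l) (hD l hl)
    rw [edist_comm] at a2 b1
    calc edist (f s) (f t) ≤ η + (∑ m ∈ range p, D (l + (m + 1)) + (D l
          + (∑ m ∈ range p, D (l + (m + 1)) + η))) :=
        (edist_triangle _ _ _).trans (add_le_add a1 ((edist_triangle _ _ _).trans (add_le_add b1
          ((edist_triangle _ _ _).trans (add_le_add c1 ((edist_triangle _ _ _).trans
            (add_le_add b2 a2)))))))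
      _ = (D l + ∑ m ∈ range p, D (l + (m + 1))) + ∑ m ∈ range p, D (l + (m + 1)) + 2 * η := by
        ring
      _ ≤ ∑' m, D (l + m) + ∑' m, D (l + m) + 3 * η := by
        gcongr
        · exact le_add_self.trans hsum
        · norm_num
      _ = _ := by rw [two_mul]
  -- Below the finest resolved scale the two points lie in the same cell or in adjacent ones, so
  -- three steps of size `η` are enough.
  · have hstL : t - s ≤ T / 2 ^ L := hst'.trans (by gcongr; norm_num)
    have c1 := hmain L hstL η fun j hj => by
      rw [edist_comm]
      exact hη j hj _ ⟨by gcongr; simp, le_rfl⟩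
    have a2 := hlast t ht
    rw [edist_comm] at a2
    calc edist (f s) (f t) ≤ η + (η + η) := (edist_triangle _ _ _).trans (add_le_add (hlast s hs)
          ((edist_triangle _ _ _).trans (add_le_add c1 a2)))
      _ = 3 * η := by ring
      _ ≤ _ := le_add_self

/-! ### The jumps -/

/-- The phase `2 π k · u`. -/
def phase (k : ℤ²) (u : ℝ²) : ℝ := 2 * π * (k 0 * u 0 + k 1 * u 1)

theorem abs_phase_sq_le (k : ℤ²) (u : ℝ²) :
    phase k u ^ 2 ≤ 8 * π ^ 2 * (1 + freqSq k) * ‖u‖ ^ 2 := by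
  have h l : u l ^ 2 ≤ ‖u‖ ^ 2 := by
    rw [← sq_abs]; exact pow_le_pow_left₀ (abs_nonneg _) (norm_le_pi_norm u l) 2
  have h1 : (k 0 * u 0 + k 1 * u 1) ^ 2 ≤ ((k 0 : ℝ) ^ 2 + (k 1 : ℝ) ^ 2) * (u 0 ^ 2 + u 1 ^ 2) := by
    nlinarith [sq_nonneg ((k 0 : ℝ) * u 1 - k 1 * u 0)]
  have h2 : (k 0 * u 0 + k 1 * u 1) ^ 2 ≤ (1 + freqSq k) * (2 * ‖u‖ ^ 2) := by
    refine h1.trans (mul_le_mul (by unfold freqSq; linarith) (by linarith [h 0, h 1]) (by positivity)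
      (one_add_freqSq_pos k).le)
  calc phase k u ^ 2 = 4 * π ^ 2 * (k 0 * u 0 + k 1 * u 1) ^ 2 := by unfold phase; ring
    _ ≤ 4 * π ^ 2 * ((1 + freqSq k) * (2 * ‖u‖ ^ 2)) := by gcongr
    _ = _ := by ring

theorem mFourier_add_toTorus (k : ℤ²) (x : Torus) (u : ℝ²) :
    mFourier k (x + toTorus u) = mFourier k x * Complex.exp (I * phase k u) := by
  obtain ⟨v, rfl, -⟩ := exists_toTorus_eq x
  rw [← toTorus_add, mFourier_toTorus, mFourier_toTorus, ← exp_add, ← exp_add, ← exp_add]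
  congr 1
  simp only [phase, Pi.add_apply]; push_cast; ring

theorem norm_mFourier_sub_sq_le (k : ℤ²) (x y : Torus) :
    ‖mFourier k x - mFourier k y‖ ^ 2 ≤ 8 * π ^ 2 * (1 + freqSq k) * ‖x - y‖ ^ 2 := by
  obtain ⟨u, hu, -, hn⟩ := exists_toTorus_eq (x - y)
  have hx : x = y + toTorus u := by rw [hu]; abel
  have h := Real.norm_exp_I_mul_ofReal_sub_one_le (x := phase k u)
  rw [hn, hx, mFourier_add_toTorus, ← mul_sub_one, norm_mul, norm_mFourier_apply, one_mul]
  refine (pow_le_pow_left₀ (norm_nonneg _) h 2).trans ?_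
  rw [norm_eq_abs, sq_abs]
  exact abs_phase_sq_le k u

theorem ofReal_weight_sq_mul (α : ℝ) (k : ℤ²) :
    ofReal (weight α k ^ 2) * ofReal (1 + freqSq k) = ofReal (weight (α + 1) k ^ 2) := by
  rw [← ofReal_mul (sq_nonneg _), weight_sq, weight_sq, rpow_add (one_add_freqSq_pos k), rpow_one]

/-- Characters are Lipschitz with constant of order `(1 + |k|²)^(1/2)`, which raises the exponent of
the weight by one; hence `α + 1 < -1` is needed. -/
theorem continuous_dirac (hα : α < -2) : Continuous (dirac α (by linarith)) := by
  set C : ℝ≥0∞ := ofReal (8 * π ^ 2) * ∑' k, ofReal (weight (α + 1) k ^ 2)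
  have hC : C ≠ ∞ := mul_ne_top ofReal_ne_top (tsum_weight_sq_ne_top (by linarith))
  have h : ∀ x y, edist (dirac α (by linarith) x) (dirac α (by linarith) y) ^ 2 ≤ C * edist x y ^ 2 := by
    intro x y
    rw [edist_sq_eq_energy, energy, mul_assoc, ← ENNReal.tsum_mul_right, ← ENNReal.tsum_mul_left]
    refine tsum_le_tsum fun k => ?_
    have h1 := ofReal_le_ofReal (norm_mFourier_sub_sq_le (-k) x y)
    rw [ofReal_mul (by have := one_add_freqSq_pos (-k); positivity),
      ofReal_mul (by positivity), ofReal_pow (norm_nonneg _),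
      ofReal_pow (norm_nonneg _), ofReal_norm, ofReal_norm, ← edist_eq_enorm_sub x y] at h1
    have e : freqSq (-k) = freqSq k := by simp [freqSq]
    rw [e] at h1
    rw [← ofReal_weight_sq_mul]
    refine (mul_le_mul_right h1 _).trans_eq (by ring)
  have h2 : LipschitzWith (C ^ (2⁻¹ : ℝ)).toNNReal (dirac α (by linarith)) := fun x y => by
    rw [coe_toNNReal (ENNReal.rpow_ne_top_of_nonneg (by norm_num) hC)]
    refine (ENNReal.pow_le_pow_left_iff two_ne_zero).1 ?_
    have e : (C ^ (2⁻¹ : ℝ)) ^ 2 = C := by rw [← rpow_natCast, ← rpow_mul]; norm_num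
    rw [mul_pow, e]
    exact h x y
  exact h2.continuous

theorem flip_apply (i j : Idx) (d : Sample) :
    flip i d j = ((d j).1, if j = i then -(d j).2.1 else (d j).2.1, (d j).2.2) := by
  by_cases h : j = i
  · subst h; simp [flip]
  · simp [flip, update_of_ne h, h]

theorem flipInvariant_arrival : FlipInvariant arrival := fun i d => by
  funext j; rcases j with n | n <;> simp [arrival_inl, arrival_inr, flip_apply]

/-- The intensities of the jumps in `(s,t]`. -/
def jumpInt (N : ℕ) (s t : ℝ) (d : Sample) : Idx → ℝ
  | inl _ => 0
  | inr n => (Ioc s t).indicator (fun _ => (d (inr n)).2.1 / √N) (arrival d (inr n))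

theorem flipOdd_jumpInt (N : ℕ) (s t : ℝ) : FlipOdd (jumpInt N s t) := by
  intro i j d
  rcases j with n | n
  · simp [jumpInt]
  · simp only [jumpInt, flipInvariant_arrival i d, flip_apply, indicator]
    split_ifs <;> simp [neg_div]

theorem measurable_jumpInt (N : ℕ) (s t : ℝ) (j : Idx) : Measurable fun d => jumpInt N s t d j := by
  rcases j with n | n
  · exact measurable_const
  · exact Measurable.ite ((measurable_arrival (.inr n)) measurableSet_Ioc) (by fun_prop) measurable_const

/-- The indicator of the `n`-th arrival in `(s,t]`. -/
def hit (s t : ℝ) (n : ℕ) (d : Sample) : ℝ≥0∞ := (Ioc s t).indicator 1 (arrival d (inr n))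

theorem measurable_hit (s t : ℝ) (n : ℕ) : Measurable (hit s t n) :=
  (measurable_one.indicator measurableSet_Ioc).comp (measurable_arrival (.inr n))

theorem sum_lintegral_hit_le (s t : ℝ) (m : ℕ) :
    ∑ n ∈ range m, ∫⁻ d, hit s t n d ∂sampleLaw r ≤ ofReal r * ofReal (t - s) := by
  refine (sum_le_tsum _).trans ((tsum_lintegral_arrival_le r (.inr rfl)
    (φ := (Ioc s t).indicator 1) (measurable_one.indicator measurableSet_Ioc)).trans ?_)
  gcongr
  rw [lintegral_indicator_one measurableSet_Ioc, ← Real.volume_Ioc]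
  exact Measure.restrict_apply_le _ _

/-- The number of pairs of arrivals in `(s,t]`. -/
def hitPairs (s t : ℝ) (m : ℕ) (d : Sample) : ℝ≥0∞ :=
  ∑ n' ∈ range m, hit s t n' d * ∑ n ∈ range n', hit s t n d

theorem measurable_hitPairs (s t : ℝ) (m : ℕ) : Measurable (hitPairs s t m) := by
  have := measurable_hit s t
  unfold hitPairs; fun_prop

/-- After a first arrival in `(s, t]`, a second one must follow within time `t - s`. The first event
does not depend on the later gaps and serves as the weight in `sum_lintegral_gaps_le`. -/
theorem lintegral_hitPairs_le (s t : ℝ) (m : ℕ) :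
    ∫⁻ d, hitPairs s t m d ∂sampleLaw r ≤ (ofReal r * ofReal (t - s)) ^ 2 := by
  have hm := measurable_hit s t
  have e d : hitPairs s t m d = ∑ n ∈ range m, ∑ l ∈ range (m - (n + 1)),
      hit s t n d * hit s t (n + 1 + l) d := by
    simp only [hitPairs, mul_sum]
    rw [Finset.sum_comm' (t' := range m) (s' := fun n => Finset.Ico (n + 1) m)
      (by intro a b; simp only [Finset.mem_range, Finset.mem_Ico]; omega)]
    refine sum_congr rfl fun n _ => ?_
    rw [Finset.sum_Ico_eq_sum_range]
    exact sum_congr rfl fun l _ => mul_comm _ _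
  simp only [e]
  rw [lintegral_finsetSum _ fun n _ => by fun_prop]
  have h1 n : ∫⁻ d, ∑ l ∈ range (m - (n + 1)), hit s t n d * hit s t (n + 1 + l) d ∂sampleLaw r
      ≤ (∫⁻ d, hit s t n d ∂sampleLaw r) * (ofReal r * ofReal (t - s)) := by
    rw [lintegral_finsetSum _ fun l _ => by fun_prop]
    have h2 := sum_lintegral_gaps_le r Sum.inr_injective (n + 1) (hm n) (fun d n' y hn' => by
      have : arrival (update d (inr n') y) (inr n) = arrival d (inr n) := by
        rw [arrival_inr, arrival_inr]
        refine sum_congr rfl fun j hj => ?_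
        rw [update_of_ne]
        intro h
        have := Sum.inr_injective h
        have := Finset.mem_range.1 hj
        omega
      simp only [hit, this]) (m - (n + 1)) (φ := (Iio (t - s)).indicator 1)
      (measurable_one.indicator measurableSet_Iio)
    refine (sum_le_sum fun l _ => lintegral_mono fun d => ?_).trans (h2.trans ?_)
    · have hsum : arrival d (inr (n + 1 + l)) = arrival d (inr n)
          + ∑ j ∈ range (l + 1), (d (inr (n + 1 + j))).1 := by
        rw [arrival_inr, arrival_inr, ← Finset.sum_range_add, add_assoc (n + 1)]
      simp only [hit, indicator, hsum]
      split_ifs with ha hb hc <;> simp only [Pi.one_apply, mul_one, mul_zero, le_refl, zero_le]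
      exact absurd (mem_Iio.2 (by linarith [ha.1, hb.2])) hc
    · gcongr
      rw [lintegral_indicator_one measurableSet_Iio, Measure.restrict_apply measurableSet_Iio,
        inter_comm, Ici_inter_Iio, Real.volume_Ico, sub_zero]
  refine (sum_le_sum fun n _ => h1 n).trans ?_
  rw [← sum_mul, sq]
  gcongr
  exact sum_lintegral_hit_le r s t m

theorem sq_sum_hit (s t : ℝ) (m : ℕ) (d : Sample) : (∑ n ∈ range m, hit s t n d) ^ 2 = ∑ n ∈
    range m, hit s t n d + 2 * hitPairs s t m d := by
  induction m with
  | zero => simp [hitPairs]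
  | succ m ih =>
    have h : hit s t m d ^ 2 = hit s t m d := by
      simp only [hit, indicator]; split_ifs <;> simp
    simp only [hitPairs] at ih ⊢
    rw [sum_range_succ, sum_range_succ, add_sq, ih, h]
    ring

theorem lintegral_sq_sum_hit_le (s t : ℝ) (m : ℕ) : ∫⁻ d, (∑ n ∈ range m, hit s t n d) ^ 2
    ∂sampleLaw r ≤ ofReal r * ofReal (t - s) + 2 * (ofReal r * ofReal (t - s)) ^ 2 := by
  have hm := measurable_hit s t
  simp only [sq_sum_hit]
  rw [lintegral_add_left (by fun_prop), lintegral_finsetSum _ fun n _ => hm n,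
    lintegral_const_mul _ (measurable_hitPairs s t m)]
  gcongr
  · exact sum_lintegral_hit_le r s t m
  · exact lintegral_hitPairs_le r s t m

theorem sqSum_jumpInt (hd : RegularSample d) (hN : 1 ≤ N) (s t : ℝ) (m : ℕ) :
    sqSum (lowIdx m) (jumpInt N s t d) = (N : ℝ≥0∞)⁻¹ * ∑ n ∈ range m, hit s t n d := by
  rw [sqSum, lowIdx, sum_disjSum]
  simp only [jumpInt, enorm_zero, ne_eq, OfNat.ofNat_ne_zero, not_false_eq_true, zero_pow,
    sum_const_zero, zero_add, mul_sum]
  refine sum_congr rfl fun n _ => ?_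
  simp only [hit, indicator]
  split_ifs
  · rw [← ofReal_norm, ← ofReal_pow (norm_nonneg _), norm_div, norm_eq_abs, hd.abs_sign,
      norm_of_nonneg (sqrt_nonneg _), div_pow, sq_sqrt (by positivity), one_pow, one_div,
      ofReal_inv_of_pos (by positivity), ofReal_natCast, Pi.one_apply, mul_one]
  · simp

/-- For an interval of length `h` the fourth moment is controlled by the second moment of the number
of arrivals divided by `N²`, that is by `λh / N + 2(λh)²`. The quadratic term is good for chaining;
the term `λh / N` is not, so chaining has to stop at a scale depending on `N`. -/
theorem lintegral_energy_jump_le (α lam : ℝ) (hN : 1 ≤ N) [Fact (0 < N * lam)] (s t : ℝ) (m : ℕ) :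
    ∫⁻ d, energy α (emp (jumpInt N s t d) (lowIdx m) start d) ^ 2 ∂sampleLaw (N * lam)
      ≤ empConst α 2 * (ofReal lam * ofReal (t - s) * (N : ℝ≥0∞)⁻¹
        + 2 * (ofReal lam * ofReal (t - s)) ^ 2) := by
  have hr : (0 : ℝ) < N * lam := Fact.out
  have h := lintegral_energy_emp_pow_le (N * lam) (w := 1) α one_le_two (lowIdx m) measurable_one
    (fun _ _ => rfl) (measurable_jumpInt N s t) (flipOdd_jumpInt N s t)
  simp only [Pi.one_apply, one_mul] at h
  refine h.trans ?_
  gcongr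
  have hN0 : (N : ℝ≥0∞) ≠ 0 := by simpa using (by omega : N ≠ 0)
  calc ∫⁻ d, sqSum (lowIdx m) (jumpInt N s t d) ^ 2 ∂sampleLaw (N * lam)
      = ∫⁻ d, (N : ℝ≥0∞)⁻¹ ^ 2 * (∑ n ∈ range m, hit s t n d) ^ 2 ∂sampleLaw (N * lam) := by
        refine lintegral_congr_ae ?_
        filter_upwards [ae_regularSample (N * lam)] with d hd
        rw [sqSum_jumpInt hd hN, mul_pow]
    _ ≤ (N : ℝ≥0∞)⁻¹ ^ 2 * (ofReal (N * lam) * ofReal (t - s)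
        + 2 * (ofReal (N * lam) * ofReal (t - s)) ^ 2) := by
        have hm := measurable_hit s t
        rw [lintegral_const_mul _ (by fun_prop)]
        gcongr
        exact lintegral_sq_sum_hit_le (N * lam) s t m
    _ = _ := by
        rw [ofReal_mul (by positivity), ofReal_natCast]
        have e : (N : ℝ≥0∞)⁻¹ * N = 1 := ENNReal.inv_mul_cancel hN0 (by simp)
        generalize ofReal lam = a
        generalize ofReal (t - s) = h
        calc _ = ((N : ℝ≥0∞)⁻¹ * N) * (a * h * (N : ℝ≥0∞)⁻¹)
              + 2 * (((N : ℝ≥0∞)⁻¹ * N) * (a * h)) ^ 2 := by ring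
          _ = _ := by rw [e, one_mul, one_mul]

/-! ### Tightness of the jumps -/

/-- The samples whose jump times are admissible on `[0,T]`. -/
def goodSample (T : ℝ) : Set Sample := {d | (fun n => arrival d (inr n)) ∈ GoodTimes T}

theorem RegularSample.mem_goodSample (hd : RegularSample d) (hT : ∀ n, arrival d (inr n) ≠ T) : d ∈
    goodSample T :=
  ⟨hd.arrival_pos _, hd.strictMono_inr, (hd.tendsto_inr.eventually_gt_atTop T).exists, hT⟩

/-- The `n`-th jump. -/
def jumpVec (α : ℝ) (hα : α < -1) (N : ℕ) (d : Sample) (n : ℕ) : Sobolev α :=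
  ((d (inr n)).2.1 / √N) • dirac α hα (d (inr n)).2.2

/-- The jump part of the vorticity. -/
def jumpPath {T : ℝ} (α : ℝ) (hα : α < -1) (N : ℕ) (d : goodSample T) : Cadlag T (Sobolev α) :=
  jumpFun ⟨fun n => arrival d (inr n), d.2⟩ (jumpVec α hα N d)

theorem continuous_jumpPath (hT : 0 < T) (hα : α < -2) (N : ℕ) :
    Continuous (jumpPath (T := T) α (by linarith) N) := by
  have hc i : Continuous fun d : goodSample T => d.1 i :=
    (continuous_apply i).comp continuous_subtype_val
  refine (continuous_jumpFun hT).comp (Continuous.prodMk (Continuous.subtype_mk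
    (continuous_pi fun n => ?_) _) (continuous_pi fun n => ?_))
  · simp only [arrival_inr]
    exact continuous_finsetSum _ fun m _ => (hc (.inr m)).fst
  · exact Continuous.smul ((hc (.inr n)).snd.fst.div_const _)
      ((continuous_dirac hα).comp (hc (.inr n)).snd.snd)

/-- The sum of the first `m` jumps, up to time `t`. -/
def jumpSum (α : ℝ) (hα : α < -1) (N : ℕ) (d : Sample) (m : ℕ) (t : ℝ) : Sobolev α :=
  ∑ n ∈ range m, if arrival d (inr n) ≤ t then jumpVec α hα N d n else 0

theorem coeff_jumpSum (α : ℝ) (hα : α < -1) (N : ℕ) (d : Sample) (m : ℕ) (t : ℝ) (k : ℤ²) :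
    (jumpSum α hα N d m t).coeff k = ∑ n ∈ range m, if arrival d (inr n) ≤ t then
      (((d (inr n)).2.1 / √N : ℝ) : ℂ) * mFourier (-k) (d (inr n)).2.2 else 0 := by
  rw [jumpSum, Sobolev.coeff_sum, Finset.sum_apply]
  refine sum_congr rfl fun n _ => ?_
  split_ifs
  · simp [jumpVec]
  · rfl

theorem edist_jumpSum_sq (hα : α < -1) (N : ℕ) (d : Sample) (m : ℕ) (hst : s ≤ t) :
    edist (jumpSum α hα N d m s) (jumpSum α hα N d m t) ^ 2
      = energy α (emp (jumpInt N s t d) (lowIdx m) start d) := by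
  rw [edist_comm, edist_sq_eq_energy]
  congr 1
  funext k
  rw [Pi.sub_apply, coeff_jumpSum, coeff_jumpSum, ← sum_sub_distrib, emp, lowIdx, sum_disjSum]
  simp only [jumpInt, ofReal_zero, zero_mul, sum_const_zero, zero_add]
  refine sum_congr rfl fun n _ => ?_
  by_cases h1 : arrival d (inr n) ≤ s
  · rw [if_pos h1, if_pos (h1.trans hst), indicator_of_notMem (fun h => h.1.not_ge h1)]; simp
  · by_cases h2 : arrival d (inr n) ≤ t
    · rw [if_neg h1, if_pos h2, indicator_of_mem (show _ ∈ Ioc s t from ⟨not_le.1 h1, h2⟩), sub_zero]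
    · rw [if_neg h1, if_neg h2, indicator_of_notMem (fun h => h2 h.2)]; simp

theorem jumpPath_apply (hα : α < -1) (N : ℕ) (d : goodSample T) (hm : T < arrival d (inr m)) (t :
    Icc 0 T) : jumpPath α hα N d t = jumpSum α hα N d m t :=
  jumpFun_apply (⟨fun n => arrival d (inr n), d.2⟩ : GoodTimes T) _ hm t

/-- Markov's inequality after Fatou; the lower limit removes the truncation to finitely many
vortices. -/
theorem measure_le_liminf_le (μ : Measure X) {f : ℕ → X → ℝ≥0∞} (hf : ∀ m, Measurable (f m)) {C x :
    ℝ≥0∞} (hC : ∀ m, ∫⁻ d, f m d ∂μ ≤ C) (hx : x ≠ 0) (hx' : x ≠ ∞) : μ {d | x ≤ liminf (fun m => f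
    m d) atTop} ≤ C / x := by
  refine (meas_ge_le_lintegral_div (Measurable.liminf hf).aemeasurable hx hx').trans ?_
  gcongr
  refine (lintegral_liminf_le hf).trans ?_
  exact (liminf_le_liminf (.of_forall hC)).trans_eq (liminf_const _)

/-- The level of the dyadic partition at which the jumps are resolved. -/
def jumpLevel (N : ℕ) : ℕ := 3 * Nat.clog 2 N

/-- Since `0.8 ^ 3 ≥ 1 / 2`, the factor `0.8 ^ l` is still at least `1 / (2 * N)` at level `l = 3 *
Nat.clog 2 N`. -/
theorem inv_le_of_le_jumpLevel {l : ℕ} (hN : 1 ≤ N) (hl : l ≤ jumpLevel N) :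
    (N : ℝ≥0∞)⁻¹ ≤ 2 * ofReal 0.8 ^ l := by
  have h1 : (2 : ℝ) ^ Nat.clog 2 N ≤ 2 * N := by
    rcases hN.eq_or_lt with rfl | h
    · simp
    · have h2 := (Nat.pow_pred_clog_lt_self one_lt_two h).le
      have h3 : Nat.clog 2 N = (Nat.clog 2 N).pred + 1 :=
        (Nat.succ_pred_eq_of_pos (Nat.clog_pos one_lt_two h)).symm
      rw [h3, pow_succ, mul_comm]
      gcongr
      exact_mod_cast h2
  have h2 : (N : ℝ)⁻¹ ≤ 2 * 0.8 ^ l := by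
    have h4 : (0.8 : ℝ) ^ jumpLevel N ≤ 0.8 ^ l := pow_le_pow_of_le_one (by norm_num) (by norm_num) hl
    have h5 : (2⁻¹ : ℝ) ^ Nat.clog 2 N ≤ 0.8 ^ jumpLevel N := by
      rw [jumpLevel, pow_mul]; gcongr; norm_num
    have h6 : (2 * N : ℝ)⁻¹ ≤ 2⁻¹ ^ Nat.clog 2 N := by
      rw [inv_pow]; gcongr
    have h7 : (N : ℝ)⁻¹ = 2 * (2 * N : ℝ)⁻¹ := by rw [mul_inv]; ring
    rw [h7]; linarith
  have h3 := ofReal_le_ofReal h2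
  rwa [ofReal_inv_of_pos (by positivity), ofReal_natCast,
    ofReal_mul (by norm_num), ofReal_pow (by norm_num), ofReal_ofNat] at h3

theorem ofReal_cell (T : ℝ) (l j : ℕ) :
    ofReal ((j + 1 : ℕ) * (T / 2 ^ l) - j * (T / 2 ^ l)) = ofReal T * 2⁻¹ ^ l := by
  have : ((j + 1 : ℕ) * (T / 2 ^ l) - j * (T / 2 ^ l) : ℝ) = T * 2⁻¹ ^ l := by
    push_cast; rw [inv_pow]; ring
  rw [this, mul_comm, ofReal_mul (by positivity), ofReal_pow (by positivity),
    ofReal_inv_of_pos two_pos, ofReal_ofNat, mul_comm]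

theorem two_pow_mul_inv_pow (l : ℕ) : (2 : ℝ≥0∞) ^ l * 2⁻¹ ^ l = 1 := by
  rw [← mul_pow, ENNReal.mul_inv_cancel (by simp) (by simp), one_pow]

/-- The constant in the bound of the large dyadic increments. -/
def jumpConst (α lam T : ℝ) : ℝ≥0∞ :=
  empConst α 2 * (2 * (ofReal lam * ofReal T)
    + 2 * (ofReal lam * ofReal T) ^ 2) * (1 - ofReal (0.8 * 0.95⁻¹ ^ 4))⁻¹

theorem jumpConst_ne_top (hα : α < -1) (lam T : ℝ) : jumpConst α lam T ≠ ∞ := by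
  refine mul_ne_top (mul_ne_top (empConst_ne_top hα 2) (by finiteness)) ?_
  refine ENNReal.inv_ne_top.2 (tsub_pos_iff_lt.2 ?_).ne'
  rw [ofReal_lt_one]; norm_num

/-- The `2 ^ l` cells of level `l` together have fourth moments of order `1 / N + 2⁻¹ ^ l`, hence at
most of order `0.8 ^ l`. The thresholds decrease like `0.95 ^ l`, slowly enough that `0.8 * 0.95⁻¹ ^
4 < 1` and the series over `l` converges. -/
theorem measure_large_increment_le (α lam T : ℝ) (hN : 1 ≤ N) [Fact (0 < N * lam)] {R : ℝ≥0∞} (hR :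
    R ≠ 0) (hR' : R ≠ ∞) : sampleLaw (N * lam) (⋃ l ∈ range (jumpLevel N + 1), ⋃ j ∈
    range (2 ^ l), {d | (R * ofReal 0.95 ^ l) ^ 4 ≤ liminf (fun m => energy α (emp (jumpInt N
    (j * (T / 2 ^ l)) ((j + 1 : ℕ) * (T / 2 ^ l)) d) (lowIdx m) start d) ^ 2) atTop}) ≤
    jumpConst α lam T * R⁻¹ ^ 4 := by
  set ρ := ofReal 0.95
  have hρ0 : ρ ≠ 0 := by simp only [ρ, ne_eq, ENNReal.ofReal_eq_zero]; norm_num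
  have hρ1 : ρ ≠ ∞ := ofReal_ne_top
  set a := ofReal lam * ofReal T with ha
  set E := empConst α 2
  have hb : ofReal 0.8 * ρ⁻¹ ^ 4 = ofReal (0.8 * 0.95⁻¹ ^ 4) := by
    rw [ofReal_mul (by norm_num), ofReal_pow (by norm_num), ofReal_inv_of_pos (by norm_num)]
  have hterm : ∀ l ≤ jumpLevel N, ∀ j : ℕ, sampleLaw (N * lam) {d | (R * ρ ^ l) ^ 4 ≤
      liminf (fun m => energy α (emp (jumpInt N (j * (T / 2 ^ l)) ((j + 1 : ℕ) * (T / 2 ^ l)) d)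
        (lowIdx m) start d) ^ 2) atTop}
      ≤ E * (a * 2⁻¹ ^ l * (N : ℝ≥0∞)⁻¹ + 2 * (a * 2⁻¹ ^ l) ^ 2) * (R⁻¹ ^ 4 * (ρ⁻¹ ^ 4) ^ l) := by
    intro l hl j
    have h := measure_le_liminf_le (sampleLaw (N * lam)) (x := (R * ρ ^ l) ^ 4)
      (fun m => (measurable_energy α fun k => measurable_emp (lowIdx m)
        (measurable_jumpInt N (j * (T / 2 ^ l)) ((j + 1 : ℕ) * (T / 2 ^ l)))
        (x := fun d i => (d i).2.2) (fun i => by fun_prop) k).pow_const 2)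
      (lintegral_energy_jump_le α lam hN (j * (T / 2 ^ l)) ((j + 1 : ℕ) * (T / 2 ^ l)))
      (by positivity) (by finiteness)
    have e : ((R * ρ ^ l) ^ 4)⁻¹ = R⁻¹ ^ 4 * (ρ⁻¹ ^ 4) ^ l := by
      rw [ENNReal.inv_pow, ENNReal.mul_inv (.inl hR) (.inl hR'), mul_pow, ENNReal.inv_pow, ← pow_mul,
        ← pow_mul, mul_comm l 4]
    refine h.trans_eq ?_
    rw [ofReal_cell, ← mul_assoc (ofReal lam), ← ha, ENNReal.div_eq_inv_mul, mul_comm, e]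
  calc _ ≤ ∑ l ∈ range (jumpLevel N + 1), ∑ j ∈ range (2 ^ l),
        E * (a * 2⁻¹ ^ l * (N : ℝ≥0∞)⁻¹ + 2 * (a * 2⁻¹ ^ l) ^ 2) * (R⁻¹ ^ 4 * (ρ⁻¹ ^ 4) ^ l) :=
        (measure_biUnion_finset_le _ _).trans (sum_le_sum fun l hl =>
          (measure_biUnion_finset_le _ _).trans (sum_le_sum fun j _ =>
            hterm l (Nat.lt_succ_iff.1 (Finset.mem_range.1 hl)) j))
    _ ≤ ∑ l ∈ range (jumpLevel N + 1),
        E * (2 * a + 2 * a ^ 2) * R⁻¹ ^ 4 * (ofReal 0.8 * ρ⁻¹ ^ 4) ^ l := by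
        refine sum_le_sum fun l hl => ?_
        rw [sum_const, card_range, nsmul_eq_mul, Nat.cast_pow, Nat.cast_ofNat]
        have h1 := inv_le_of_le_jumpLevel hN (Nat.lt_succ_iff.1 (Finset.mem_range.1 hl))
        have h2 : (2⁻¹ : ℝ≥0∞) ^ l ≤ ofReal 0.8 ^ l := by
          gcongr
          rw [← ofReal_ofNat, ← ofReal_inv_of_pos two_pos]
          exact ofReal_le_ofReal (by norm_num)
        generalize (N : ℝ≥0∞)⁻¹ = n at *
        have e : (2 : ℝ≥0∞) ^ l * (a * 2⁻¹ ^ l * n + 2 * (a * 2⁻¹ ^ l) ^ 2)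
            = (2 ^ l * 2⁻¹ ^ l) * (a * n) + 2 * ((2 ^ l * 2⁻¹ ^ l) * 2⁻¹ ^ l * a ^ 2) := by ring
        calc _ = E * (2 ^ l * (a * 2⁻¹ ^ l * n + 2 * (a * 2⁻¹ ^ l) ^ 2)) * (R⁻¹ ^ 4 * (ρ⁻¹ ^ 4) ^ l) := by
              ring
          _ ≤ E * (a * (2 * ofReal 0.8 ^ l) + 2 * (ofReal 0.8 ^ l * a ^ 2))
              * (R⁻¹ ^ 4 * (ρ⁻¹ ^ 4) ^ l) := by
              rw [e, two_pow_mul_inv_pow, one_mul, one_mul]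
              gcongr
          _ = _ := by rw [mul_pow]; ring
    _ ≤ _ := by
        rw [← mul_sum, hb]
        refine (mul_le_mul_right (sum_le_tsum _) _).trans_eq ?_
        rw [tsum_geometric, jumpConst]
        ring

/-- A cell of length `h` contains two arrivals with probability of order `(N h)²`. There are `T / h`
cells, and `h ≤ T * N⁻³` by the factor `3` in `jumpLevel`, so the total is of order `1 / N`. -/
theorem measure_two_arrivals_le (lam T : ℝ) (hN : 1 ≤ N) [Fact (0 < N * lam)] :
    sampleLaw (N * lam) (⋃ j ∈ range (2 ^ jumpLevel N), {d | 1 ≤ liminf (fun m =>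
      hitPairs (j * (T / 2 ^ jumpLevel N)) ((j + 1 : ℕ) * (T / 2 ^ jumpLevel N)) m d) atTop})
      ≤ (ofReal lam * ofReal T) ^ 2 * (N : ℝ≥0∞)⁻¹ := by
  have hN0 : (N : ℝ≥0∞) ≠ 0 := by simpa using (by omega : N ≠ 0)
  refine (measure_biUnion_finset_le _ _).trans ((sum_le_sum fun j _ =>
    measure_le_liminf_le _ (measurable_hitPairs _ _) (lintegral_hitPairs_le (N * lam) _ _)
      one_ne_zero ENNReal.one_ne_top).trans ?_)
  simp only [div_one, ofReal_cell]
  rw [sum_const, card_range, nsmul_eq_mul, Nat.cast_pow, Nat.cast_ofNat,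
    ofReal_mul (by positivity), ofReal_natCast]
  have h1 : (2⁻¹ : ℝ≥0∞) ^ jumpLevel N ≤ (N : ℝ≥0∞)⁻¹ ^ 3 := by
    rw [jumpLevel, mul_comm, pow_mul]
    gcongr
    rw [← ENNReal.inv_pow]
    gcongr
    exact_mod_cast Nat.le_pow_clog one_lt_two N
  calc _ = (2 ^ jumpLevel N * 2⁻¹ ^ jumpLevel N)
        * ((ofReal lam * ofReal T) ^ 2 * ((N : ℝ≥0∞) ^ 2 * 2⁻¹ ^ jumpLevel N)) := by ring
    _ ≤ 1 * ((ofReal lam * ofReal T) ^ 2 * ((N : ℝ≥0∞) ^ 2 * (N : ℝ≥0∞)⁻¹ ^ 3)) := by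
        rw [two_pow_mul_inv_pow]; gcongr
    _ = (ofReal lam * ofReal T) ^ 2 * ((N * (N : ℝ≥0∞)⁻¹) ^ 2 * (N : ℝ≥0∞)⁻¹) := by ring
    _ = _ := by rw [ENNReal.mul_inv_cancel hN0 (by simp), one_pow, one_mul]

/-- The bound of a jump in `H^α`. -/
def jumpSize (α : ℝ) (N : ℕ) : ℝ≥0∞ :=
  ((∑' k, ofReal (weight α k ^ 2)) * ofReal (2 / √N) ^ 2) ^ (2⁻¹ : ℝ)

theorem tendsto_jumpSize (hα : α < -1) : Tendsto (jumpSize α) atTop (𝓝 0) := by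
  have h1 : Tendsto (fun N : ℕ => ofReal (2 / √N) ^ 2) atTop (𝓝 (0 ^ 2)) := by
    refine ENNReal.Tendsto.pow (ENNReal.ofReal_zero ▸ tendsto_ofReal ?_)
    exact Tendsto.const_div_atTop (Real.tendsto_sqrt_atTop.comp tendsto_natCast_atTop_atTop) 2
  have h2 := (ENNReal.Tendsto.const_mul h1 (.inr (tsum_weight_sq_ne_top hα))).ennrpow_const (2⁻¹ : ℝ)
  simp only [ne_eq, OfNat.ofNat_ne_zero, not_false_eq_true, zero_pow, mul_zero] at h2
  rwa [zero_rpow_of_pos (by norm_num)] at h2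

theorem jumpSize_le (α : ℝ) (hN : 1 ≤ N) : jumpSize α N ≤ jumpSize α 1 := by
  unfold jumpSize
  gcongr

theorem edist_jumpSum_le (hα : α < -1) (hd : RegularSample d) (m : ℕ)
    {u : ℝ} (hst : s ≤ t) (htu : t ≤ u) (h : hitPairs s u m d < 1) :
    edist (jumpSum α hα N d m t) (jumpSum α hα N d m s) ≤ jumpSize α N := by
  set S := ∑ n ∈ range m, hit s u n d with hS
  have hSf : S ≠ ∞ := (ENNReal.sum_lt_top.2 fun n _ => by
    unfold hit indicator; split_ifs <;> simp).ne
  -- The square of the count is the count plus twice the number of pairs, so fewer than one pair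
  -- gives `S² < S + 2`. The bound `2` follows without using that the count is an integer.
  have hS2 : S ≤ 2 := by
    by_contra! h2
    have h3 : S ^ 2 < S + 2 := by
      rw [hS, sq_sum_hit, ← hS]
      refine ENNReal.add_lt_add_left hSf ?_
      calc 2 * hitPairs s u m d < 2 * 1 := ENNReal.mul_lt_mul_right (by simp) (by simp) h
        _ = 2 := mul_one _
    have h4 : S + 2 ≤ S ^ 2 := by
      calc S + 2 ≤ S + S := by gcongr
        _ = 2 * S := (two_mul S).symm
        _ ≤ S * S := by gcongr
        _ = S ^ 2 := (sq S).symm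
    exact h4.not_gt h3
  rw [jumpSize, ← ENNReal.rpow_inv_le_iff (by norm_num), inv_inv, edist_comm, ENNReal.rpow_ofNat,
    edist_jumpSum_sq hα N d m hst]
  refine energy_le_of_norm_le _ fun k => ?_
  rw [← ENNReal.ofReal_le_ofReal_iff (by positivity), ofReal_norm]
  calc ‖emp (jumpInt N s t d) (lowIdx m) (start d) k‖ₑ
      ≤ ∑ n ∈ range m, ‖jumpInt N s t d (inr n)‖ₑ := by
        rw [emp, lowIdx, sum_disjSum]
        simp only [jumpInt, ofReal_zero, zero_mul, sum_const_zero, zero_add]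
        refine (enorm_sum_le _ _).trans (sum_le_sum fun n _ => ?_)
        rw [enorm_mul, ← ofReal_norm (mFourier _ _), norm_mFourier_apply, ofReal_one,
          mul_one, ← ofReal_norm, norm_real, ofReal_norm]
    _ ≤ ∑ n ∈ range m, hit s u n d * ofReal (1 / √N) := by
        refine sum_le_sum fun n _ => ?_
        simp only [jumpInt, hit, indicator]
        split_ifs with h1 h2
        · rw [← ofReal_norm, norm_div, norm_eq_abs, hd.abs_sign,
            norm_of_nonneg (sqrt_nonneg _), Pi.one_apply, one_mul]
        · exact absurd ⟨h1.1, h1.2.trans htu⟩ h2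
        all_goals simp
    _ ≤ 2 * ofReal (1 / √N) := by rw [← sum_mul]; gcongr
    _ = ofReal (2 / √N) := by
        rw [← ofReal_ofNat, ← ofReal_mul two_pos.le, mul_one_div]

theorem edist_jumpSum_le_of_dyadic (hα : α < -1) (hT : 0 < T) (hd : RegularSample d) {R ρ : ℝ≥0∞}
    (h1 : ∀ l ≤ jumpLevel N, ∀ j : ℕ, j < 2 ^ l → liminf (fun m => energy α (emp (jumpInt N (j * (T
    / 2 ^ l)) ((j + 1 : ℕ) * (T / 2 ^ l)) d) (lowIdx m) start d) ^ 2) atTop < (R * ρ ^ l)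
    ^ 4) (h2 : ∀ j : ℕ, j < 2 ^ jumpLevel N → liminf (fun m => hitPairs (j * (T / 2 ^ jumpLevel N))
    ((j + 1 : ℕ) * (T / 2 ^ jumpLevel N)) m d) atTop < 1) (hm : T < arrival d (inr m)) (l : ℕ) (hs :
    s ∈ Icc 0 T) (ht : t ∈ Icc 0 T) (hst : |s - t| ≤ T / 2 ^ l) : edist (jumpSum α hα N d m s)
    (jumpSum α hα N d m t) ≤ 2 * ∑' i, R * ρ ^ (l + i) + 3 * jumpSize α N := by
  refine edist_le_of_dyadic hT (jumpSum α hα N d m) (jumpLevel N) (fun l => R * ρ ^ l) ?_ ?_ l hs ht hst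
  · intro l hl j hj
    have hle : (j * (T / 2 ^ l) : ℝ) ≤ (j + 1 : ℕ) * (T / 2 ^ l) := by gcongr; omega
    have hle' : ((j + 1 : ℕ) * (T / 2 ^ l) : ℝ) ≤ T := by
      have : ((j + 1 : ℕ) : ℝ) ≤ 2 ^ l := by exact_mod_cast hj
      calc ((j + 1 : ℕ) * (T / 2 ^ l) : ℝ) ≤ 2 ^ l * (T / 2 ^ l) := by gcongr
        _ = T := by field_simp
    have h := h1 l hl j hj
    rw [Tendsto.liminf_eq (a := edist (jumpSum α hα N d m (j * (T / 2 ^ l)))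
      (jumpSum α hα N d m ((j + 1 : ℕ) * (T / 2 ^ l))) ^ 4)] at h
    · exact ((ENNReal.pow_lt_pow_left_iff (by norm_num)).1 h).le
    · refine tendsto_const_nhds.congr' ?_
      filter_upwards [eventually_ge_atTop m] with m' hm'
      have hm2 : T < arrival d (inr m') := hm.trans_le (hd.strictMono_inr.monotone hm')
      rw [← edist_jumpSum_sq hα N d m' hle, ← pow_mul]
      congr 2
      · exact sum_ite_le_eq_of_lt hd.strictMono_inr _ hm hm2 (hle.trans hle')
      · exact sum_ite_le_eq_of_lt hd.strictMono_inr _ hm hm2 hle'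
  · intro j hj t ht
    refine edist_jumpSum_le hα hd m ht.1 ht.2 (lt_of_le_of_lt ?_ (h2 j hj))
    refine le_liminf_of_le (by isBoundedDefault) ?_
    filter_upwards [eventually_ge_atTop m] with m' hm'
    exact Finset.sum_le_sum_of_subset (range_mono hm')

/-- The space of samples is Polish, so finite measures are inner regular by compact sets; a
measurable hull of the complement of `G` makes measurability of `G` unnecessary. -/
theorem exists_isCompact_measure_compl_le (μ : Measure Sample) [IsFiniteMeasure μ] {G : Set Sample}
    {ε : ℝ≥0∞} (hε : ε ≠ 0) (hG : μ Gᶜ ≤ ε / 2) : ∃ C, IsCompact C ∧ C ⊆ G ∧ μ Cᶜ ≤ ε := by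
  have hA : MeasurableSet (toMeasurable μ Gᶜ)ᶜ := (measurableSet_toMeasurable μ _).compl
  have : μ.InnerRegularCompactLTTop := instInnerRegularCompactLTTopOfIsCompletelyPseudoMetrizableSpace μ
  obtain ⟨C, hCA, hC, -, hlt⟩ := hA.exists_isCompact_isClosed_sdiff_lt (measure_ne_top μ _)
    (ENNReal.half_pos hε).ne'
  refine ⟨C, hC, hCA.trans (compl_subset_comm.1 (subset_toMeasurable μ _)), ?_⟩
  calc μ Cᶜ ≤ μ (toMeasurable μ Gᶜ ∪ (toMeasurable μ Gᶜ)ᶜ \ C) := measure_mono fun d hd => by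
        by_cases h : d ∈ toMeasurable μ Gᶜ
        · exact .inl h
        · exact .inr ⟨h, hd⟩
    _ ≤ ε / 2 + ε / 2 := (measure_union_le _ _).trans (add_le_add (by rwa [measure_toMeasurable]) hlt.le)
    _ = ε := ENNReal.add_halves ε

/-- The jump parts are tight in the Skorokhod space. -/
theorem exists_isCompact_jumpPath (hT : 0 < T) {γ : ℝ} (hα : α < -2) (hαγ : α < γ) (hγ : γ < -1)
    (lam : ℝ) [hlam : Fact (0 < lam)] {ε : ℝ≥0∞} (hε : ε ≠ 0) (hε' : ε ≠ ∞) : ∃ K : Set (Cadlag T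
    (Sobolev α)), IsCompact K ∧ ∀ N : ℕ, 1 ≤ N → sampleLaw (N * lam) {d | ∀ h : d ∈ goodSample T,
    jumpPath α (by linarith) N ⟨d, h⟩ ∉ K} ≤ ε := by
  have hε4 : ε / 2 / 2 ≠ 0 := (ENNReal.half_pos (ENNReal.half_pos hε).ne').ne'
  set ρ := ofReal 0.95
  have hρ : ρ < 1 := by simp only [ρ, ofReal_lt_one]; norm_num
  obtain ⟨R, hR0, hR, hRε⟩ : ∃ R : ℝ≥0∞, R ≠ 0 ∧ R ≠ ∞ ∧ jumpConst γ lam T * R⁻¹ ^ 4 ≤ ε / 2 / 2 := by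
    have hC := jumpConst_ne_top hγ lam T
    -- As `R ≥ 1`, the fourth power of `R⁻¹` may be replaced by `R⁻¹` itself.
    refine ⟨1 + jumpConst γ lam T / (ε / 2 / 2), by simp, by finiteness, ?_⟩
    set R := 1 + jumpConst γ lam T / (ε / 2 / 2)
    have h1 : R⁻¹ ≤ 1 := ENNReal.inv_le_one.2 le_self_add
    calc jumpConst γ lam T * R⁻¹ ^ 4 ≤ jumpConst γ lam T * R⁻¹ ^ 1 := by
          refine mul_le_mul_right ?_ _
          exact pow_le_pow_right_of_le_one' h1 (by norm_num)
      _ = jumpConst γ lam T / R := by rw [pow_one, div_eq_mul_inv]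
      _ ≤ ε / 2 / 2 := by
          refine ENNReal.div_le_of_le_mul ?_
          calc jumpConst γ lam T = ε / 2 / 2 * (jumpConst γ lam T / (ε / 2 / 2)) :=
                (ENNReal.mul_div_cancel hε4 (by finiteness)).symm
            _ ≤ _ := by gcongr; exact le_add_self
  obtain ⟨n₀, hn₀⟩ : ∃ n₀ : ℕ, ∀ n ≥ n₀,
      (ofReal lam * ofReal T) ^ 2 * (n : ℝ≥0∞)⁻¹ ≤ ε / 2 / 2 := by
    have h := ENNReal.Tendsto.const_mul (a := (ofReal lam * ofReal T) ^ 2)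
      ENNReal.tendsto_inv_nat_nhds_zero (.inr (by finiteness))
    rw [mul_zero] at h
    exact eventually_atTop.1 (h.eventually_le_const (pos_iff_ne_zero.2 hε4))
  set e : ℕ → ℝ≥0∞ := fun l => 2 * ∑' i, R * ρ ^ (l + i)
  have he l : e l = 2 * (R * (1 - ρ)⁻¹) * ρ ^ l := by
    simp only [e, pow_add, ← mul_assoc, ENNReal.tsum_mul_left, tsum_geometric]; ring
  have hρ' : (1 - ρ)⁻¹ ≠ ∞ := ENNReal.inv_ne_top.2 (tsub_pos_iff_lt.2 hρ).ne'
  have he0 : Tendsto e atTop (𝓝 0) := by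
    have h := ENNReal.Tendsto.const_mul (a := 2 * (R * (1 - ρ)⁻¹))
      (ENNReal.tendsto_pow_atTop_nhds_zero_of_lt_one hρ) (.inr (by finiteness))
    rw [mul_zero] at h
    exact h.congr fun l => (he l).symm
  -- The index `n` stands for `N = n + 1`. For every `N` a compact set of samples carries the law up
  -- to `ε`; only for `N ≥ n₀` is it also chosen to avoid large increments and cells with two
  -- arrivals.
  have hstep : ∀ n : ℕ, ∃ C : Set Sample, IsCompact C ∧ C ⊆ goodSample T ∧
      sampleLaw ((n + 1 : ℕ) * lam) Cᶜ ≤ ε ∧ (n₀ ≤ n + 1 → ∀ d ∈ C, ∀ m, T < arrival d (inr m) → ∀ l,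
        ∀ s ∈ Icc 0 T, ∀ t ∈ Icc 0 T, |s - t| ≤ T / 2 ^ l →
        edist (jumpSum γ hγ (n + 1) d m s) (jumpSum γ hγ (n + 1) d m t)
          ≤ e l + 3 * jumpSize γ (n + 1)) := by
    intro n
    have hN : 1 ≤ n + 1 := by omega
    have : Fact (0 < ((n + 1 : ℕ) : ℝ) * lam) := ⟨mul_pos (by positivity) hlam.out⟩
    have hreg : ∀ᵐ d ∂sampleLaw ((n + 1 : ℕ) * lam), RegularSample d ∧ ∀ k, arrival d (inr k) ≠ T :=
      (ae_regularSample _).and (ae_arrival_ne _ T)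
    by_cases hn : n₀ ≤ n + 1
    · set B₁ := _
      have hB₁ : sampleLaw ((n + 1 : ℕ) * lam) B₁ ≤ _ := measure_large_increment_le γ lam T hN hR0 hR
      set B₂ := _
      have hB₂ : sampleLaw ((n + 1 : ℕ) * lam) B₂ ≤ _ := measure_two_arrivals_le lam T hN
      obtain ⟨C, hC, hCG, hμ⟩ := exists_isCompact_measure_compl_le (sampleLaw ((n + 1 : ℕ) * lam))
        (G := {d | RegularSample d ∧ ∀ k, arrival d (inr k) ≠ T} ∩ (B₁ ∪ B₂)ᶜ) hε (by
          rw [compl_inter, compl_compl]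
          refine (measure_union_le _ _).trans ?_
          refine (add_le_add (ae_iff.1 hreg).le le_rfl).trans ?_
          rw [zero_add]
          exact (measure_union_le _ _).trans ((add_le_add (hB₁.trans hRε) (hB₂.trans (hn₀ _ hn))).trans_eq
            (ENNReal.add_halves _)))
      refine ⟨C, hC, fun d hd => (hCG hd).1.1.mem_goodSample (hCG hd).1.2, hμ,
        fun _ d hd m hm l s hs t ht hst => ?_⟩
      obtain ⟨⟨hd1, hd2⟩, hd3⟩ := hCG hd
      simp only [B₁, B₂, mem_compl_iff, mem_union, mem_iUnion, mem_ofPred_eq, not_or, not_exists, not_le,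
        Finset.mem_range] at hd3
      exact edist_jumpSum_le_of_dyadic hγ hT hd1 (fun l hl j hj => hd3.1 l (Nat.lt_succ_of_le hl) j hj)
        (fun j hj => hd3.2 j hj) hm l hs ht hst
    · obtain ⟨C, hC, hCG, hμ⟩ := exists_isCompact_measure_compl_le (sampleLaw ((n + 1 : ℕ) * lam))
        (G := {d | RegularSample d ∧ ∀ k, arrival d (inr k) ≠ T}) hε
        ((ae_iff.1 hreg).trans_le zero_le)
      exact ⟨C, hC, fun d hd => (hCG hd).1.mem_goodSample (hCG hd).2, hμ, fun h => absurd h hn⟩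
  choose C hC hCG hμ hmod using hstep
  set K : ℕ → Set (Cadlag T (Sobolev α)) := fun n =>
    jumpPath α (by linarith) (n + 1) '' (Subtype.val ⁻¹' C n)
  have hK n : IsCompact (K n) := by
    refine IsCompact.image ?_ (continuous_jumpPath hT hα (n + 1))
    rw [Subtype.isCompact_iff, Subtype.image_preimage_coe, inter_eq_right.2 (hCG n)]
    exact hC n
  have hfin : e 0 + 3 * jumpSize γ 1 ≠ ∞ := by
    rw [he, jumpSize]
    have := tsum_weight_sq_ne_top hγ
    finiteness
  have hcoeff N d m t : (jumpSum α (by linarith) N d m t).coeff = (jumpSum γ hγ N d m t).coeff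
      := by funext k; rw [coeff_jumpSum, coeff_jumpSum]
  obtain ⟨K', hK', hsub⟩ := exists_isCompact_of_modulus hT
    (isCompact_energy_le hαγ ((e 0 + 3 * jumpSize γ 1) ^ 2).toNNReal) he0
    (η := fun n => 3 * jumpSize γ (n + 1)) (by
      have h := ENNReal.Tendsto.const_mul (a := 3) ((tendsto_add_atTop_iff_nat 1).2 (tendsto_jumpSize hγ))
        (.inr (by simp))
      rwa [mul_zero] at h) hK (by
      filter_upwards [eventually_ge_atTop n₀] with n hn f hf
      obtain ⟨d, hd, rfl⟩ := hf
      obtain ⟨m, hm⟩ := d.2.2.2.1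
      simp only [jumpPath_apply _ _ d hm]
      have hmd := hmod n (by omega) d hd m hm
      refine ⟨fun t => ?_, fun l s t hst => ?_⟩
      · rw [coe_toNNReal (by finiteness), hcoeff]
        have h0 : jumpSum γ hγ (n + 1) d m 0 = 0 := sum_eq_zero fun k _ => if_neg <| not_le.2 <|
          d.2.1.trans_le (d.2.2.1.monotone (Nat.zero_le k))
        have h := hmd 0 t t.2 0 ⟨le_rfl, hT.le⟩ (by
          rw [sub_zero, abs_of_nonneg t.2.1, pow_zero, div_one]; exact t.2.2)
        rw [h0, edist_zero_right] at h
        rw [← enorm_sq_eq_energy]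
        gcongr
        exact h.trans (by gcongr; exact jumpSize_le γ (by omega))
      · refine le_trans ?_ (hmd l s s.2 t t.2 (by rwa [Subtype.dist_eq, dist_eq] at hst))
        refine (ENNReal.pow_le_pow_left_iff two_ne_zero).1 ?_
        rw [edist_sq_eq_energy, edist_sq_eq_energy, hcoeff, hcoeff]
        exact energy_mono hαγ.le _)
  refine ⟨K', hK', fun N hN => ?_⟩
  obtain ⟨n, rfl⟩ : ∃ n, N = n + 1 := ⟨N - 1, by omega⟩
  refine (measure_mono fun d hd hdC => ?_).trans (hμ n)
  exact hd (hCG n hdC) (hsub n ⟨⟨d, hCG n hdC⟩, hdC, rfl⟩)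

/-! ### The drift -/

theorem lipschitzOnWith_integral {h : ℝ → ℂ} {B : ℝ} (hi : IntervalIntegrable h volume 0 T)
    (hB : ∀ s ∈ uIcc 0 T, ‖h s‖ ≤ B) :
    LipschitzOnWith B.toNNReal (fun t => ∫ s in 0..t, h s) (uIcc 0 T) :=
  LipschitzOnWith.of_dist_le_mul fun t ht t' ht' => by
    have hs : ∀ {t}, t ∈ uIcc 0 T → IntervalIntegrable h volume 0 t := fun ht =>
      hi.mono_set (uIcc_subset_uIcc left_mem_uIcc ht)
    rw [dist_comm, dist_eq_norm, integral_interval_sub_left (hs ht') (hs ht),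
      Real.coe_toNNReal _ ((norm_nonneg _).trans (hB t ht)), dist_eq, abs_sub_comm]
    exact intervalIntegral.norm_integral_le_of_norm_le_const fun s hs' =>
      hB s (uIcc_subset_uIcc ht ht' (uIoc_subset_uIcc hs'))

/-- As `h` is only bounded and integrable, the identity is obtained by comparing two absolutely
continuous functions with the same derivative almost everywhere. -/
theorem exp_integral_sub_one {h : ℝ → ℂ} {B : ℝ} (hi : IntervalIntegrable h volume 0 T) (hB : ∀ s ∈
    uIcc 0 T, ‖h s‖ ≤ B) : IntervalIntegrable (fun s => h s * Complex.exp (∫ u in 0..s, h u))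
    volume 0 T ∧ Complex.exp (∫ s in 0..T, h s) - 1 = ∫ s in 0..T, h s * Complex.exp (∫
    u in 0..s, h u) := by
  have hG := lipschitzOnWith_integral hi hB
  have hc := hG.continuousOn.cexp
  obtain ⟨B', hB'⟩ := isCompact_uIcc.exists_bound_of_continuousOn hc
  have hi' := hi.mul_continuousOn hc
  refine ⟨hi', ?_⟩
  obtain ⟨B₁, hB₁⟩ := isCompact_uIcc.exists_bound_of_continuousOn hG.continuousOn
  obtain ⟨K, hK⟩ := (Complex.contDiff_exp (𝕜 := ℝ) (n := 1)).contDiffOn.exists_lipschitzOnWith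
    (s := Metric.closedBall 0 B₁) (by decide) (convex_closedBall _ _) (isCompact_closedBall _ _)
  have h1 := (hK.comp hG fun s hs => mem_closedBall_zero_iff.2 (hB₁ s hs)).absolutelyContinuousOnInterval
  have h2 := (lipschitzOnWith_integral (B := B * B') hi' fun s hs => by
    rw [norm_mul]
    exact mul_le_mul (hB s hs) (hB' s hs) (norm_nonneg _)
      ((norm_nonneg _).trans (hB s hs))).absolutelyContinuousOnInterval
  obtain ⟨C, hC⟩ := (h1.sub h2).const_of_ae_hasDerivAt_zero (by
    filter_upwards [hi.ae_hasDerivAt_integral, hi'.ae_hasDerivAt_integral] with s hs hs' hsT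
    have h3 := (hs hsT 0 left_mem_uIcc).cexp.sub (hs' hsT 0 left_mem_uIcc)
    rwa [mul_comm, sub_self] at h3)
  have e0 := hC 0 left_mem_uIcc
  have e1 := hC T right_mem_uIcc
  simp only [Pi.sub_apply, comp_apply, integral_same, exp_zero, sub_zero] at e0 e1
  rw [← e0] at e1
  linear_combination e1

theorem IsSolutionOn.exists_norm_velocity_le (hd : RegularSample d) (hθ : 0 < θ) (hN : 1 ≤ N) (h :
    IsSolutionOn θ M N d a x) : ∃ B, ∀ t ∈ Icc 0 a, ∀ i, ‖velocity θ M N d x i t‖ ≤ B := by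
  obtain ⟨n, hact⟩ := (hd.eventually_activeBelow M a).exists
  obtain ⟨L, hL⟩ := h.exists_le_green hact
  obtain ⟨C, -, hC, -⟩ := exists_lipschitz_skewGrad (contDiff_regGreen (L + 1))
  refine ⟨(lowIdx n).card * C, fun t ht i => ?_⟩
  rw [velocity_eq_pairDrift hd hθ hN ht.1 (hact t ht.2) (k := regKernel (L + 1)) fun i j hij hi hj =>
    regKernel_eq_of_le_green (sub_ne_zero.2 (h.ne t ht i j hij hi hj)) (by linarith [hL t ht i j hij hi hj])]
  exact norm_pairDrift_le (abs_coef_le θ M N n d) hC _ i t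

open Classical in
/-- The intensity, which is zero as long as the vortex is not present. -/
def actInt (θ M : ℝ) (N : ℕ) (d : Sample) (t : ℝ) (i : Idx) : ℝ :=
  if IsActive M d i t then intensity θ N d i t else 0

theorem measurable_actInt (θ M : ℝ) (N : ℕ) (i : Idx) :
    Measurable fun p : Sample × ℝ => actInt θ M N p.1 p.2 i :=
  Measurable.ite (measurableSet_isActive M i) (measurable_intensity θ N i) measurable_const

theorem posInvariant_actInt (θ M : ℝ) (N : ℕ) : PosInvariant (actInt θ M N) := by
  intro d d' h
  unfold actInt
  rw [posInvariant_isActive M d d' h, posInvariant_intensity θ N d d' h]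

theorem flipOdd_actInt (θ M : ℝ) (N : ℕ) (t : ℝ) : FlipOdd fun d => actInt θ M N d t := by
  intro i j d
  have h : IsActive M (flip i d) j t ↔ IsActive M d j t := by
    rcases j with n | n <;> simp only [IsActive, flipInvariant_arrival i d]
  have h' : intensity θ N (flip i d) j t = if j = i then -intensity θ N d j t else intensity θ N d j t := by
    rcases j with n | n <;> simp only [intensity, flipInvariant_arrival i d, flip_apply] <;>
      split_ifs <;> ring
  simp only [actInt, h, h']
  split_ifs <;> simp_all

theorem RegularSample.abs_actInt_le (hd : RegularSample d) (M : ℝ) (hθ : 0 < θ)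
    (hN : 1 ≤ N) (i : Idx) (ht : 0 ≤ t) : |actInt θ M N d t i| ≤ 1 := by
  unfold actInt
  split_ifs with h
  · exact hd.abs_intensity_le hθ hN ht h
  · simp

theorem vorticity_eq_emp (hact : ActiveBelow M d T n) (ht : t ≤ T) (k : ℤ²) : vorticity θ M N d t k
    = emp (actInt θ M N d t) (lowIdx n) (fun i => position θ M N d i t) k := by
  classical
  unfold vorticity emp
  rw [finsum_eq_finsetSum_of_support_subset (s := lowIdx n)]
  · refine sum_congr rfl fun i _ => ?_
    rw [finsum_eq_if, actInt]
    split_ifs <;> simp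
  · intro i hi
    by_contra h
    exact hi ((finsum_eq_if).trans (if_neg fun g => h (hact t ht i g)))

/-- The phase as a linear map. -/
def phaseL (k : ℤ²) : ℝ² →L[ℝ] ℝ :=
  (2 * π) • ((k 0 : ℝ) • proj 0 + (k 1 : ℝ) • proj 1)

theorem phaseL_apply (k : ℤ²) (u : ℝ²) : phaseL k u = phase k u := by
  simp [phaseL, phase, mul_add]

/-- The symmetrised interaction of a pair of vortices. -/
def quadKer (k : ℤ²) (x y : Torus) : ℂ :=
  2⁻¹ * (I * phase (-k) (biotSavart (x - y))) * (mFourier (-k) x - mFourier (-k) y)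

/-- The difference of the characters gains a factor `|k| |x - y|`, which cancels the singularity of
the kernel; the phase contributes the second factor `|k|`. -/
theorem exists_enorm_quadKer_le : ∃ C : ℝ≥0, ∀ k x y,
    ‖quadKer k x y‖ₑ ≤ C * ofReal (1 + freqSq k) := by
  obtain ⟨C, hC0, hC⟩ := exists_norm_biotSavart_le
  refine ⟨(4 * π ^ 2 * C).toNNReal, fun k x y => ?_⟩
  rw [← ofReal_norm, ← ofReal, ← ofReal_mul (by positivity)]
  refine ofReal_le_ofReal ?_
  have h1 := abs_phase_sq_le (-k) (biotSavart (x - y))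
  have h2 := norm_mFourier_sub_sq_le (-k) x y
  rw [freqSq_neg] at h1 h2
  have hk := one_add_freqSq_pos k
  refine abs_le_of_sq_le_sq' ?_ (by positivity) |>.2
  have e : ‖quadKer k x y‖ ^ 2 = 4⁻¹ * (phase (-k) (biotSavart (x - y)) ^ 2
      * ‖mFourier (-k) x - mFourier (-k) y‖ ^ 2) := by
    simp only [quadKer, norm_mul, norm_inv, norm_I, norm_real, norm_eq_abs,
      Complex.norm_ofNat, mul_pow, sq_abs]
    ring
  rw [e]
  calc _ ≤ 4⁻¹ * ((8 * π ^ 2 * (1 + freqSq k) * ‖biotSavart (x - y)‖ ^ 2)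
        * (8 * π ^ 2 * (1 + freqSq k) * ‖x - y‖ ^ 2)) := by gcongr
    _ = (4 * π ^ 2 * (1 + freqSq k)) ^ 2 * (‖biotSavart (x - y)‖ * ‖x - y‖) ^ 2 := by ring
    _ ≤ (4 * π ^ 2 * (1 + freqSq k)) ^ 2 * C ^ 2 := by gcongr; exact hC _
    _ = _ := by ring

theorem measurable_quadKer {Y : Type*} [MeasurableSpace Y] {x y : Y → Torus} (hx : Measurable x)
    (hy : Measurable y) (k : ℤ²) : Measurable fun d => quadKer k (x d) (y d) := by
  have h : Measurable fun d => phase (-k) (biotSavart (x d - y d)) := by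
    simp only [← phaseL_apply]
    exact (phaseL (-k)).measurable.comp (measurable_biotSavart.comp (hx.sub hy))
  unfold quadKer
  fun_prop

/-- The rate of change of the coefficients of the vorticity, apart from the jumps. -/
def drift (θ : ℝ) (a : Idx → ℝ) (A : Finset Idx) (x : Idx → Torus) (k : ℤ²) : ℂ :=
  -θ * emp a A x k + ∑ p ∈ A.offDiag, (a p.1 : ℂ) * a p.2 * quadKer k (x p.1) (x p.2)

/-- Exchange the two indices and average, using that the kernel is odd. The diagonal contributes
nothing because the difference of characters vanishes there. -/
theorem sum_quadKer (a : Idx → ℝ) (A : Finset Idx) (x : Idx → Torus) (k : ℤ²) : ∑ p ∈ A.offDiag, (a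
    p.1 : ℂ) * a p.2 * quadKer k (x p.1) (x p.2) = ∑ i ∈ A, ∑ j ∈ A, (a i : ℂ) * a j * (I * phase
    (-k) (biotSavart (x i - x j))) * mFourier (-k) (x i) := by
  classical
  set f : Idx → Idx → ℂ := fun i j => (a i : ℂ) * a j
    * (I * phase (-k) (biotSavart (x i - x j))) * mFourier (-k) (x i)
  have hf i j : (a i : ℂ) * a j * quadKer k (x i) (x j) = 2⁻¹ * (f i j + f j i) := by
    have e : phase (-k) (biotSavart (x j - x i)) = -phase (-k) (biotSavart (x i - x j)) := by
      rw [← neg_sub (x i) (x j), biotSavart_neg, ← phaseL_apply, map_neg, phaseL_apply]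
    simp only [f, e, quadKer, ofReal_neg]; ring
  rw [sum_subset (s₂ := A ×ˢ A) (fun p hp => ?_) fun p hp hp' => ?_, sum_product]
  · simp only [hf, ← mul_sum, sum_add_distrib]
    rw [Finset.sum_comm (f := fun i j => f j i)]
    ring
  · exact Finset.mem_product.2 ⟨(Finset.mem_offDiag.1 hp).1, (Finset.mem_offDiag.1 hp).2.1⟩
  · have : p.1 = p.2 := by
      by_contra h
      exact hp' (Finset.mem_offDiag.2 ⟨(Finset.mem_product.1 hp).1, (Finset.mem_product.1 hp).2, h⟩)
    simp [quadKer, this]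

/-- The contribution of the `i`-th vortex to the jumps up to time `t`. -/
def jumpTerm (N : ℕ) (d : Sample) (k : ℤ²) (t : ℝ) : Idx → ℂ
  | inl _ => 0
  | inr m => if arrival d (inr m) ≤ t then
      (((d (inr m)).2.1 / √N : ℝ) : ℂ) * mFourier (-k) (d (inr m)).2.2 else 0

theorem integral_indicator_Ici (ha : 0 < a) (has : a ≤ s) (c : ℂ) :
    ∫ u in 0..s, (Ici a).indicator (fun _ => c) u = (s - a : ℝ) * c := by
  rw [integral_of_le (ha.le.trans has), setIntegral_indicator measurableSet_Ici, setIntegral_const]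
  have : Ioc 0 s ∩ Ici a = Icc a s := by
    ext u; simp only [mem_inter_iff, mem_Ioc, mem_Ici, mem_Icc]
    exact ⟨fun h => ⟨h.2, h.1.2⟩, fun h => ⟨⟨ha.trans_le h.1, h.2⟩, h.1⟩⟩
  rw [this, Real.volume_real_Icc_of_le has, real_smul]

/-- While a vortex is present, its contribution is a constant times the exponential of the integral
of `-θ + I * phase (-k) velocity`. Extending this rate by zero to earlier times treats both kinds of
vortices alike: the birth of a vortex is the value of the constant, and it is accounted for by
`jumpTerm`. -/
theorem IsSolutionOn.single_eq (hd : RegularSample d) (hθ : 0 < θ) (hN : 1 ≤ N) (h : IsSolutionOn θ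
    M N d T x) (k : ℤ²) (i : Idx) (ht : t ∈ Icc 0 T) : IntervalIntegrable (fun s => actInt θ M N d s
    i * mFourier (-k) (x i s) * (-θ + I * phase (-k) (velocity θ M N d x i s))) volume 0 t ∧ actInt
    θ M N d t i * mFourier (-k) (x i t) - jumpTerm N d k t i = actInt θ M N d 0 i * mFourier (-k) (x
    i 0) + ∫ s in 0..t, actInt θ M N d s i * mFourier (-k) (x i s) * (-θ + I * phase (-k)
    (velocity θ M N d x i s)) := by
  classical
  set v := velocity θ M N d x i
  set A : Set ℝ := {s | IsActive M d i s}
  have hAm : MeasurableSet A := (isClosed_isActive M d i).measurableSet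
  have hmono : ∀ {u s}, u ≤ s → u ∈ A → s ∈ A := fun {u s} hus hu => by
    rcases i with m | m
    · exact hu
    · exact le_trans (show arrival d (inr m) ≤ u from hu) hus
  set g : ℝ → ℂ := fun s => A.indicator (fun _ => (-θ : ℂ)) s + I * phaseL (-k) (v s)
  have hv0 : ∀ s ∉ A, v s = 0 := fun s hs => if_neg hs
  have hg0 : ∀ s ∉ A, g s = 0 := fun s hs => by simp [g, hs, hv0 s hs]
  have hg1 : ∀ s ∈ A, g s = -θ + I * phase (-k) (v s) := fun s hs => by
    simp [g, hs, phaseL_apply]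
  have hsub : ∀ {s}, s ∈ Icc 0 T → uIcc 0 s ⊆ Icc 0 T := fun {s} hs => by
    rw [uIcc_of_le hs.1]; exact Icc_subset_Icc_right hs.2
  have hi1 s : IntervalIntegrable (A.indicator fun _ => (-θ : ℂ)) volume 0 s :=
    intervalIntegrable_iff.2 ((intervalIntegrable_iff.1 intervalIntegrable_const).indicator hAm)
  have hi2 : ∀ s ∈ Icc 0 T, IntervalIntegrable (fun s => (phaseL (-k) (v s) : ℂ)) volume 0 s :=
    fun s hs => intervalIntegrable_iff.2 ((phaseL (-k)).integrable_comp
      (intervalIntegrable_iff.1 (h.integrable i s hs))).ofReal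
  have hi : ∀ s ∈ Icc 0 T, IntervalIntegrable g volume 0 s := fun s hs =>
    (hi1 s).add ((hi2 s hs).const_mul _)
  obtain ⟨B, hB⟩ := h.exists_norm_velocity_le hd hθ hN
  have hgB : ∀ s ∈ Icc 0 T, ‖g s‖ ≤ θ + ‖phaseL (-k)‖ * B := fun s hs => by
    refine (norm_add_le _ _).trans (add_le_add ((norm_indicator_le_norm_self _ _).trans ?_) ?_)
    · rw [norm_neg, norm_real, norm_of_nonneg hθ.le]
    · rw [norm_mul, norm_I, one_mul, norm_real]
      exact ((phaseL (-k)).le_opNorm _).trans (by gcongr; exact hB s hs i)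
  set G : ℝ → ℂ := fun s => ∫ u in 0..s, g u with hG
  have hG0 : ∀ s ∈ Icc 0 T, s ∉ A → G s = 0 := fun s hs hsA => by
    refine integral_zero_ae (.of_forall fun u hu => hg0 u fun huA => ?_)
    exact hsA (hmono (uIoc_of_le hs.1 ▸ hu).2 huA)
  have hGs : ∀ s ∈ Icc 0 T, G s = (∫ u in 0..s, A.indicator (fun _ => (-θ : ℂ)) u)
      + I * phase (-k) (∫ u in 0..s, v u) := fun s hs => by
    rw [hG]
    simp only [g]
    rw [intervalIntegral.integral_add (hi1 s) ((hi2 s hs).const_mul _),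
      intervalIntegral.integral_const_mul, intervalIntegral.integral_ofReal,
      (phaseL (-k)).intervalIntegral_comp_comm (h.integrable i s hs), phaseL_apply]
  -- `C` is the contribution at birth. An initial vortex has a constant activity indicator and no
  -- jump; a vortex of the noise is inactive at time zero, since arrival times are positive.
  obtain ⟨C, hC, hC0⟩ : ∃ C : ℂ, (∀ s ∈ Icc 0 T, s ∈ A →
      actInt θ M N d s i * mFourier (-k) (x i s) = C * Complex.exp (G s)) ∧
      ∀ s ∈ Icc 0 T, jumpTerm N d k s i = A.indicator (fun _ => C) s - A.indicator (fun _ => C) 0 := by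
    have hx : ∀ s ∈ Icc 0 T, mFourier (-k) (x i s)
        = mFourier (-k) (d i).2.2 * Complex.exp (I * phase (-k)
          (∫ u in 0..s, v u)) := fun s hs => by rw [h.eq i s hs, mFourier_add_toTorus]
    rcases i with m | m
    · refine ⟨((d (.inl m)).2.1 * exp (-θ * arrival d (.inl m)) / √N : ℝ)
        * mFourier (-k) (d (.inl m)).2.2, fun s hs hsA => ?_, fun s hs => ?_⟩
      · have hA : A = univ := eq_univ_of_forall fun u => hsA
        rw [hx s hs, hGs s hs, exp_add, actInt, if_pos (show IsActive M d (.inl m) s from hsA), intensity, hA]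
        simp only [indicator_univ, intervalIntegral.integral_const, sub_zero, real_smul]
        push_cast
        rw [mul_comm (s : ℂ)]
        ring
      · by_cases hA : s ∈ A
        · have h0 : (0 : ℝ) ∈ A := hA
          simp [jumpTerm, hA, h0]
        · have h0 : (0 : ℝ) ∉ A := hA
          simp [jumpTerm, hA, h0]
    · have h0 : (0 : ℝ) ∉ A := not_le.2 (hd.arrival_pos _)
      refine ⟨((d (.inr m)).2.1 / √N : ℝ) * mFourier (-k) (d (.inr m)).2.2,
        fun s hs hsA => ?_, fun s hs => ?_⟩
      · have hA : A = Ici (arrival d (.inr m)) := rfl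
        rw [hx s hs, hGs s hs, exp_add, actInt, if_pos (show IsActive M d (.inr m) s from hsA), intensity,
          hA,
          integral_indicator_Ici (hd.arrival_pos _) hsA]
        push_cast
        rw [mul_comm ((s : ℂ) - _)]
        ring
      · rw [indicator_of_notMem h0, sub_zero]
        exact if_congr Iff.rfl rfl rfl
  have hP0 : ∀ s ∉ A, actInt θ M N d s i = 0 := fun s hs => if_neg hs
  have hF : ∀ s ∈ Icc 0 T, actInt θ M N d s i * mFourier (-k) (x i s)
      * (-θ + I * phase (-k) (v s)) = C * (g s * Complex.exp (G s)) := fun s hs => by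
    by_cases hsA : s ∈ A
    · rw [hC s hs hsA, hg1 s hsA]; ring
    · rw [hP0 s hsA, hg0 s hsA]; simp
  obtain ⟨he1, he2⟩ := exp_integral_sub_one (hi t ht) fun s hs => hgB s (hsub ht hs)
  refine ⟨(he1.const_mul C).congr fun s hs => (hF s (hsub ht (uIoc_subset_uIcc hs))).symm, ?_⟩
  rw [integral_congr fun s hs => hF s (hsub ht hs), intervalIntegral.integral_const_mul,
    ← he2, hC0 t ht]
  have h0T : (0 : ℝ) ∈ Icc 0 T := ⟨le_rfl, ht.1.trans ht.2⟩
  have hz : G 0 = 0 := integral_same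
  by_cases htA : t ∈ A
  · by_cases h0A : (0 : ℝ) ∈ A
    · rw [hC t ht htA, hC 0 h0T h0A, hz, indicator_of_mem htA, indicator_of_mem h0A, exp_zero]
      ring
    · rw [hC t ht htA, hP0 0 h0A, indicator_of_mem htA, indicator_of_notMem h0A]
      simp only [G]; push_cast; ring
  · have h0A : (0 : ℝ) ∉ A := fun h0 => htA (hmono ht.1 h0)
    have := hG0 t ht htA
    simp only [G] at this
    rw [hP0 t htA, hP0 0 h0A, indicator_of_notMem htA, indicator_of_notMem h0A, this]
    simp

/-- The coefficients of the vorticity are, apart from the jumps, the integrals of the drift. -/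
theorem IsSolutionOn.emp_sub_jump (hd : RegularSample d) (hθ : 0 < θ) (hN : 1 ≤ N) (h : IsSolutionOn
    θ M N d T x) (hact : ActiveBelow M d T n) (hα : α < -1) (k : ℤ²) (ht : t ∈ Icc 0 T) :
    IntervalIntegrable (fun s => drift θ (actInt θ M N d s) (lowIdx n) (fun i => x i s) k) volume 0
    t ∧ emp (actInt θ M N d t) (lowIdx n) (fun i => x i t) k - (jumpSum α hα N d n t).coeff k = emp
    (actInt θ M N d 0) (lowIdx n) (fun i => x i 0) k + ∫ s in 0..t, drift θ (actInt θ M N d s)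
    (lowIdx n) (fun i => x i s) k := by
  classical
  have hs := fun i => h.single_eq hd hθ hN k i ht
  have hdr : ∀ s ∈ Icc 0 T, drift θ (actInt θ M N d s) (lowIdx n) (fun i => x i s) k
      = ∑ i ∈ lowIdx n, actInt θ M N d s i * mFourier (-k) (x i s)
          * (-θ + I * phase (-k) (velocity θ M N d x i s)) := by
    intro s hs
    rw [drift, sum_quadKer (actInt θ M N d s) (lowIdx n) (fun i => x i s), emp, mul_sum, ← sum_add_distrib]
    refine sum_congr rfl fun i hi => ?_
    have hv : (actInt θ M N d s i : ℂ) * phase (-k) (velocity θ M N d x i s)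
        = ∑ j ∈ lowIdx n, (actInt θ M N d s i : ℂ) * actInt θ M N d s j
          * phase (-k) (biotSavart (x i s - x j s)) := by
      rw [velocity_eq_pairDrift hd hθ hN hs.1 (hact s hs.2) (k := biotSavart) fun _ _ _ _ _ => rfl,
        ← phaseL_apply, pairDrift, map_sum, Complex.ofReal_sum, mul_sum]
      refine sum_congr rfl fun j hj => ?_
      rw [map_smul, phaseL_apply, smul_eq_mul, Complex.ofReal_mul, ← mul_assoc]
      rcases eq_or_ne j i with rfl | hji
      · simp [biotSavart_zero, phase]
      congr 1
      by_cases hai : IsActive M d i s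
      · by_cases haj : IsActive M d j s
        · have hle := abs_le.1 (hd.abs_intensity_le hθ hN hs.1 haj)
          rw [coef, if_pos ⟨hi, hji, hai, haj⟩, min_eq_right hle.2, max_eq_right hle.1]
          simp only [actInt, if_pos haj]
        · simp [coef, actInt, haj]
      · simp [actInt, hai]
    have hr (a e p : ℂ) : a * e * (-θ + I * p) = -θ * (a * e) + I * e * (a * p) := by ring
    rw [hr, hv, mul_sum]
    congr 1
    exact sum_congr rfl fun j _ => by ring
  have hsub : uIcc 0 t ⊆ Icc 0 T := by rw [uIcc_of_le ht.1]; exact Icc_subset_Icc_right ht.2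
  refine ⟨(IntervalIntegrable.sum (lowIdx n) fun i _ => (hs i).1).congr fun s hs' => ?_, ?_⟩
  · rw [hdr s (hsub (uIoc_subset_uIcc hs')), Finset.sum_apply]
  rw [integral_congr fun s hs => hdr s (hsub hs),
    intervalIntegral.integral_finsetSum fun i _ => (hs i).1]
  have hj : (jumpSum α hα N d n t).coeff k = ∑ i ∈ lowIdx n, jumpTerm N d k t i := by
    rw [coeff_jumpSum, lowIdx, sum_disjSum]
    simp [jumpTerm]
  rw [hj, emp, emp, ← sum_sub_distrib, ← sum_add_distrib]
  exact sum_congr rfl fun i _ => (hs i).2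

/-! ### Moments of the vorticity and of the drift -/

/-- A bound for the sum of the squared intensities up to time `T`. -/
def mass (θ T : ℝ) (N : ℕ) (d : Sample) : ℝ≥0∞ :=
  (N : ℝ≥0∞)⁻¹ * (∑' n, ofReal (exp (-(2 * θ) * arrival d (inl n)))
    + ∑' n, (Iic T).indicator 1 (arrival d (inr n)))

theorem measurable_mass (θ T : ℝ) (N : ℕ) : Measurable (mass θ T N) := by
  refine Measurable.const_mul (Measurable.add (Measurable.tsum fun n => ?_)
    (Measurable.tsum fun n => ?_)) _
  · have := measurable_arrival (.inl n); fun_prop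
  · exact (measurable_one.indicator measurableSet_Iic).comp (measurable_arrival (.inr n))

theorem RegularSample.sqSum_actInt_le (hd : RegularSample d) (hθ : 0 < θ) (M : ℝ) (hN : 1 ≤ N) (ht :
    t ∈ Icc 0 T) (n : ℕ) : sqSum (lowIdx n) (actInt θ M N d t) ≤ mass θ T N d := by
  have hs (a : ℝ) : ‖a‖ₑ ^ 2 = ofReal (a ^ 2) := by
    rw [← ofReal_norm, ← ofReal_pow (norm_nonneg _), norm_eq_abs, sq_abs]
  have hN' : ofReal (N : ℝ)⁻¹ = (N : ℝ≥0∞)⁻¹ := by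
    rw [ofReal_inv_of_pos (by positivity), ofReal_natCast]
  have he : ∀ {u : ℝ}, u ≤ 0 → exp u ^ 2 ≤ 1 := fun {u} hu => by
    rw [← exp_nat_mul, Real.exp_le_one_iff]; push_cast; linarith
  have hσ i : (d i).2.1 ^ 2 = 1 := by rw [← sq_abs, hd.abs_sign, one_pow]
  rw [sqSum, lowIdx, sum_disjSum, mass, mul_add, ← ENNReal.tsum_mul_left, ← ENNReal.tsum_mul_left]
  refine add_le_add ((sum_le_sum fun m _ => ?_).trans (sum_le_tsum _))
    ((sum_le_sum fun m _ => ?_).trans (sum_le_tsum _))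
  · rw [actInt]
    split_ifs with h
    · rw [hs, ← hN', ← ofReal_mul (by positivity)]
      refine ofReal_le_ofReal ?_
      have e : exp (-(2 * θ) * arrival d (inl m)) = exp (-θ * arrival d (inl m)) ^ 2 := by
        rw [← exp_nat_mul]; push_cast; ring_nf
      rw [intensity, div_pow, mul_pow, mul_pow, hσ, one_mul, sq_sqrt (by positivity), e, inv_mul_eq_div]
      gcongr
      exact mul_le_of_le_one_right (by positivity) (he (by nlinarith [ht.1]))
    · simp
  · rw [actInt]
    split_ifs with h
    · have h' : arrival d (inr m) ≤ t := h
      rw [indicator_of_mem (show _ ∈ Iic T from h'.trans ht.2), Pi.one_apply, mul_one, hs, ← hN']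
      refine ofReal_le_ofReal ?_
      rw [intensity, div_pow, mul_pow, hσ, one_mul, sq_sqrt (by positivity), ← one_div]
      gcongr
      exact he (by nlinarith)
    · simp

/-- The rate `N * lam` cancels the factor `N⁻¹`. All points of the first process are counted, also
those beyond `M`; this is finite because `exp (-2 * θ * s)` is integrable on the half line, and
makes the bound uniform in `M`. -/
theorem exists_lintegral_mass_le (hθ : 0 < θ) (lam T : ℝ) : ∃ C : ℝ≥0∞, C ≠ ∞ ∧ ∀ N : ℕ, 1 ≤ N → ∀ _
    : Fact (0 < (N : ℝ) * lam), ∫⁻ d, mass θ T N d ∂sampleLaw (N * lam) ≤ C := by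
  set I := ∫⁻ s in Ici (0 : ℝ), ofReal (exp (-(2 * θ) * s))
  have hI : I ≠ ∞ := by
    have := (integrableOn_Ici_iff_integrableOn_Ioi (by simp)).2
      (exp_neg_integrableOn_Ioi 0 (by positivity : 0 < 2 * θ))
    exact this.lintegral_lt_top.ne
  refine ⟨ofReal lam * (I + ofReal T), by finiteness, fun N hN _ => ?_⟩
  have hN0 : (N : ℝ≥0∞) ≠ 0 := by simpa using (by omega : N ≠ 0)
  have hm1 n : Measurable fun d => ofReal (exp (-(2 * θ) * arrival d (inl n)))
      := by have := measurable_arrival (.inl n); fun_prop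
  have hm2 n : Measurable fun d => (Iic T).indicator (1 : ℝ → ℝ≥0∞) (arrival d (inr n)) :=
    (measurable_one.indicator measurableSet_Iic).comp (measurable_arrival (.inr n))
  have h1 := tsum_lintegral_arrival_le (N * lam) (.inl rfl) (φ := fun s => ofReal
    (exp (-(2 * θ) * s))) (by fun_prop)
  have h2 := tsum_lintegral_arrival_le (N * lam) (.inr rfl) (φ := (Iic T).indicator 1)
    (measurable_one.indicator measurableSet_Iic)
  rw [lintegral_indicator_one measurableSet_Iic, Measure.restrict_apply measurableSet_Iic,
    inter_comm, Ici_inter_Iic, volume_Icc, sub_zero] at h2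
  unfold mass
  rw [lintegral_const_mul _ (show Measurable fun d => _ + _ from (Measurable.tsum hm1).add
      (Measurable.tsum hm2)),
    lintegral_add_left (Measurable.tsum hm1), lintegral_tsum fun n => (hm1 n).aemeasurable,
    lintegral_tsum fun n => (hm2 n).aemeasurable]
  refine (mul_le_mul_right (add_le_add h1 h2) _).trans_eq ?_
  rw [ofReal_mul (by positivity), ofReal_natCast, ← mul_add, ← mul_assoc, ← mul_assoc,
    ENNReal.inv_mul_cancel hN0 (by simp), one_mul]

/-- The indicator of the samples of mass at most `R`. -/
def massCut (θ T : ℝ) (N : ℕ) (R : ℝ≥0∞) (d : Sample) : ℝ≥0∞ := {d | mass θ T N d ≤ R}.indicator 1 d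

theorem measurable_massCut (θ T : ℝ) (N : ℕ) (R : ℝ≥0∞) : Measurable (massCut θ T N R) :=
  measurable_one.indicator (measurableSet_le (measurable_mass θ T N) measurable_const)

theorem massCut_congr {R : ℝ≥0∞} {d' : Sample} (h : arrival d = arrival d') :
    massCut θ T N R d = massCut θ T N R d' := by
  simp only [massCut, indicator, mem_ofPred_eq, mass, h, Pi.one_apply]

theorem measurable_drift (θ : ℝ) {Y : Type*} [MeasurableSpace Y] (A : Finset Idx) {ξ : Y → Idx → ℝ}
    (hξ : ∀ j, Measurable fun d => ξ d j) {x : Y → Idx → Torus} (hx : ∀ j, Measurable fun d => x d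
    j) (k : ℤ²) : Measurable fun d => drift θ (ξ d) A (x d) k := by
  have h := measurable_emp A hξ hx k
  have hq i j : Measurable fun d => quadKer k (x d i) (x d j) := measurable_quadKer (hx i) (hx j) k
  unfold drift
  fun_prop

section

variable {θ M r T t : ℝ} {N : ℕ} {R : ℝ≥0∞} [Fact (0 < r)] (hθ : 0 < θ) (hN : 1 ≤ N)
  (ht : t ∈ Icc 0 T) {X : Sample → Idx → Torus} (hX : ∀ f : Sample → ℝ≥0∞, Measurable f →
    ∫⁻ d, f (setPos d (X d)) ∂sampleLaw r ≤ ∫⁻ d, f d ∂sampleLaw r)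

include hX in
-- Intensities and mass depend only on arrival times and signs, so invariance of the law allows the
-- positions at time `t` to be replaced by the initial uniform ones.
theorem lintegral_position_le (Ψ : (Idx → ℝ) → (Idx → Torus) → ℝ≥0∞)
    (hΨ : Measurable fun d => massCut θ T N R d * Ψ (actInt θ M N d t) start d) :
    ∫⁻ d, massCut θ T N R d * Ψ (actInt θ M N d t) (X d) ∂sampleLaw r
      ≤ ∫⁻ d, massCut θ T N R d * Ψ (actInt θ M N d t) (start d) ∂sampleLaw r := by
  refine le_trans (le_of_eq (lintegral_congr fun d => ?_)) (hX _ hΨ)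
  have h i : (setPos d (X d) i).1 = (d i).1 ∧ (setPos d (X d) i).2.1 = (d i).2.1 := ⟨rfl, rfl⟩
  rw [massCut_congr (posInvariant_arrival _ _ h), posInvariant_actInt θ M N _ _ h]
  rfl

include hθ hN ht in
theorem lintegral_massCut_sqSum_le (n m : ℕ) :
    ∫⁻ d, massCut θ T N R d * sqSum (lowIdx n) (actInt θ M N d t) ^ m ∂sampleLaw r ≤ R ^ m := by
  calc _ ≤ ∫⁻ _, R ^ m ∂sampleLaw r := by
        refine lintegral_mono_ae ?_
        filter_upwards [ae_regularSample r] with d hd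
        simp only [massCut, indicator, mem_ofPred_eq]
        split_ifs with h
        · rw [Pi.one_apply, one_mul]
          gcongr
          exact (hd.sqSum_actInt_le hθ M hN ht n).trans h
        · simp
    _ = R ^ m := by simp

theorem measurable_actInt_left (θ M : ℝ) (N : ℕ) (t : ℝ) (i : Idx) :
    Measurable fun d => actInt θ M N d t i :=
  (measurable_actInt θ M N i).comp (by fun_prop : Measurable fun d : Sample => (d, t))

theorem flipInvariant_massCut (θ T : ℝ) (N : ℕ) (R : ℝ≥0∞) : FlipInvariant (massCut θ T N R) := fun i d =>
  massCut_congr (flipInvariant_arrival i d)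

include hθ hN ht hX in
theorem lintegral_energy_position_le (α : ℝ) (hm : 1 ≤ m) (n : ℕ) : ∫⁻ d, massCut θ T N R d * energy
    α (emp (actInt θ M N d t) (lowIdx n) (X d)) ^ m ∂sampleLaw r ≤ empConst α m * R ^ m := by
  have hξ := measurable_actInt_left θ M N t
  have hw := measurable_massCut θ T N R
  refine (lintegral_position_le hX (fun a x => energy α (emp a (lowIdx n) x) ^ m) (hw.mul
    ((measurable_energy α fun k => measurable_emp (lowIdx n) hξ (fun i => by fun_prop) k).pow_const m))).trans
    ((lintegral_energy_emp_pow_le r α hm (lowIdx n) hw (flipInvariant_massCut θ T N R) hξ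
      (flipOdd_actInt θ M N t)).trans ?_)
  gcongr
  exact lintegral_massCut_sqSum_le hθ hN ht n m

/-- The constant in the bound of the drift, if the interaction of a pair is bounded by `C (1 + |k|²)`. -/
def driftConst (α θ : ℝ) (C : ℝ≥0) (R : ℝ≥0∞) : ℝ≥0∞ :=
  2 * (ofReal (θ ^ 2) * (empConst α 1 * R ^ 1)
    + (∑' k, ofReal (weight (α + 1 + 1) k ^ 2)) * ((2 * C) ^ 2 * R ^ 2))

include hθ hN ht hX in
-- The symmetrised interaction costs a factor `(1 + |k|²)²`, that is two units of `α`. The resulting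
-- constant is finite exactly when the shifted weights are summable, and this is where the
-- regularity `-3` comes from.
theorem lintegral_energy_drift_le (α : ℝ) {C : ℝ≥0} (hC : ∀ k x y, ‖quadKer k x y‖ₑ ≤ C * ofReal (1
    + freqSq k)) (n : ℕ) : ∫⁻ d, massCut θ T N R d * energy α (drift θ (actInt θ M N d t) (lowIdx n)
    (X d)) ∂sampleLaw r ≤ driftConst α θ C R := by
  have hξ := measurable_actInt_left θ M N t
  have hw := measurable_massCut θ T N R
  have hx i : Measurable fun d : Sample => (d i).2.2 := by fun_prop
  set e : Sample → ℤ² → ℂ := fun d => emp (actInt θ M N d t) (lowIdx n) start d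
  set q : Sample → ℤ² → ℂ := fun d k => ∑ p ∈ (lowIdx n).offDiag,
    (actInt θ M N d t p.1 : ℂ) * actInt θ M N d t p.2 * quadKer k (d p.1).2.2 (d p.2).2.2
  have hem : Measurable fun d => energy α (e d) := measurable_energy α fun k => measurable_emp _ hξ hx k
  have hHm k i j : Measurable fun d : Sample => quadKer k (d i).2.2 (d j).2.2 :=
    measurable_quadKer (hx i) (hx j) k
  have hqm k : Measurable fun d => q d k := by
    have := hHm k
    simp only [q]; fun_prop
  have hqk k : Measurable fun d => massCut θ T N R d * ‖q d k‖ₑ ^ 2 :=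
    hw.mul ((hqm k).enorm.pow_const 2)
  have hle d : energy α (drift θ (actInt θ M N d t) (lowIdx n) start d)
      ≤ 2 * (ofReal (θ ^ 2) * energy α (e d) + energy α (q d)) := by
    have h := energy_add_le α (fun k => -θ * e d k) (q d)
    have e1 : energy α (fun k => -θ * e d k) = ofReal (θ ^ 2) * energy α (e d) := by
      rw [energy, energy, ← ENNReal.tsum_mul_left]
      refine tsum_congr fun k => ?_
      rw [enorm_mul, mul_pow, enorm_neg, ← ofReal_norm (θ : ℂ), norm_real,
        ← ofReal_pow (norm_nonneg _), norm_eq_abs, sq_abs]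
      ring
    have e2 : drift θ (actInt θ M N d t) (lowIdx n) (start d)
        = (fun k => -θ * e d k) + q d := by funext k; simp only [drift, Pi.add_apply, e, q]
    rwa [e1, ← e2] at h
  have hq : ∫⁻ d, massCut θ T N R d * energy α (q d) ∂sampleLaw r
      ≤ (∑' k, ofReal (weight (α + 1 + 1) k ^ 2)) * ((2 * C) ^ 2 * R ^ 2) := by
    simp only [energy, ← ENNReal.tsum_mul_left, mul_left_comm (massCut θ T N R _)]
    rw [lintegral_tsum fun k => ((hqk k).const_mul _).aemeasurable, ← ENNReal.tsum_mul_right]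
    refine tsum_le_tsum fun k => ?_
    rw [lintegral_const_mul _ (hqk k), ← ofReal_weight_sq_mul, ← ofReal_weight_sq_mul]
    have h := lintegral_norm_quad_sq_le r (lowIdx n) hw (flipInvariant_massCut θ T N R) hξ
      (flipOdd_actInt θ M N t) (hHm k) (fun i d => by funext a b; simp [flip_apply])
      (fun d i j => hC k (d i).2.2 (d j).2.2)
    refine (mul_le_mul_right (h.trans (mul_le_mul_right
      (lintegral_massCut_sqSum_le hθ hN ht n 2) _)) _).trans_eq ?_
    ring
  refine (lintegral_position_le hX (fun a x => energy α (drift θ a (lowIdx n) x)) (hw.mul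
    (measurable_energy α fun k => measurable_drift θ (lowIdx n) hξ hx k))).trans ?_
  calc _ ≤ ∫⁻ d, 2 * (ofReal (θ ^ 2) * (massCut θ T N R d * energy α (e d) ^ 1)
        + massCut θ T N R d * energy α (q d)) ∂sampleLaw r := by
        refine lintegral_mono fun d => (mul_le_mul_right (hle d) _).trans_eq ?_
        rw [pow_one]; ring
    _ ≤ _ := by
        have hm1 : Measurable fun d => massCut θ T N R d * energy α (e d) ^ 1 := hw.mul (hem.pow_const 1)
        have hm2 : Measurable fun d => massCut θ T N R d * energy α (q d) :=
          hw.mul (measurable_energy α hqm)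
        rw [lintegral_const_mul _ (show Measurable fun d => _ + _ from (hm1.const_mul _).add hm2),
            lintegral_add_left (hm1.const_mul _),
          lintegral_const_mul _ hm1, driftConst]
        gcongr
        refine (lintegral_energy_emp_pow_le r α le_rfl (lowIdx n) hw (flipInvariant_massCut θ T N R) hξ
          (flipOdd_actInt θ M N t)).trans ?_
        gcongr
        exact lintegral_massCut_sqSum_le hθ hN ht n 1

end

/-! ### The continuous part of the vorticity -/

theorem sq_lintegral_le (μ : Measure X) {f : X → ℝ≥0∞} (hf : AEMeasurable f μ) :
    (∫⁻ x, f x ∂μ) ^ 2 ≤ μ univ * ∫⁻ x, f x ^ 2 ∂μ := by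
  have h := ENNReal.lintegral_mul_le_Lp_mul_Lq μ Real.HolderConjugate.two_two hf aemeasurable_one
  have h2 (y : ℝ≥0∞) : (y ^ (1 / 2 : ℝ)) ^ 2 = y := by
    rw [← rpow_natCast, ← rpow_mul]; norm_num
  simp only [Pi.mul_apply, Pi.one_apply, mul_one, lintegral_const, ENNReal.rpow_two, one_pow, one_mul] at h
  calc _ ≤ _ := pow_le_pow_left' h 2
    _ = _ := by rw [mul_pow, h2, h2, mul_comm]

/-- Cauchy–Schwarz in time, frequency by frequency: a drift that is square integrable in time gives
increments of order the square root of the elapsed time. -/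
theorem energy_integral_le (γ : ℝ) {b : ℝ → ℤ² → ℂ} (hb : ∀ k, IntervalIntegrable (fun u => b u k)
    volume 0 T) (hs : 0 ≤ s) (hst : s ≤ t) (ht : t ≤ T) : energy γ (fun k => ∫ u in s..t, b u k) ≤
    ofReal (t - s) * ∫⁻ u in Icc 0 T, energy γ (b u) := by
  have hsub : Ioc s t ⊆ Icc 0 T := fun u hu => ⟨hs.trans hu.1.le, hu.2.trans ht⟩
  have hm k : AEMeasurable (fun u => ‖b u k‖ₑ) (volume.restrict (Icc 0 T)) :=
    ((integrableOn_Icc_iff_integrableOn_Ioc (by simp)).2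
      ((intervalIntegrable_iff_integrableOn_Ioc_of_le (by linarith)).1 (hb k))).aestronglyMeasurable.enorm
  unfold energy
  rw [lintegral_tsum fun k => ((hm k).pow_const 2).const_mul _, ← ENNReal.tsum_mul_left]
  refine tsum_le_tsum fun k => ?_
  rw [lintegral_const_mul'' _ ((hm k).pow_const 2), mul_left_comm]
  gcongr
  beta_reduce
  rw [integral_of_le hst]
  calc _ ≤ (∫⁻ u in Ioc s t, ‖b u k‖ₑ) ^ 2 := pow_le_pow_left' (enorm_integral_le_lintegral_enorm _) 2
    _ ≤ volume.restrict (Ioc s t) univ * ∫⁻ u in Ioc s t, ‖b u k‖ₑ ^ 2 :=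
      sq_lintegral_le _ ((hm k).mono_measure (Measure.restrict_mono_set _ hsub))
    _ ≤ _ := by
      rw [Measure.restrict_apply_univ, Real.volume_Ioc]
      gcongr

theorem norm_emp_le {a : Idx → ℝ} (ha : ∀ i, |a i| ≤ 1) (A : Finset Idx) (x : Idx → Torus)
    (k : ℤ²) : ‖emp a A x k‖ ≤ A.card := by
  refine (norm_sum_le_of_le A (f := fun i => (a i : ℂ) * mFourier (-k) (x i)) (n := fun _ => 1)
    fun i _ => ?_).trans_eq (by simp)
  rw [norm_mul, norm_mFourier_apply, mul_one, norm_real]; exact ha i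

theorem emp_neg (a : Idx → ℝ) (A : Finset Idx) (x : Idx → Torus) (k : ℤ²) :
    emp a A x (-k) = star (emp a A x k) := by
  rw [emp, emp, star_sum]
  refine sum_congr rfl fun i _ => ?_
  rw [star_mFourier_neg, star_mul', Complex.star_def, Complex.conj_ofReal]

/-- A crude bound depending on the number of vortices. It serves only to see that the path of a
single sample is continuous and plays no role in the uniform estimates. -/
theorem exists_energy_drift_le (θ : ℝ) {γ : ℝ} (hγ : γ < -3) (A : Finset Idx) : ∃ C : ℝ≥0∞, C ≠ ∞ ∧
    ∀ a : Idx → ℝ, (∀ i, |a i| ≤ 1) → ∀ x, energy γ (drift θ a A x) ≤ C := by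
  obtain ⟨C, hC⟩ := exists_enorm_quadKer_le
  set B : ℝ≥0∞ := ‖(-θ : ℂ)‖ₑ * A.card + A.offDiag.card * C
  refine ⟨(∑' k, ofReal (weight (γ + 1 + 1) k ^ 2)) * B ^ 2, mul_ne_top
    (tsum_weight_sq_ne_top (by linarith)) (by finiteness), fun a ha x => ?_⟩
  have hle k : ‖drift θ a A x k‖ₑ ≤ B * ofReal (1 + freqSq k) := by
    have h1 : 1 ≤ ofReal (1 + freqSq k) := by
      rw [one_le_ofReal]; unfold freqSq; nlinarith [sq_nonneg (k 0 : ℝ), sq_nonneg (k 1 : ℝ)]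
    have ha' i : ‖(a i : ℂ)‖ₑ ≤ 1 := by
      rw [← ofReal_norm, norm_real, ENNReal.ofReal_le_one]; exact ha i
    refine (enorm_add_le _ _).trans ?_
    rw [add_mul]
    refine add_le_add ?_ ?_
    · rw [enorm_mul]
      refine (mul_le_mul_right ?_ _).trans (le_mul_of_one_le_right zero_le h1)
      rw [← ofReal_norm, ENNReal.ofReal_le_natCast]
      exact norm_emp_le ha A x k
    · refine (enorm_sum_le _ _).trans ((Finset.sum_le_card_nsmul _ _ _ fun p _ => ?_).trans_eq
        (nsmul_eq_mul _ _)) |>.trans_eq (mul_assoc _ _ _).symm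
      rw [enorm_mul, enorm_mul]
      exact (mul_le_mul' (mul_le_one' (ha' _) (ha' _)) (hC k _ _)).trans_eq (one_mul _)
  rw [energy, ← ENNReal.tsum_mul_right]
  refine tsum_le_tsum fun k => ?_
  rw [← ofReal_weight_sq_mul, ← ofReal_weight_sq_mul]
  refine (mul_le_mul_right (pow_le_pow_left' (hle k) 2) _).trans_eq ?_
  ring

/-- The path `c` is the vorticity minus its jumps. For any `n` beyond the active vortices its
coefficients are an initial value plus the integral of the drift, so bounds on these two quantities
at any regularity `γ` control size and Hölder modulus of `c`. -/
theorem exists_continuous_part (hd : RegularSample d) (hθ : 0 < θ) (hN : 1 ≤ N) (hT : 0 < T) (hsol :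
    IsSolution θ M N d (position θ M N d)) (hα : α < -3) (h : d ∈ goodSample T) : ∃ c : C(Icc (0 :
    ℝ) T, Sobolev α), (∀ t, (Cadlag.addCont c (jumpPath α (by linarith) N ⟨d, h⟩) t).coeff =
    vorticity θ M N d t) ∧ ∀ n, ActiveBelow M d T n → T < arrival d (inr n) → ∀ (γ : ℝ) (x : ℝ≥0∞),
    energy γ (emp (actInt θ M N d 0) (lowIdx n) (fun i => position θ M N d i 0)) ≤ x → ∫⁻ u in Icc 0
    T, energy γ (drift θ (actInt θ M N d u) (lowIdx n) fun i => position θ M N d i u) ≤ x → (∀ t,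
    energy γ (c t).coeff ≤ 2 * (x + ofReal T * x)) ∧ ∀ s t, energy γ ((c s).coeff - (c t).coeff) ≤
    ofReal (dist s t) * x := by
  set e : ℕ → ℝ → ℤ² → ℂ := fun n t =>
    emp (actInt θ M N d t) (lowIdx n) (fun i => position θ M N d i t)
  set b : ℕ → ℝ → ℤ² → ℂ := fun n t =>
    drift θ (actInt θ M N d t) (lowIdx n) (fun i => position θ M N d i t)
  have hα1 : α < -1 := by linarith
  have hv : ∀ n, ActiveBelow M d T n → ∀ t ∈ Icc 0 T, vorticity θ M N d t = e n t := fun n hn t ht =>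
    funext fun k => vorticity_eq_emp hn ht.2 k
  have ha : ∀ t ∈ Icc 0 T, ∀ i, |actInt θ M N d t i| ≤ 1 := fun t ht i =>
    hd.abs_actInt_le M hθ hN i ht.1
  have hw : ∀ t ∈ Icc 0 T, (toSobolev α (vorticity θ M N d t)).coeff = vorticity θ M N d t := by
    intro t ht
    obtain ⟨n, hn⟩ := (hd.eventually_activeBelow M T).exists
    rw [hv n hn t ht]
    exact coeff_toSobolev (emp_neg _ _ _)
      (energy_ne_top_of_norm_le hα1 _ (norm_emp_le (ha t ht) _ _))
  set c : Icc 0 T → Sobolev α := fun t =>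
    toSobolev α (vorticity θ M N d t) - jumpPath α hα1 N ⟨d, h⟩ t
  have hc : ∀ n, ActiveBelow M d T n → T < arrival d (inr n) →
      (∀ k, IntervalIntegrable (fun u => b n u k) volume 0 T) ∧
      ∀ t : Icc 0 T, (c t).coeff = e n 0 + fun k => ∫ u in 0..t, b n u k := by
    intro n hn hn'
    refine ⟨fun k => ((hsol.isSolutionOn T).emp_sub_jump hd hθ hN hn hα1 k (right_mem_Icc.2 hT.le)).1,
      fun t => funext fun k => ?_⟩
    have := ((hsol.isSolutionOn T).emp_sub_jump hd hθ hN hn hα1 k t.2).2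
    simp only [c]
    rw [Sobolev.coeff_sub, Pi.sub_apply, hw t t.2, hv n hn t t.2, jumpPath_apply _ _ _ hn']
    exact this
  have hinc : ∀ n, ActiveBelow M d T n → T < arrival d (inr n) → ∀ γ, ∀ s t : Icc 0 T,
      energy γ ((c s).coeff - (c t).coeff)
        ≤ ofReal (dist s t) * ∫⁻ u in Icc 0 T, energy γ (b n u) := by
    intro n hn hn' γ s t
    obtain ⟨hb, hc⟩ := hc n hn hn'
    wlog hst : t ≤ s generalizing s t
    · have := this t s (le_of_not_ge hst)
      rw [dist_comm]
      refine le_trans (le_of_eq ?_) this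
      unfold energy
      exact tsum_congr fun k => by rw [Pi.sub_apply, Pi.sub_apply, enorm_sub_rev]
    have hst' : (t : ℝ) ≤ s := hst
    have e1 : (c s).coeff - (c t).coeff = fun k => ∫ u in (t : ℝ)..s, b n u k := by
      funext k
      have hI : ∀ u ∈ Icc 0 T, IntervalIntegrable (fun u => b n u k) volume 0 u := fun u hu =>
        (hb k).mono_set (by rw [uIcc_of_le hu.1, uIcc_of_le hT.le]; exact Icc_subset_Icc_right hu.2)
      rw [hc, hc, add_sub_add_left_eq_sub, Pi.sub_apply,
        integral_interval_sub_left (hI s s.2) (hI t t.2)]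
    rw [e1, Subtype.dist_eq, dist_eq, abs_of_nonneg (by linarith)]
    exact energy_integral_le γ hb t.2.1 hst' s.2.2
  have hcc : Continuous c := by
    obtain ⟨n, hn, hn'⟩ := ((hd.eventually_activeBelow M T).and
      (hd.tendsto_inr.eventually_gt_atTop T)).exists
    obtain ⟨C, hC, hCb⟩ := exists_energy_drift_le θ hα (lowIdx n)
    have hI : ∫⁻ u in Icc 0 T, energy α (b n u) ≤ C * ofReal T := by
      refine (setLIntegral_mono measurable_const fun u hu => hCb _ (ha u hu) _).trans_eq ?_
      simp
    refine continuous_iff_continuousAt.2 fun t => tendsto_iff_edist_tendsto_0.2 ?_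
    have h0 : Tendsto (fun s => (ofReal (dist s t) * (C * ofReal T)) ^ (2⁻¹ : ℝ)) (𝓝 t) (𝓝 0) := by
      have h1 : Tendsto (fun s : Icc 0 T => ofReal (dist s t)) (𝓝 t) (𝓝 0) := by
        have : Continuous fun s : Icc 0 T => ofReal (dist s t) :=
          ENNReal.continuous_ofReal.comp (by fun_prop)
        simpa using this.tendsto t
      have := (ENNReal.Tendsto.mul_const (b := C * ofReal T) h1
        (.inr (by finiteness))).ennrpow_const 2⁻¹
      simpa using this
    refine tendsto_of_tendsto_of_tendsto_of_le_of_le tendsto_const_nhds h0 (fun _ => zero_le) fun s => ?_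
    have h2 : edist (c s) (c t) = (edist (c s) (c t) ^ 2) ^ (2⁻¹ : ℝ) := by
      rw [← rpow_natCast, ← rpow_mul]; norm_num
    rw [h2, edist_sq_eq_energy]
    exact rpow_le_rpow ((hinc n hn hn' α s t).trans (by gcongr)) (by norm_num)
  refine ⟨⟨c, hcc⟩, fun t => ?_, fun n hn hn' γ x h0 hx => ⟨fun t => ?_, fun s t =>
    (hinc n hn hn' γ s t).trans (by gcongr)⟩⟩
  · change (c t + _).coeff = _
    simp only [c]
    rw [sub_add_cancel, hw t t.2]
  · obtain ⟨hb, hc⟩ := hc n hn hn'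
    change energy γ (c t).coeff ≤ _
    rw [hc]
    refine (energy_add_le γ _ _).trans ?_
    gcongr
    refine (energy_integral_le γ hb le_rfl t.2.1 t.2.2).trans ?_
    rw [sub_zero]
    gcongr
    exact t.2.2

/-! ### The path of the vorticity as a random variable -/

theorem measurable_continuousMap {X K S : Type*} [MeasurableSpace X] [TopologicalSpace K]
    [CompactSpace K] [TopologicalSpace.SeparableSpace K] [MetricSpace S] [MeasurableSpace S]
    [BorelSpace S] [SecondCountableTopology S] [MeasurableSpace C(K, S)] [BorelSpace C(K, S)]
    [SecondCountableTopology C(K, S)] {f : X → C(K, S)} (hf : ∀ t, Measurable fun x => f x t) :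
    Measurable f := by
  refine measurable_of_measurable_edist fun y => ?_
  obtain ⟨D, hDc, hD⟩ := TopologicalSpace.exists_countable_dense K
  have h x : edist (f x) y = ⨆ t ∈ D, edist (f x t) (y t) := by
    rw [ContinuousMap.edist_eq_iSup]
    refine le_antisymm (iSup_le fun t => ?_) (iSup₂_le fun t _ => le_iSup (fun t => edist (f x t) (y t)) t)
    have hcl : IsClosed {t | edist (f x t) (y t) ≤ ⨆ t ∈ D, edist (f x t) (y t)} :=
      isClosed_le (by fun_prop) continuous_const
    exact hcl.closure_subset_iff.2 (fun s hs => le_iSup₂ (f := fun t _ => edist (f x t) (y t)) s hs) (hD t)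
  simp only [h]
  exact Measurable.biSup D hDc fun t _ => (hf t).edist measurable_const

theorem measurable_toLp {X Y : Type*} [MeasurableSpace X] [MeasurableSpace Y] {μ : Measure Y}
    [SFinite μ] (hq : q ≠ ∞) [MeasurableSpace (Lp (Sobolev α) q μ)] [BorelSpace (Lp (Sobolev α) q
    μ)] [SecondCountableTopology (Lp (Sobolev α) q μ)] {v : X → Y → Sobolev α} (hv : Measurable fun
    p : X × Y => v p.1 p.2) (hm : ∀ x, MemLp (v x) q μ) : Measurable fun x => (hm x).toLp (v x) :=
    by
  have hq0 : q ≠ 0 := (zero_lt_one.trans_le Fact.out).ne'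
  refine measurable_of_measurable_edist fun y => ?_
  have h x : edist ((hm x).toLp (v x)) y
      = (∫⁻ t, energy α (v x t - y t).coeff ^ (q.toReal / 2) ∂μ) ^ (1 / q.toReal) := by
    rw [Lp.edist_def, ← eLpNorm_eq_lintegral_energy hq0 hq fun t => v x t - y t]
    refine eLpNorm_congr_ae ?_
    filter_upwards [(hm x).coeFn_toLp] with t ht
    rw [Pi.sub_apply, ht]
  simp only [h]
  refine Measurable.pow_const (Measurable.lintegral_prod_right' (f := fun p : X × Y =>
    energy α (v p.1 p.2 - y p.2).coeff ^ (q.toReal / 2)) ?_) _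
  refine (measurable_energy α fun k => ?_).pow_const _
  exact (Sobolev.continuous_coeff k).measurable.comp
    (hv.sub ((Lp.stronglyMeasurable y).measurable.comp measurable_snd))

/-- Borel measurability into the path space is obtained by factoring through a continuous map, which
avoids describing the Borel sets of the Skorokhod topology. -/
theorem measurable_pathSpace {X Y : Type*} [MeasurableSpace X] [TopologicalSpace Y] [MeasurableSpace
    Y] [OpensMeasurableSpace Y] {F : X → PathSpace T δ q} {g : X → Y} {Ψ : Y → Cadlag T (Sobolev (-3
    - δ)) × Lp (Sobolev (-1 - δ)) q (timeMeasure T)} (hΨ : Continuous Ψ) (hg : Measurable g) (h : ∀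
    x, (F x).1 = Ψ (g x)) : Measurable F := by
  refine measurable_of_isOpen fun s hs => ?_
  obtain ⟨U, hU, rfl⟩ := isEmbedding_pathSpace.isInducing.isOpen_iff.1 hs
  have := hg (hU.preimage hΨ).measurableSet
  rwa [show F ⁻¹' ((fun p => p.1) ⁻¹' U) = g ⁻¹' (Ψ ⁻¹' U) by ext x; simp [h x]]

/-- The vorticity is a random variable in the path space. It is the sum of the jumps and a continuous
process, which is controlled by the coefficients of the measurable version `X` of the positions. -/
theorem exists_measurable_path (hθ : 0 < θ) (M : ℝ) (hN : 1 ≤ N) (r : ℝ) [Fact (0 < r)] (hT : 0 < T)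
    (hδ : 0 < δ) (hq : q ≠ ∞) : ∃ (X : Sample → ℝ → Idx → Torus) (F : Sample → PathSpace T δ q),
    Measurable F ∧ (∀ i, Measurable fun p : Sample × ℝ => X p.1 p.2 i) ∧ (∀ t ∈ Icc 0 T, ∀ f :
    Sample → ℝ≥0∞, Measurable f → ∫⁻ d, f (setPos d (X d t)) ∂sampleLaw r ≤ ∫⁻ d, f d ∂sampleLaw r)
    ∧ ∀ᵐ d ∂sampleLaw r, (∀ t, (F d).coeff t = vorticity θ M N d t) ∧ ∃ (h : d ∈ goodSample T) (c :
    C(Icc 0 T, Sobolev (-3 - δ))), (F d).1.1 = Cadlag.addCont c (jumpPath (-3 - δ) (by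
    linarith) N ⟨d, h⟩) ∧ ∀ᶠ n in atTop, (∀ t, (F d).coeff t = emp (actInt θ M N d t) (lowIdx n) (X
    d t)) ∧ ∀ (γ : ℝ) (x : ℝ≥0∞), energy γ (emp (actInt θ M N d 0) (lowIdx n) (X d 0)) ≤ x → ∫⁻ u in
    Icc 0 T, energy γ (drift θ (actInt θ M N d u) (lowIdx n) (X d u)) ≤ x → (∀ t, energy γ (c
    t).coeff ≤ 2 * (x + ofReal T * x)) ∧ ∀ s t, energy γ ((c s).coeff - (c t).coeff) ≤ ofReal (dist
    s t) * x := by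
  have hq0 : q ≠ 0 := (zero_lt_one.trans_le Fact.out).ne'
  obtain ⟨X, hXm, hsol, hXp, hlaw⟩ := exists_measurable_position hθ M hN r T
  have hae : ∀ᵐ d ∂sampleLaw r, ((RegularSample d ∧ IsSolution θ M N d (position θ M N d)) ∧
      d ∈ goodSample T) ∧ ∀ t ∈ Icc 0 T, X d t = fun i => position θ M N d i t := by
    filter_upwards [hsol, hXp, ae_arrival_ne r T] with d h1 h2 h3
    exact ⟨⟨h1, h1.1.mem_goodSample fun n => h3 _⟩, fun t ht => funext (h2 t ht)⟩
  obtain ⟨B, hBs, hBm, hB0⟩ := exists_measurable_superset_of_null (ae_iff.1 hae)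
  have hB (d : ↥Bᶜ) : _ := by_contra fun h => d.2 (hBs h)
  have hBae : ∀ᵐ d ∂sampleLaw r, d ∈ Bᶜ := by rw [ae_iff]; simpa using hB0
  obtain ⟨d₀, hd₀⟩ := hBae.exists
  choose c hcv hc using fun d : ↥Bᶜ =>
    exists_continuous_part (hB d).1.1.1 hθ hN hT (hB d).1.1.2 (by linarith : -3 - δ < -3) (hB d).1.2
  have hact (d : ↥Bᶜ) : ∀ᶠ n in atTop, ActiveBelow M d T n ∧ T < arrival d (inr n) :=
    ((hB d).1.1.1.eventually_activeBelow M T).and ((hB d).1.1.1.tendsto_inr.eventually_gt_atTop T)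
  have hve : ∀ d : ↥Bᶜ, ∀ n, ActiveBelow M d T n → ∀ t : Icc 0 T,
      vorticity θ M N d t = emp (actInt θ M N d t) (lowIdx n) (X d t) := fun d n hn t => by
    rw [(hB d).2 t t.2]; exact funext fun k => vorticity_eq_emp hn t.2.2 k
  have hvm k : Measurable fun p : ↥Bᶜ × Icc 0 T => vorticity θ M N p.1 p.2 k := by
    have hφ : Measurable fun p : ↥Bᶜ × Icc 0 T => ((p.1 : Sample), (p.2 : ℝ)) := by fun_prop
    refine measurable_of_tendsto_metrizable (f := fun n (p : ↥Bᶜ × Icc 0 T) =>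
      emp (actInt θ M N p.1 p.2) (lowIdx n) (X p.1 p.2) k) (fun n => measurable_emp _
        (fun i => (measurable_actInt θ M N i).comp hφ) (fun i => (hXm i).comp hφ) k)
      (tendsto_pi_nhds.2 fun p => ?_)
    refine tendsto_const_nhds.congr' ?_
    filter_upwards [hact p.1] with n hn
    rw [hve p.1 n hn.1]
  have hvb (d : ↥Bᶜ) : ∃ C : ℝ≥0∞, C ≠ ∞ ∧ ∀ t : Icc 0 T,
      energy (-1 - δ) (toSobolev (-1 - δ) (vorticity θ M N d t)).coeff ≤ C ∧
      (toSobolev (-1 - δ) (vorticity θ M N d t)).coeff = vorticity θ M N d t := by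
    obtain ⟨n, hn⟩ := (hact d).exists
    refine ⟨(∑' k, ofReal (weight (-1 - δ) k ^ 2)) * ofReal (lowIdx n).card ^ 2,
      mul_ne_top (tsum_weight_sq_ne_top (by linarith)) (by finiteness), fun t => ?_⟩
    have hb : ∀ k, ‖emp (actInt θ M N d t) (lowIdx n) (X d t) k‖ ≤ (lowIdx n).card :=
      norm_emp_le (fun i => (hB d).1.1.1.abs_actInt_le M hθ hN i t.2.1) _ _
    rw [hve d n hn.1, coeff_toSobolev (emp_neg _ _ _) (energy_ne_top_of_norm_le (by linarith) _ hb)]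
    exact ⟨energy_le_of_norm_le _ hb, rfl⟩
  have hVm : Measurable fun p : ↥Bᶜ × Icc 0 T => toSobolev (-1 - δ) (vorticity θ M N p.1 p.2) :=
    measurable_toSobolev hvm
  have hV (d : ↥Bᶜ) : MemLp (fun t : Icc 0 T => toSobolev (-1 - δ) (vorticity θ M N d t)) q
      (timeMeasure T) := by
    obtain ⟨C, hC, hCb⟩ := hvb d
    refine ⟨(hVm.comp measurable_prodMk_left).aestronglyMeasurable, ?_⟩
    rw [eLpNorm_eq_lintegral_energy hq0 hq]
    refine ENNReal.rpow_lt_top_of_nonneg (by positivity) (ne_top_of_le_ne_top ?_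
      (lintegral_mono fun t => rpow_le_rpow (hCb t).1 (by positivity)))
    rw [lintegral_const]; finiteness
  set F : ↥Bᶜ → PathSpace T δ q := fun d =>
    ⟨(Cadlag.addCont (c d) (jumpPath (-3 - δ) (by linarith) N ⟨d, (hB d).1.2⟩), (hV d).toLp _), by
      obtain ⟨C, hC, hCb⟩ := hvb d
      filter_upwards [(hV d).coeFn_toLp] with t ht
      rw [ht, (hCb t).2]; exact hcv d t⟩
  have hF : Measurable F := by
    let _ : MeasurableSpace C(Icc 0 T, Sobolev (-3 - δ)) := borel _
    have : BorelSpace C(Icc 0 T, Sobolev (-3 - δ)) := ⟨rfl⟩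
    let _ : MeasurableSpace (Lp (Sobolev (-1 - δ)) q (timeMeasure T)) := borel _
    have : BorelSpace (Lp (Sobolev (-1 - δ)) q (timeMeasure T)) := ⟨rfl⟩
    have : Fact (q ≠ ∞) := ⟨hq⟩
    have hcm : Measurable c := measurable_continuousMap fun t => measurable_sobolev fun k => by
      refine measurable_of_tendsto_metrizable (f := fun n (d : ↥Bᶜ) => vorticity θ M N d t k
        - (jumpSum (-3 - δ) (by linarith) N d n t).coeff k) (fun n => ?_) (tendsto_pi_nhds.2 fun d => ?_)
      · refine ((hvm k).comp measurable_prodMk_right).sub ?_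
        simp only [coeff_jumpSum]
        refine Finset.measurable_fun_sum _ fun i _ => Measurable.ite (measurableSet_le
          ((measurable_arrival (.inr i)).comp measurable_subtype_coe) measurable_const) ?_ measurable_const
        have hd : Measurable fun d : ↥Bᶜ => d.1 (inr i) :=
          (measurable_pi_apply _).comp measurable_subtype_coe
        exact (Complex.measurable_ofReal.comp (hd.snd.fst.div_const _)).mul
          ((mFourier (-k)).continuous.measurable.comp hd.snd.snd)
      · refine tendsto_const_nhds.congr' ?_
        filter_upwards [hact d] with n hn
        rw [← hcv d t, ← jumpPath_apply (by linarith) N ⟨d, (hB d).1.2⟩ hn.2, ← Pi.sub_apply, ←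
            Sobolev.coeff_sub]
        congr 2
        exact (add_sub_cancel_right _ _).symm
    -- The intermediate space consists of the continuous part, the sample itself and the `L^q`
    -- class; the jump path depends continuously on the sample.
    refine measurable_pathSpace (g := fun d => ((c d, (⟨d, (hB d).1.2⟩ : goodSample T)), (hV d).toLp _))
      (Ψ := fun p => (Cadlag.addCont p.1.1 (jumpPath (-3 - δ) (by linarith) N p.1.2), p.2)) ?_ ?_ fun d => rfl
    · exact (Cadlag.continuous_addCont.comp (continuous_fst.fst.prodMk
        ((continuous_jumpPath hT (by linarith) N).comp continuous_fst.snd))).prodMk continuous_snd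
    · exact (hcm.prodMk (measurable_subtype_coe.subtype_mk)).prodMk (measurable_toLp hq hVm hV)
  classical
  -- Exceptional samples are sent to one fixed good sample, so that the path is defined and
  -- measurable everywhere.
  set ρ : Sample → ↥Bᶜ := fun d => if h : d ∈ Bᶜ then ⟨d, h⟩ else ⟨d₀, hd₀⟩
  have hρ : Measurable ρ := Measurable.dite (f := fun d : ↥Bᶜ => d) (g := fun _ => ⟨d₀, hd₀⟩)
    measurable_id measurable_const hBm.compl
  refine ⟨X, F ∘ ρ, hF.comp hρ, hXm, hlaw, ?_⟩
  filter_upwards [hBae] with d hd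
  have e : ρ d = ⟨d, hd⟩ := dif_pos hd
  have hc' := hc ⟨d, hd⟩
  have hp := (hB ⟨d, hd⟩).2
  simp only [comp_apply, e]
  refine ⟨hcv ⟨d, hd⟩, (hB ⟨d, hd⟩).1.2, c ⟨d, hd⟩, rfl, ?_⟩
  filter_upwards [hact ⟨d, hd⟩] with n hn
  refine ⟨fun t => (hcv ⟨d, hd⟩ t).trans (hve ⟨d, hd⟩ n hn.1 t), fun γ x h0 hx => hc' n hn.1 hn.2 γ x ?_ ?_⟩
  · rwa [hp 0 (left_mem_Icc.2 hT.le)] at h0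
  · refine le_trans (le_of_eq (setLIntegral_congr_fun measurableSet_Icc fun u hu => ?_)) hx
    rw [hp u hu]

/-! ### Tightness -/

theorem exists_div_le {C ε : ℝ≥0∞} (hC : C ≠ ∞) (hε : ε ≠ 0) : ∃ x : ℝ≥0∞, x ≠ 0 ∧ x ≠ ∞ ∧ C / x ≤ ε
    := by
  obtain ⟨n, hn⟩ := ENNReal.exists_nat_gt (div_ne_top hC hε)
  refine ⟨n, (zero_le.trans_lt hn).ne', by simp, ENNReal.div_le_of_le_mul' ?_⟩
  exact (ENNReal.div_le_iff_le_mul (.inl hε) (.inr (zero_le.trans_lt hn).ne')).1 hn.le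

theorem rpow_le_one_add_pow (y : ℝ≥0∞) {p : ℝ} (hp : 0 ≤ p) (hm : p ≤ m) : y ^ p ≤ 1 + y ^ m := by
  rcases le_total y 1 with h | h
  · exact (ENNReal.rpow_le_one h hp).trans le_self_add
  · rw [← rpow_natCast]
    exact (ENNReal.rpow_le_rpow_of_exponent_le h hm).trans le_add_self

/-- The versions of the vorticity in the path space are uniformly tight. -/
theorem exists_tight_paths {lam : ℝ} (hθ : 0 < θ) (hlam : 0 < lam) (hT : 0 < T) (hδ : 0 < δ) (hq : q
    ≠ ∞) : ∃ F : ℝ → ℕ → Sample → PathSpace T δ q, (∀ (M : ℝ) (N : ℕ), 1 ≤ N → Measurable (F M N) ∧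
    ∀ᵐ d ∂sampleLaw (N * lam), ∀ t, (F M N d).coeff t = vorticity θ M N d t) ∧ ∀ ε : ℝ≥0∞, ε ≠ 0 → ∃
    𝒦 : Set (PathSpace T δ q), IsCompact 𝒦 ∧ ∀ (M : ℝ) (N : ℕ), 1 ≤ N → sampleLaw (N * lam) {d | F M
    N d ∉ 𝒦} ≤ ε := by
  have hr : ∀ N : ℕ, 1 ≤ N → Fact (0 < (N : ℝ) * lam) := fun N hN => ⟨by positivity⟩
  have : Nonempty (PathSpace T δ q) := by
    have := hr 1 le_rfl
    obtain ⟨-, F, -⟩ := exists_measurable_path hθ 0 le_rfl ((1 : ℕ) * lam) hT hδ hq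
    exact ⟨F 0⟩
  have hex := fun (M : ℝ) (N : ℕ) (hN : 1 ≤ N) => by
    have := hr N hN
    exact exists_measurable_path hθ M hN (N * lam) hT hδ hq
  choose! X F hFm hXm hlaw hF using hex
  refine ⟨F, fun M N hN => ⟨hFm M N hN, (hF M N hN).mono fun d hd => hd.1⟩, fun ε hε => ?_⟩
  -- Three bad events get probability `ε'` each: large mass, large integrated energies, and jumps
  -- outside `K`. The minimum keeps `ε'` finite when `ε = ∞`.
  set ε' := min ε 1 / 3
  have hε' : ε' ≠ 0 := ENNReal.div_ne_zero.2 ⟨by simp [hε], by simp⟩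
  have hε'' : ε' ≠ ∞ := div_ne_top (by simp) (by simp)
  have hεs : ε' + (ε' + ε') ≤ ε := by
    rw [← add_assoc, ENNReal.add_thirds]; exact min_le_left _ _
  have : Fact (0 < lam) := ⟨hlam⟩
  obtain ⟨K, hK, hKμ⟩ := exists_isCompact_jumpPath hT (by linarith : -3 - δ < -2) (by linarith : -3 - δ < -2)
    (by norm_num : (-2 : ℝ) < -1) lam hε' hε''
  obtain ⟨Cm, hCm, hmass⟩ := exists_lintegral_mass_le hθ lam T
  obtain ⟨R, hR0, hR, hRε⟩ := exists_div_le hCm hε'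
  obtain ⟨Q, hQ⟩ := exists_enorm_quadKer_le
  -- The exponents `γ` and `β` lie strictly between the regularity of the path space and the
  -- critical values `-3` and `-1`: moments are still finite and the embeddings are compact. The
  -- power `m` is large enough to control `L^q` norms.
  set γ := -3 - δ / 2
  set β := -1 - δ / 2
  set m := ⌈q.toReal⌉₊ + 1
  have hqm : q.toReal / 2 ≤ m := by
    have := Nat.le_ceil q.toReal
    simp only [m]; push_cast; linarith [q.toReal_nonneg]
  have hγ : γ < -3 := by simp only [γ]; linarith
  have hβ : β < -1 := by simp only [β]; linarith
  set C := empConst γ 1 * R ^ 1 + (driftConst γ θ Q R + empConst β m * R ^ m) * ofReal T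
  have hC : C ≠ ∞ := by
    have h1 := empConst_ne_top (by linarith : γ < -1) 1
    have h2 := empConst_ne_top hβ m
    have h3 := tsum_weight_sq_ne_top (by linarith : γ + 1 + 1 < -1)
    simp only [C, driftConst]
    finiteness
  obtain ⟨x, hx0, hx, hxε⟩ := exists_div_le hC hε'
  set e : ℕ → ℝ≥0∞ := fun l => (ofReal (T / 2 ^ l) * x) ^ (2⁻¹ : ℝ)
  have he : Tendsto e atTop (𝓝 0) := by
    have h1 : Tendsto (fun l : ℕ => ofReal (T / 2 ^ l)) atTop (𝓝 0) := by
      have := tendsto_ofReal (tendsto_const_nhds (x := T) |>.div_atTop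
        (tendsto_pow_atTop_atTop_of_one_lt one_lt_two))
      simpa using this
    simpa using (ENNReal.Tendsto.mul_const (b := x) h1 (.inr hx)).ennrpow_const 2⁻¹
  set B := 2 * (x + ofReal T * x)
  have hB : (B.toNNReal : ℝ≥0∞) = B := coe_toNNReal (by finiteness)
  have hc := ((isCompact_modSet hT (isCompact_energy_le (by simp only [γ]; linarith : -3 - δ < γ) B.toNNReal)
    he).prod hK).image Cadlag.continuous_addCont
  refine ⟨_, isCompact_pathSpace hq hc (by simp only [β]; linarith : -1 - δ < β)
    (ofReal T + x).toNNReal, fun M N hN => ?_⟩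
  have := hr N hN
  set μ := sampleLaw (N * lam)
  set a : Sample → ℝ → Idx → ℝ := fun d t => actInt θ M N d t
  set w := massCut θ T N R
  set f₀ : ℕ → Sample → ℝ≥0∞ := fun n d => w d * energy γ (emp (a d 0) (lowIdx n) (X M N d 0)) ^ 1
  set f₁ : ℕ → Sample × ℝ → ℝ≥0∞ := fun n p =>
    w p.1 * energy γ (drift θ (a p.1 p.2) (lowIdx n) (X M N p.1 p.2))
  set f₂ : ℕ → Sample × ℝ → ℝ≥0∞ := fun n p =>
    w p.1 * energy β (emp (a p.1 p.2) (lowIdx n) (X M N p.1 p.2)) ^ m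
  have hwm : Measurable w := measurable_massCut θ T N R
  have hwm' : Measurable fun p : Sample × ℝ => w p.1 := hwm.comp measurable_fst
  have ham := measurable_actInt θ M N
  have hx' := hXm M N hN
  have hs : Measurable fun d : Sample => (d, (0 : ℝ)) := by fun_prop
  have hf₀ n : Measurable (f₀ n) := hwm.mul ((measurable_energy γ
    (measurable_emp _ (fun i => (ham i).comp hs) fun i => (hx' i).comp hs)).pow_const 1)
  have hf₁ n : Measurable (f₁ n) := hwm'.mul (measurable_energy γ (measurable_drift θ _ ham hx'))
  have hf₂ n : Measurable (f₂ n) := hwm'.mul ((measurable_energy β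
    (measurable_emp _ ham hx')).pow_const m)
  -- A single functional collects the initial energy, the drift and the `L^q` norm, so that they are
  -- all small enough for one and the same `n`.
  set f : ℕ → Sample → ℝ≥0∞ := fun n d => f₀ n d + ∫⁻ u in Icc 0 T, (f₁ n (d, u) + f₂ n (d, u))
  have hfm n : Measurable (f n) := (hf₀ n).add ((hf₁ n).add (hf₂ n)).lintegral_prod_right'
  have hfC n : ∫⁻ d, f n d ∂μ ≤ C := by
    have h12 : Measurable fun p => f₁ n p + f₂ n p := (hf₁ n).add (hf₂ n)
    simp only [f]
    rw [lintegral_add_left (hf₀ n), lintegral_lintegral_swap h12.aemeasurable]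
    refine add_le_add (lintegral_energy_position_le hθ hN (left_mem_Icc.2 hT.le)
      (hlaw M N hN 0 (left_mem_Icc.2 hT.le)) γ le_rfl n) ?_
    refine (setLIntegral_mono (g := fun _ => driftConst γ θ Q R + empConst β m * R ^ m) measurable_const
      fun u hu => ?_).trans_eq (by simp)
    rw [lintegral_add_left (show Measurable fun d => f₁ n (d, u) from (hf₁ n).comp measurable_prodMk_right)]
    exact add_le_add (lintegral_energy_drift_le hθ hN hu (hlaw M N hN u hu) γ hQ n)
      (lintegral_energy_position_le hθ hN hu (hlaw M N hN u hu) β (by omega) n)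
  refine le_trans ?_ ((add_le_add ((meas_ge_le_lintegral_div (measurable_mass θ T N).aemeasurable
      hR0 hR).trans
    ((ENNReal.div_le_div_right (hmass N hN ‹_›) R).trans hRε)) (add_le_add ((measure_le_liminf_le μ
        hfm hfC hx0
      hx).trans hxε) (hKμ N hN))).trans hεs)
  refine (measure_mono_ae ?_).trans ((measure_union_le _ _).trans (add_le_add le_rfl (measure_union_le _ _)))
  filter_upwards [hF M N hN] with d hd hdK
  by_contra hnot
  obtain ⟨-, hgood, c, hFc, hev⟩ := hd
  replace hnot : ¬(R ≤ mass θ T N d ∨ x ≤ liminf (fun n => f n d) atTop ∨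
    ∀ h : d ∈ goodSample T, jumpPath (-3 - δ) (by linarith) N ⟨d, h⟩ ∉ K) := hnot
  push Not at hnot
  obtain ⟨hdm, hdf, hg', hdJ⟩ := hnot
  -- The functional is below `x` for infinitely many `n`, whereas the representation by the first
  -- `n` vortices holds for all large `n`; some `n` has both properties.
  obtain ⟨n, hnx, hnv, hnc⟩ := ((frequently_lt_of_liminf_lt (by isBoundedDefault)
      hdf).and_eventually hev).exists
  have hw1 : w d = 1 := indicator_of_mem (show d ∈ {d | mass θ T N d ≤ R} from hdm.le) _
  have hm2 : Measurable fun u => f₂ n (d, u) := (hf₂ n).comp measurable_prodMk_left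
  simp only [f] at hnx
  rw [lintegral_add_right _ hm2] at hnx
  have h0 := (le_self_add.trans hnx.le : f₀ n d ≤ x)
  have h1 := (le_self_add.trans (le_add_self.trans hnx.le) : ∫⁻ u in Icc 0 T, f₁ n (d, u) ≤ x)
  have h2 := (le_add_self.trans (le_add_self.trans hnx.le) : ∫⁻ u in Icc 0 T, f₂ n (d, u) ≤ x)
  simp only [f₀, f₁, f₂, hw1, one_mul, pow_one] at h0 h1 h2
  obtain ⟨hcQ, hcm⟩ := hnc γ x h0 h1
  refine hdK ⟨⟨(c, _), ⟨⟨fun t => ?_, fun l s t hst => ?_⟩, hdJ⟩, hFc.symm⟩, ?_⟩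
  · rw [mem_ofPred_eq, hB]; exact hcQ t
  · have h2 : edist (c s) (c t) = (edist (c s) (c t) ^ 2) ^ (2⁻¹ : ℝ) := by
      rw [← rpow_natCast, ← rpow_mul]; norm_num
    rw [h2, edist_sq_eq_energy]
    refine rpow_le_rpow ((energy_mono (by simp only [γ]; linarith) _).trans ((hcm s t).trans ?_))
      (by norm_num)
    gcongr
  · rw [coe_toNNReal (by finiteness)]
    have hae : ∀ᵐ t ∂timeMeasure T, energy β ((F M N d).1.2 t).coeff ^ (q.toReal / 2)
        ≤ 1 + energy β (emp (a d t) (lowIdx n) (X M N d t)) ^ m := by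
      filter_upwards [(F M N d).2] with t ht
      rw [← ht, ← hnv t]
      exact rpow_le_one_add_pow _ (by positivity) hqm
    refine (lintegral_mono_ae hae).trans ?_
    rw [timeMeasure, lintegral_subtype_comap measurableSet_Icc fun t =>
      1 + energy β (emp (a d t) (lowIdx n) (X M N d t)) ^ m, lintegral_add_left measurable_const]
    gcongr
    simp

end PointVortex

end

/-! ### Transfer to a general probability space -/

theorem proposition9 {Ω : Type*} [MeasurableSpace Ω] (P : Measure Ω) [IsProbabilityMeasure P]
    (θ lam T : ℝ) (hθ : 0 < θ) (hlam : 0 < lam) (hT : 0 < T)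
    (Z : ℝ≥0 → ℕ → ℕ ⊕ ℕ → Ω → ℝ × ℝ × PointVortex.Torus)
    (hlaw : ∀ M N, 1 ≤ N → ∀ i, HasLaw (Z M N i) (PointVortex.markLaw (N * lam)) P)
    (hindep : ∀ M N, 1 ≤ N → iIndepFun (Z M N) P)
    (δ : ℝ) (hδ : 0 < δ) (q : ℝ≥0∞) [Fact (1 ≤ q)] (hq : q ≠ ∞) :
    ∃ Φ : ℝ≥0 → ℕ → Ω → PointVortex.PathSpace T δ q,
      (∀ M N, 1 ≤ N → Measurable (Φ M N) ∧
        ∀ᵐ w ∂P, ∀ t : Icc (0 : ℝ) T,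
          (Φ M N w).coeff t = PointVortex.vorticity θ M N (fun i => Z M N i w) t) ∧
      IsTightMeasureSet {μ | ∃ (M : ℝ≥0) (N : ℕ), 1 ≤ N ∧ μ = P.map (Φ M N)} := by
  obtain ⟨F, hF, htight⟩ := PointVortex.exists_tight_paths hθ hlam hT hδ hq
  have hZ : ∀ M N, 1 ≤ N → HasLaw (fun w i => Z M N i w) (PointVortex.sampleLaw (N * lam)) P :=
    fun M N hN => by
      have : Fact (0 < (N : ℝ) * lam) := ⟨by positivity⟩
      exact (hindep M N hN).hasLaw_infinitePi (hlaw M N hN)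
        (aemeasurable_pi_iff.2 fun i => (hlaw M N hN i).aemeasurable)
  -- The marks are only almost everywhere measurable, so the paths are composed with a measurable
  -- version of the sample. For `N = 0` nothing is required and any value will do.
  have hY : ∀ M N, ∃ Y : Ω → PointVortex.Sample, 1 ≤ N → Measurable Y ∧ (fun w i => Z M N i w) =ᵐ[P] Y :=
    fun M N => by
      by_cases hN : 1 ≤ N
      · exact ⟨_, fun _ => ⟨(hZ M N hN).aemeasurable.measurable_mk, (hZ M N hN).aemeasurable.ae_eq_mk⟩⟩
      · exact ⟨0, fun h => absurd h hN⟩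
  choose Y hY using hY
  refine ⟨fun M N => F M N ∘ Y M N, fun M N hN => ⟨(hF M N hN).1.comp (hY M N hN).1, ?_⟩, ?_⟩
  · filter_upwards [(hY M N hN).2, ae_of_ae_map (hZ M N hN).aemeasurable
      ((hZ M N hN).map_eq.symm ▸ (hF M N hN).2)] with w h1 h2 t
    rw [Function.comp_apply, ← h1]
    exact h2 t
  · refine isTightMeasureSet_iff_exists_isCompact_measure_compl_le.2 fun ε hε => ?_
    obtain ⟨K, hK, hμ⟩ := htight ε hε.ne'
    -- The Skorokhod distance is given as a pseudo-distance, so `K` need not be closed. In an R1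
    -- space its closure is still compact, and it is a Borel set.
    have : R1Space (PointVortex.PathSpace T δ q) := PointVortex.isEmbedding_pathSpace.isInducing.r1Space
    refine ⟨closure K, hK.closure, ?_⟩
    rintro _ ⟨M, N, hN, rfl⟩
    have hm : Measurable (F M N ∘ Y M N) := (hF M N hN).1.comp (hY M N hN).1
    have hmap : P.map (Y M N) = PointVortex.sampleLaw (N * lam) := by
      rw [← (hZ M N hN).map_eq]; exact (Measure.map_congr (hY M N hN).2).symm
    rw [Measure.map_apply hm isClosed_closure.measurableSet.compl, preimage_comp,
      ← Measure.map_apply (hY M N hN).1 ((hF M N hN).1 isClosed_closure.measurableSet.compl), hmap]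
    refine (measure_mono ?_).trans (hμ M N hN)
    exact preimage_mono (compl_subset_compl.2 subset_closure)
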